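/- Manifolds are smooth, Hausdorff, second countable, and without boundary unless stated otherwise; they need not be connected or nonempty. Dimensions are integers, and a manifold of negative dimension is empty. Let $X$ be an oriented manifold of dimension $n$, not necessarily compact. **Pseudocycles.** A $k$-pseudocycle ($k\in\mathbb Z$) in $X$ is a smooth map $f\colon M\to X$ from an oriented $k$-dimensional manifold $M$ such that $\overline{f(M)}$ is compact and $$\operatorname{Bd}(f):=\bigcap_{K\subset M\text{ compact}}\overline{f(M\smallsetminus K)}$$ has dimension at most $k-2$, i.e. is contained in the image of a smooth map $g\colon W\to X$ from a manifold $W$ of dimension $k-2$ (such a $g$ is called a covering of $\operatorname{Bd}(f)$). Two $k$-pseudocycles $f_i\colon M_i\to X$ ($i=0,1$) are equivalent if there are an oriented $(k+1)$-manifold $B$ with boundary $\partial B=M_1-M_0$ (boundary orientation: outward normal first) and a smooth map $F\colon B\to X$ with $F|_{M_i}=f_i$ such that $\overline{F(B)}$ is compact and $\operatorname{Bd}(F)$ has dimension at most $k-1$. Let $\mathcal H_k(X)$ be the set of equivalence classes $[f]$ of $k$-pseudocycles. **Intersections.** Smooth maps $h_i\colon N_i\to X$ are transverse if $\operatorname{im}d(h_0)_{q_0}+\operatorname{im}d(h_1)_{q_1}=T_xX$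 whenever $h_0(q_0)=x=h_1(q_1)$. Pseudocycles $f_0,f_1$ are strongly transverse if there are coverings $g_i$ of $\operatorname{Bd}(f_i)$, $i=0,1$, such that each of $f_0,g_0$ is transverse to each of $f_1,g_1$. For a strongly transverse $k$-pseudocycle $f_0\colon M_0\to X$ and $\ell$-pseudocycle $f_1\colon M_1\to X$, let $f_0\cdot f_1\colon M\to X$ be the map $(p_0,p_1)\mapsto f_0(p_0)=f_1(p_1)$ on the fibre product $M=\{(p_0,p_1)\in M_0\times M_1 : f_0(p_0)=f_1(p_1)\}$, a submanifold of $M_0\times M_1$. It is oriented so that the isomorphism $TM\oplus TX\cong TM_0\oplus TM_1$ given by splitting $$0\to TM\to TM_0\oplus TM_1\xrightarrow{\;(v_0,v_1)\mapsto df_0v_0-df_1v_1\;}TX\to0$$ changes orientations by the sign $(-1)^{\ell n}$. **Proposition.** Disjoint union makes every $\mathcal H_k(X)$ an abelian group: there is an abelian group structure with $[f]+[g]=[f\sqcup g]$ for all $k$-pseudocycles $f,g$. For all $k,\ell\in\mathbb Z$: 1. For every $k$-pseudocycle $f_0$ and every $\ell$-pseudocycle $f_1$ in $X$ there is a diffeomorphism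 $\varphi$ of $X$, smoothly isotopic to the identity, such that $\varphi\circ f_1$ is equivalent to $f_1$ and $f_0$ is strongly transverse to $\varphi\circ f_1$. 2. If $f_0$ and $f_1$ are strongly transverse, then $f_0\cdot f_1$ is a $(k+\ell-n)$-pseudocycle. 3. There is a unique $\mathbb Z$-bilinear map $$\mathcal H_k(X)\times\mathcal H_\ell(X)\to\mathcal H_{k+\ell-n}(X),\qquad(\alpha,\beta)\mapsto\alpha\cdot\beta,$$ such that $\alpha\cdot\beta=[\tilde f_0\cdot\tilde f_1]$ for all $\tilde f_0\in\alpha$ and $\tilde f_1\in\beta$ that are strongly transverse. In particular, the class $[\tilde f_0\cdot\tilde f_1]$ depends only on $\alpha$ and $\beta$. -/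

import Mathlib

open Set Topology
open scoped Manifold ContDiff

noncomputable section

namespace Pseudocycles

/-! ### Orientations of manifolds -/

/-- An orientation of a manifold `M` of dimension `k`, possibly with boundary: an orientation of
every tangent space which is locally constant in the local trivialisations of the tangent bundle
that are given by charts.  Mathlib's `Orientation` is a ray of nonzero alternating forms of top
degree, so that a point has two orientations. -/
structure ManifoldOrientation {E H : Type*} [NormedAddCommGroup E] [NormedSpace ℝ E]
    [TopologicalSpace H] (I : ModelWithCorners ℝ E H) (M : Type*) [TopologicalSpace M]
    [ChartedSpace H M] [IsManifold I 1 M] (k : ℕ) where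
  orient : ∀ x : M, Orientation ℝ (TangentSpace I x) (Fin k)
  locallyConstant : ∀ x₀ : M, ∃ o₀ : Orientation ℝ E (Fin k), ∀ᶠ x in 𝓝 x₀,
    ∀ hx : x ∈ (trivializationAt E (TangentSpace I) x₀).baseSet,
      Orientation.map (Fin k)
        ((trivializationAt E (TangentSpace I) x₀).continuousLinearEquivAt ℝ x hx).toLinearEquiv
        (orient x) = o₀

/-- The sign (`1`, `-1`, or `0` if the vectors are linearly dependent) of a family of `k` tangent
vectors at a point of an oriented `k`-manifold. -/
def ManifoldOrientation.frameSign {E H : Type*} [NormedAddCommGroup E] [NormedSpace ℝ E]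
    [TopologicalSpace H] {I : ModelWithCorners ℝ E H} {M : Type*} [TopologicalSpace M]
    [ChartedSpace H M] [IsManifold I 1 M] {k : ℕ} (o : ManifoldOrientation I M k)
    (x : M) (v : Fin k → TangentSpace I x) : SignType :=
  SignType.sign ((o.orient x).someVector v)

/-! ### Smooth maps from manifolds, and the dimension of a set -/

/-- A smooth manifold of dimension `d` (Hausdorff, second countable, without boundary, not
necessarily connected or nonempty) with a smooth map to the `n`-manifold `X`.  The dimension is an
integer; a manifold of negative dimension is empty.  (As every manifold has at most continuum many
points, it is no restriction that the underlying types live in the lowest universe.) -/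
structure MapFromManifold (n : ℕ) (X : Type*) [TopologicalSpace X]
    [ChartedSpace (EuclideanSpace ℝ (Fin n)) X] (d : ℤ) where
  M : Type
  [topM : TopologicalSpace M]
  [t2 : T2Space M]
  [secondCountable : SecondCountableTopology M]
  [charted : ChartedSpace (EuclideanSpace ℝ (Fin d.toNat)) M]
  [manifold : IsManifold (𝓡 d.toNat) ∞ M]
  isEmpty_of_neg : d < 0 → IsEmpty M
  map : M → X
  smooth : ContMDiff (𝓡 d.toNat) (𝓡 n) ∞ map

attribute [instance] MapFromManifold.topM MapFromManifold.t2 MapFromManifold.secondCountable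
  MapFromManifold.charted MapFromManifold.manifold

/-- The differential of `f` at `p`.  Its values lie in the tangent space of `X` at `f p`, which in
Mathlib is the model space `EuclideanSpace ℝ (Fin n)`, through the preferred chart at the point
`f p`. -/
def MapFromManifold.diff {n : ℕ} {X : Type*} [TopologicalSpace X]
    [ChartedSpace (EuclideanSpace ℝ (Fin n)) X] {d : ℤ} (f : MapFromManifold n X d) (p : f.M) :
    TangentSpace (𝓡 d.toNat) p →L[ℝ] EuclideanSpace ℝ (Fin n) :=
  mfderiv (𝓡 d.toNat) (𝓡 n) f.map p

/-- The dimension of `S ⊆ X` is at most `d`: it is covered by the image of a smooth map from a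
`d`-dimensional manifold. -/
def DimAtMost (n : ℕ) {X : Type*} [TopologicalSpace X]
    [ChartedSpace (EuclideanSpace ℝ (Fin n)) X] (d : ℤ) (S : Set X) : Prop :=
  ∃ g : MapFromManifold n X d, S ⊆ range g.map

/-- `Bd f`, the intersection over all compact `K ⊆ M` of the closures of `f (M ∖ K)`. -/
def Bd {M X : Type*} [TopologicalSpace M] [TopologicalSpace X] (f : M → X) : Set X :=
  ⋂ (K : Set M) (_ : IsCompact K), closure (f '' Kᶜ)

/-- Two maps to `X` are transverse: wherever `f p = g q`, the images of the two differentials span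
the tangent space of `X` at this point. -/
def Transverse {n : ℕ} {X : Type*} [TopologicalSpace X]
    [ChartedSpace (EuclideanSpace ℝ (Fin n)) X] {d e : ℤ}
    (f : MapFromManifold n X d) (g : MapFromManifold n X e) : Prop :=
  ∀ (p : f.M) (q : g.M), f.map p = g.map q →
    ∀ v : EuclideanSpace ℝ (Fin n), ∃ (a : TangentSpace (𝓡 d.toNat) p)
      (b : TangentSpace (𝓡 e.toNat) q),
      f.diff p a + g.diff q b = v

/-! ### Pseudocycles -/

/-- `k`-pseudocycles in the `n`-manifold `X`. -/
structure Pseudocycle (n : ℕ) (X : Type*) [TopologicalSpace X]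
    [ChartedSpace (EuclideanSpace ℝ (Fin n)) X] (k : ℤ) extends MapFromManifold n X k where
  orientation : ManifoldOrientation (𝓡 k.toNat) M k.toNat
  isCompact_closure : IsCompact (closure (range map))
  dim_bd : DimAtMost n (k - 2) (Bd map)

section

variable {n : ℕ} {X : Type*} [TopologicalSpace X] [ChartedSpace (EuclideanSpace ℝ (Fin n)) X]

/-- A smooth map `F : B → X` that is an equivalence from the pseudocycle `f₀` to the pseudocycle
`f₁`.  Here `B` is an oriented `(k + 1)`-manifold with boundary, and the boundary is identified
with the disjoint union of `M₀` and `M₁` by the smooth embedding `Sum.elim ι₀ ι₁`.  A tangent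
vector at a boundary point is outward pointing iff its coordinate with number `0` in the chart
there, which takes values in the half space of all `y` with `0 ≤ y 0`, is negative.
The orientation condition says that `∂B = M₁ - M₀` when `∂B` is oriented by the rule
`outward normal first`.  (For `k < 0` both pseudocycles are empty, and so is `B`.) -/
structure Cobordism {k : ℤ} (f₀ f₁ : Pseudocycle n X k) where
  B : Type
  [topB : TopologicalSpace B]
  [t2 : T2Space B]
  [secondCountable : SecondCountableTopology B]
  [charted : ChartedSpace (EuclideanHalfSpace (k.toNat + 1)) B]
  [manifold : IsManifold (𝓡∂ (k.toNat + 1)) ∞ B]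
  isEmpty_of_neg : k < 0 → IsEmpty B
  orientation : ManifoldOrientation (𝓡∂ (k.toNat + 1)) B (k.toNat + 1)
  F : B → X
  smooth : ContMDiff (𝓡∂ (k.toNat + 1)) (𝓡 n) ∞ F
  isCompact_closure : IsCompact (closure (range F))
  dim_bd : DimAtMost n (k - 1) (Bd F)
  ι₀ : f₀.M → B
  ι₁ : f₁.M → B
  isSmoothEmbedding :
    Manifold.IsSmoothEmbedding (𝓡 k.toNat) (𝓡∂ (k.toNat + 1)) ∞ (Sum.elim ι₀ ι₁)
  range_eq : range (Sum.elim ι₀ ι₁) = (𝓡∂ (k.toNat + 1)).boundary B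
  restrict₀ : ∀ p, F (ι₀ p) = f₀.map p
  restrict₁ : ∀ p, F (ι₁ p) = f₁.map p
  orient₀ : ∀ (p : f₀.M) (ν : EuclideanSpace ℝ (Fin (k.toNat + 1))), ν 0 < 0 →
    ∀ v : Fin k.toNat → TangentSpace (𝓡 k.toNat) p,
      orientation.frameSign (ι₀ p)
          (Fin.cons ν fun i => mfderiv (𝓡 k.toNat) (𝓡∂ (k.toNat + 1)) ι₀ p (v i))
        = - f₀.orientation.frameSign p v
  orient₁ : ∀ (p : f₁.M) (ν : EuclideanSpace ℝ (Fin (k.toNat + 1))), ν 0 < 0 →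
    ∀ v : Fin k.toNat → TangentSpace (𝓡 k.toNat) p,
      orientation.frameSign (ι₁ p)
          (Fin.cons ν fun i => mfderiv (𝓡 k.toNat) (𝓡∂ (k.toNat + 1)) ι₁ p (v i))
        = f₁.orientation.frameSign p v

/-- Equivalence of pseudocycles. -/
def Equivalent {k : ℤ} (f₀ f₁ : Pseudocycle n X k) : Prop :=
  Nonempty (Cobordism f₀ f₁)

variable (n X) in
/-- The set of equivalence classes of `k`-pseudocycles in `X`. -/
def Homology (k : ℤ) : Type _ :=
  Quot (Equivalent (n := n) (X := X) (k := k))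

/-- The equivalence class of a pseudocycle. -/
def Pseudocycle.cls {k : ℤ} (f : Pseudocycle n X k) : Homology n X k :=
  Quot.mk _ f

/-- `h` is a disjoint union of `f` and `g`: up to an orientation preserving diffeomorphism, its
domain is the disjoint union of the oriented manifolds `f.M` and `g.M`, and `h` is `f` on the
first and `g` on the second. -/
def IsDisjointUnion {k : ℤ} (f g h : Pseudocycle n X k) : Prop :=
  ∃ Φ : (f.M ⊕ g.M) ≃ₘ^∞⟮𝓡 k.toNat, 𝓡 k.toNat⟯ h.M,
    (∀ p, h.map (Φ (Sum.inl p)) = f.map p) ∧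
    (∀ p, h.map (Φ (Sum.inr p)) = g.map p) ∧
    (∀ (p : f.M) (v : Fin k.toNat → TangentSpace (𝓡 k.toNat) p),
      h.orientation.frameSign (Φ (Sum.inl p))
          (fun i => mfderiv (𝓡 k.toNat) (𝓡 k.toNat) (fun q : f.M => Φ (Sum.inl q)) p (v i))
        = f.orientation.frameSign p v) ∧
    (∀ (p : g.M) (v : Fin k.toNat → TangentSpace (𝓡 k.toNat) p),
      h.orientation.frameSign (Φ (Sum.inr p))
          (fun i => mfderiv (𝓡 k.toNat) (𝓡 k.toNat) (fun q : g.M => Φ (Sum.inr q)) p (v i))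
        = g.orientation.frameSign p v)

/-! ### Intersections -/

/-- Two pseudocycles are strongly transverse: for suitable coverings `g₀`, `g₁` of their `Bd`, by
manifolds of the dimensions that the definition of a pseudocycle asks for, each of `f₀`, `g₀` is
transverse to each of `f₁`, `g₁`. -/
def StronglyTransverse {k l : ℤ} (f₀ : Pseudocycle n X k) (f₁ : Pseudocycle n X l) : Prop :=
  ∃ (g₀ : MapFromManifold n X (k - 2)) (g₁ : MapFromManifold n X (l - 2)),
    Bd f₀.map ⊆ range g₀.map ∧ Bd f₁.map ⊆ range g₁.map ∧
    Transverse f₀.toMapFromManifold f₁.toMapFromManifold ∧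
    Transverse g₀ g₁ ∧
    Transverse f₀.toMapFromManifold g₁ ∧
    Transverse g₀ f₁.toMapFromManifold

/-- `f` is the intersection `f₀ · f₁`: its domain is the fibre product of `f₀` and `f₁`, that is, it
is smoothly embedded in `M₀ × M₁` by the map `(pr₀, pr₁)` with image the set of all `(p₀, p₁)` with
`f₀ p₀ = f₁ p₁`, and `f = f₀ ∘ pr₀ = f₁ ∘ pr₁`.

Orientation: let `w` be a basis of the tangent space of the fibre product, and let `s` consist of
vectors of `T M₀ × T M₁` which `(v₀, v₁) ↦ df₀ v₀ - df₁ v₁` sends to a basis `z` of `T X`.  Then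
`w` followed by `s` is a basis of `T M₀ × T M₁`, and
`T (M₀ ×_X M₁) ⊕ T X ≅ T M₀ ⊕ T M₁` preserves the orientation up to the sign
`(-1) ^ (dim M₁ * dim X)`.  With this sign, the identity of `X` acts as a unit from both sides.
The equation `hdim` between dimensions holds automatically if the fibre product is nonempty. -/
structure IsIntersection [IsManifold (𝓡 n) 1 X] (oX : ManifoldOrientation (𝓡 n) X n) {k l : ℤ}
    (f₀ : Pseudocycle n X k) (f₁ : Pseudocycle n X l) (f : Pseudocycle n X (k + l - n))
    (pr₀ : f.M → f₀.M) (pr₁ : f.M → f₁.M) : Prop where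
  isSmoothEmbedding : Manifold.IsSmoothEmbedding (𝓡 (k + l - n).toNat)
    ((𝓡 k.toNat).prod (𝓡 l.toNat)) ∞ (fun p => (pr₀ p, pr₁ p))
  range_eq : range (fun p => (pr₀ p, pr₁ p)) = {q | f₀.map q.1 = f₁.map q.2}
  map_eq₀ : ∀ p, f.map p = f₀.map (pr₀ p)
  map_eq₁ : ∀ p, f.map p = f₁.map (pr₁ p)
  orient_eq : ∀ (p : f.M) (hdim : (k + l - n).toNat + n = k.toNat + l.toNat)
    (a : Module.Basis (Fin k.toNat) ℝ (TangentSpace (𝓡 k.toNat) (pr₀ p)))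
    (b : Module.Basis (Fin l.toNat) ℝ (TangentSpace (𝓡 l.toNat) (pr₁ p)))
    (w : Module.Basis (Fin (k + l - n).toNat) ℝ (TangentSpace (𝓡 (k + l - n).toNat) p))
    (z : Module.Basis (Fin n) ℝ (TangentSpace (𝓡 n) (f.map p)))
    (s : Fin n → TangentSpace (𝓡 k.toNat) (pr₀ p) × TangentSpace (𝓡 l.toNat) (pr₁ p)),
    (∀ j, f₀.diff (pr₀ p) (s j).1 - f₁.diff (pr₁ p) (s j).2 = z j) →
    f.orientation.frameSign p w * oX.frameSign (f.map p) z *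
        SignType.sign (((a.prod b).reindex finSumFinEquiv).det
          (Fin.append
            (fun i => (mfderiv (𝓡 (k + l - n).toNat) (𝓡 k.toNat) pr₀ p (w i),
              mfderiv (𝓡 (k + l - n).toNat) (𝓡 l.toNat) pr₁ p (w i)))
            s ∘ Fin.cast hdim.symm))
      = (-1) ^ (l.toNat * n) *
        (f₀.orientation.frameSign (pr₀ p) a * f₁.orientation.frameSign (pr₁ p) b)

/-! ### Perturbations -/

/-- A diffeomorphism of `X` that is smoothly isotopic to the identity. -/
def IsotopicToId (φ : X ≃ₘ^∞⟮𝓡 n, 𝓡 n⟯ X) : Prop :=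
  ∃ Φ : unitInterval → X ≃ₘ^∞⟮𝓡 n, 𝓡 n⟯ X,
    ContMDiff ((𝓡∂ 1).prod (𝓡 n)) (𝓡 n) ∞ (fun q : unitInterval × X => Φ q.1 q.2) ∧
    Φ 0 = Diffeomorph.refl (𝓡 n) X ∞ ∧ Φ 1 = φ

lemma bd_comp {M : Type*} [TopologicalSpace M] (φ : X ≃ₜ X) (f : M → X) :
    Bd (φ ∘ f) = φ '' Bd f := by
  ext x
  obtain ⟨y, rfl⟩ := φ.surjective x
  simp only [Bd, image_comp, ← φ.image_closure, mem_iInter, φ.injective.mem_set_image]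

/-- The pseudocycle `φ ∘ f`, with the same oriented domain as `f`. -/
def Pseudocycle.comp {k : ℤ} (φ : X ≃ₘ^∞⟮𝓡 n, 𝓡 n⟯ X) (f : Pseudocycle n X k) :
    Pseudocycle n X k where
  M := f.M
  isEmpty_of_neg := f.isEmpty_of_neg
  map := φ ∘ f.map
  smooth := φ.contMDiff.comp f.smooth
  orientation := f.orientation
  isCompact_closure := by
    have h := φ.toHomeomorph.image_closure (range f.map)
    change φ '' _ = closure (φ '' _) at h
    rw [range_comp, ← h]
    exact f.isCompact_closure.image φ.continuous
  dim_bd := by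
    obtain ⟨g, hg⟩ := f.dim_bd
    refine ⟨{ g with map := φ ∘ g.map, smooth := φ.contMDiff.comp g.smooth }, ?_⟩
    have h := bd_comp φ.toHomeomorph f.map
    change Bd (φ ∘ f.map) = φ '' _ at h
    rw [h]
    change φ '' _ ⊆ range (φ ∘ g.map)
    rw [range_comp]
    exact image_mono hg

end

end Pseudocycles

end

open Pseudocycles

/-! Two facts about transversality carry the proof: it can be achieved by moving one of the maps by
a diffeomorphism, and the fibre product of transverse maps is a manifold of the expected dimension
whose limit set is controlled by the limit sets of the factors.

Moving. Around a compact subset of $X$ there is a finite-dimensional smooth family of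
diffeomorphisms $\varphi_s$ with $\varphi_0=\mathrm{id}$ which moves each nearby point in all
directions (`exists_perturbation`: cut-off translations in charts, composed over a finite cover). If
$f$ has its image in that neighbourhood, Sard's theorem makes $\varphi_s\circ f$ transverse to any
given map for almost all $s$ (`sard`, `parametric_zero_null`, `generic_trans`). Finitely many such
conditions hold simultaneously for almost all $s$, and $t\mapsto\varphi_{ts}$ is an isotopy to the
identity whose trace is an equivalence. This gives statement 1.

Fibre products. A limit point of $f_0\cdot f_1$ arises along points that leave every compact set, so
at least one of the two coordinates leaves every compact set: the limit set lies in
$(\mathrm{Bd}f_0\cap\mathrm{im}f_1)\cup(\mathrm{im}f_0\cap\mathrm{Bd}f_1)\cup(\mathrm{Bd}f_0\cap\mathrm{Bd}f_1)$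
(`bd_fibreProduct_subset`). After `Bd` is replaced by coverings, strong transversality bounds all
three dimensions by $k+l-n-2$, which gives statement 2. A cobordism in place of $f_0$ yields a
manifold with boundary, bounded by the fibre products of the ends. Its boundary orientation is the
right one because the outward normal is put first on the cobordism as well as on the fibre product
(`Filling.exists_fibreProduct`, `sign_boundary_fibre`).

The product of classes. Four comparisons show that it is well defined. If $\varphi_s f$ and
$\varphi_{s'}f$ are both strongly transverse to $g$, the products are equivalent: along the path
$s+t(s'-s)+t(1-t)u$ the ends stay fixed, and a generic $u$ makes the rest of the trace transverse to
$g$ (`equivalent_of_transversePairs`). Moving $f$ and moving $g$ give the same class, because each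
agrees with the result of moving both (`MovedRight.eq_of_movedLeft`). So the class of $f\cdot\varphi
g$ depends neither on $\varphi$ nor on the family from which $\varphi$ is taken. If $f$ and $f'$ are
equivalent by a cobordism, a generic $\varphi g$ is transverse to the whole cobordism and to a
covering of its limit set (`Cobordism.eventually_equivalent`). Exchanging the factors changes the
orientation by a sign that depends on dimensions only (`exists_sign_swap`), so invariance and
additivity in the second variable follow from those in the first. Uniqueness of the bilinear map is
clear, since every pair of classes has strongly transverse representatives.

The group. Disjoint unions of cobordisms make addition well defined, and a cylinder with both ends
regarded as incoming shows that reversing the orientation gives inverses. Classes are taken with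
respect to the equivalence relation generated by cobordism; every map out of them is tested on
single cobordisms, so cobordisms never have to be glued. -/

noncomputable section

namespace Pseudocycles

/-! ### Inverse functions and straightening charts, up to the boundary -/

section InverseFunction

variable {E E' F K : Type*} [NormedAddCommGroup E] [NormedSpace ℝ E]
  [NormedAddCommGroup E'] [NormedSpace ℝ E'] [NormedAddCommGroup F] [NormedSpace ℝ F]
  [NormedAddCommGroup K] [NormedSpace ℝ K]

/-- The inverse of a partial homeomorphism which is smooth on a set `S` with invertible derivative
is smooth on the corresponding set `T`. -/
theorem contDiffOn_symm_of_within [CompleteSpace E] (e : OpenPartialHomeomorph E E')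
    {S : Set E} {T : Set E'}
    (hST : ∀ x ∈ e.source, x ∈ S ↔ e x ∈ T) (hS : UniqueDiffOn ℝ (e.source ∩ S))
    (hT : UniqueDiffOn ℝ (e.target ∩ T)) (he : ContDiffOn ℝ ∞ e (e.source ∩ S))
    (hinv : ∀ x ∈ e.source ∩ S, ∃ L : E ≃L[ℝ] E',
      HasFDerivWithinAt e (L : E →L[ℝ] E') (e.source ∩ S) x) :
    ContDiffOn ℝ ∞ e.symm (e.target ∩ T) := by
  have hmaps : MapsTo e.symm (e.target ∩ T) (e.source ∩ S) := fun y hy =>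
    ⟨e.map_target hy.1, (hST _ (e.map_target hy.1)).2 (by rw [e.right_inv hy.1]; exact hy.2)⟩
  have hmaps' : MapsTo e (e.source ∩ S) (e.target ∩ T) := fun x hx =>
    ⟨e.map_source hx.1, (hST _ hx.1).1 hx.2⟩
  have hder : ∀ y ∈ e.target ∩ T, ∃ L : E ≃L[ℝ] E',
      HasFDerivWithinAt e (L : E →L[ℝ] E') (e.source ∩ S) (e.symm y) ∧
      HasFDerivWithinAt e.symm (L.symm : E' →L[ℝ] E) (e.target ∩ T) y := by
    intro y hy
    obtain ⟨L, hL⟩ := hinv _ (hmaps hy)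
    refine ⟨L, hL, ?_⟩
    refine HasFDerivWithinAt.of_local_left_inverse (f := e) ?_ hL hy ?_
    · exact tendsto_nhdsWithin_of_tendsto_nhds_of_eventually_within _
        ((e.continuousAt_symm hy.1).tendsto.mono_left nhdsWithin_le_nhds)
        (eventually_nhdsWithin_of_forall hmaps)
    · exact eventually_nhdsWithin_of_forall fun z hz => e.right_inv hz.1
  rw [contDiffOn_infty]
  intro n
  -- Bootstrap: the derivative of the inverse at `y` is the inverse of the derivative of `e` at
  -- `e.symm y`, so it is as often differentiable as `e.symm` is.
  induction n with
  | zero =>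
    rw [Nat.cast_zero, contDiffOn_zero]
    exact e.continuousOn_symm.mono inter_subset_left
  | succ n ih =>
    rw [Nat.cast_add, Nat.cast_one, contDiffOn_succ_iff_fderivWithin hT]
    refine ⟨fun y hy => ?_, by simp, ?_⟩
    · obtain ⟨L, -, h⟩ := hder y hy
      exact h.differentiableWithinAt
    · have h1 : ContDiffOn ℝ n (fderivWithin ℝ e (e.source ∩ S)) (e.source ∩ S) :=
        he.fderivWithin hS (mod_cast le_top)
      have h2 : ContDiffOn ℝ n (fun y => fderivWithin ℝ e (e.source ∩ S) (e.symm y))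
          (e.target ∩ T) := h1.comp ih hmaps
      have h3 : ContDiffOn ℝ n
          (fun y => (fderivWithin ℝ e (e.source ∩ S) (e.symm y)).inverse) (e.target ∩ T) := by
        intro y hy
        obtain ⟨L, h, -⟩ := hder y hy
        have h4 : fderivWithin ℝ e (e.source ∩ S) (e.symm y) = L :=
          h.fderivWithin (hS _ (hmaps hy))
        have h5 := contDiffAt_map_inverse (n := (n : WithTop ℕ∞)) (𝕜 := ℝ) L
        rw [← h4] at h5
        exact h5.comp_contDiffWithinAt y (h2 y hy)
      refine h3.congr fun y hy => ?_
      obtain ⟨L, h, h'⟩ := hder y hy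
      rw [h.fderivWithin (hS _ (hmaps hy)), h'.fderivWithin (hT _ hy),
        ContinuousLinearMap.inverse_equiv]

/-- A chart which straightens the level sets of a function `G` that is smooth on a set `H`
(typically a half space or everything); the second component of the chart is linear. -/
theorem exists_slice_chart [CompleteSpace E] {H O : Set E} {T : Set K} {y₀ : E} (hO : IsOpen O)
    (hyO : y₀ ∈ O) (hyH : y₀ ∈ H) (hH : UniqueDiffOn ℝ H) (hT : UniqueDiffOn ℝ T) {G : E → F}
    (L : E ≃L[ℝ] F × K)
    (hG : HasStrictFDerivAt G ((ContinuousLinearMap.fst ℝ F K).comp (L : E →L[ℝ] F × K)) y₀)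
    (hGs : ContDiffOn ℝ ∞ G (O ∩ H)) (hHT : ∀ y ∈ O, y ∈ H ↔ (L y).2 ∈ T) :
    ∃ e : OpenPartialHomeomorph E (F × K), y₀ ∈ e.source ∧ e.source ⊆ O ∧
      (∀ y, e y = (G y, (L y).2)) ∧ ContDiffOn ℝ ∞ e.symm (e.target ∩ (univ ×ˢ T)) := by
  set P : E →L[ℝ] K := (ContinuousLinearMap.snd ℝ F K).comp (L : E →L[ℝ] F × K) with hP
  set Ψ : E → F × K := fun y => (G y, (L y).2) with hΨ
  have hΨ' : HasStrictFDerivAt Ψ (L : E →L[ℝ] F × K) y₀ := by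
    have := hG.prodMk P.hasStrictFDerivAt
    exact this
  have hOH : UniqueDiffOn ℝ (O ∩ H) := by rw [inter_comm]; exact hH.inter hO
  have hΨs : ContDiffOn ℝ ∞ Ψ (O ∩ H) := hGs.prodMk P.contDiff.contDiffOn
  have hcont : ContinuousOn (fderivWithin ℝ Ψ (O ∩ H)) (O ∩ H) :=
    hΨs.continuousOn_fderivWithin hOH (by simp)
  have hd0 : fderivWithin ℝ Ψ (O ∩ H) y₀ = L :=
    hΨ'.hasFDerivAt.hasFDerivWithinAt.fderivWithin (hOH _ ⟨hyO, hyH⟩)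
  -- `G` is smooth only on one side and strictly differentiable only at `y₀`, so invertibility of
  -- the derivative at the other points must come from its one-sided continuity and the openness of
  -- the invertible operators.
  have hev : ∀ᶠ y in 𝓝[O ∩ H] y₀,
      fderivWithin ℝ Ψ (O ∩ H) y ∈ range ((↑) : (E ≃L[ℝ] F × K) → E →L[ℝ] F × K) := by
    apply (hcont y₀ ⟨hyO, hyH⟩).tendsto.eventually
    rw [hd0]
    exact ContinuousLinearEquiv.nhds L
  obtain ⟨V, hVo, hyV, hV⟩ := mem_nhdsWithin.1 hev
  let e := (hΨ'.toOpenPartialHomeomorph Ψ).restrOpen (O ∩ V) (hO.inter hVo)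
  have hes : e.source ⊆ O ∩ V := inter_subset_right
  refine ⟨e, ⟨hΨ'.mem_toOpenPartialHomeomorph_source, hyO, hyV⟩, hes.trans inter_subset_left,
    fun y => rfl, ?_⟩
  refine contDiffOn_symm_of_within (S := H) (T := univ ×ˢ T) e ?_ ?_ ?_ ?_ ?_
  · intro x hx
    rw [hHT x (hes hx).1]
    change _ ↔ Ψ x ∈ _
    simp [hΨ]
  · rw [inter_comm]; exact hH.inter e.open_source
  · rw [inter_comm]; exact (uniqueDiffOn_univ.prod hT).inter e.open_target
  · exact hΨs.mono fun x hx => ⟨(hes hx.1).1, hx.2⟩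
  · intro x hx
    have hxO : x ∈ O ∩ H := ⟨(hes hx.1).1, hx.2⟩
    obtain ⟨L', hL'⟩ := hV ⟨(hes hx.1).2, hxO⟩
    refine ⟨L', ?_⟩
    rw [hL']
    exact ((hΨs.differentiableOn (by simp) x hxO).hasFDerivWithinAt).mono
      fun z hz => ⟨(hes hz.1).1, hz.2⟩

/-- A smooth map is, near a point where its derivative is onto, the first component of a smooth
chart. -/
theorem exists_submersion_chart [CompleteSpace E] [FiniteDimensional ℝ F] {U : Set E}
    (hU : IsOpen U) {x₀ : E} (hx : x₀ ∈ U)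
    {f : E → F} (hf : ContDiffOn ℝ ∞ f U) (hs : Function.Surjective (fderiv ℝ f x₀)) :
    ∃ e : OpenPartialHomeomorph E (F × (fderiv ℝ f x₀).ker), x₀ ∈ e.source ∧ e.source ⊆ U ∧
      (∀ y, (e y).1 = f y) ∧ ContDiffOn ℝ ∞ e e.source ∧ ContDiffOn ℝ ∞ e.symm e.target := by
  have : CompleteSpace F := FiniteDimensional.complete ℝ F
  obtain ⟨R, hR⟩ := (fderiv ℝ f x₀).exists_rightInverse_of_surjective
    (LinearMap.range_eq_top.2 hs)
  let L := ContinuousLinearEquiv.equivOfRightInverse (fderiv ℝ f x₀) R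
    (fun v => by simpa using congrArg (fun A => A v) hR)
  have hst : HasStrictFDerivAt f (fderiv ℝ f x₀) x₀ :=
    (hf.contDiffAt (hU.mem_nhds hx)).hasStrictFDerivAt (by simp)
  obtain ⟨e, h0, h1, h2, h3⟩ := exists_slice_chart (H := univ) (T := univ) hU hx trivial
    uniqueDiffOn_univ uniqueDiffOn_univ L (G := f) hst (by simpa using hf)
    (by simp)
  refine ⟨e, h0, h1, fun y => by rw [h2], ?_, by simpa using h3⟩
  refine ContDiffOn.congr (f := fun y => (f y, (L y).2)) ?_ fun y _ => h2 y
  exact (hf.mono h1).prodMk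
    (contDiff_snd.comp L.contDiff).contDiffOn

end InverseFunction

end Pseudocycles

end

noncomputable section

namespace Pseudocycles

/-! ### Sard's theorem and its parametric form -/

section Sard

open MeasureTheory Module
open scoped ENNReal NNReal

/-- To show that the image of a set is null, it suffices to do so locally. -/
theorem measure_image_null_of_locally_null {A B : Type*} [TopologicalSpace A]
    [SecondCountableTopology A] [MeasurableSpace B] (μ : Measure B) (f : A → B) (s : Set A)
    (h : ∀ x ∈ s, ∃ u ∈ 𝓝 x, μ (f '' (s ∩ u)) = 0) : μ (f '' s) = 0 := by
  have := measure_null_of_locally_null (μ := OuterMeasure.comap f μ.toOuterMeasure) s ?_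
  · simpa using this
  · intro x hx
    obtain ⟨u, hu, h0⟩ := h x hx
    exact ⟨s ∩ u, inter_mem_nhdsWithin _ hu, by simpa using h0⟩

variable {E F : Type} [NormedAddCommGroup E] [NormedSpace ℝ E]
  [NormedAddCommGroup F] [NormedSpace ℝ F]

/-- Taylor estimate at a point where all derivatives of orders `1, …, k` vanish. -/
theorem norm_sub_le_of_iteratedFDeriv_eq_zero {k : ℕ} {V : Set E} (hV : Convex ℝ V)
    (hVo : IsOpen V) {C : ℝ} :
    ∀ {F : Type} [NormedAddCommGroup F] [NormedSpace ℝ F] {g : E → F},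
    ContDiffOn ℝ ∞ g V → (∀ y ∈ V, ‖iteratedFDeriv ℝ (k + 1) g y‖ ≤ C) →
    ∀ x ∈ V, (∀ i, 1 ≤ i → i ≤ k → iteratedFDeriv ℝ i g x = 0) →
    ∀ y ∈ V, ‖g y - g x‖ ≤ C * ‖y - x‖ ^ (k + 1) := by
  induction k with
  | zero =>
    intro F _ _ g hg hC x hx _ y hy
    rw [zero_add, pow_one]
    refine hV.norm_image_sub_le_of_norm_fderiv_le (𝕜 := ℝ)
      (fun z hz => (hg.contDiffAt (hVo.mem_nhds hz)).differentiableAt (by simp)) (fun z hz => ?_)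
      hx hy
    have := hC z hz
    rwa [zero_add, norm_iteratedFDeriv_one] at this
  | succ k ih =>
    intro F _ _ g hg hC x hx h0 y hy
    have hC0 : 0 ≤ C := (norm_nonneg _).trans (hC x hx)
    -- The induction hypothesis is applied to the derivative of `g`; the mean value inequality on
    -- the segment from `x` to `y` supplies the missing power.
    have h1 : ∀ z ∈ V, ‖fderiv ℝ g z - fderiv ℝ g x‖ ≤ C * ‖z - x‖ ^ (k + 1) := by
      refine ih (hg.fderiv_of_isOpen (m := ∞) hVo le_rfl) (fun z hz => ?_) x hx ?_
      · rw [norm_iteratedFDeriv_fderiv]; exact hC z hz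
      · intro i hi hik
        rw [← norm_eq_zero, norm_iteratedFDeriv_fderiv, h0 (i + 1) (by omega) (by omega),
          norm_zero]
    have hx0 : fderiv ℝ g x = 0 := by
      rw [← norm_eq_zero, ← norm_iteratedFDeriv_one, h0 1 le_rfl (by omega), norm_zero]
    rw [hx0] at h1
    have hseg : segment ℝ x y ⊆ V := hV.segment_subset hx hy
    have h2 : ∀ z ∈ segment ℝ x y, ‖fderiv ℝ g z‖ ≤ C * ‖y - x‖ ^ (k + 1) := by
      intro z hz
      have h3 := h1 z (hseg hz)
      rw [sub_zero] at h3
      refine h3.trans ?_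
      have h4 : ‖z - x‖ ≤ ‖y - x‖ := by
        rw [← dist_eq_norm, ← dist_eq_norm]
        have := dist_add_dist_of_mem_segment hz
        have h5 := dist_nonneg (x := z) (y := y)
        rw [dist_comm z x, dist_comm y x]
        linarith
      gcongr
    have h5 := (convex_segment x y).norm_image_sub_le_of_norm_fderiv_le (𝕜 := ℝ)
      (fun z hz => (hg.contDiffAt (hVo.mem_nhds (hseg hz))).differentiableAt (by simp)) h2
      (left_mem_segment ℝ x y) (right_mem_segment ℝ x y)
    rw [pow_succ, ← mul_assoc]
    exact h5

/-- The values of a real function at points where the first `finrank E` derivatives vanish form a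
null set. -/
theorem volume_image_flat_eq_zero [FiniteDimensional ℝ E] {U : Set E} (hU : IsOpen U) {g : E → ℝ}
    (hg : ContDiffOn ℝ ∞ g U) :
    volume (g '' {x ∈ U | ∀ i, 1 ≤ i → i ≤ finrank ℝ E → iteratedFDeriv ℝ i g x = 0}) = 0 := by
  set m := finrank ℝ E
  refine measure_image_null_of_locally_null _ _ _ fun x hx => ?_
  have hcont : ContinuousAt (fun y => ‖iteratedFDeriv ℝ (m + 1) g y‖) x := by
    have : ContDiffAt ℝ 0 (iteratedFDeriv ℝ (m + 1) g) x :=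
      (hg.contDiffAt (hU.mem_nhds hx.1)).iteratedFDeriv_right (by simp; exact mod_cast le_top)
    exact this.continuousAt.norm
  obtain ⟨ε, hε, hb⟩ : ∃ ε > 0, ∀ y ∈ Metric.ball x ε,
      y ∈ U ∧ ‖iteratedFDeriv ℝ (m + 1) g y‖ ≤ ‖iteratedFDeriv ℝ (m + 1) g x‖ + 1 :=
    Metric.eventually_nhds_iff_ball.1 ((show ∀ᶠ y in 𝓝 x, y ∈ U from hU.mem_nhds hx.1).and
      (hcont.eventually (eventually_le_nhds (by simp))))
  set C : ℝ := ‖iteratedFDeriv ℝ (m + 1) g x‖ + 1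
  have hC0 : 0 ≤ C := by positivity
  refine ⟨Metric.ball x ε, Metric.ball_mem_nhds _ hε, ?_⟩
  set A := {x ∈ U | ∀ i, 1 ≤ i → i ≤ m → iteratedFDeriv ℝ i g x = 0} ∩ Metric.ball x ε
  -- By the Taylor estimate `g` is Hölder of exponent `m + 1` on the flat points, so the image has
  -- Hausdorff dimension at most `m / (m + 1) < 1` and is therefore null.
  have hH : HolderOnWith (Real.toNNReal C) ((m : ℝ≥0) + 1) g A := by
    intro a ha b hb'
    have h1 := norm_sub_le_of_iteratedFDeriv_eq_zero (convex_ball x ε) Metric.isOpen_ball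
      (hg.mono fun y hy => (hb y hy).1) (fun y hy => (hb y hy).2) b hb'.2 hb'.1.2 a ha.2
    rw [edist_dist, edist_dist, ENNReal.ofReal_rpow_of_nonneg dist_nonneg (by positivity)]
    change _ ≤ ENNReal.ofReal C * _
    rw [← ENNReal.ofReal_mul hC0]
    apply ENNReal.ofReal_le_ofReal
    rw [dist_eq_norm, dist_eq_norm]
    refine h1.trans_eq ?_
    congr 1
    rw [← Real.rpow_natCast]
    norm_num
  have h2 : dimH (g '' A) < (1 : ℝ≥0) := by
    refine (hH.dimH_image_le (by positivity)).trans_lt ?_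
    have h3 : dimH A ≤ m := by
      rw [← Real.dimH_univ_eq_finrank E]
      exact dimH_mono (subset_univ _)
    refine (ENNReal.div_le_div_right h3 _).trans_lt ?_
    rw [ENNReal.div_lt_iff (by simp) (by simp)]
    simp only [ENNReal.coe_one, one_mul, ENNReal.coe_add, ENNReal.coe_natCast]
    exact ENNReal.lt_add_right (by simp) (by simp)
  have := hausdorffMeasure_of_dimH_lt h2
  rwa [NNReal.coe_one, hausdorffMeasure_real] at this

theorem finrank_ker_lt [FiniteDimensional ℝ E] {A : E →L[ℝ] F} (hA : A ≠ 0) :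
    finrank ℝ A.ker < finrank ℝ E := by
  apply Submodule.finrank_lt
  rw [Ne, LinearMap.ker_eq_top]
  intro h
  exact hA (by ext x; simpa using congrArg (fun B => B x) h)

/-- Sard's theorem for real valued functions. -/
theorem sard_real (m : ℕ) : ∀ {E : Type} [NormedAddCommGroup E] [NormedSpace ℝ E]
    [FiniteDimensional ℝ E], finrank ℝ E = m → ∀ {U : Set E}, IsOpen U → ∀ {g : E → ℝ},
    ContDiffOn ℝ ∞ g U → volume (g '' {x ∈ U | fderiv ℝ g x = 0}) = 0 := by
  induction m using Nat.strong_induction_on with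
  | _ m ih =>
  intro E _ _ _ hm U hU g hg
  let A : ℕ → Set E := fun k => {x ∈ U | ∀ i, 1 ≤ i → i ≤ k → iteratedFDeriv ℝ i g x = 0}
  have hA1 : {x ∈ U | fderiv ℝ g x = 0} ⊆ A 1 := by
    rintro x ⟨hx, h0⟩
    refine ⟨hx, fun i h1 h2 => ?_⟩
    obtain rfl : i = 1 := by omega
    rw [← norm_eq_zero, norm_iteratedFDeriv_one, h0, norm_zero]
  -- Near a point of `A k` outside `A (k + 1)`, some component `w` of the `k`-th derivative has
  -- nonzero differential. All of `A k` lies in the hypersurface `w = 0` and consists of critical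
  -- points of `g`, so the statement in lower dimension applies to `g` on this hypersurface.
  have hstep : ∀ k, 1 ≤ k → volume (g '' (A k \ A (k + 1))) = 0 := by
    intro k hk
    refine measure_image_null_of_locally_null _ _ _ fun x hx => ?_
    have hx1 : iteratedFDeriv ℝ (k + 1) g x ≠ 0 := by
      intro h0
      refine hx.2 ⟨hx.1.1, fun i h1 h2 => ?_⟩
      rcases Nat.lt_or_ge k i with h | h
      · obtain rfl : i = k + 1 := by omega
        exact h0
      · exact hx.1.2 i h1 h
    have hWs : ContDiffOn ℝ ∞ (iteratedFDeriv ℝ k g) U := fun y hy =>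
      ((hg.contDiffAt (hU.mem_nhds hy)).iteratedFDeriv_right
        (m := ∞) (by exact_mod_cast le_top)).contDiffWithinAt
    have hW : fderiv ℝ (iteratedFDeriv ℝ k g) x ≠ 0 := by
      intro h0
      apply hx1
      have h3 := norm_fderiv_iteratedFDeriv (𝕜 := ℝ) (f := g) (x := x) (n := k)
      have h4 : ‖fderiv ℝ (iteratedFDeriv ℝ k g) x‖ = 0 := by
        rw [h0]; exact ContinuousLinearMap.opNorm_zero
      rw [← norm_eq_zero, ← h3, h4]
    obtain ⟨e, he⟩ : ∃ e, fderiv ℝ (iteratedFDeriv ℝ k g) x e ≠ 0 := by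
      by_contra! h
      exact hW (by ext1 v; simpa using h v)
    obtain ⟨v, hv⟩ : ∃ v, fderiv ℝ (iteratedFDeriv ℝ k g) x e v ≠ 0 := by
      by_contra! h
      exact he (by ext v; simpa using h v)
    let ev : (E [×k]→L[ℝ] ℝ) →L[ℝ] ℝ := ContinuousMultilinearMap.apply ℝ (fun _ => E) ℝ v
    let w : E → ℝ := fun y => ev (iteratedFDeriv ℝ k g y)
    have hw : ContDiffOn ℝ ∞ w U := ev.contDiff.comp_contDiffOn hWs
    have hwd : fderiv ℝ w x = ev.comp (fderiv ℝ (iteratedFDeriv ℝ k g) x) :=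
      (ev.hasFDerivAt.comp x ((hWs.contDiffAt (hU.mem_nhds hx.1.1)).differentiableAt
        (by simp)).hasFDerivAt).fderiv
    have hwe : fderiv ℝ w x e ≠ 0 := by rw [hwd]; exact hv
    have hsurj : Function.Surjective (fderiv ℝ w x) := fun r =>
      ⟨(r / fderiv ℝ w x e) • e, by simp [hwe]⟩
    obtain ⟨c, hxc, hcU, hc1, -, hc2⟩ := exists_submersion_chart hU hx.1.1 hw hsurj
    have hlt : finrank ℝ (fderiv ℝ w x).ker < m := by
      rw [← hm]; exact finrank_ker_lt fun h => hwe (by simp [h])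
    let γ : (fderiv ℝ w x).ker → E := fun κ => c.symm (0, κ)
    let D : Set (fderiv ℝ w x).ker := {κ | ((0 : ℝ), κ) ∈ c.target}
    have hD : IsOpen D := c.open_target.preimage (by fun_prop)
    have hγ : ContDiffOn ℝ ∞ γ D := hc2.comp (by fun_prop) fun κ hκ => hκ
    have hγU : MapsTo γ D U := fun κ hκ => hcU (c.map_target hκ)
    have hnull := ih _ hlt rfl hD (hg.comp hγ hγU)
    refine ⟨c.source, c.open_source.mem_nhds hxc, measure_mono_null ?_ hnull⟩
    rintro _ ⟨y, ⟨⟨hyA, -⟩, hyc⟩, rfl⟩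
    have hwy : w y = 0 := by simp [w, ev, hyA.2 k hk le_rfl]
    have hcy : c y = (0, (c y).2) := Prod.ext (by rw [hc1, hwy]) rfl
    have hyD : (c y).2 ∈ D := by
      change _ ∈ c.target
      rw [← hcy]; exact c.map_source hyc
    have hγy : γ (c y).2 = y := by
      change c.symm _ = y
      rw [← hcy, c.left_inv hyc]
    refine ⟨(c y).2, ⟨hyD, ?_⟩, by simp [hγy]⟩
    have hg0 : fderiv ℝ g y = 0 := by
      rw [← norm_eq_zero, ← norm_iteratedFDeriv_one, hyA.2 1 le_rfl hk, norm_zero]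
    have h1 : HasFDerivAt g (0 : E →L[ℝ] ℝ) (γ (c y).2) := by
      rw [hγy, ← hg0]
      exact ((hg.contDiffAt (hU.mem_nhds hyA.1)).differentiableAt (by simp)).hasFDerivAt
    have h2 := h1.comp _ ((hγ.contDiffAt (hD.mem_nhds hyD)).differentiableAt
      (by simp)).hasFDerivAt
    rw [h2.fderiv]; simp
  have hall : ∀ k, 1 ≤ k → volume (g '' (A 1 \ A k)) = 0 := by
    intro k hk
    induction k, hk using Nat.le_induction with
    | base => simp
    | succ k hk ihk =>
      refine measure_mono_null ?_ (measure_union_null ihk (hstep k hk))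
      rw [← image_union]
      apply image_mono
      rintro y ⟨h1, h2⟩
      by_cases h : y ∈ A k
      · exact Or.inr ⟨h, h2⟩
      · exact Or.inl ⟨h1, h⟩
  -- The critical points that are not removed by the steps above are flat to an order covered by the
  -- Hölder argument.
  have hflat := volume_image_flat_eq_zero hU hg
  refine measure_mono_null ?_ (measure_union_null (hall (finrank ℝ E + 1) (by omega)) hflat)
  rw [← image_union]
  apply image_mono
  intro y hy
  by_cases h : y ∈ A (finrank ℝ E + 1)
  · exact Or.inr ⟨h.1, fun i h1 h2 => h.2 i h1 (by omega)⟩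
  · exact Or.inl ⟨hA1 hy, h⟩

/-- If `R` is a right inverse of `A`, then `B.comp R` is close to the identity for `B` near `A`,
hence invertible, which makes `B` onto. -/
theorem isOpen_setOf_surjective {F : Type} [NormedAddCommGroup F] [NormedSpace ℝ F]
    [FiniteDimensional ℝ F] : IsOpen {A : E →L[ℝ] F | Function.Surjective A} := by
  have : CompleteSpace F := FiniteDimensional.complete ℝ F
  rw [isOpen_iff_mem_nhds]
  intro A hA
  obtain ⟨R, hR⟩ := A.exists_rightInverse_of_surjective (LinearMap.range_eq_top.2 hA)
  have hc : ContinuousAt (fun B : E →L[ℝ] F => B.comp R) A := by fun_prop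
  have h1 : range ((↑) : (F ≃L[ℝ] F) → F →L[ℝ] F) ∈ 𝓝 (A.comp R) := by
    rw [hR]; exact ContinuousLinearEquiv.nhds (ContinuousLinearEquiv.refl ℝ F)
  filter_upwards [hc h1] with B hB
  obtain ⟨L, hL⟩ := hB
  intro v
  obtain ⟨w, rfl⟩ := L.surjective v
  exact ⟨R w, (congrArg (fun T => T w) hL).symm⟩

/-- A nonzero functional splits a finite-dimensional space. -/
theorem exists_splitting [FiniteDimensional ℝ F] {l : F →L[ℝ] ℝ} (hl : l ≠ 0) :
    ∃ L : F ≃L[ℝ] ℝ × l.ker, ∀ v, (L v).1 = l v := by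
  obtain ⟨w, hw⟩ : ∃ w, l w ≠ 0 := by
    by_contra! h
    exact hl (by ext v; simpa using h v)
  have hs : Function.Surjective l := fun r => ⟨(r / l w) • w, by simp [hw]⟩
  obtain ⟨R, hR⟩ := l.exists_rightInverse_of_surjective (LinearMap.range_eq_top.2 hs)
  exact ⟨ContinuousLinearEquiv.equivOfRightInverse l R
    (fun v => by simpa using congrArg (fun A => A v) hR), fun v => rfl⟩

/-- Haar measures are absolutely continuous with respect to each other, so null sets may be tested
in any linear coordinates. Here the coordinates are a product, where the measure of slices can be
used. -/
theorem absolutelyContinuous_map_splitting [FiniteDimensional ℝ F] [MeasurableSpace F]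
    [BorelSpace F] (μ : Measure F) [μ.IsAddHaarMeasure] {K : Type} [NormedAddCommGroup K]
    [NormedSpace ℝ K] [FiniteDimensional ℝ K] [MeasurableSpace K] [BorelSpace K]
    (ν : Measure K) [ν.IsAddHaarMeasure] (L : F ≃L[ℝ] ℝ × K) {s : Set F}
    (hs : (volume.prod ν) (L '' s) = 0) : μ s = 0 := by
  have : (Measure.map L.symm (volume.prod ν)).IsAddHaarMeasure :=
    L.symm.isAddHaarMeasure_map _
  apply Measure.absolutelyContinuous_isAddHaarMeasure μ (Measure.map L.symm (volume.prod ν))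
  have h0 := L.symm.toHomeomorph.toMeasurableEquiv.map_apply (μ := volume.prod ν) s
  refine Eq.trans h0 ?_
  convert hs using 2
  ext v
  constructor
  · intro h; exact ⟨_, h, L.apply_symm_apply v⟩
  · rintro ⟨w, hw, rfl⟩
    change L.symm (L w) ∈ s
    rwa [L.symm_apply_apply]

/-- Sard's theorem. -/
theorem sard (m : ℕ) : ∀ {E F : Type} [NormedAddCommGroup E] [NormedSpace ℝ E]
    [FiniteDimensional ℝ E] [NormedAddCommGroup F] [NormedSpace ℝ F] [FiniteDimensional ℝ F]
    [MeasurableSpace F] [BorelSpace F] (μ : Measure F) [μ.IsAddHaarMeasure],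
    finrank ℝ E = m → ∀ {U : Set E}, IsOpen U → ∀ {f : E → F}, ContDiffOn ℝ ∞ f U →
    μ (f '' {x ∈ U | ¬ Function.Surjective (fderiv ℝ f x)}) = 0 := by
  induction m using Nat.strong_induction_on with
  | _ m ih =>
  intro E F _ _ _ _ _ _ _ _ μ _ hm U hU f hf
  have hfd : ∀ x ∈ U, DifferentiableAt ℝ f x := fun x hx =>
    (hf.contDiffAt (hU.mem_nhds hx)).differentiableAt (by simp)
  -- Where the derivative vanishes, a single nonzero functional `l` suffices: `l ∘ f` is critical
  -- there, so its values form a null set, and the image lies in the product of that null set with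
  -- the kernel of `l`.
  have hzero : μ (f '' {x ∈ U | ¬ Function.Surjective (fderiv ℝ f x) ∧ fderiv ℝ f x = 0}) = 0 := by
    rcases subsingleton_or_nontrivial F with hF | hF
    · convert measure_empty (μ := μ)
      rw [image_eq_empty, eq_empty_iff_forall_notMem]
      exact fun x hx => hx.2.1 fun v => ⟨0, Subsingleton.elim _ _⟩
    obtain ⟨v, hv⟩ := exists_ne (0 : F)
    obtain ⟨l, hl⟩ := SeparatingDual.exists_ne_zero (R := ℝ) hv
    obtain ⟨L, hL⟩ := exists_splitting (l := l) fun h => hl (by simp [h])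
    refine absolutelyContinuous_map_splitting μ (Measure.addHaar (G := l.ker)) L ?_
    have h1 := sard_real m hm hU (l.contDiff.comp_contDiffOn hf)
    refine measure_mono_null (t := ((l ∘ f) '' {x ∈ U | fderiv ℝ (l ∘ f) x = 0}) ×ˢ univ) ?_ ?_
    · rintro _ ⟨_, ⟨x, hx, rfl⟩, rfl⟩
      refine ⟨⟨x, ⟨hx.1, ?_⟩, (hL _).symm⟩, trivial⟩
      rw [(l.hasFDerivAt.comp x (hfd x hx.1).hasFDerivAt).fderiv, hx.2.2]
      simp
    · rw [Measure.prod_prod, h1, zero_mul]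
  -- Where the derivative is nonzero, `l ∘ f` is a submersion for some functional `l`. Slice the
  -- domain by its level sets and the target by those of `l`; on each slice the dimension of the
  -- domain has dropped, and Fubini reassembles the slices.
  have hne : μ (f '' {x ∈ U | ¬ Function.Surjective (fderiv ℝ f x) ∧ fderiv ℝ f x ≠ 0}) = 0 := by
    refine measure_image_null_of_locally_null _ _ _ fun x₀ hx₀ => ?_
    obtain ⟨hxU, -, hx₀⟩ := hx₀
    obtain ⟨e, he⟩ : ∃ e, fderiv ℝ f x₀ e ≠ 0 := by
      by_contra! h
      exact hx₀ (by ext v; simpa using h v)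
    obtain ⟨l, hl⟩ := SeparatingDual.exists_ne_zero (R := ℝ) he
    obtain ⟨L, hL⟩ := exists_splitting (l := l) fun h => hl (by simp [h])
    have hg : ContDiffOn ℝ ∞ (l ∘ f) U := l.contDiff.comp_contDiffOn hf
    have hgd : ∀ x ∈ U, fderiv ℝ (l ∘ f) x = l.comp (fderiv ℝ f x) := fun x hx =>
      (l.hasFDerivAt.comp x (hfd x hx).hasFDerivAt).fderiv
    have hge : fderiv ℝ (l ∘ f) x₀ e ≠ 0 := by rw [hgd _ hxU]; exact hl
    obtain ⟨c, hxc, hcU, hc1, -, hc2⟩ := exists_submersion_chart hU hxU hg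
      (fun r => ⟨(r / fderiv ℝ (l ∘ f) x₀ e) • e, by simp [hge]⟩)
    have hlt : finrank ℝ (fderiv ℝ (l ∘ f) x₀).ker < m := by
      rw [← hm]; exact finrank_ker_lt fun h => hge (by simp [h])
    obtain ⟨k, hk, hkc, hkn⟩ := exists_compact_subset c.open_source hxc
    refine ⟨interior k, isOpen_interior.mem_nhds hkc, ?_⟩
    refine measure_mono_null (t := f '' ({x | ¬ Function.Surjective (fderiv ℝ f x)} ∩ k)) ?_ ?_
    · apply image_mono
      exact fun x hx => ⟨hx.1.2.1, interior_subset hx.2⟩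
    -- Fubini needs a measurable set; restricting to a compact neighbourhood makes the critical set,
    -- and hence its image, compact.
    have hcomp : IsCompact ({x | ¬ Function.Surjective (fderiv ℝ f x)} ∩ k) := by
      have h1 : ContinuousOn (fderiv ℝ f) k :=
        (hf.continuousOn_fderiv_of_isOpen hU (by simp)).mono (hkn.trans hcU)
      obtain ⟨C, hC, hCk⟩ := h1.preimage_isClosed_of_isClosed hk.isClosed
        (isOpen_setOf_surjective (E := E) (F := F)).isClosed_compl |> fun h =>
          (⟨_, h, rfl⟩ : ∃ C, IsClosed C ∧ C = k ∩ fderiv ℝ f ⁻¹' _)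
      refine hk.of_isClosed_subset ?_ inter_subset_right
      rw [inter_comm]
      rw [hCk] at hC
      exact hC
    have hcomp' : IsCompact (L '' (f '' ({x | ¬ Function.Surjective (fderiv ℝ f x)} ∩ k))) :=
      (hcomp.image_of_continuousOn (hf.continuousOn.mono fun x hx => hcU (hkn hx.2))).image
        L.continuous
    refine absolutelyContinuous_map_splitting μ (Measure.addHaar (G := l.ker)) L ?_
    rw [Measure.measure_prod_null hcomp'.isClosed.measurableSet]
    refine Filter.Eventually.of_forall fun t => ?_
    let D : Set (fderiv ℝ (l ∘ f) x₀).ker := {κ | (t, κ) ∈ c.target}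
    have hD : IsOpen D := c.open_target.preimage (by fun_prop)
    let h : (fderiv ℝ (l ∘ f) x₀).ker → l.ker := fun κ => (L (f (c.symm (t, κ)))).2
    have hfc : ContDiffOn ℝ ∞ (fun z => f (c.symm z)) c.target :=
      hf.comp hc2 fun z hz => hcU (c.map_target hz)
    have hh : ContDiffOn ℝ ∞ h D :=
      (contDiff_snd.comp L.contDiff).comp_contDiffOn
        (hfc.comp (t := c.target) (s := D) (g := fun z => f (c.symm z))
          (f := fun κ => (t, κ)) (by fun_prop) fun κ hκ => hκ)
    refine measure_mono_null ?_ (ih _ hlt (Measure.addHaar (G := l.ker)) rfl hD hh)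
    rintro y ⟨_, ⟨x, ⟨hxs, hxk⟩, rfl⟩, hxy⟩
    have hxc' : x ∈ c.source := hkn hxk
    have hcx : c x = (t, (c x).2) := by
      refine Prod.ext ?_ rfl
      rw [hc1]
      have := congrArg Prod.fst hxy
      rw [hL] at this
      exact this
    have hcx' : c.symm (t, (c x).2) = x := by rw [← hcx, c.left_inv hxc']
    have hxD : (c x).2 ∈ D := by
      change _ ∈ c.target
      rw [← hcx]; exact c.map_source hxc'
    refine ⟨(c x).2, ⟨hxD, ?_⟩, ?_⟩
    swap
    · change (L (f (c.symm (t, (c x).2)))).2 = y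
      rw [hcx', hxy]
    -- If the slice map is submersive at this point, so is `f`: the direction transverse to the
    -- slice realises every value of `l` by `hlf`, and the slice realises everything in the kernel
    -- of `l`.
    intro hsurj
    apply hxs
    set z : ℝ × (fderiv ℝ (l ∘ f) x₀).ker := (t, (c x).2)
    have hγ : HasFDerivAt c.symm (fderiv ℝ c.symm z) z :=
      ((hc2.contDiffAt (c.open_target.mem_nhds hxD)).differentiableAt (by simp)).hasFDerivAt
    have hf' : HasFDerivAt f (fderiv ℝ f x) (c.symm z) := by
      rw [hcx']; exact (hfd x (hcU hxc')).hasFDerivAt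
    have hfγ := hf'.comp z hγ
    have hlf : ∀ p, l (fderiv ℝ f x (fderiv ℝ c.symm z p)) = p.1 := by
      have h1 := l.hasFDerivAt.comp z hfγ
      have h2 : HasFDerivAt (l ∘ f ∘ c.symm)
          (ContinuousLinearMap.fst ℝ ℝ (fderiv ℝ (l ∘ f) x₀).ker) z := by
        refine hasFDerivAt_fst.congr_of_eventuallyEq ?_
        filter_upwards [c.open_target.mem_nhds hxD] with p hp
        change (l ∘ f) (c.symm p) = p.1
        rw [← hc1, c.right_inv hp]
      intro p
      exact congrArg (fun A => A p) (h1.unique h2)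
    have hhd : ∀ κ, fderiv ℝ h (c x).2 κ = (L (fderiv ℝ f x (fderiv ℝ c.symm z (0, κ)))).2 := by
      have h1 : HasFDerivAt (fun κ : (fderiv ℝ (l ∘ f) x₀).ker => (t, κ))
          (ContinuousLinearMap.inr ℝ ℝ _) (c x).2 := hasFDerivAt_prodMk_right t (c x).2
      have h2 := ((hasFDerivAt_snd (𝕜 := ℝ)).comp _ (L.hasFDerivAt.comp _ (hfγ.comp _ h1)))
      intro κ
      exact congrArg (fun A => A κ) h2.fderiv
    intro v
    obtain ⟨κ, hκ⟩ := hsurj (L (v - fderiv ℝ f x (fderiv ℝ c.symm z (l v, 0)))).2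
    refine ⟨fderiv ℝ c.symm z (l v, κ), ?_⟩
    have h3 : ((l v, κ) : ℝ × (fderiv ℝ (l ∘ f) x₀).ker) = (l v, 0) + (0, κ) := by simp
    rw [h3, map_add, map_add, eq_comm, ← sub_eq_iff_eq_add', eq_comm]
    apply L.injective
    refine Prod.ext ?_ ?_
    · rw [hL, hL, hlf, map_sub, hlf]
      simp
    · rw [← hhd, hκ]
  refine measure_mono_null ?_ (measure_union_null hzero hne)
  rw [← image_union]
  apply image_mono
  intro x hx
  by_cases h : fderiv ℝ f x = 0
  · exact Or.inl ⟨hx.1, hx.2, h⟩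
  · exact Or.inr ⟨hx.1, hx.2, h⟩

/-- Parametric transversality to zero: if `H (x, s)` is, at its zeros, submersive in the
parameter `s`, then for almost all `s` the map `H (·, s)` is submersive at its zeros. -/
theorem parametric_zero_null {E S F : Type} [NormedAddCommGroup E] [NormedSpace ℝ E]
    [FiniteDimensional ℝ E] [NormedAddCommGroup S] [NormedSpace ℝ S] [FiniteDimensional ℝ S]
    [MeasurableSpace S] [BorelSpace S] (μ : Measure S) [μ.IsAddHaarMeasure]
    [NormedAddCommGroup F] [NormedSpace ℝ F] [FiniteDimensional ℝ F]
    {Ω : Set (E × S)} (hΩ : IsOpen Ω) {H : E × S → F} (hH : ContDiffOn ℝ ∞ H Ω)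
    (hs : ∀ z ∈ Ω, H z = 0 → ∀ v, ∃ σ, fderiv ℝ H z (0, σ) = v) :
    μ {s | ∃ x, (x, s) ∈ Ω ∧ H (x, s) = 0 ∧ ¬ ∀ v, ∃ ξ, fderiv ℝ H (x, s) (ξ, 0) = v} = 0 := by
  have : {s | ∃ x, (x, s) ∈ Ω ∧ H (x, s) = 0 ∧ ¬ ∀ v, ∃ ξ, fderiv ℝ H (x, s) (ξ, 0) = v} =
      Prod.snd '' {z ∈ Ω | H z = 0 ∧ ¬ ∀ v, ∃ ξ, fderiv ℝ H z (ξ, 0) = v} := by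
    ext s
    exact ⟨fun ⟨x, h⟩ => ⟨_, h, rfl⟩, by rintro ⟨⟨x, s⟩, h, rfl⟩; exact ⟨x, h⟩⟩
  rw [this]
  refine measure_image_null_of_locally_null _ _ _ fun z₀ hz₀ => ?_
  obtain ⟨hzΩ, hz0, -⟩ := hz₀
  obtain ⟨c, hzc, hcΩ, hc1, -, hc2⟩ := exists_submersion_chart hΩ hzΩ hH
    (fun v => by obtain ⟨σ, hσ⟩ := hs z₀ hzΩ hz0 v; exact ⟨_, hσ⟩)
  refine ⟨c.source, c.open_source.mem_nhds hzc, ?_⟩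
  let D : Set (fderiv ℝ H z₀).ker := {κ | ((0 : F), κ) ∈ c.target}
  have hD : IsOpen D := c.open_target.preimage (by fun_prop)
  let γ : (fderiv ℝ H z₀).ker → E × S := fun κ => c.symm (0, κ)
  have hγ : ContDiffOn ℝ ∞ γ D := hc2.comp (by fun_prop) fun κ hκ => hκ
  -- `γ` parametrises the zero set of `H`. The bad parameters are critical values of the projection
  -- of this zero set to `S`.
  refine measure_mono_null ?_ (sard _ μ rfl hD (contDiff_snd.comp_contDiffOn hγ))
  rintro _ ⟨z, ⟨⟨hz, hHz, hns⟩, hzs⟩, rfl⟩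
  have hcz : c z = (0, (c z).2) := Prod.ext (by rw [hc1, hHz]) rfl
  have hzD : (c z).2 ∈ D := by
    change _ ∈ c.target
    rw [← hcz]; exact c.map_source hzs
  have hγz : γ (c z).2 = z := by
    change c.symm _ = z
    rw [← hcz, c.left_inv hzs]
  refine ⟨(c z).2, ⟨hzD, ?_⟩, by simp [hγz]⟩
  -- Given `v`, take `σ` with `H' (0, σ) = v` and a tangent vector `(ξ, σ)` of the zero set over it.
  -- Then `H' (ξ, 0) = -v`, so `-ξ` is the required direction.
  intro hsurj
  apply hns
  intro v
  obtain ⟨σ, hσ⟩ := hs z hz hHz v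
  obtain ⟨κ, hκ⟩ := hsurj σ
  have hγ' : HasFDerivAt γ (fderiv ℝ γ (c z).2) (c z).2 :=
    ((hγ.contDiffAt (hD.mem_nhds hzD)).differentiableAt (by simp)).hasFDerivAt
  have hH' : HasFDerivAt H (fderiv ℝ H z) (γ (c z).2) := by
    rw [hγz]
    exact ((hH.contDiffAt (hΩ.mem_nhds hz)).differentiableAt (by simp)).hasFDerivAt
  have h1 : fderiv ℝ H z (fderiv ℝ γ (c z).2 κ) = 0 := by
    have h2 : HasFDerivAt (H ∘ γ) (0 : (fderiv ℝ H z₀).ker →L[ℝ] F) (c z).2 := by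
      refine (hasFDerivAt_const (0 : F) _).congr_of_eventuallyEq ?_
      filter_upwards [hD.mem_nhds hzD] with κ hκ
      change H (c.symm _) = 0
      rw [← hc1, c.right_inv hκ]
    exact congrArg (fun A => A κ) ((hH'.comp _ hγ').unique h2)
  rw [((hasFDerivAt_snd (𝕜 := ℝ)).comp _ hγ').fderiv] at hκ
  have h3 : fderiv ℝ γ (c z).2 κ = ((fderiv ℝ γ (c z).2 κ).1, 0) + (0, σ) := by
    refine Prod.ext (by simp) ?_
    simpa using hκ
  rw [h3, map_add, hσ] at h1
  refine ⟨-(fderiv ℝ γ (c z).2 κ).1, ?_⟩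
  have h4 : ((-(fderiv ℝ γ (c z).2 κ).1, 0) : E × S) = -((fderiv ℝ γ (c z).2 κ).1, 0) := by simp
  rw [h4, map_neg, neg_eq_iff_eq_neg]
  exact eq_neg_of_add_eq_zero_left h1

end Sard

end Pseudocycles

end

noncomputable section

namespace Pseudocycles

/-! ### Extending functions across the boundary of a half space -/

section HalfSpace

variable {E F : Type*} [NormedAddCommGroup E] [NormedSpace ℝ E]
  [NormedAddCommGroup F] [NormedSpace ℝ F]

/-- A function which is smooth on a half space up to the boundary extends to a function which is
strictly differentiable at a given boundary point. -/
theorem exists_strict_extension {l : E →L[ℝ] ℝ} {e : E} (he : l e = 1) {O : Set E} (hO : IsOpen O)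
    {y₀ : E} (hy : y₀ ∈ O) (hl : l y₀ = 0) {G : E → F}
    (hG : ContDiffOn ℝ ∞ G (O ∩ {y | 0 ≤ l y})) :
    ∃ G₁ : E → F, (∀ y, 0 ≤ l y → G₁ y = G y) ∧
      HasStrictFDerivAt G₁ (fderivWithin ℝ G (O ∩ {y | 0 ≤ l y}) y₀) y₀ := by
  set H : Set E := {y | 0 ≤ l y} with hH
  have hHc : Convex ℝ H := (convex_Ici (0 : ℝ)).linear_preimage l.toLinearMap
  have hHi : (interior H).Nonempty := by
    refine ⟨e, mem_interior.2 ⟨{y | 0 < l y}, fun y (hy : 0 < l y) => le_of_lt (a := (0 : ℝ)) hy,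
      isOpen_lt continuous_const l.continuous, ?_⟩⟩
    simp [he]
  have hu : UniqueDiffOn ℝ (O ∩ H) := by
    rw [inter_comm]; exact (uniqueDiffOn_convex hHc hHi).inter hO
  set G' := fderivWithin ℝ G (O ∩ H) y₀
  have hyH : y₀ ∈ O ∩ H := ⟨hy, hl.ge⟩
  -- A reflection with weights `2` and `-1`. For `l y < 0` the two arguments lie on and above the
  -- hyperplane, and with these weights both the value and the first derivative match at `l y = 0`.
  let G₁ : E → F := fun y =>
    if 0 ≤ l y then G y else (2 : ℝ) • G (y - l y • e) - G (y - (2 * l y) • e)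
  refine ⟨G₁, fun y hy => if_pos hy, ?_⟩
  have hG₁p : ∀ y, 0 ≤ l y → G₁ y = G y := fun y hy => if_pos hy
  have hG₁n : ∀ y, l y ≤ 0 → G₁ y = (2 : ℝ) • G (y - l y • e) - G (y - (2 * l y) • e) := by
    intro y hy
    rcases hy.lt_or_eq with h | h
    · exact if_neg (not_le.2 h)
    · rw [hG₁p y h.ge, h]
      simp [two_smul]
  set M : ℝ := ‖l‖ * ‖e‖ with hM
  have hM0 : 0 ≤ M := by positivity
  have hnorm : ∀ (r : ℝ) (v : E), 0 ≤ r → ‖v - (r * l v) • e‖ ≤ (1 + r * M) * ‖v‖ := by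
    intro r v hr
    calc ‖v - (r * l v) • e‖ ≤ ‖v‖ + ‖(r * l v) • e‖ := norm_sub_le _ _
      _ = ‖v‖ + r * (‖l v‖ * ‖e‖) := by
        rw [norm_smul, norm_mul, Real.norm_of_nonneg hr, mul_assoc]
      _ ≤ ‖v‖ + r * ((‖l‖ * ‖v‖) * ‖e‖) := by gcongr; exact l.le_opNorm v
      _ = (1 + r * M) * ‖v‖ := by rw [hM]; ring
  rw [hasStrictFDerivAt_iff_isLittleO, Asymptotics.isLittleO_iff]
  intro c hc
  -- The weighted reflections multiply the linearisation error by at most `2 * (1 + M) + (1 + 2 * M)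
  -- = 3 + 4 * M`.
  set c' : ℝ := c / (3 + 4 * M) with hc'
  have hMp : 0 < 3 + 4 * M := by positivity
  have hc'0 : 0 < c' := by positivity
  have hcont : ContinuousWithinAt (fderivWithin ℝ G (O ∩ H)) (O ∩ H) y₀ :=
    hG.continuousOn_fderivWithin hu (by simp) y₀ hyH
  obtain ⟨ε, hε, hball⟩ : ∃ ε > 0, Metric.ball y₀ ε ∩ (O ∩ H) ⊆
      {y | ‖fderivWithin ℝ G (O ∩ H) y - G'‖ ≤ c'} := by
    have h1 : ∀ᶠ y in 𝓝[O ∩ H] y₀, ‖fderivWithin ℝ G (O ∩ H) y - G'‖ ≤ c' := by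
      have := hcont.tendsto.sub_const G'
      rw [sub_self] at this
      have h2 := this.norm
      rw [norm_zero] at h2
      exact h2.eventually (eventually_le_nhds hc'0)
    exact Metric.mem_nhdsWithin_iff.1 h1
  obtain ⟨ε', hε', hball'⟩ := Metric.isOpen_iff.1 hO y₀ hy
  set δ := min ε ε'
  have hδ : 0 < δ := lt_min hε hε'
  have hlin : ∀ y ∈ Metric.ball y₀ δ ∩ H, ∀ z ∈ Metric.ball y₀ δ ∩ H,
      ‖G y - G z - G' (y - z)‖ ≤ c' * ‖y - z‖ := by
    intro y hy z hz
    have hsub : Metric.ball y₀ δ ∩ H ⊆ O ∩ H := fun w hw =>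
      ⟨hball' (Metric.ball_subset_ball (min_le_right _ _) hw.1), hw.2⟩
    refine ((convex_ball y₀ δ).inter hHc).norm_image_sub_le_of_norm_hasFDerivWithin_le'
      (f' := fderivWithin ℝ G (O ∩ H)) (fun w hw => ?_) (fun w hw => ?_) hz hy
    · exact ((hG.differentiableOn (by simp) w (hsub hw)).hasFDerivWithinAt).mono hsub
    · exact hball ⟨Metric.ball_subset_ball (min_le_left _ _) hw.1, hsub hw⟩
  -- Reflection stretches distances to `y₀` by at most `1 + 2 * M`, so points of the ball of radius
  -- `η` are reflected into the ball of radius `δ`.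
  set η := δ / (1 + 2 * M)
  have hη : 0 < η := by positivity
  have hηδ : η ≤ δ := div_le_self hδ.le (by linarith)
  have hrefl : ∀ (r : ℝ), 1 ≤ r → r ≤ 2 → ∀ y ∈ Metric.ball y₀ η, l y ≤ 0 →
      y - (r * l y) • e ∈ Metric.ball y₀ δ ∩ H := by
    intro r hr hr2 y hy hly
    constructor
    · rw [mem_ball_iff_norm] at hy ⊢
      have h1 : y - (r * l y) • e - y₀ = (y - y₀) - (r * l (y - y₀)) • e := by
        rw [map_sub, hl, sub_zero]; abel
      rw [h1]
      calc _ ≤ (1 + r * M) * ‖y - y₀‖ := hnorm r _ (by linarith)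
        _ ≤ (1 + 2 * M) * ‖y - y₀‖ := by gcongr
        _ < (1 + 2 * M) * η := by gcongr
        _ = δ := by simp only [η]; field_simp
    · change 0 ≤ l (y - (r * l y) • e)
      rw [map_sub, map_smul, he, smul_eq_mul, mul_one]
      nlinarith
  have hneg : ∀ y ∈ Metric.ball y₀ η, l y ≤ 0 → ∀ z ∈ Metric.ball y₀ η, l z ≤ 0 →
      ‖G₁ y - G₁ z - G' (y - z)‖ ≤ c * ‖y - z‖ := by
    intro y hy hly z hz hlz
    rw [hG₁n y hly, hG₁n z hlz]
    have h1 := hlin _ (hrefl 1 le_rfl one_le_two y hy hly) _ (hrefl 1 le_rfl one_le_two z hz hlz)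
    have h2 := hlin _ (hrefl 2 one_le_two le_rfl y hy hly) _ (hrefl 2 one_le_two le_rfl z hz hlz)
    have e1 : ∀ r : ℝ, y - (r * l y) • e - (z - (r * l z) • e)
        = (y - z) - (r * l (y - z)) • e := by
      intro r; rw [map_sub, mul_sub, sub_smul]; abel
    rw [e1 1] at h1
    rw [e1 2] at h2
    simp only [one_mul] at h1
    have h3 := hnorm 1 (y - z) zero_le_one
    have h4 := hnorm 2 (y - z) zero_le_two
    simp only [one_mul] at h3
    have h5 : (2 : ℝ) • G (y - l y • e) - G (y - (2 * l y) • e) -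
        ((2 : ℝ) • G (z - l z • e) - G (z - (2 * l z) • e)) - G' (y - z) =
        (2 : ℝ) • (G (y - l y • e) - G (z - l z • e) - G' (y - z - l (y - z) • e)) -
        (G (y - (2 * l y) • e) - G (z - (2 * l z) • e) - G' (y - z - (2 * l (y - z)) • e)) := by
      simp only [map_sub, map_smul, map_add, smul_sub, sub_smul, two_smul, two_mul, add_smul,
        mul_sub]
      abel
    rw [h5]
    calc _ ≤ 2 * (c' * ((1 + M) * ‖y - z‖)) + c' * ((1 + 2 * M) * ‖y - z‖) := by
          refine (norm_sub_le _ _).trans (add_le_add ?_ ?_)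
          · rw [norm_smul, Real.norm_of_nonneg zero_le_two]
            refine mul_le_mul_of_nonneg_left (h1.trans ?_) zero_le_two
            gcongr
          · exact h2.trans (by gcongr)
      _ = c * ‖y - z‖ := by rw [hc']; field_simp; ring
  have hpos : ∀ y ∈ Metric.ball y₀ η, 0 ≤ l y → ∀ z ∈ Metric.ball y₀ η, 0 ≤ l z →
      ‖G₁ y - G₁ z - G' (y - z)‖ ≤ c * ‖y - z‖ := by
    intro y hy hly z hz hlz
    rw [hG₁p y hly, hG₁p z hlz]
    refine (hlin y ⟨Metric.ball_subset_ball hηδ hy, hly⟩ z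
      ⟨Metric.ball_subset_ball hηδ hz, hlz⟩).trans ?_
    gcongr
    exact div_le_self hc.le (by linarith)
  -- A segment that changes sides meets the hyperplane at `w`. The estimates for its two parts add
  -- up without loss because `w` lies on the segment.
  have hmix : ∀ y ∈ Metric.ball y₀ η, 0 ≤ l y → ∀ z ∈ Metric.ball y₀ η, l z < 0 →
      ‖G₁ y - G₁ z - G' (y - z)‖ ≤ c * ‖y - z‖ := by
    intro y hy hly z hz hlz
    set t : ℝ := l y / (l y - l z) with ht
    have hd : 0 < l y - l z := by linarith
    have ht0 : 0 ≤ t := by positivity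
    have ht1 : t ≤ 1 := by rw [ht, div_le_one hd]; linarith
    set w : E := y + t • (z - y) with hw
    have hlw : l w = 0 := by
      rw [hw, map_add, map_smul, map_sub, ht, smul_eq_mul]; field_simp; ring
    have hwb : w ∈ Metric.ball y₀ η := by
      have := (convex_ball y₀ η).add_smul_sub_mem hy hz ⟨ht0, ht1⟩
      exact this
    have h1 := hpos y hy hly w hwb hlw.ge
    have h2 := hneg w hwb hlw.le z hz hlz.le
    have e1 : y - w = t • (y - z) := by rw [hw]; simp only [smul_sub]; abel
    have e2 : w - z = (1 - t) • (y - z) := by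
      rw [hw]; simp only [smul_sub, sub_smul, one_smul]; abel
    have e3 : G₁ y - G₁ z - G' (y - z)
        = (G₁ y - G₁ w - G' (y - w)) + (G₁ w - G₁ z - G' (w - z)) := by
      simp only [map_sub]; abel
    rw [e3]
    refine (norm_add_le _ _).trans ((add_le_add h1 h2).trans_eq ?_)
    rw [e1, e2, norm_smul, norm_smul, Real.norm_of_nonneg ht0,
      Real.norm_of_nonneg (by linarith : 0 ≤ 1 - t)]
    ring
  have hnhds : Metric.ball y₀ η ×ˢ Metric.ball y₀ η ∈ 𝓝 (y₀, y₀) :=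
    prod_mem_nhds (Metric.ball_mem_nhds _ hη) (Metric.ball_mem_nhds _ hη)
  filter_upwards [hnhds] with ⟨y, z⟩ ⟨hy, hz⟩
  change ‖G₁ y - G₁ z - G' (y - z)‖ ≤ c * ‖y - z‖
  rcases le_or_gt 0 (l y) with h1 | h1 <;> rcases le_or_gt 0 (l z) with h2 | h2
  · exact hpos y hy h1 z hz h2
  · exact hmix y hy h1 z hz h2
  · have := hmix z hz h2 y hy h1
    have h3 : G₁ y - G₁ z - G' (y - z) = -(G₁ z - G₁ y - G' (z - y)) := by
      simp only [map_sub]; abel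
    rwa [h3, norm_neg, norm_sub_rev y z]
  · exact hneg y hy h1.le z hz h2.le

end HalfSpace

/-! ### Subsets of manifolds that carry a smooth structure -/

section Submanifold

variable {E H P E' H' : Type*} [NormedAddCommGroup E] [NormedSpace ℝ E] [TopologicalSpace H]
  {I : ModelWithCorners ℝ E H} [TopologicalSpace P] [ChartedSpace H P]
  [NormedAddCommGroup E'] [NormedSpace ℝ E'] [TopologicalSpace H']
  {J : ModelWithCorners ℝ E' H'} {S : Set P}

variable (I J S) in
/-- A chart near `p` of a subset `S` of a manifold `P`: a smooth map to the model space, which has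
a smooth inverse on `S`. -/
structure SubmanifoldChart (p : S) where
  toFun : P → H'
  invFun : H' → P
  source : Set P
  target : Set H'
  open_source : IsOpen source
  open_target : IsOpen target
  mem_source : p.1 ∈ source
  contMDiffOn : ContMDiffOn I J ∞ toFun source
  contMDiffOn_inv : ContMDiffOn J I ∞ invFun target
  map_source : ∀ q ∈ source, q ∈ S → toFun q ∈ target
  left_inv : ∀ q ∈ source, q ∈ S → invFun (toFun q) = q
  map_target : ∀ t ∈ target, invFun t ∈ source ∧ invFun t ∈ S
  right_inv : ∀ t ∈ target, toFun (invFun t) = t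
  interior_iff : J (toFun p) ∈ interior (range J) ↔ I.IsInteriorPoint p.1

open Classical in
/-- The partial homeomorphism on the subset given by a chart of it. -/
def SubmanifoldChart.toOpenPartialHomeomorph {p : S} (c : SubmanifoldChart I J S p) :
    OpenPartialHomeomorph S H' where
  toFun q := c.toFun q
  invFun t := if h : c.invFun t ∈ S then ⟨c.invFun t, h⟩ else p
  source := Subtype.val ⁻¹' c.source
  target := c.target
  map_source' q hq := c.map_source q hq q.2
  map_target' t ht := by
    rw [dif_pos (c.map_target t ht).2]
    exact (c.map_target t ht).1
  left_inv' q hq := by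
    have := c.left_inv q hq q.2
    simp [this]
  right_inv' t ht := by
    rw [dif_pos (c.map_target t ht).2]
    exact c.right_inv t ht
  open_source := c.open_source.preimage continuous_subtype_val
  open_target := c.open_target
  continuousOn_toFun := c.contMDiffOn.continuousOn.comp continuous_subtype_val.continuousOn
    fun q hq => hq
  continuousOn_invFun := by
    rw [IsInducing.subtypeVal.continuousOn_iff]
    refine c.contMDiffOn_inv.continuousOn.congr fun t ht => ?_
    simp [(c.map_target t ht).2]

open Classical in
theorem SubmanifoldChart.coe_symm {p : S} (c : SubmanifoldChart I J S p) {t : H'}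
    (ht : t ∈ c.target) : (c.toOpenPartialHomeomorph.symm t : P) = c.invFun t := by
  change ((dite _ _ _ : S) : P) = _
  rw [dif_pos (c.map_target t ht).2]

variable (I J S) in
/-- A family of charts of a subset `S` of a manifold `P`, which makes it a manifold. -/
def SubmanifoldAtlas := ∀ p : S, SubmanifoldChart I J S p

namespace SubmanifoldAtlas

/-- The subset `S`, as a manifold. -/
def Carrier (_ : SubmanifoldAtlas I J S) : Type _ := S

variable (c : SubmanifoldAtlas I J S)

instance : TopologicalSpace c.Carrier := inferInstanceAs (TopologicalSpace S)

instance [T2Space P] : T2Space c.Carrier := inferInstanceAs (T2Space S)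

instance [SecondCountableTopology P] : SecondCountableTopology c.Carrier :=
  inferInstanceAs (SecondCountableTopology S)

/-- The inclusion of the submanifold. -/
def val (z : c.Carrier) : P := Subtype.val (p := fun p => p ∈ S) z

theorem val_mem (z : c.Carrier) : c.val z ∈ S := Subtype.prop (p := fun p => p ∈ S) z

/-- Points of the submanifold from points of the subset. -/
def mk (p : P) (hp : p ∈ S) : c.Carrier := (⟨p, hp⟩ : S)

theorem val_injective : Function.Injective c.val := Subtype.val_injective

theorem isEmbedding_val : IsEmbedding c.val := IsEmbedding.subtypeVal

theorem range_val : range c.val = S := Subtype.range_coe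

instance : ChartedSpace H' c.Carrier where
  atlas := range fun z : S => (c z).toOpenPartialHomeomorph
  chartAt z := (c z).toOpenPartialHomeomorph
  mem_chart_source z := (c z).mem_source
  chart_mem_atlas z := mem_range_self _

instance : IsManifold J ∞ c.Carrier := by
  refine isManifold_of_contDiffOn J ∞ _ ?_
  rintro _ _ ⟨z, rfl⟩ ⟨w, rfl⟩
  rw [← contMDiffOn_iff_contDiffOn]
  have h1 : ContMDiffOn J J ∞ ((c w).toFun ∘ (c z).invFun)
      ((c z).toOpenPartialHomeomorph.symm.trans (c w).toOpenPartialHomeomorph).source := by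
    refine (c w).contMDiffOn.comp ((c z).contMDiffOn_inv.mono fun t ht => ht.1) ?_
    rintro t ⟨ht, ht'⟩
    have : ((c z).toOpenPartialHomeomorph.symm t : P) ∈ (c w).source := ht'
    rwa [(c z).coe_symm ht] at this
  have h2 : ContMDiffOn J J ∞
      ((c z).toOpenPartialHomeomorph.symm.trans (c w).toOpenPartialHomeomorph)
      ((c z).toOpenPartialHomeomorph.symm.trans (c w).toOpenPartialHomeomorph).source := by
    refine h1.congr fun t ht => ?_
    change (c w).toFun ((c z).toOpenPartialHomeomorph.symm t : P) = _
    rw [(c z).coe_symm ht.1]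
    rfl
  exact (J.contMDiff.comp_contMDiffOn h2).comp
    (J.contMDiffOn_symm.mono inter_subset_right) fun t ht => ht.1

theorem contMDiff_val : ContMDiff J I ∞ c.val := by
  intro z
  have h1 : ContMDiffOn J J ∞ (chartAt H' z) (chartAt H' z).source := contMDiffOn_chart
  have h2 : ContMDiffOn J I ∞ ((c z).invFun ∘ chartAt H' z) (chartAt H' z).source :=
    (c z).contMDiffOn_inv.comp h1 fun w hw => (chartAt H' z).map_source hw
  refine (h2.congr fun w hw => ?_).contMDiffAt
    ((chartAt H' z).open_source.mem_nhds (mem_chart_source H' z))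
  exact ((c z).left_inv _ hw (c.val_mem w)).symm

variable {N E₁ H₁ : Type*} [NormedAddCommGroup E₁] [NormedSpace ℝ E₁] [TopologicalSpace H₁]
  {I₁ : ModelWithCorners ℝ E₁ H₁} [TopologicalSpace N] [ChartedSpace H₁ N]

/-- The charts of the subset are restrictions of smooth maps on open sets of `P`, so smoothness of
`f` in these charts follows from smoothness of `f` as a map to `P`; continuity follows from the
subspace topology. -/
theorem contMDiff_iff {f : N → c.Carrier} :
    ContMDiff I₁ J ∞ f ↔ ContMDiff I₁ I ∞ (c.val ∘ f) := by
  refine ⟨fun h => c.contMDiff_val.comp h, fun h y => ?_⟩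
  have hf : Continuous f := c.isEmbedding_val.continuous_iff.2 h.continuous
  rw [contMDiffAt_iff_target]
  refine ⟨hf.continuousAt, ?_⟩
  have h1 : ContMDiffAt I₁ J ∞ ((c (f y)).toFun ∘ c.val ∘ f) y :=
    ((c (f y)).contMDiffOn.contMDiffAt ((c (f y)).open_source.mem_nhds
      (c (f y)).mem_source)).comp y (h y)
  exact ContMDiffAt.comp (I' := J) (f := (c (f y)).toFun ∘ c.val ∘ f) y (J.contMDiff _) h1

theorem mdifferentiable_val : MDifferentiable J I c.val :=
  c.contMDiff_val.mdifferentiable (by simp)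

/-- The ambient chart map followed by the inverse of the intrinsic chart is a local left inverse `r`
of the inclusion; the chain rule then gives a left inverse of the derivative. -/
theorem mfderiv_val_injective (z : c.Carrier) : Function.Injective (mfderiv J I c.val z) := by
  set r : P → c.Carrier := (chartAt H' z).symm ∘ (c z).toFun
  have hz : (c z).toFun (c.val z) ∈ (chartAt H' z).target :=
    (chartAt H' z).map_source (mem_chart_source H' z)
  have h1 : MDifferentiableAt I J r (c.val z) := by
    refine MDifferentiableAt.comp (I' := J) _ ?_ ?_
    · exact ((contMDiffOn_chart_symm (I := J) (n := ∞)).contMDiffAt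
        ((chartAt H' z).open_target.mem_nhds hz)).mdifferentiableAt (by simp)
    · exact ((c z).contMDiffOn.contMDiffAt ((c z).open_source.mem_nhds
        (c z).mem_source)).mdifferentiableAt (by simp)
  have h2 : r ∘ c.val =ᶠ[𝓝 z] id := by
    filter_upwards [(chartAt H' z).open_source.mem_nhds (mem_chart_source H' z)] with w hw
    exact (chartAt H' z).left_inv hw
  have h3 := mfderiv_comp z h1 (c.mdifferentiable_val z)
  rw [h2.mfderiv_eq, mfderiv_id] at h3
  intro v w hvw
  have h4 : ∀ u : TangentSpace J z, u = mfderiv I J r (c.val z) (mfderiv J I c.val z u) :=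
    fun u => congrArg (fun A => A u) h3
  rw [h4 v, hvw, ← h4 w]

theorem isInteriorPoint_iff (z : c.Carrier) :
    J.IsInteriorPoint z ↔ I.IsInteriorPoint (c.val z) := (c z).interior_iff

end SubmanifoldAtlas

end Submanifold

end Pseudocycles

end

noncomputable section

namespace Pseudocycles

open Module

/-! ### Charts of regular zero sets -/

section SliceCharts

variable {E H P E' H' F : Type*} [NormedAddCommGroup E] [NormedSpace ℝ E] [TopologicalSpace H]
  {I : ModelWithCorners ℝ E H} [TopologicalSpace P] [ChartedSpace H P]
  [NormedAddCommGroup E'] [NormedSpace ℝ E'] [TopologicalSpace H']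
  {J : ModelWithCorners ℝ E' H'} {S : Set P} [NormedAddCommGroup F] [NormedSpace ℝ F]

/-- The common construction at interior and at boundary points. `L` splits the model space into the
directions seen by the equation `g` and the tangent directions, which become coordinates; the shift
`t₀` places these in the range of `J`. `G` stands for `g` in the chart, extended off the range of
`I` so that the inverse function theorem applies even at the boundary. -/
theorem exists_submanifoldChart [CompleteSpace E] [IsManifold I ∞ P] {p : P} (hp : p ∈ S)
    {g : P → F} {O : Set P} (hO : IsOpen O) (hpO : p ∈ O) (hg : ContMDiffOn I 𝓘(ℝ, F) ∞ g O)
    (hS : ∀ q ∈ O, q ∈ S ↔ g q = 0) (L : E ≃L[ℝ] F × E') (t₀ : E') {O₁ : Set E}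
    (hO₁ : IsOpen O₁) (hpO₁ : extChartAt I p p ∈ O₁)
    (hIJ : ∀ y ∈ O₁, y ∈ range I ↔ (L y).2 + t₀ ∈ range J) {G : E → F}
    (hG : ∀ y ∈ O₁, y ∈ range I → G y = g ((extChartAt I p).symm y))
    (hG' : HasStrictFDerivAt G ((ContinuousLinearMap.fst ℝ F E').comp (L : E →L[ℝ] F × E'))
      (extChartAt I p p))
    (hint : (L (extChartAt I p p)).2 + t₀ ∈ interior (range J) ↔ I.IsInteriorPoint p) :
    ∃ c : SubmanifoldChart I J S ⟨p, hp⟩, ∀ q ∈ c.source, q ∈ S →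
      J (c.toFun q) = (L (extChartAt I p q)).2 + t₀ := by
  set φ := extChartAt I p with hφ
  set O₂ : Set E := O₁ ∩ I.symm ⁻¹' ((chartAt H p).symm.source ∩ (chartAt H p).symm ⁻¹' O)
  have hO₂ : IsOpen O₂ := hO₁.inter
    (((chartAt H p).symm.isOpen_inter_preimage hO).preimage I.continuous_symm)
  have hφO₂ : ∀ y ∈ O₂, y ∈ range I → y ∈ φ.target ∧ φ.symm y ∈ O := by
    rintro y ⟨-, h2, h3⟩ hy
    refine ⟨?_, h3⟩
    rw [hφ, extChartAt_target]
    exact ⟨h2, hy⟩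
  have hpO₂ : φ p ∈ O₂ := by
    refine ⟨hpO₁, ?_, ?_⟩
    · change I.symm (φ p) ∈ (chartAt H p).target
      simp [hφ]
    · change (chartAt H p).symm (I.symm (φ p)) ∈ O
      simp [hφ, hpO]
  have hφr : ∀ q ∈ φ.source, φ q ∈ range I := fun q hq =>
    extChartAt_target_subset_range p (φ.map_source hq)
  let A : Homeomorph E' E' := Homeomorph.addRight t₀
  have hT : UniqueDiffOn ℝ {κ : E' | κ + t₀ ∈ range J} := by
    refine uniqueDiffOn_convex ?_ ?_
    · have : {κ : E' | κ + t₀ ∈ range J} = (fun κ => t₀ + κ) ⁻¹' range J := by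
        ext κ; simp [add_comm]
      rw [this]
      exact J.convex_range.translate_preimage_right t₀
    · obtain ⟨k, hk⟩ := J.nonempty_interior
      change (interior (A ⁻¹' range J)).Nonempty
      rw [← A.preimage_interior]
      exact ⟨k - t₀, by simpa [A] using hk⟩
  have hGs : ContDiffOn ℝ ∞ G (O₂ ∩ range I) := by
    rw [← contMDiffOn_iff_contDiffOn]
    have h1 : ContMDiffOn 𝓘(ℝ, E) 𝓘(ℝ, F) ∞ (g ∘ φ.symm) (O₂ ∩ range I) :=
      hg.comp ((contMDiffOn_extChartAt_symm p).mono fun y hy => (hφO₂ y hy.1 hy.2).1)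
        fun y hy => (hφO₂ y hy.1 hy.2).2
    exact h1.congr fun y hy => hG y hy.1.1 hy.2
  -- The chart `e` sends the zero set to points with first component zero; the second component is
  -- affine in the old coordinates, so by `hIJ` it detects the range of `I` exactly.
  obtain ⟨e, he0, heO, he1, he2⟩ := exists_slice_chart (H := range I) (T := {κ | κ + t₀ ∈ range J})
    hO₂ hpO₂ (hφr p (mem_extChartAt_source p)) I.uniqueDiffOn hT L hG' hGs
    (fun y hy => hIJ y hy.1)
  have hsrc : ∀ q ∈ φ.source ∩ φ ⁻¹' e.source, (L (φ q)).2 + t₀ ∈ range J := fun q hq =>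
    (hIJ _ (heO hq.2).1).1 (hφr q hq.1)
  have hJ : ∀ q ∈ φ.source ∩ φ ⁻¹' e.source,
      J (J.symm ((L (φ q)).2 + t₀)) = (L (φ q)).2 + t₀ := fun q hq => J.right_inv (hsrc q hq)
  have hinv : ∀ t : H', ((0 : F), J t - t₀) ∈ e.target →
      e.symm (0, J t - t₀) ∈ e.source ∧ e.symm (0, J t - t₀) ∈ range I ∧
      (L (e.symm (0, J t - t₀))).2 = J t - t₀ ∧ G (e.symm (0, J t - t₀)) = 0 := by
    intro t ht
    have h1 := e.map_target ht
    have h2 := e.right_inv ht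
    rw [he1] at h2
    have h3 : (L (e.symm (0, J t - t₀))).2 = J t - t₀ := congrArg Prod.snd h2
    refine ⟨h1, ?_, h3, congrArg Prod.fst h2⟩
    rw [hIJ _ (heO h1).1, h3, sub_add_cancel]
    exact mem_range_self t
  have heq : ∀ q ∈ φ.source ∩ φ ⁻¹' e.source, q ∈ S → e (φ q) = (0, (L (φ q)).2) := by
    intro q hq hqS
    have h1 := hφO₂ _ (heO hq.2) (hφr q hq.1)
    rw [φ.left_inv hq.1] at h1
    rw [he1, hG _ (heO hq.2).1 (hφr q hq.1), φ.left_inv hq.1, (hS q h1.2).1 hqS]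
  refine ⟨{ toFun := fun q => J.symm ((L (φ q)).2 + t₀)
            invFun := fun t => φ.symm (e.symm (0, J t - t₀))
            source := φ.source ∩ φ ⁻¹' e.source
            target := {t | ((0 : F), J t - t₀) ∈ e.target}
            open_source := (continuousOn_extChartAt p).isOpen_inter_preimage
              (isOpen_extChartAt_source p) e.open_source
            open_target := e.open_target.preimage
              (continuous_const.prodMk (J.continuous.sub continuous_const))
            mem_source := ⟨mem_extChartAt_source p, he0⟩
            contMDiffOn := ?_
            contMDiffOn_inv := ?_
            map_source := ?_
            left_inv := ?_
            map_target := ?_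
            right_inv := ?_
            interior_iff := ?_ }, fun q hq hqS => hJ q hq⟩
  · refine J.contMDiffOn_symm.comp (t := range J) ?_ hsrc
    have h1 : ContMDiffOn I 𝓘(ℝ, E) ∞ φ (φ.source ∩ φ ⁻¹' e.source) :=
      (contMDiffOn_extChartAt (x := p)).mono (by
        rw [hφ, extChartAt_source]; exact inter_subset_left)
    have h2 : ContDiff ℝ ∞ fun y : E => (L y).2 + t₀ :=
      (contDiff_snd.comp L.contDiff).add contDiff_const
    exact h2.contMDiff.comp_contMDiffOn h1
  · refine (contMDiffOn_extChartAt_symm p).comp (t := φ.target) ?_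
      fun t ht => (hφO₂ _ (heO (hinv t ht).1) (hinv t ht).2.1).1
    refine he2.contMDiffOn.comp (t := e.target ∩ univ ×ˢ {κ | κ + t₀ ∈ range J}) ?_ fun t ht => ⟨ht, trivial, ?_⟩
    · have h2 : ContDiff ℝ ∞ fun y : E' => ((0 : F), y - t₀) :=
        contDiff_const.prodMk (contDiff_id.sub contDiff_const)
      exact (h2.contMDiff.comp J.contMDiff).contMDiffOn
    · change J t - t₀ + t₀ ∈ range J
      rw [sub_add_cancel]; exact mem_range_self t
  · intro q hq hqS
    change ((0 : F), J (J.symm ((L (φ q)).2 + t₀)) - t₀) ∈ e.target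
    rw [hJ q hq, add_sub_cancel_right, ← heq q hq hqS]
    exact e.map_source hq.2
  · intro q hq hqS
    rw [hJ q hq, add_sub_cancel_right, ← heq q hq hqS, e.left_inv hq.2, φ.left_inv hq.1]
  · intro t ht
    obtain ⟨h1, h2, h3, h4⟩ := hinv t ht
    obtain ⟨h5, h6⟩ := hφO₂ _ (heO h1) h2
    refine ⟨⟨φ.map_target h5, ?_⟩, ?_⟩
    · change φ (φ.symm _) ∈ e.source
      rw [φ.right_inv h5]; exact h1
    · rw [hS _ h6, ← hG _ (heO h1).1 h2, h4]
  · intro t ht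
    obtain ⟨h1, h2, h3, h4⟩ := hinv t ht
    obtain ⟨h5, h6⟩ := hφO₂ _ (heO h1) h2
    rw [φ.right_inv h5, h3, sub_add_cancel, J.left_inv]
  · change J (J.symm ((L (φ p)).2 + t₀)) ∈ interior (range J) ↔ _
    rw [hJ p ⟨mem_extChartAt_source p, he0⟩]
    exact hint

theorem mfderiv_eq_fderivWithin_extChartAt {p : P} {g : P → F}
    (hg : MDifferentiableAt I 𝓘(ℝ, F) g p) :
    mfderiv I 𝓘(ℝ, F) g p =
      fderivWithin ℝ (g ∘ (extChartAt I p).symm) (range I) (extChartAt I p p) := by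
  exact hg.mfderiv

/-- Chart of a regular zero set at an interior point. -/
theorem exists_submanifoldChart_of_interior [FiniteDimensional ℝ E] [FiniteDimensional ℝ F]
    [FiniteDimensional ℝ E'] [IsManifold I ∞ P] {p : P} (hp : p ∈ S) (hpi : I.IsInteriorPoint p)
    {g : P → F} {O : Set P} (hO : IsOpen O) (hpO : p ∈ O) (hg : ContMDiffOn I 𝓘(ℝ, F) ∞ g O)
    (hS : ∀ q ∈ O, q ∈ S ↔ g q = 0)
    (hs : Function.Surjective (mfderiv I 𝓘(ℝ, F) g p))
    (hdim : finrank ℝ E = finrank ℝ F + finrank ℝ E') :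
    Nonempty (SubmanifoldChart I J S ⟨p, hp⟩) := by
  have : CompleteSpace E := FiniteDimensional.complete ℝ E
  set φ := extChartAt I p with hφ
  set G' : E →L[ℝ] F := mfderiv I 𝓘(ℝ, F) g p with hG'
  obtain ⟨R, hR⟩ := G'.exists_rightInverse_of_surjective (LinearMap.range_eq_top.2 hs)
  have hR' : Function.RightInverse R G' := fun v => by simpa using congrArg (fun A => A v) hR
  have hfr : finrank ℝ G'.ker = finrank ℝ E' := by
    have h1 := LinearMap.finrank_range_add_finrank_ker G'.toLinearMap
    have h2 : LinearMap.range G'.toLinearMap = ⊤ := LinearMap.range_eq_top.2 hs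
    rw [h2, finrank_top] at h1
    exact Nat.add_left_cancel (h1.trans hdim)
  let L : E ≃L[ℝ] F × E' := (ContinuousLinearEquiv.equivOfRightInverse G' R hR').trans
    ((ContinuousLinearEquiv.refl ℝ F).prodCongr (ContinuousLinearEquiv.ofFinrankEq hfr))
  have hgm : ContMDiffAt I 𝓘(ℝ, F) ∞ g p := hg.contMDiffAt (hO.mem_nhds hpO)
  have hrange : range I ∈ 𝓝 (φ p) := mem_interior_iff_mem_nhds.1 hpi
  have hGs : ContDiffAt ℝ ∞ (g ∘ φ.symm) (φ p) := by
    have := (contMDiffAt_iff.1 hgm).2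
    simp only [extChartAt_model_space_eq_id, PartialEquiv.refl_coe, Function.id_comp] at this
    exact this.contDiffAt hrange
  have hst : HasStrictFDerivAt (g ∘ φ.symm) G' (φ p) := by
    have h1 := hGs.hasStrictFDerivAt (by simp)
    rwa [hG', mfderiv_eq_fderivWithin_extChartAt (hgm.mdifferentiableAt (by simp)),
      fderivWithin_of_mem_nhds hrange]
  obtain ⟨k, hk⟩ := J.nonempty_interior
  -- The shift moves `p` to an interior point `k` of the model, so that a neighbourhood of `p` stays
  -- away from the boundary of the new model.
  set t₀ : E' := k - (L (φ p)).2
  have hcont : Continuous fun y : E => (L y).2 + t₀ := by fun_prop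
  have hk' : (L (φ p)).2 + t₀ ∈ interior (range J) := by
    rwa [show (L (φ p)).2 + t₀ = k from add_sub_cancel _ _]
  obtain ⟨c, -⟩ := exists_submanifoldChart (J := J) hp hO hpO hg hS L t₀
    (O₁ := interior (range I) ∩ (fun y : E => (L y).2 + t₀) ⁻¹' interior (range J))
    (isOpen_interior.inter (isOpen_interior.preimage hcont))
    ⟨hpi, hk'⟩
    (fun y hy => iff_of_true (interior_subset hy.1) (interior_subset hy.2))
    (G := g ∘ φ.symm) (fun _ _ _ => rfl) hst
    (iff_of_true hk' hpi)
  exact ⟨c⟩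

/-- The first coordinate and the other ones. -/
def consEquiv (d : ℕ) : (ℝ × EuclideanSpace ℝ (Fin d)) ≃L[ℝ] EuclideanSpace ℝ (Fin (d + 1)) :=
  LinearEquiv.toContinuousLinearEquiv
    { toFun := fun v => WithLp.toLp 2 (Fin.cons v.1 v.2)
      invFun := fun w => (w 0, WithLp.toLp 2 fun i => w i.succ)
      map_add' := fun v w => by
        ext i; refine Fin.cases ?_ (fun i => ?_) i <;> simp
      map_smul' := fun r v => by
        ext i; refine Fin.cases ?_ (fun i => ?_) i <;> simp
      left_inv := fun v => by ext <;> simp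
      right_inv := fun w => by
        ext i; refine Fin.cases ?_ (fun i => ?_) i <;> simp }

/-- Splitting of a space by a map `G'` which is onto on the kernel of a functional `l`. -/
theorem exists_splitting_compatible [FiniteDimensional ℝ E] [FiniteDimensional ℝ F] {d : ℕ}
    {G' : E →L[ℝ] F} {l : E →L[ℝ] ℝ} (hl : ∃ e, l e = 1) (hs : ∀ v, ∃ y, l y = 0 ∧ G' y = v)
    (hdim : finrank ℝ E = finrank ℝ F + (d + 1)) :
    ∃ L : E ≃L[ℝ] F × EuclideanSpace ℝ (Fin (d + 1)),
      (∀ y, (L y).1 = G' y) ∧ ∀ y, (L y).2 0 = l y := by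
  have hs' : Function.Surjective G' := fun v => (hs v).imp fun y hy => hy.2
  have hs₁ : Function.Surjective (G'.comp (Submodule.subtypeL l.ker)) := fun v => by
    obtain ⟨y, h1, h2⟩ := hs v
    exact ⟨⟨y, h1⟩, h2⟩
  obtain ⟨R₀, hR₀⟩ := (G'.comp (Submodule.subtypeL l.ker)).exists_rightInverse_of_surjective
    (LinearMap.range_eq_top.2 hs₁)
  let R : F →L[ℝ] E := (Submodule.subtypeL l.ker).comp R₀
  have hR : Function.RightInverse R G' := fun v =>
    congrArg (fun A => A v) hR₀
  have hlR : ∀ v, l (R v) = 0 := fun v => (R₀ v).2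
  let l' : G'.ker →L[ℝ] ℝ := l.comp (Submodule.subtypeL G'.ker)
  -- Since `G'` is onto already on the kernel of `l`, a vector with `l e = 1` can be corrected by an
  -- element of that kernel so that it lies in the kernel of `G'`.
  have hl' : l' ≠ 0 := by
    obtain ⟨e, he⟩ := hl
    intro h0
    have hmem : e - R (G' e) ∈ G'.ker := by
      change G' (e - R (G' e)) = 0
      rw [map_sub, hR, sub_self]
    have : l' ⟨_, hmem⟩ = 1 := by
      change l (e - R (G' e)) = 1
      rw [map_sub, hlR, he, sub_zero]
    rw [h0] at this
    simp at this
  have hfr : finrank ℝ G'.ker = d + 1 := by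
    have h1 := LinearMap.finrank_range_add_finrank_ker G'.toLinearMap
    have h2 : LinearMap.range G'.toLinearMap = ⊤ := LinearMap.range_eq_top.2 hs'
    rw [h2, finrank_top] at h1
    exact Nat.add_left_cancel (h1.trans hdim)
  obtain ⟨w, hw⟩ : ∃ w, l' w ≠ 0 := by
    by_contra! h
    exact hl' (by ext v; simpa using h v)
  have hs'' : Function.Surjective l' := fun r => ⟨(r / l' w) • w, by simp [hw]⟩
  obtain ⟨R', hR'⟩ := l'.exists_rightInverse_of_surjective (LinearMap.range_eq_top.2 hs'')
  let B := ContinuousLinearEquiv.equivOfRightInverse l' R'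
    (fun v => by simpa using congrArg (fun A => A v) hR')
  have hfr' : finrank ℝ l'.ker = finrank ℝ (EuclideanSpace ℝ (Fin d)) := by
    have h1 := LinearMap.finrank_range_add_finrank_ker l'.toLinearMap
    have h2 : LinearMap.range l'.toLinearMap = ⊤ := LinearMap.range_eq_top.2 hs''
    rw [h2, finrank_top, hfr, finrank_self] at h1
    rw [finrank_euclideanSpace_fin]
    have h3 : 1 + finrank ℝ l'.ker = d + 1 := h1
    omega
  let B' : G'.ker ≃L[ℝ] EuclideanSpace ℝ (Fin (d + 1)) := (B.trans
    ((ContinuousLinearEquiv.refl ℝ ℝ).prodCongr (ContinuousLinearEquiv.ofFinrankEq hfr'))).trans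
    (consEquiv d)
  refine ⟨(ContinuousLinearEquiv.equivOfRightInverse G' R hR).trans
    ((ContinuousLinearEquiv.refl ℝ F).prodCongr B'), fun y => rfl, fun y => ?_⟩
  change l (((ContinuousLinearEquiv.equivOfRightInverse G' R hR) y).2 : E) = l y
  have : (((ContinuousLinearEquiv.equivOfRightInverse G' R hR) y).2 : E) = y - R (G' y) := rfl
  rw [this, map_sub, hlR, sub_zero]

end SliceCharts

/-! ### Regular zero sets in a product with one factor with boundary -/

section HalfSpaceCharts

variable {a b d : ℕ} {B M : Type*} [TopologicalSpace B]
  [ChartedSpace (EuclideanHalfSpace (a + 1)) B] [TopologicalSpace M]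
  [ChartedSpace (EuclideanSpace ℝ (Fin b)) M]
  {F : Type*} [NormedAddCommGroup F] [NormedSpace ℝ F]

theorem isBoundaryPoint_iff_coord {p : B} :
    (𝓡∂ (a + 1)).IsBoundaryPoint p ↔ extChartAt (𝓡∂ (a + 1)) p p 0 = 0 := by
  rw [ModelWithCorners.isBoundaryPoint_iff, frontier_range_modelWithCornersEuclideanHalfSpace]
  exact eq_comm

/-- Charts of a regular zero set in `B × M`, where `B` has boundary; at a boundary point the
first coordinate is that of `B`. -/
theorem exists_submanifoldChart_halfSpace [IsManifold (𝓡∂ (a + 1)) ∞ B] [IsManifold (𝓡 b) ∞ M]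
    [FiniteDimensional ℝ F] {S : Set (B × M)} {p : B × M} (hp : p ∈ S) {g : B × M → F}
    {O : Set (B × M)} (hO : IsOpen O) (hpO : p ∈ O)
    (hg : ContMDiffOn ((𝓡∂ (a + 1)).prod (𝓡 b)) 𝓘(ℝ, F) ∞ g O)
    (hS : ∀ q ∈ O, q ∈ S ↔ g q = 0)
    (hs : Function.Surjective (mfderiv ((𝓡∂ (a + 1)).prod (𝓡 b)) 𝓘(ℝ, F) g p))
    (hs' : (𝓡∂ (a + 1)).IsBoundaryPoint p.1 → ∀ v : F,
      ∃ y : EuclideanSpace ℝ (Fin (a + 1)) × EuclideanSpace ℝ (Fin b), y.1 0 = 0 ∧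
        mfderiv ((𝓡∂ (a + 1)).prod (𝓡 b)) 𝓘(ℝ, F) g p y = v)
    (hdim : a + 1 + b = finrank ℝ F + (d + 1)) :
    ∃ c : SubmanifoldChart ((𝓡∂ (a + 1)).prod (𝓡 b)) (𝓡∂ (d + 1)) S ⟨p, hp⟩,
      (𝓡∂ (a + 1)).IsBoundaryPoint p.1 → ∀ q ∈ c.source, q ∈ S →
        (𝓡∂ (d + 1)) (c.toFun q) 0 = extChartAt (𝓡∂ (a + 1)) p.1 q.1 0 := by
  set I := (𝓡∂ (a + 1)).prod (𝓡 b) with hI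
  have hdim' : finrank ℝ (EuclideanSpace ℝ (Fin (a + 1)) × EuclideanSpace ℝ (Fin b)) =
      finrank ℝ F + (d + 1) := by
    rw [finrank_prod, finrank_euclideanSpace_fin, finrank_euclideanSpace_fin, hdim]
  by_cases hb : (𝓡∂ (a + 1)).IsBoundaryPoint p.1
  swap
  · have hpi : I.IsInteriorPoint p := by
      have := ModelWithCorners.interior_prod (I := 𝓡∂ (a + 1)) (J := 𝓡 b) (M := B) (N := M)
      have h2 : p ∈ I.interior (B × M) := by
        rw [hI, this]
        exact ⟨((𝓡∂ (a + 1)).isInteriorPoint_iff_not_isBoundaryPoint _).2 hb,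
          BoundarylessManifold.isInteriorPoint⟩
      exact h2
    obtain ⟨c⟩ := exists_submanifoldChart_of_interior (J := 𝓡∂ (d + 1)) hp hpi hO hpO hg hS hs
      (by rw [hdim', finrank_euclideanSpace_fin])
    exact ⟨c, fun h => absurd h hb⟩
  set φ := extChartAt I p with hφ
  have hφ1 : ∀ q, (φ q).1 = extChartAt (𝓡∂ (a + 1)) p.1 q.1 := fun q => by
    rw [hφ, hI, extChartAt_prod]; rfl
  let l : EuclideanSpace ℝ (Fin (a + 1)) × EuclideanSpace ℝ (Fin b) →L[ℝ] ℝ :=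
    (EuclideanSpace.proj 0).comp (ContinuousLinearMap.fst ℝ _ _)
  have hl : ∀ y, l y = y.1 0 := fun y => rfl
  have hrange : range I = {y | 0 ≤ l y} := by
    rw [hI, ModelWithCorners.range_prod, range_modelWithCornersEuclideanHalfSpace]
    ext y
    simp [l]
  have hgm : ContMDiffAt I 𝓘(ℝ, F) ∞ g p := hg.contMDiffAt (hO.mem_nhds hpO)
  set O₁ : Set (EuclideanSpace ℝ (Fin (a + 1)) × EuclideanSpace ℝ (Fin b)) :=
    I.symm ⁻¹' ((chartAt _ p).symm.source ∩ (chartAt _ p).symm ⁻¹' O)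
  have hO₁ : IsOpen O₁ :=
    ((chartAt _ p).symm.isOpen_inter_preimage hO).preimage I.continuous_symm
  have hpO₁ : φ p ∈ O₁ := by
    refine ⟨?_, ?_⟩
    · change I.symm (φ p) ∈ (chartAt _ p).target
      simp only [hφ, extChartAt_coe, Function.comp_apply, ModelWithCorners.left_inv]
      exact mem_chart_target _ p
    · change (chartAt _ p).symm (I.symm (φ p)) ∈ O
      simp only [hφ, extChartAt_coe, Function.comp_apply, ModelWithCorners.left_inv]
      rw [(chartAt _ p).left_inv (mem_chart_source _ p)]
      exact hpO
  have hGs : ContDiffOn ℝ ∞ (g ∘ φ.symm) (O₁ ∩ {y | 0 ≤ l y}) := by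
    rw [← contMDiffOn_iff_contDiffOn]
    refine hg.comp ((contMDiffOn_extChartAt_symm p).mono ?_) ?_
    · rintro y ⟨hy, hy'⟩
      rw [extChartAt_target]
      rw [← hrange] at hy'
      exact ⟨hy.1, hy'⟩
    · rintro y ⟨hy, hy'⟩
      exact hy.2
  have hlp : l (φ p) = 0 := by
    rw [hl, hφ1]
    exact isBoundaryPoint_iff_coord.1 hb
  obtain ⟨e, he⟩ : ∃ e, l e = 1 := ⟨(EuclideanSpace.single 0 1, 0), by simp [l]⟩
  -- In the chart the equation is defined on a half space only, while the inverse function theorem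
  -- needs strict differentiability on a full neighbourhood.
  obtain ⟨G₁, hG₁, hG₁'⟩ := exists_strict_extension he hO₁ hpO₁ hlp hGs
  let G' : EuclideanSpace ℝ (Fin (a + 1)) × EuclideanSpace ℝ (Fin b) →L[ℝ] F :=
    mfderiv I 𝓘(ℝ, F) g p
  have hder : fderivWithin ℝ (g ∘ φ.symm) (O₁ ∩ {y | 0 ≤ l y}) (φ p) = G' := by
    change _ = mfderiv I 𝓘(ℝ, F) g p
    rw [mfderiv_eq_fderivWithin_extChartAt (hgm.mdifferentiableAt (by simp)), inter_comm,
      fderivWithin_inter (hO₁.mem_nhds hpO₁), hrange]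
  rw [hder] at hG₁'
  -- The splitting keeps the boundary coordinate `l` as coordinate `0` of the tangent directions, so
  -- the zero set has the same boundary defining function as the ambient manifold.
  obtain ⟨L, hL1, hL2⟩ := exists_splitting_compatible (d := d) (G' := G')
    ⟨e, he⟩ (hs' hb) hdim'
  have hLG : (ContinuousLinearMap.fst ℝ F _).comp
      (L : _ →L[ℝ] F × EuclideanSpace ℝ (Fin (d + 1))) = G' := ContinuousLinearMap.ext hL1
  have hni : ¬ I.IsInteriorPoint p := by
    intro h
    have := ModelWithCorners.interior_prod (I := 𝓡∂ (a + 1)) (J := 𝓡 b) (M := B) (N := M)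
    have h2 : p ∈ I.interior (B × M) := h
    rw [hI, this] at h2
    exact ((𝓡∂ (a + 1)).isInteriorPoint_iff_not_isBoundaryPoint _).1 h2.1 hb
  obtain ⟨c, hc⟩ := exists_submanifoldChart (J := 𝓡∂ (d + 1)) hp hO hpO hg hS L 0 hO₁ hpO₁
    (fun y _ => by
      rw [hrange, range_modelWithCornersEuclideanHalfSpace, add_zero]
      change 0 ≤ l y ↔ 0 ≤ (L y).2 0
      rw [hL2])
    (G := G₁) (fun y _ hy => hG₁ y (by rw [hrange] at hy; exact hy)) (by rw [hLG]; exact hG₁')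
    (iff_of_false (by
      rw [interior_range_modelWithCornersEuclideanHalfSpace, add_zero]
      change ¬ 0 < (L (φ p)).2 0
      rw [hL2, hlp]; exact lt_irrefl _) hni)
  refine ⟨c, fun _ q hq hqS => ?_⟩
  rw [hc q hq hqS, add_zero, hL2, hl, hφ1]

end HalfSpaceCharts

end Pseudocycles

end

noncomputable section

namespace Pseudocycles

/-! ### Immersions detected by injective derivatives -/

section Immersion

open Module

/-- The inverse function theorem, with smooth inverse on a whole neighbourhood. -/
theorem exists_localDiffeo {E E' : Type*} [NormedAddCommGroup E] [NormedSpace ℝ E]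
    [NormedAddCommGroup E'] [NormedSpace ℝ E'] [CompleteSpace E] [FiniteDimensional ℝ E']
    {U : Set E} (hU : IsOpen U) {x₀ : E} (hx : x₀ ∈ U) {f : E → E'} (hf : ContDiffOn ℝ ∞ f U)
    (hb : Function.Bijective (fderiv ℝ f x₀)) :
    ∃ e : OpenPartialHomeomorph E E', x₀ ∈ e.source ∧ e.source ⊆ U ∧ (∀ y, e y = f y) ∧
      ContDiffOn ℝ ∞ e e.source ∧ ContDiffOn ℝ ∞ e.symm e.target := by
  obtain ⟨e, h1, h2, h3, h4, h5⟩ := exists_submersion_chart hU hx hf hb.2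
  have hk : Subsingleton (fderiv ℝ f x₀).ker := by
    refine ⟨fun a b => Subtype.ext (hb.1 ?_)⟩
    rw [show (fderiv ℝ f x₀) a = 0 from a.2, show (fderiv ℝ f x₀) b = 0 from b.2]
  let _ : Unique (fderiv ℝ f x₀).ker := uniqueOfSubsingleton 0
  let c : (E' × (fderiv ℝ f x₀).ker) ≃L[ℝ] E' := ContinuousLinearEquiv.prodUnique ℝ _ _
  refine ⟨e.trans c.toHomeomorph.toOpenPartialHomeomorph, by simpa using h1, by simpa using h2,
    h3, ?_, ?_⟩
  · refine (c.contDiff.comp_contDiffOn h4).mono ?_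
    simp
  · refine h5.comp c.symm.contDiff.contDiffOn fun y hy => ?_
    simpa using hy

variable {E H P : Type*} [NormedAddCommGroup E] [NormedSpace ℝ E] [TopologicalSpace H]
  {I : ModelWithCorners ℝ E H} [TopologicalSpace P] [ChartedSpace H P]
  {E' H' N : Type*} [NormedAddCommGroup E'] [NormedSpace ℝ E'] [TopologicalSpace H']
  {J : ModelWithCorners ℝ E' H'} [TopologicalSpace N] [ChartedSpace H' N]

/-- In a chart of the domain and a chart of the codomain, the derivative is the composition of
`mfderiv` with isomorphisms. -/
theorem mfderiv_eq_fderivWithin_charts {h : N → P} {x : N} (hh : MDifferentiableAt J I h x) :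
    mfderiv J I h x = fderivWithin ℝ (extChartAt I (h x) ∘ h ∘ (extChartAt J x).symm) (range J)
      (extChartAt J x x) := hh.mfderiv

theorem exists_completion_of_injective {V W : Type*} [NormedAddCommGroup V] [NormedSpace ℝ V]
    [NormedAddCommGroup W] [NormedSpace ℝ W] [FiniteDimensional ℝ V] [FiniteDimensional ℝ W]
    (A : V →L[ℝ] W) (hA : Function.Injective A) {c : ℕ} (hc : finrank ℝ V + c = finrank ℝ W) :
    ∃ Λ : (V × EuclideanSpace ℝ (Fin c)) ≃L[ℝ] W, ∀ u, Λ (u, 0) = A u := by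
  obtain ⟨q, hq⟩ := Submodule.exists_isCompl (LinearMap.range A.toLinearMap)
  have h1 : finrank ℝ (LinearMap.range A.toLinearMap) = finrank ℝ V :=
    LinearMap.finrank_range_of_inj hA
  have h2 := Submodule.finrank_add_eq_of_isCompl hq
  have h3 : finrank ℝ (EuclideanSpace ℝ (Fin c)) = finrank ℝ q := by
    rw [finrank_euclideanSpace_fin]; omega
  let e1 : V ≃ₗ[ℝ] LinearMap.range A.toLinearMap := LinearEquiv.ofInjective A.toLinearMap hA
  let e2 : EuclideanSpace ℝ (Fin c) ≃ₗ[ℝ] q := LinearEquiv.ofFinrankEq _ _ h3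
  refine ⟨((e1.prodCongr e2).trans (Submodule.prodEquivOfIsCompl _ q hq)).toContinuousLinearEquiv,
    fun u => ?_⟩
  simp [e1]

/-- A smooth map with injective derivatives into a manifold without boundary is an immersion. -/
theorem isImmersionAtOfComplement_of_injective [FiniteDimensional ℝ E] [I.Boundaryless] {d c : ℕ}
    {N : Type*} [TopologicalSpace N] [ChartedSpace (EuclideanSpace ℝ (Fin d)) N]
    [IsManifold I ∞ P] [IsManifold (𝓡 d) ∞ N] {h : N → P} (hh : ContMDiff (𝓡 d) I ∞ h) (x : N)
    (hi : Function.Injective (mfderiv (𝓡 d) I h x)) (hc : d + c = finrank ℝ E) :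
    Manifold.IsImmersionAtOfComplement (EuclideanSpace ℝ (Fin c)) (𝓡 d) I ∞ h x := by
  set φ := chartAt (EuclideanSpace ℝ (Fin d)) x with hφ
  set ψ := extChartAt I (h x) with hψ
  set O : Set (EuclideanSpace ℝ (Fin d)) := φ.target ∩ φ.symm ⁻¹' (h ⁻¹' ψ.source) with hO
  have hOo : IsOpen O := φ.symm.isOpen_inter_preimage
    ((isOpen_extChartAt_source (h x)).preimage hh.continuous)
  have hxO : φ x ∈ O := by
    refine ⟨φ.map_source (mem_chart_source _ x), ?_⟩
    change h (φ.symm (φ x)) ∈ ψ.source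
    rw [φ.left_inv (mem_chart_source _ x)]
    exact mem_extChartAt_source _
  set k : EuclideanSpace ℝ (Fin d) → E := ψ ∘ h ∘ φ.symm with hk
  have hks : ContDiffOn ℝ ∞ k O := by
    rw [← contMDiffOn_iff_contDiffOn]
    refine (contMDiffOn_extChartAt (I := I) (n := ∞) (x := h x)).comp
      (t := (chartAt H (h x)).source) (hh.comp_contMDiffOn
      (contMDiffOn_chart_symm.mono inter_subset_left)) ?_
    intro y hy
    simpa [hψ] using hy.2
  have hder : mfderiv (𝓡 d) I h x = fderiv ℝ k (φ x) := by
    rw [mfderiv_eq_fderivWithin_charts (hh.mdifferentiable (by simp) x)]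
    simp only [hk, hφ, hψ, mfld_simps]
    rw [fderivWithin_univ]
  obtain ⟨Λ, hΛ⟩ := exists_completion_of_injective (fderiv ℝ k (φ x))
    (by rw [← hder]; exact hi) (c := c) (by simpa using hc)
  -- Adding complementary directions to `h` in charts gives a local diffeomorphism; its inverse
  -- straightens `h` to `u ↦ (u, 0)`.
  let Θ : EuclideanSpace ℝ (Fin d) × EuclideanSpace ℝ (Fin c) → E := fun y => k y.1 + Λ (0, y.2)
  have hΘ : ContDiffOn ℝ ∞ Θ (O ×ˢ univ) := by
    refine ContDiffOn.add (hks.comp contDiff_fst.contDiffOn fun y hy => hy.1) ?_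
    exact (Λ.contDiff.comp (contDiff_const.prodMk contDiff_snd)).contDiffOn
  have hΘ' : fderiv ℝ Θ (φ x, 0) = (Λ : _ →L[ℝ] E) := by
    let Λ₂ : EuclideanSpace ℝ (Fin d) × EuclideanSpace ℝ (Fin c) →L[ℝ] E :=
      (Λ : _ →L[ℝ] E).comp ((ContinuousLinearMap.inr ℝ (EuclideanSpace ℝ (Fin d)) _).comp
          (ContinuousLinearMap.snd ℝ _ _))
    have h1 : HasFDerivAt k (fderiv ℝ k (φ x)) (φ x) :=
      ((hks.contDiffAt (hOo.mem_nhds hxO)).differentiableAt (by simp)).hasFDerivAt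
    have h2 : HasFDerivAt (fun y : EuclideanSpace ℝ (Fin d) × EuclideanSpace ℝ (Fin c) => k y.1)
        ((fderiv ℝ k (φ x)).comp (ContinuousLinearMap.fst ℝ _ _)) (φ x, 0) :=
      HasFDerivAt.comp (g := k) (φ x, (0 : EuclideanSpace ℝ (Fin c))) h1 hasFDerivAt_fst
    have h3 : HasFDerivAt (fun y : EuclideanSpace ℝ (Fin d) × EuclideanSpace ℝ (Fin c) =>
        Λ (0, y.2)) Λ₂ (φ x, 0) := Λ₂.hasFDerivAt
    rw [show Θ = (fun y => k y.1) + fun y => Λ (0, y.2) from rfl, (h2.add h3).fderiv]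
    refine ContinuousLinearMap.ext fun y => ?_
    change fderiv ℝ k (φ x) y.1 + Λ (0, y.2) = Λ y
    rw [← hΛ, ← map_add]
    simp
  obtain ⟨e, he1, he2, he3, he4, he5⟩ := exists_localDiffeo (hOo.prod isOpen_univ)
    (x₀ := (φ x, 0)) (mk_mem_prod hxO (mem_univ _)) hΘ (by rw [hΘ']; exact Λ.bijective)
  let dom : OpenPartialHomeomorph N (EuclideanSpace ℝ (Fin d)) :=
    φ.trans (OpenPartialHomeomorph.ofSet {u | (u, (0 : EuclideanSpace ℝ (Fin c))) ∈ e.source}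
      (e.open_source.preimage (by fun_prop)))
  let IH := I.toHomeomorph
  let cod : OpenPartialHomeomorph P H :=
    (((chartAt H (h x)).trans IH.toOpenPartialHomeomorph).trans e.symm).trans
      (Λ.toHomeomorph.trans IH.symm).toOpenPartialHomeomorph
  have hIH : ∀ y, IH y = I y := fun y => rfl
  have hIHs : ∀ y, IH.symm y = I.symm y := fun y => rfl
  have hcsrc : ∀ p, p ∈ cod.source ↔ p ∈ ψ.source ∧ ψ p ∈ e.target := by
    intro p
    simp [cod, hψ, hIH]
  have hcod : ∀ p, I (cod p) = Λ (e.symm (ψ p)) := by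
    intro p
    change I (I.symm _) = _
    rw [I.right_inv (by rw [I.range_eq_univ]; trivial)]
    rfl
  have hctgt : ∀ y, y ∈ cod.target ↔ Λ.symm (I y) ∈ e.source ∧ e (Λ.symm (I y)) ∈ ψ.target := by
    intro y
    simp [cod, hψ, hIH, hIHs, I.range_eq_univ]
  have hcsym : ∀ y, cod.symm y = ψ.symm (e (Λ.symm (I y))) := fun y => rfl
  have hdtgt : ∀ u, u ∈ dom.target ↔ u ∈ φ.target ∧ (u, (0 : EuclideanSpace ℝ (Fin c))) ∈ e.source := by
    intro u
    simp [dom, and_comm]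
  have hkey : ∀ u, (u, (0 : EuclideanSpace ℝ (Fin c))) ∈ e.source →
      ψ (h (φ.symm u)) = e (u, 0) := by
    intro u hu
    rw [he3]
    change _ = k u + Λ (0, 0)
    rw [show ((0 : EuclideanSpace ℝ (Fin d)), (0 : EuclideanSpace ℝ (Fin c))) = 0 from rfl, map_zero,
      add_zero]
    rfl
  refine Manifold.IsImmersionAtOfComplement.mk_of_continuousAt hh.continuous.continuousAt Λ dom cod
    ?_ ?_ ?_ ?_ ?_
  · simp only [dom, OpenPartialHomeomorph.trans_source, mem_inter_iff, mem_preimage]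
    exact ⟨mem_chart_source _ x, he1⟩
  · rw [hcsrc]
    refine ⟨mem_extChartAt_source _, ?_⟩
    have := hkey (φ x) he1
    rw [φ.left_inv (mem_chart_source _ x)] at this
    rw [this]
    exact e.map_source he1
  · refine OpenPartialHomeomorph.mem_maximalAtlas_of_contMDiffOn _ ?_ ?_
    · refine (contMDiffOn_chart (I := 𝓡 d) (n := ∞) (x := x)).mono ?_
      intro y hy
      exact (by simpa [dom] using hy : y ∈ φ.source ∧ _).1
    · refine (contMDiffOn_chart_symm (I := 𝓡 d) (n := ∞) (x := x)).mono ?_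
      intro y hy
      exact ((hdtgt y).1 hy).1
  · refine OpenPartialHomeomorph.mem_maximalAtlas_of_contMDiffOn _ ?_ ?_
    · have h1 : ContMDiffOn I 𝓘(ℝ, E) ∞ (fun p => Λ (e.symm (ψ p))) cod.source := by
        refine (Λ.contDiff.comp_contDiffOn he5).contMDiffOn.comp (t := e.target)
          ((contMDiffOn_extChartAt (I := I) (n := ∞) (x := h x)).mono ?_) fun p hp => ((hcsrc p).1 hp).2
        intro p hp
        simpa [hψ] using ((hcsrc p).1 hp).1
      have h2 := (I.contMDiffOn_symm (n := ∞)).comp h1 fun p _ => by rw [I.range_eq_univ]; trivial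
      exact h2
    · have h1 : ContMDiffOn I 𝓘(ℝ, E) ∞ (fun y => e (Λ.symm (I y))) cod.target := by
        refine he4.contMDiffOn.comp (t := e.source)
          ((Λ.symm.contDiff.contMDiff.comp I.contMDiff).contMDiffOn) fun y hy => ((hctgt y).1 hy).1
      exact (contMDiffOn_extChartAt_symm (I := I) (n := ∞) (h x)).comp h1 fun y hy => ((hctgt y).1 hy).2
  · intro u hu
    have hu' : u ∈ dom.target := by simpa using hu
    have hu2 := ((hdtgt u).1 hu').2
    change I (cod (h (φ.symm u))) = Λ (u, 0)
    rw [hcod, hkey u hu2, e.left_inv hu2]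

theorem isImmersion_of_injective [FiniteDimensional ℝ E] [I.Boundaryless] {d c : ℕ}
    {N : Type*} [TopologicalSpace N] [ChartedSpace (EuclideanSpace ℝ (Fin d)) N]
    [IsManifold I ∞ P] [IsManifold (𝓡 d) ∞ N] {h : N → P} (hh : ContMDiff (𝓡 d) I ∞ h)
    (hi : ∀ x, Function.Injective (mfderiv (𝓡 d) I h x)) (hc : d + c = finrank ℝ E) :
    Manifold.IsImmersion (𝓡 d) I ∞ h :=
  Manifold.IsImmersionOfComplement.isImmersion fun x =>
    isImmersionAtOfComplement_of_injective hh x (hi x) hc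

theorem mfderiv_injective_of_comp {E'' H'' Q : Type*} [NormedAddCommGroup E''] [NormedSpace ℝ E'']
    [TopologicalSpace H''] {K : ModelWithCorners ℝ E'' H''} [TopologicalSpace Q]
    [ChartedSpace H'' Q] {g : P → Q} {f : N → P} {x : N} (hg : MDifferentiableAt I K g (f x))
    (hf : MDifferentiableAt J I f x) (h : Function.Injective (mfderiv J K (g ∘ f) x)) :
    Function.Injective (mfderiv J I f x) := fun v w hvw => h <|
  (mfderiv_comp_apply x hg hf v).trans ((congrArg (fun u => mfderiv I K g (f x) u) hvw).trans
    (mfderiv_comp_apply x hg hf w).symm)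

/-- The derivative of an immersion is injective. -/
theorem IsImmersionAtOfComplement.mfderiv_injective [IsManifold I ∞ P] [IsManifold J ∞ N]
    {F : Type*} [NormedAddCommGroup F] [NormedSpace ℝ F] {h : N → P} {x : N}
    (hx : Manifold.IsImmersionAtOfComplement F J I ∞ h x) :
    Function.Injective (mfderiv J I h x) := by
  have hd : MDifferentiableAt J I h x := hx.contMDiffAt.mdifferentiableAt (by simp)
  have hle : IsManifold.maximalAtlas I ∞ P ⊆ IsManifold.maximalAtlas I 1 P :=
    IsManifold.maximalAtlas_subset_of_le (by simp)
  have hle' : IsManifold.maximalAtlas J ∞ N ⊆ IsManifold.maximalAtlas J 1 N :=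
    IsManifold.maximalAtlas_subset_of_le (by simp)
  set e := hx.domChart
  set e' := hx.codChart
  have h2 : MDifferentiableAt I 𝓘(ℝ, E) (e'.extend I) (h x) :=
    I.mdifferentiableAt.comp _ (mdifferentiableAt_of_mem_maximalAtlas (hle
      hx.codChart_mem_maximalAtlas) hx.mem_codChart_source)
  have he : MDifferentiableAt J J e x := mdifferentiableAt_of_mem_maximalAtlas
      (hle' hx.domChart_mem_maximalAtlas) hx.mem_domChart_source
  -- In the charts of an immersion `h` is `u ↦ (u, 0)`. Projecting back by `π` recovers the domain
  -- chart, whose derivative is invertible.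
  let π : E →L[ℝ] E' := (ContinuousLinearMap.fst ℝ E' F).comp (hx.equiv.symm : E →L[ℝ] E' × F)
  have hloc : (fun y => π (e'.extend I (h y))) =ᶠ[𝓝 x] e.extend J := by
    filter_upwards [e.open_source.mem_nhds hx.mem_domChart_source] with y hy
    have hy' : e.extend J y ∈ (e.extend J).target :=
      (e.extend J).map_source (by rwa [e.extend_source])
    have := hx.writtenInCharts hy'
    simp only [Function.comp_apply] at this
    rw [(e.extend J).left_inv (by rwa [e.extend_source])] at this
    change π (e'.extend I (h y)) = _
    rw [this]
    simp [π]
  have hinj : Function.Injective (mfderiv J 𝓘(ℝ, E') (e.extend J) x) := by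
    have h3 : MDifferentiableAt J J e.symm (e x) := mdifferentiableAt_symm_of_mem_maximalAtlas
      (hle' hx.domChart_mem_maximalAtlas) (e.map_source hx.mem_domChart_source)
    have h5 : mfderiv J J e.symm (e x) ∘ mfderiv J J e x = id := by
      have h6 := mfderiv_comp x h3 he
      rw [Filter.EventuallyEq.mfderiv_eq (f := id), mfderiv_id] at h6
      · funext v
        exact (congrArg (fun A => A v) h6).symm
      · filter_upwards [e.open_source.mem_nhds hx.mem_domChart_source] with y hy
        exact e.left_inv hy
    have h7 : mfderiv J 𝓘(ℝ, E') (e.extend J) x = mfderiv J J e x := by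
      refine (mfderiv_comp x J.mdifferentiableAt he).trans ?_
      rw [J.hasMFDerivAt.mfderiv]
      rfl
    rw [h7]
    exact Function.LeftInverse.injective (congrFun h5)
  have hπ : MDifferentiableAt 𝓘(ℝ, E) 𝓘(ℝ, E') π (e'.extend I (h x)) :=
    (π.contDiff.contMDiff (n := ∞)).mdifferentiableAt (by simp)
  refine mfderiv_injective_of_comp (g := fun y => π (e'.extend I y)) (hπ.comp _ h2) hd ?_
  rw [show (fun y => π (e'.extend I y)) ∘ h = fun y => π (e'.extend I (h y)) from rfl,
    hloc.mfderiv_eq]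
  exact hinj

/-- In a chart around a boundary point, the first coordinate vanishes at all boundary points. -/
theorem extChartAt_apply_zero_of_isBoundaryPoint {a : ℕ} {B : Type*} [TopologicalSpace B]
    [ChartedSpace (EuclideanHalfSpace (a + 1)) B] [IsManifold (𝓡∂ (a + 1)) ∞ B] {p q : B}
    (hq : q ∈ (extChartAt (𝓡∂ (a + 1)) p).source) :
    (𝓡∂ (a + 1)).IsBoundaryPoint q ↔ extChartAt (𝓡∂ (a + 1)) p q 0 = 0 := by
  set e := chartAt (EuclideanHalfSpace (a + 1)) p
  have hq' : q ∈ e.source := by simpa using hq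
  have h1 := (𝓡∂ (a + 1)).isInteriorPoint_iff_of_mem_atlas (n := ∞) (by simp)
    (chart_mem_atlas (EuclideanHalfSpace (a + 1)) p) hq'
  have h2 : (𝓡∂ (a + 1)).IsInteriorPoint q ↔ 0 < extChartAt (𝓡∂ (a + 1)) p q 0 := by
    rw [h1]
    refine Iff.trans ⟨fun h => e.interior_extend_target_subset_interior_range h, fun h =>
      e.mem_interior_extend_target (e.map_source hq') h⟩ ?_
    rw [interior_range_modelWithCornersEuclideanHalfSpace]
    rfl
  have h3 : 0 ≤ extChartAt (𝓡∂ (a + 1)) p q 0 := (e q).2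
  rw [← not_iff_not, ← ModelWithCorners.isInteriorPoint_iff_not_isBoundaryPoint, h2]
  exact ⟨fun h => h.ne', fun h => lt_of_le_of_ne h3 (Ne.symm h)⟩

/-- The derivative of a map into the boundary has no normal component. -/
theorem mfderiv_apply_zero_of_isBoundaryPoint {a : ℕ} {B : Type*} [TopologicalSpace B]
    [ChartedSpace (EuclideanHalfSpace (a + 1)) B] [IsManifold (𝓡∂ (a + 1)) ∞ B] {h : N → B}
    {x : N} (hh : MDifferentiableAt J (𝓡∂ (a + 1)) h x)
    (hb : ∀ y, (𝓡∂ (a + 1)).IsBoundaryPoint (h y)) (v : TangentSpace J x) :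
    (EuclideanSpace.proj 0 : EuclideanSpace ℝ (Fin (a + 1)) →L[ℝ] ℝ)
      (mfderiv J (𝓡∂ (a + 1)) h x v) = 0 := by
  rw [mfderiv_eq_fderivWithin_charts hh]
  set k := extChartAt (𝓡∂ (a + 1)) (h x) ∘ h ∘ (extChartAt J x).symm with hk
  have hkd : DifferentiableWithinAt ℝ k (range J) (extChartAt J x x) :=
    ((mdifferentiableAt_iff _ _).1 hh).2
  let l : EuclideanSpace ℝ (Fin (a + 1)) →L[ℝ] ℝ := EuclideanSpace.proj 0
  have hu : UniqueDiffWithinAt ℝ (range J) (extChartAt J x x) :=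
    J.uniqueDiffOn _ (mem_range_self _)
  have h1 := fderivWithin_comp (extChartAt J x x) (g := l) (t := univ)
    l.differentiableAt.differentiableWithinAt hkd (mapsTo_univ _ _) hu
  -- The boundary coordinate is identically zero along `h`, so its derivative vanishes.
  have h2 : fderivWithin ℝ (l ∘ k) (range J) (extChartAt J x x) = 0 := by
    have hz : l ∘ k =ᶠ[𝓝[range J] (extChartAt J x x)] fun _ => (0 : ℝ) := by
      have hs : (extChartAt (𝓡∂ (a + 1)) (h x)).source ∈ 𝓝 (h x) := extChartAt_source_mem_nhds _
      have h3 : h ⁻¹' (extChartAt (𝓡∂ (a + 1)) (h x)).source ∈ 𝓝 x :=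
        hh.continuousAt.preimage_mem_nhds hs
      have h4 := extChartAt_preimage_mem_nhdsWithin (I := J) (x := x) (s := univ)
        (by rwa [nhdsWithin_univ])
      rw [preimage_univ, univ_inter] at h4
      filter_upwards [h4] with y hy
      exact (extChartAt_apply_zero_of_isBoundaryPoint hy).1 (hb _)
    rw [hz.fderivWithin_eq]
    · exact fderivWithin_const_apply _
    · exact (extChartAt_apply_zero_of_isBoundaryPoint (by simp)).1 (hb _)
  rw [h2, fderivWithin_univ, l.fderiv] at h1
  exact (congrArg (fun A : E' →L[ℝ] ℝ => A v) h1).symm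

/-- A smooth map with injective derivatives into the boundary is an immersion. -/
theorem isImmersion_of_injective_boundary {d : ℕ} {N B : Type*} [TopologicalSpace N]
    [ChartedSpace (EuclideanSpace ℝ (Fin d)) N] [IsManifold (𝓡 d) ∞ N] [TopologicalSpace B]
    [ChartedSpace (EuclideanHalfSpace (d + 1)) B] [IsManifold (𝓡∂ (d + 1)) ∞ B]
    {h : N → B} (hh : ContMDiff (𝓡 d) (𝓡∂ (d + 1)) ∞ h)
    (hb : ∀ y, (𝓡∂ (d + 1)).IsBoundaryPoint (h y))
    (hi : ∀ x, Function.Injective (mfderiv (𝓡 d) (𝓡∂ (d + 1)) h x)) :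
    Manifold.IsImmersion (𝓡 d) (𝓡∂ (d + 1)) ∞ h := by
  refine Manifold.IsImmersionOfComplement.isImmersion (F := ℝ) fun x => ?_
  set φ := chartAt (EuclideanSpace ℝ (Fin d)) x with hφ
  set ψ := extChartAt (𝓡∂ (d + 1)) (h x) with hψ
  set O : Set (EuclideanSpace ℝ (Fin d)) := φ.target ∩ φ.symm ⁻¹' (h ⁻¹' ψ.source) with hO
  have hOo : IsOpen O := φ.symm.isOpen_inter_preimage
    ((isOpen_extChartAt_source (h x)).preimage hh.continuous)
  have hxO : φ x ∈ O := by
    refine ⟨φ.map_source (mem_chart_source _ x), ?_⟩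
    change h (φ.symm (φ x)) ∈ ψ.source
    rw [φ.left_inv (mem_chart_source _ x)]
    exact mem_extChartAt_source _
  set k₀ : EuclideanSpace ℝ (Fin d) → EuclideanSpace ℝ (Fin (d + 1)) := ψ ∘ h ∘ φ.symm with hk₀
  have hks₀ : ContDiffOn ℝ ∞ k₀ O := by
    rw [← contMDiffOn_iff_contDiffOn]
    refine (contMDiffOn_extChartAt (I := 𝓡∂ (d + 1)) (n := ∞) (x := h x)).comp
      (t := (chartAt _ (h x)).source) (hh.comp_contMDiffOn
      (contMDiffOn_chart_symm.mono inter_subset_left)) ?_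
    intro y hy
    simpa [hψ] using hy.2
  have hder : mfderiv (𝓡 d) (𝓡∂ (d + 1)) h x = fderiv ℝ k₀ (φ x) := by
    rw [mfderiv_eq_fderivWithin_charts (hh.mdifferentiable (by simp) x)]
    simp only [hk₀, hφ, hψ, mfld_simps]
    rw [fderivWithin_univ]
  -- Along the boundary the coordinate `0` carries no information. Without it the derivative is an
  -- injective endomorphism, hence bijective, and the inverse function gives a new chart of the
  -- domain in which `h` is `u ↦ (0, u)`; the chart of `B` needs no change.
  let τ : EuclideanSpace ℝ (Fin (d + 1)) →L[ℝ] EuclideanSpace ℝ (Fin d) :=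
    (ContinuousLinearMap.snd ℝ _ _).comp ((consEquiv d).symm : _ →L[ℝ] ℝ × _)
  have hk : fderiv ℝ (τ ∘ k₀) (φ x) = τ.comp (fderiv ℝ k₀ (φ x)) := by
    rw [fderiv_comp _ τ.differentiableAt
      ((hks₀.contDiffAt (hOo.mem_nhds hxO)).differentiableAt (by simp)), τ.fderiv]
  have hinj : Function.Injective (fderiv ℝ (τ ∘ k₀) (φ x)) := by
    rw [hk, injective_iff_map_eq_zero]
    intro v hv
    have h0 := mfderiv_apply_zero_of_isBoundaryPoint (hh.mdifferentiable (by simp) x) hb v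
    rw [hder] at h0
    have h1 : fderiv ℝ k₀ (φ x) v = 0 := by
      apply (consEquiv d).symm.injective
      rw [map_zero]
      exact Prod.ext h0 hv
    have h2 := hi x
    rw [hder] at h2
    exact h2 (h1.trans (map_zero _).symm)
  have hbij : Function.Bijective (fderiv ℝ (τ ∘ k₀) (φ x)) :=
    ⟨hinj, LinearMap.surjective_of_injective (f := (fderiv ℝ (τ ∘ k₀) (φ x)).toLinearMap) hinj⟩
  obtain ⟨e, he1, he2, he3, he4, he5⟩ := exists_localDiffeo hOo hxO
    (τ.contDiff.comp_contDiffOn hks₀) hbij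
  have hchart : ∀ u ∈ O, consEquiv d (0, (τ ∘ k₀) u) = ψ (h (φ.symm u)) := by
    intro u hu
    rw [← (consEquiv d).apply_symm_apply (ψ (h (φ.symm u)))]
    congr 1
    exact Prod.ext ((extChartAt_apply_zero_of_isBoundaryPoint hu.2).1 (hb _)).symm rfl
  refine Manifold.IsImmersionAtOfComplement.mk_of_continuousAt hh.continuous.continuousAt
    ((ContinuousLinearEquiv.prodComm ℝ _ _).trans (consEquiv d)) (φ.trans e) (chartAt _ (h x))
    ?_ (mem_chart_source _ _) ?_ (IsManifold.chart_mem_maximalAtlas _) ?_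
  · rw [OpenPartialHomeomorph.trans_source]
    exact ⟨mem_chart_source _ x, he1⟩
  · refine OpenPartialHomeomorph.mem_maximalAtlas_of_contMDiffOn _ ?_ ?_
    · refine he4.contMDiffOn.comp ((contMDiffOn_chart (I := 𝓡 d) (n := ∞) (x := x)).mono ?_) ?_
      · rw [OpenPartialHomeomorph.trans_source]; exact inter_subset_left
      · rw [OpenPartialHomeomorph.trans_source]; exact inter_subset_right
    · refine (contMDiffOn_chart_symm (I := 𝓡 d) (n := ∞) (x := x)).comp
        (he5.contMDiffOn.mono ?_) ?_
      · rw [OpenPartialHomeomorph.trans_target]; exact inter_subset_left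
      · rw [OpenPartialHomeomorph.trans_target]; exact inter_subset_right
  · intro u hu
    have hu' : u ∈ e.target ∧ e.symm u ∈ φ.target := by
      simpa [OpenPartialHomeomorph.trans_target] using hu
    have h1 := hchart (e.symm u) (he2 (e.map_target hu'.1))
    rw [← he3, e.right_inv hu'.1] at h1
    exact h1.symm

end Immersion

end Pseudocycles

end

noncomputable section

namespace Pseudocycles

/-! ### Signs of frames -/

section FrameSigns

open Module

variable {V W : Type*} [AddCommGroup V] [Module ℝ V] [AddCommGroup W] [Module ℝ W] {k : ℕ}

/-- The sign of a family of vectors with respect to an orientation. -/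
def osign (o : Orientation ℝ V (Fin k)) (v : Fin k → V) : SignType :=
  SignType.sign (o.someVector v)

/-- `osign` uses an arbitrary form on the ray; any other form on the ray is a positive multiple of
it. -/
theorem osign_rayOfNeZero {η : V [⋀^Fin k]→ₗ[ℝ] ℝ} (h : η ≠ 0) (v : Fin k → V) :
    osign (rayOfNeZero ℝ η h) v = SignType.sign (η v) := by
  have h1 := Module.Ray.someVector_ray (rayOfNeZero ℝ η h)
  rw [ray_eq_iff] at h1
  obtain ⟨r₁, r₂, hr₁, hr₂, h2⟩ := h1.exists_pos (Module.Ray.someVector_ne_zero _) h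
  have h3 := congrArg (fun f => SignType.sign (f v)) h2
  simp only [AlternatingMap.smul_apply, smul_eq_mul, sign_mul, sign_pos hr₁, sign_pos hr₂,
    one_mul] at h3
  exact h3

/-- Forms of top degree are multiples of one determinant. All comparisons of orientations below are
reduced to determinants in this way. -/
theorem osign_eq_mul (e : Basis (Fin k) ℝ V) (o : Orientation ℝ V (Fin k)) (v : Fin k → V) :
    osign o v = osign o e * SignType.sign (e.det v) := by
  rw [osign, osign, ← sign_mul]
  conv_lhs => rw [AlternatingMap.eq_smul_basis_det e o.someVector]
  rfl

theorem osign_basis_ne_zero (o : Orientation ℝ V (Fin k)) (e : Basis (Fin k) ℝ V) :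
    osign o e ≠ 0 := by
  rw [osign, Ne, sign_eq_zero_iff]
  intro h
  apply Module.Ray.someVector_ne_zero o
  rw [AlternatingMap.eq_smul_basis_det e o.someVector, h, zero_smul]

theorem exists_basis_of_osign_ne_zero (e : Basis (Fin k) ℝ V) {o : Orientation ℝ V (Fin k)}
    {v : Fin k → V} (h : osign o v ≠ 0) : ∃ c : Basis (Fin k) ℝ V, ⇑c = v := by
  have h1 : e.det v ≠ 0 := by
    rintro h0
    rw [osign_eq_mul e, h0, sign_zero, mul_zero] at h
    exact h rfl
  obtain ⟨h2, h3⟩ := (Basis.is_basis_iff_det e).2 (isUnit_iff_ne_zero.2 h1)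
  exact ⟨Basis.mk h2 h3.ge, Basis.coe_mk _ _⟩

theorem exists_osign_eq (e : Basis (Fin k) ℝ V) {ε : SignType} (hε : ε ≠ 0) :
    ∃ o : Orientation ℝ V (Fin k), osign o e = ε := by
  have h1 : e.det ≠ 0 := fun h => by
    have h2 := e.det_self
    rw [h] at h2
    exact zero_ne_one h2
  have h2 : (SignType.cast ε : ℝ) • e.det ≠ 0 := by
    refine smul_ne_zero ?_ h1
    cases ε <;> simp_all
  refine ⟨rayOfNeZero ℝ _ h2, ?_⟩
  rw [osign_rayOfNeZero, AlternatingMap.smul_apply, e.det_self]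
  cases ε <;> simp_all

/-- Both representing forms are multiples of `e.det`; equal signs of the factors mean that the forms
lie on the same ray. -/
theorem osign_ext (e : Basis (Fin k) ℝ V) {o o' : Orientation ℝ V (Fin k)}
    (h : osign o e = osign o' e) : o = o' := by
  rw [← Module.Ray.someVector_ray o, ← Module.Ray.someVector_ray o', ray_eq_iff]
  have h0 := osign_basis_ne_zero o e
  rw [AlternatingMap.eq_smul_basis_det e o.someVector,
    AlternatingMap.eq_smul_basis_det e o'.someVector]
  simp only [osign] at h h0
  have key : |o'.someVector e| * o.someVector e = |o.someVector e| * o'.someVector e := by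
    rcases lt_trichotomy (o.someVector e) 0 with h1 | h1 | h1
    · have h2 : o'.someVector e < 0 := by rwa [sign_neg h1, eq_comm, sign_eq_neg_one_iff] at h
      rw [abs_of_neg h1, abs_of_neg h2]; ring
    · simp [h1] at h0
    · have h2 : 0 < o'.someVector e := by rwa [sign_pos h1, eq_comm, sign_eq_one_iff] at h
      rw [abs_of_pos h1, abs_of_pos h2]; ring
  have h0' := h0
  rw [h] at h0'
  refine Or.inr (Or.inr ⟨|o'.someVector e|, |o.someVector e|, abs_pos.2 (sign_ne_zero.1 h0'),
    abs_pos.2 (sign_ne_zero.1 h0), ?_⟩)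
  rw [smul_smul, smul_smul, key]

theorem osign_neg (o : Orientation ℝ V (Fin k)) (v : Fin k → V) :
    osign (-o) v = - osign o v := by
  have h0 := Module.Ray.someVector_ne_zero o
  have h1 : -o = rayOfNeZero ℝ (-o.someVector) (neg_ne_zero.2 h0) := by
    conv_lhs => rw [← Module.Ray.someVector_ray o]
    exact neg_rayOfNeZero ..
  rw [h1, osign_rayOfNeZero, AlternatingMap.neg_apply, Left.sign_neg]
  rfl

theorem osign_map (A : V ≃ₗ[ℝ] W) (o : Orientation ℝ V (Fin k)) (v : Fin k → V) :
    osign (Orientation.map (Fin k) A o) (A ∘ v) = osign o v := by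
  have h1 : Orientation.map (Fin k) A o = rayOfNeZero ℝ
      (AlternatingMap.domLCongr ℝ ℝ (Fin k) ℝ A o.someVector)
      ((LinearEquiv.map_ne_zero_iff _).2 (Module.Ray.someVector_ne_zero o)) := by
    conv_lhs => rw [← Module.Ray.someVector_ray o]
    exact Orientation.map_apply _ _ _ _
  rw [h1, osign_rayOfNeZero]
  simp [osign, Function.comp_def]

/-- Orientations can be pulled back by isomorphisms. -/
theorem exists_osign_comp (A : V →ₗ[ℝ] W) (hA : Function.Surjective A)
    (o : Orientation ℝ W (Fin k)) :
    ∃ o' : Orientation ℝ V (Fin k), ∀ v, osign o' v = osign o (A ∘ v) := by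
  have h1 : o.someVector.compLinearMap A ≠ 0 := by
    intro h
    apply Module.Ray.someVector_ne_zero o
    ext w
    choose r hr using hA
    have := congrArg (fun f => f (r ∘ w)) h
    simpa [Function.comp_def, hr] using this
  exact ⟨rayOfNeZero ℝ _ h1, fun v => osign_rayOfNeZero _ _⟩

theorem det_sum_elim_of_triangular {ι κ : Type*} [Fintype ι] [DecidableEq ι] [Fintype κ]
    [DecidableEq κ] (c : Basis (ι ⊕ κ) ℝ V) (w : ι → V) (s : κ → V)
    (h : ∀ i j, c.repr (w i) (Sum.inr j) = 0) :
    c.det (Sum.elim w s) = (Matrix.of fun i j => c.repr (w j) (Sum.inl i)).det *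
      (Matrix.of fun i j => c.repr (s j) (Sum.inr i)).det := by
  rw [Basis.det_apply, ← Matrix.det_fromBlocks_zero₂₁ _
    (Matrix.of fun i j => c.repr (s j) (Sum.inl i))]
  congr 1
  ext (i | i) (j | j) <;> simp [Basis.toMatrix_apply, h]

end FrameSigns

/-! ### Orientations of short exact sequences -/

section FibreLinear

open Module

variable {VB VM VX VZ : Type*} [AddCommGroup VB] [Module ℝ VB] [AddCommGroup VM] [Module ℝ VM]
  [AddCommGroup VX] [Module ℝ VX] [AddCommGroup VZ] [Module ℝ VZ] {kb l n d : ℕ}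
  {ι : VZ →ₗ[ℝ] VB × VM} {Δ : VB × VM →ₗ[ℝ] VX}

/-- A basis of the middle term of a short exact sequence. -/
theorem exists_basis_of_exact (hι : Function.Injective ι) (hex : LinearMap.range ι = LinearMap.ker Δ)
    (w : Basis (Fin d) ℝ VZ) (z : Basis (Fin n) ℝ VX) (s : Fin n → VB × VM)
    (hs : ∀ j, Δ (s j) = z j) :
    ∃ c : Basis (Fin d ⊕ Fin n) ℝ (VB × VM), ⇑c = Sum.elim (ι ∘ w) s ∧
      (∀ u i, c.repr (ι u) (Sum.inl i) = w.repr u i) ∧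
      ∀ v j, c.repr v (Sum.inr j) = z.repr (Δ v) j := by
  have hΔι : ∀ u, Δ (ι u) = 0 := fun u => by
    have : ι u ∈ LinearMap.ker Δ := hex ▸ LinearMap.mem_range_self ι u
    exact this
  let R : VX →ₗ[ℝ] VB × VM := z.constr ℝ s
  have hR : ∀ x, Δ (R x) = x := by
    intro x
    have : Δ.comp R = LinearMap.id := z.ext fun j => by simp [R, hs]
    exact congrArg (fun f => f x) this
  let Ψ : (VZ × VX) →ₗ[ℝ] VB × VM := ι.coprod R
  have hΨ : Function.Bijective Ψ := by
    constructor
    · rw [injective_iff_map_eq_zero]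
      rintro ⟨u, x⟩ h
      have h' : ι u + R x = 0 := h
      have h1 : x = 0 := by
        have := congrArg Δ h'
        rwa [map_add, hΔι, hR, zero_add, map_zero] at this
      subst h1
      rw [map_zero, add_zero] at h'
      rw [(injective_iff_map_eq_zero ι).1 hι u h']
      rfl
    · intro v
      have : v - R (Δ v) ∈ LinearMap.range ι := by
        rw [hex, LinearMap.mem_ker, map_sub, hR, sub_self]
      obtain ⟨u, hu⟩ := this
      exact ⟨(u, Δ v), by simp [Ψ, hu]⟩
  let Ψ' := LinearEquiv.ofBijective Ψ hΨ
  have hΨ' : ∀ p, Ψ' p = ι p.1 + R p.2 := fun p => rfl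
  refine ⟨(w.prod z).map Ψ', ?_, ?_, ?_⟩
  · funext i
    rcases i with i | j
    · simp [hΨ']
    · simp [hΨ', R]
  · intro u i
    have : Ψ'.symm (ι u) = (u, 0) := by rw [LinearEquiv.symm_apply_eq, hΨ']; simp
    simp [this]
  · intro v j
    obtain ⟨p, rfl⟩ := Ψ'.surjective v
    have : Δ (Ψ' p) = p.2 := by rw [hΨ', map_add, hΔι, hR, zero_add]
    simp [this]

/-- Because `Δ` kills the image of `ι`, the matrix of the new frame in a reference frame is block
triangular. Its determinant does not see the components of `s` along `ι`, so the orientation of the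
fibre product is independent of the choice of lifts. -/
theorem det_fibre_change (hι : Function.Injective ι) (hex : LinearMap.range ι = LinearMap.ker Δ)
    (τ : Fin kb ⊕ Fin l ≃ Fin d ⊕ Fin n) (e : Basis (Fin kb ⊕ Fin l) ℝ (VB × VM))
    (w₀ : Basis (Fin d) ℝ VZ) (z₀ : Basis (Fin n) ℝ VX) (s₀ : Fin n → VB × VM)
    (hs₀ : ∀ j, Δ (s₀ j) = z₀ j) (w : Fin d → VZ) (s : Fin n → VB × VM) :
    e.det (Sum.elim (ι ∘ w) s ∘ τ) =
      w₀.det w * z₀.det (Δ ∘ s) * e.det (Sum.elim (ι ∘ w₀) s₀ ∘ τ) := by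
  obtain ⟨c, hc, hc1, hc2⟩ := exists_basis_of_exact hι hex w₀ z₀ s₀ hs₀
  have hΔι : ∀ u, Δ (ι u) = 0 := fun u => by
    have : ι u ∈ LinearMap.ker Δ := hex ▸ LinearMap.mem_range_self ι u
    exact this
  have h1 : e.det (Sum.elim (ι ∘ w) s ∘ τ) =
      e.det (c.reindex τ.symm) * (c.reindex τ.symm).det (Sum.elim (ι ∘ w) s ∘ τ) := by
    have := AlternatingMap.eq_smul_basis_det (c.reindex τ.symm) e.det
    exact congrArg (fun f => f (Sum.elim (ι ∘ w) s ∘ τ)) this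
  have h2 : ⇑(c.reindex τ.symm) = Sum.elim (ι ∘ w₀) s₀ ∘ τ := by
    rw [Basis.coe_reindex, hc]
    rfl
  rw [h1, h2, mul_comm]
  congr 1
  rw [Basis.det_reindex]
  have h3 : (Sum.elim (ι ∘ w) s ∘ τ) ∘ τ.symm = Sum.elim (ι ∘ w) s := by
    funext i; simp
  rw [h3, det_sum_elim_of_triangular c _ _ fun i j => by simp [hc2, hΔι]]
  congr 1
  · rw [Basis.det_apply]
    congr 1
    ext i j
    simp [Basis.toMatrix_apply, hc1]
  · rw [Basis.det_apply]
    congr 1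
    ext i j
    simp [Basis.toMatrix_apply, hc2]

/-- Changing bases in the factors is block diagonal, so each factor contributes its own determinant.
-/
theorem det_prod_change (a a₀ : Basis (Fin kb) ℝ VB) (b b₀ : Basis (Fin l) ℝ VM)
    (v : Fin kb ⊕ Fin l → VB × VM) :
    (a.prod b).det v = a.det a₀ * b.det b₀ * (a₀.prod b₀).det v := by
  have := AlternatingMap.eq_smul_basis_det (a₀.prod b₀) (a.prod b).det
  refine (congrArg (fun f => f v) this).trans ?_
  change (a.prod b).det (a₀.prod b₀) * _ = _
  congr 1
  have h1 : ⇑(a₀.prod b₀) = Sum.elim (fun i => (a₀ i, (0 : VM))) (fun j => ((0 : VB), b₀ j)) := by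
    funext i; rcases i with i | i <;> simp
  rw [h1, det_sum_elim_of_triangular _ _ _ (by simp)]
  congr 1

/-- The orientation of a fibre product of vector spaces. -/
theorem exists_fibre_orientation (oB : Orientation ℝ VB (Fin kb)) (oM : Orientation ℝ VM (Fin l))
    (oX : Orientation ℝ VX (Fin n)) (τ : Fin kb ⊕ Fin l ≃ Fin d ⊕ Fin n)
    (hι : Function.Injective ι) (hΔ : Function.Surjective Δ)
    (hex : LinearMap.range ι = LinearMap.ker Δ) (a₀ : Basis (Fin kb) ℝ VB)
    (b₀ : Basis (Fin l) ℝ VM) (z₀ : Basis (Fin n) ℝ VX) (w₀ : Basis (Fin d) ℝ VZ)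
    {ε : SignType} (hε : ε ≠ 0) :
    ∃ oZ : Orientation ℝ VZ (Fin d), ∀ (a : Basis (Fin kb) ℝ VB) (b : Basis (Fin l) ℝ VM)
      (w : Basis (Fin d) ℝ VZ) (z : Basis (Fin n) ℝ VX) (s : Fin n → VB × VM),
      (∀ j, Δ (s j) = z j) →
      osign oZ w * osign oX z * SignType.sign ((a.prod b).det (Sum.elim (ι ∘ w) s ∘ τ)) =
        ε * (osign oB a * osign oM b) := by
  choose s₀ hs₀ using fun j => hΔ (z₀ j)
  set D := (a₀.prod b₀).det (Sum.elim (ι ∘ w₀) s₀ ∘ τ) with hD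
  have hD0 : SignType.sign D ≠ 0 := by
    rw [sign_ne_zero]
    obtain ⟨c, hc, -⟩ := exists_basis_of_exact hι hex w₀ z₀ s₀ hs₀
    have h2 : ⇑(c.reindex τ.symm) = Sum.elim (ι ∘ w₀) s₀ ∘ τ := by
      rw [Basis.coe_reindex, hc]
      rfl
    rw [hD, ← h2]
    exact (Basis.isUnit_det _ _).ne_zero
  -- The defining relation for one choice of bases forces this sign; since all signs involved are
  -- `1` or `-1`, dividing is the same as multiplying.
  obtain ⟨oZ, hoZ⟩ := exists_osign_eq w₀ (ε := ε * (osign oB a₀ * osign oM b₀) *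
    (osign oX z₀ * SignType.sign D)) (by
      simp only [ne_eq, mul_eq_zero, not_or]
      exact ⟨⟨hε, osign_basis_ne_zero _ _, osign_basis_ne_zero _ _⟩, osign_basis_ne_zero _ _, hD0⟩)
  refine ⟨oZ, fun a b w z s hs => ?_⟩
  have hsq : ∀ t : SignType, t ≠ 0 → t * t = 1 := by decide
  have hA : SignType.sign (a.det a₀) * SignType.sign (a.det a₀) = 1 :=
    hsq _ (sign_ne_zero.2 (Basis.isUnit_det _ _).ne_zero)
  have hB : SignType.sign (b.det b₀) * SignType.sign (b.det b₀) = 1 :=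
    hsq _ (sign_ne_zero.2 (Basis.isUnit_det _ _).ne_zero)
  have hW : SignType.sign (w₀.det w) * SignType.sign (w₀.det w) = 1 :=
    hsq _ (sign_ne_zero.2 (Basis.isUnit_det _ _).ne_zero)
  have hZ : SignType.sign (z₀.det z) * SignType.sign (z₀.det z) = 1 :=
    hsq _ (sign_ne_zero.2 (Basis.isUnit_det _ _).ne_zero)
  have hX := hsq _ (osign_basis_ne_zero oX z₀)
  rw [det_prod_change a a₀ b b₀, det_fibre_change hι hex τ _ w₀ z₀ s₀ hs₀, ← hD,
    osign_eq_mul w₀ oZ w, osign_eq_mul z₀ oX z, hoZ, osign_eq_mul a oB a₀, osign_eq_mul b oM b₀,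
    show Δ ∘ s = z from funext hs]
  simp only [sign_mul]
  generalize SignType.sign (a.det a₀) = A at *
  generalize SignType.sign (b.det b₀) = B at *
  generalize SignType.sign (w₀.det w) = W at *
  generalize SignType.sign (z₀.det z) = Z at *
  generalize SignType.sign D = D' at *
  generalize osign oX z₀ = X at *
  generalize osign oB a = p
  generalize osign oM b = q
  calc ε * (p * A * (q * B)) * (X * D') * W * (X * Z) * (A * B * (W * Z * D'))
      = ε * (p * q) * (A * A) * (B * B) * (W * W) * (Z * Z) * (X * X) * (D' * D') := by ac_rfl
    _ = ε * (p * q) := by rw [hA, hB, hW, hZ, hX, hsq _ hD0]; simp only [mul_one]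

end FibreLinear

/-! ### Orientations of manifolds through continuous frames -/

section ContinuousFrames

open Module

variable {E H M : Type*} [NormedAddCommGroup E] [NormedSpace ℝ E]
  [TopologicalSpace H] {I : ModelWithCorners ℝ E H} [TopologicalSpace M] [ChartedSpace H M]
  [IsManifold I 1 M] {k : ℕ} {T : Type*} [TopologicalSpace T]

theorem frameSign_eq_osign (o : ManifoldOrientation I M k) (x : M)
    (v : Fin k → TangentSpace I x) : o.frameSign x v = osign (o.orient x) v := rfl

/-- The coordinates of a tangent vector near `x₀`, in the trivialisation at `x₀`. -/
def coordAt (I : ModelWithCorners ℝ E H) [IsManifold I 1 M] (x₀ : M) (p : TangentBundle I M) : E :=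
  (trivializationAt E (TangentSpace I) x₀ p).2

theorem coordAt_apply {x₀ x : M} (hx : x ∈ (trivializationAt E (TangentSpace I) x₀).baseSet)
    (v : TangentSpace I x) : coordAt I x₀ ⟨x, v⟩ =
      ((trivializationAt E (TangentSpace I) x₀).continuousLinearEquivAt ℝ x hx) v := by
  exact (congrArg Prod.snd (Bundle.Trivialization.apply_eq_prod_continuousLinearEquivAt ℝ
    (trivializationAt E (TangentSpace I) x₀) x hx v))

/-- A family of tangent vectors `v t` at the points `h t` is continuous at `t₀`. -/
def ContinuousFieldAt (I : ModelWithCorners ℝ E H) [IsManifold I 1 M] (h : T → M)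
    (v : ∀ t, TangentSpace I (h t)) (t₀ : T) : Prop :=
  ContinuousAt (fun t => (⟨h t, v t⟩ : TangentBundle I M)) t₀

theorem ContinuousFieldAt.continuousAt {h : T → M} {v : ∀ t, TangentSpace I (h t)} {t₀ : T}
    (hv : ContinuousFieldAt I h v t₀) : ContinuousAt h t₀ :=
  ((FiberBundle.continuousAt_totalSpace (F := E) _).1 hv).1

theorem ContinuousFieldAt.continuousAt_coordAt {h : T → M} {v : ∀ t, TangentSpace I (h t)} {t₀ : T}
    (hv : ContinuousFieldAt I h v t₀) :
    ContinuousAt (fun t => coordAt I (h t₀) ⟨h t, v t⟩) t₀ :=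
  ((FiberBundle.continuousAt_totalSpace (F := E) _).1 hv).2

theorem continuousFieldAt_iff {h : T → M} {v : ∀ t, TangentSpace I (h t)} {t₀ : T}
    (hh : ContinuousAt h t₀) : ContinuousFieldAt I h v t₀ ↔
      ContinuousAt (fun t => coordAt I (h t₀) ⟨h t, v t⟩) t₀ :=
  ⟨fun hv => hv.continuousAt_coordAt, fun hv =>
    (FiberBundle.continuousAt_totalSpace (F := E) _).2 ⟨hh, hv⟩⟩

/-- The vector field near `x₀` which is constant in the trivialisation at `x₀`. -/
def constField (I : ModelWithCorners ℝ E H) [IsManifold I 1 M] (x₀ : M) (c : E) (x : M) :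
    TangentSpace I x :=
  (trivializationAt E (TangentSpace I) x₀).symmL ℝ x c

theorem coordAt_constField {x₀ x : M}
    (hx : x ∈ (trivializationAt E (TangentSpace I) x₀).baseSet) (c : E) :
    coordAt I x₀ ⟨x, constField I x₀ c x⟩ = c := by
  rw [coordAt_apply hx]
  have h1 := ((trivializationAt E (TangentSpace I) x₀).continuousLinearEquivAt ℝ x
    hx).apply_symm_apply c
  rwa [Bundle.Trivialization.symm_continuousLinearEquivAt_eq] at h1

theorem eventually_mem_baseSet (x₀ : M) :
    ∀ᶠ x in 𝓝 x₀, x ∈ (trivializationAt E (TangentSpace I) x₀).baseSet :=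
  (trivializationAt E (TangentSpace I) x₀).open_baseSet.mem_nhds
    (FiberBundle.mem_baseSet_trivializationAt' x₀)

theorem continuousFieldAt_constField (x₀ : M) (c : E) :
    ContinuousFieldAt I id (constField I x₀ c) x₀ := by
  rw [continuousFieldAt_iff continuousAt_id]
  refine (continuousAt_const (y := c)).congr ?_
  filter_upwards [eventually_mem_baseSet (I := I) x₀] with x hx
  exact (coordAt_constField hx c).symm

theorem ContinuousFieldAt.comp {T' : Type*} [TopologicalSpace T'] {h : T → M}
    {v : ∀ t, TangentSpace I (h t)} {g : T' → T} {t₀ : T'}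
    (hv : ContinuousFieldAt I h v (g t₀)) (hg : ContinuousAt g t₀) :
    ContinuousFieldAt I (h ∘ g) (fun t => v (g t)) t₀ :=
  ContinuousAt.comp (f := g) hv hg

theorem ContinuousFieldAt.sub {h : T → M} {v w : ∀ t, TangentSpace I (h t)} {t₀ : T}
    (hv : ContinuousFieldAt I h v t₀) (hw : ContinuousFieldAt I h w t₀) :
    ContinuousFieldAt I h (fun t => v t - w t) t₀ := by
  rw [continuousFieldAt_iff hv.continuousAt]
  refine (hv.continuousAt_coordAt.sub hw.continuousAt_coordAt).congr ?_
  filter_upwards [hv.continuousAt.eventually (eventually_mem_baseSet (I := I) (h t₀))] with t ht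
  rw [coordAt_apply ht, map_sub, ← coordAt_apply ht, ← coordAt_apply ht]
  rfl

/-- Transfers determinants at varying points `x` to determinants in the fixed model space, where
continuity in `x` can be stated. -/
theorem exists_basis_constField {ι : Type*} {x₀ x : M}
    (hx : x ∈ (trivializationAt E (TangentSpace I) x₀).baseSet) (c : Basis ι ℝ E) :
    ∃ c' : Basis ι ℝ (TangentSpace I x), (∀ i, c' i = constField I x₀ (c i) x) ∧
      ∀ v i, c'.repr v i = c.repr (coordAt I x₀ ⟨x, v⟩) i := by
  refine ⟨c.map ((trivializationAt E (TangentSpace I) x₀).continuousLinearEquivAt ℝ x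
    hx).symm.toLinearEquiv, fun i => ?_, fun v i => ?_⟩
  · rw [Basis.map_apply]
    exact congrFun (Bundle.Trivialization.symm_continuousLinearEquivAt_eq _ hx) (c i)
  · rw [coordAt_apply hx]
    rfl

variable [FiniteDimensional ℝ E]

theorem continuous_basis_det {ι : Type*} [Fintype ι] [DecidableEq ι] (e : Basis ι ℝ E) :
    Continuous fun v : ι → E => e.det v := by
  simp only [Basis.det_apply]
  refine Continuous.matrix_det (continuous_matrix fun i j => ?_)
  simp only [Basis.toMatrix_apply]
  exact ((e.coord i).continuous_of_finiteDimensional).comp (continuous_apply j)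

theorem continuous_alternatingMap (hk : finrank ℝ E = k) (η : E [⋀^Fin k]→ₗ[ℝ] ℝ) :
    Continuous η := by
  let e : Basis (Fin k) ℝ E := finBasisOfFinrankEq ℝ E hk
  rw [AlternatingMap.eq_smul_basis_det e η]
  exact continuous_const.mul (continuous_basis_det e)

/-- The sign of a continuous frame along a map is locally constant. -/
theorem eventually_frameSign_eq (hk : finrank ℝ E = k) (o : ManifoldOrientation I M k) {h : T → M}
    {v : Fin k → ∀ t, TangentSpace I (h t)} {t₀ : T} (hh : ContinuousAt h t₀)
    (hv : ∀ i, ContinuousFieldAt I h (v i) t₀)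
    (h0 : o.frameSign (h t₀) (fun i => v i t₀) ≠ 0) :
    ∀ᶠ t in 𝓝 t₀, o.frameSign (h t) (fun i => v i t) = o.frameSign (h t₀) (fun i => v i t₀) := by
  obtain ⟨o₀, ho₀⟩ := o.locallyConstant (h t₀)
  have key : ∀ x (hx : x ∈ (trivializationAt E (TangentSpace I) (h t₀)).baseSet)
      (u : Fin k → TangentSpace I x), (∀ hx : x ∈ (trivializationAt E (TangentSpace I) (h t₀)).baseSet,
        Orientation.map (Fin k) ((trivializationAt E (TangentSpace I)
          (h t₀)).continuousLinearEquivAt ℝ x hx).toLinearEquiv (o.orient x) = o₀) →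
      o.frameSign x u = osign o₀ (fun i => coordAt I (h t₀) ⟨x, u i⟩) := by
    intro x hx u hxo
    rw [← hxo hx, frameSign_eq_osign, ← osign_map (((trivializationAt E (TangentSpace I)
          (h t₀)).continuousLinearEquivAt ℝ x hx).toLinearEquiv)]
    exact congrArg _ (funext fun i => (coordAt_apply hx (u i)).symm)
  have hc : ContinuousAt (fun t => o₀.someVector (fun i => coordAt I (h t₀) ⟨h t, v i t⟩)) t₀ := by
    have h1 := continuous_alternatingMap hk o₀.someVector
    exact h1.continuousAt.comp (f := fun t i => coordAt I (h t₀) ⟨h t, v i t⟩)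
      (continuousAt_pi.2 fun i => (hv i).continuousAt_coordAt)
  have hb₀ := FiberBundle.mem_baseSet_trivializationAt' (F := E) (E := TangentSpace I) (h t₀)
  have h1 : o.frameSign (h t₀) (fun i => v i t₀) =
      osign o₀ (fun i => coordAt I (h t₀) ⟨h t₀, v i t₀⟩) := key _ hb₀ _ ho₀.self_of_nhds
  rw [h1] at h0 ⊢
  have h2 := ContinuousAt.comp (f := fun t => o₀.someVector (fun i => coordAt I (h t₀) ⟨h t, v i t⟩))
    (continuousAt_sign_of_ne_zero (sign_ne_zero.1 h0)) hc
  have h3 := h2.eventually (IsOpen.mem_nhds (isOpen_discrete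
    {osign o₀ (fun i => coordAt I (h t₀) ⟨h t₀, v i t₀⟩)}) rfl)
  filter_upwards [h3, hh.eventually ho₀, hh.eventually (eventually_mem_baseSet (I := I) (h t₀))]
    with t ht1 ht2 ht3
  rw [key _ ht3 _ ht2]
  exact ht1

/-- A family of orientations for which continuous frames have a locally constant sign. -/
def ManifoldOrientation.ofFrames (hk : finrank ℝ E = k)
    (o : ∀ x : M, Orientation ℝ (TangentSpace I x) (Fin k))
    (ho : ∀ x₀ : M, ∃ v : Fin k → ∀ x, TangentSpace I x,
      (∀ i, ContinuousFieldAt I id (v i) x₀) ∧ osign (o x₀) (fun i => v i x₀) ≠ 0 ∧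
      ∀ᶠ x in 𝓝 x₀, osign (o x) (fun i => v i x) = osign (o x₀) (fun i => v i x₀)) :
    ManifoldOrientation I M k where
  orient := o
  locallyConstant := by
    intro x₀
    obtain ⟨v, hv, h0, hev⟩ := ho x₀
    have hb₀ := FiberBundle.mem_baseSet_trivializationAt' (F := E) (E := TangentSpace I) x₀
    set o₀ := Orientation.map (Fin k) ((trivializationAt E (TangentSpace I)
      x₀).continuousLinearEquivAt ℝ x₀ hb₀).toLinearEquiv (o x₀) with ho₀
    have key : ∀ x (hx : x ∈ (trivializationAt E (TangentSpace I) x₀).baseSet)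
        (u : Fin k → TangentSpace I x), osign (Orientation.map (Fin k)
          ((trivializationAt E (TangentSpace I) x₀).continuousLinearEquivAt ℝ x hx).toLinearEquiv
          (o x)) (fun i => coordAt I x₀ ⟨x, u i⟩) = osign (o x) u := by
      intro x hx u
      rw [← osign_map (((trivializationAt E (TangentSpace I)
          x₀).continuousLinearEquivAt ℝ x hx).toLinearEquiv) (o x) u]
      exact congrArg _ (funext fun i => coordAt_apply hx (u i))
    refine ⟨o₀, ?_⟩
    have hc : ContinuousAt (fun x => o₀.someVector (fun i => coordAt I x₀ ⟨x, v i x⟩)) x₀ := by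
      have h1 := continuous_alternatingMap hk o₀.someVector
      exact h1.continuousAt.comp (f := fun x i => coordAt I x₀ ⟨x, v i x⟩)
        (continuousAt_pi.2 fun i => (hv i).continuousAt_coordAt)
    have h1 : osign o₀ (fun i => coordAt I x₀ ⟨x₀, v i x₀⟩) = osign (o x₀) (fun i => v i x₀) :=
      key x₀ hb₀ _
    have h2 := ContinuousAt.comp (f := fun x => o₀.someVector (fun i => coordAt I x₀ ⟨x, v i x⟩))
      (continuousAt_sign_of_ne_zero (sign_ne_zero.1 (h1.trans_ne h0))) hc
    have h3 := h2.eventually (IsOpen.mem_nhds (isOpen_discrete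
      {osign o₀ (fun i => coordAt I x₀ ⟨x₀, v i x₀⟩)}) rfl)
    filter_upwards [h3, hev] with x hx1 hx2 hx
    have h4 := key x hx (fun i => v i x)
    have h5 : osign o₀ (fun i => coordAt I x₀ ⟨x, v i x⟩) =
      osign o₀ (fun i => coordAt I x₀ ⟨x₀, v i x₀⟩) := hx1
    rw [hx2, ← h1, ← h5] at h4
    let e : Basis (Fin k) ℝ E := finBasisOfFinrankEq ℝ E hk
    have h6 : SignType.sign (e.det fun i => coordAt I x₀ ⟨x, v i x⟩) ≠ 0 := by
      intro h
      have := osign_eq_mul e o₀ (fun i => coordAt I x₀ ⟨x, v i x⟩)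
      rw [h, mul_zero, h5, h1] at this
      exact h0 this
    refine osign_ext e ?_
    rw [osign_eq_mul e, osign_eq_mul e o₀] at h4
    exact mul_right_cancel₀ h6 h4

/-- Near every point of an oriented manifold there is a continuous frame of constant sign. -/
theorem exists_frame_of_pullback {E' H' N : Type*} [NormedAddCommGroup E'] [NormedSpace ℝ E']
    [FiniteDimensional ℝ E'] [TopologicalSpace H'] {J : ModelWithCorners ℝ E' H'}
    [TopologicalSpace N] [ChartedSpace H' N] [IsManifold J 1 N] (hk : finrank ℝ E = k)
    (hk' : finrank ℝ E' = k) (oM : ManifoldOrientation I M k)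
    (o : ∀ x : N, Orientation ℝ (TangentSpace J x) (Fin k)) {r : N → M} (hr : ContMDiff J I 1 r)
    (x₀ : N) (ho : ∀ᶠ x in 𝓝 x₀, ∀ v : Fin k → TangentSpace J x,
      osign (o x) v = oM.frameSign (r x) (fun i => mfderiv J I r x (v i))) :
    ∃ v : Fin k → ∀ x, TangentSpace J x,
      (∀ i, ContinuousFieldAt J id (v i) x₀) ∧ osign (o x₀) (fun i => v i x₀) ≠ 0 ∧
      ∀ᶠ x in 𝓝 x₀, osign (o x) (fun i => v i x) = osign (o x₀) (fun i => v i x₀) := by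
  let c : Basis (Fin k) ℝ E' := finBasisOfFinrankEq ℝ E' hk'
  have hv : ∀ i, ContinuousFieldAt J id (constField J x₀ (c i)) x₀ := fun i =>
    continuousFieldAt_constField x₀ (c i)
  have hb₀ := FiberBundle.mem_baseSet_trivializationAt' (F := E') (E := TangentSpace J) x₀
  have h0 : osign (o x₀) (fun i => constField J x₀ (c i) x₀) ≠ 0 := by
    let A := ((trivializationAt E' (TangentSpace J) x₀).continuousLinearEquivAt ℝ x₀
      hb₀).symm.toLinearEquiv
    have := osign_basis_ne_zero (o x₀) (c.map A)
    convert this using 3 with i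
    rw [Basis.map_apply]
    exact (congrFun (Bundle.Trivialization.symm_continuousLinearEquivAt_eq _ hb₀) (c i)).symm
  refine ⟨fun i => constField J x₀ (c i), hv, h0, ?_⟩
  have hf : ∀ i, ContinuousFieldAt I r (fun x => mfderiv J I r x (constField J x₀ (c i) x)) x₀ :=
    fun i => ContinuousAt.comp (f := fun x => (⟨x, constField J x₀ (c i) x⟩ : TangentBundle J N))
      (hr.continuous_tangentMap le_rfl).continuousAt (hv i)
  rw [ho.self_of_nhds] at h0 ⊢
  filter_upwards [ho, eventually_frameSign_eq hk oM hr.continuous.continuousAt hf h0] with x h1 h2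
  rw [h1, h2]

/-- Pulling back an orientation by a local diffeomorphism. -/
theorem exists_pullback_orientation {E' H' N : Type*} [NormedAddCommGroup E'] [NormedSpace ℝ E']
    [FiniteDimensional ℝ E'] [TopologicalSpace H'] {J : ModelWithCorners ℝ E' H'}
    [TopologicalSpace N] [ChartedSpace H' N] [IsManifold J 1 N] (hk : finrank ℝ E = k)
    (hk' : finrank ℝ E' = k) (oM : ManifoldOrientation I M k) {r : N → M} (hr : ContMDiff J I 1 r)
    (hs : ∀ x, Function.Surjective (mfderiv J I r x)) :
    ∃ oN : ManifoldOrientation J N k, ∀ x (v : Fin k → TangentSpace J x),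
      oN.frameSign x v = oM.frameSign (r x) (fun i => mfderiv J I r x (v i)) := by
  choose o ho using fun x => exists_osign_comp (mfderiv J I r x).toLinearMap (hs x)
    (oM.orient (r x))
  exact ⟨ManifoldOrientation.ofFrames hk' o fun x₀ => exists_frame_of_pullback hk hk' oM o hr x₀
    (Filter.Eventually.of_forall fun x v => ho x v), ho⟩

/-- The opposite orientation. -/
theorem ManifoldOrientation.exists_neg (hk : finrank ℝ E = k) (oM : ManifoldOrientation I M k) :
    ∃ o : ManifoldOrientation I M k, ∀ x (v : Fin k → TangentSpace I x),
      o.frameSign x v = - oM.frameSign x v := by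
  refine ⟨ManifoldOrientation.ofFrames hk (fun x => - oM.orient x) fun x₀ => ?_,
    fun x v => osign_neg _ _⟩
  obtain ⟨v, h1, h2, h3⟩ := exists_frame_of_pullback hk hk oM oM.orient (r := id) contMDiff_id x₀
    (Filter.Eventually.of_forall fun x v => by rw [mfderiv_id]; rfl)
  refine ⟨v, h1, ?_, ?_⟩
  · rw [osign_neg]
    generalize osign (oM.orient x₀) (fun i => v i x₀) = t at h2
    decide +revert
  · filter_upwards [h3] with x hx
    rw [osign_neg, osign_neg, hx]

/-- The orientation of a disjoint union. -/
theorem ManifoldOrientation.exists_sum {M' : Type*} [TopologicalSpace M'] [ChartedSpace H M']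
    [IsManifold I 1 M'] (hk : finrank ℝ E = k) (o : ManifoldOrientation I M k)
    (o' : ManifoldOrientation I M' k) :
    ∃ oS : ManifoldOrientation I (M ⊕ M') k,
      (∀ x (v : Fin k → TangentSpace I x), oS.frameSign (Sum.inl x)
        (fun i => mfderiv I I (Sum.inl : M → M ⊕ M') x (v i)) = o.frameSign x v) ∧
      ∀ x (v : Fin k → TangentSpace I x), oS.frameSign (Sum.inr x)
        (fun i => mfderiv I I (Sum.inr : M' → M ⊕ M') x (v i)) = o'.frameSign x v := by
  -- Each summand is a local retract: `r p` is the identity on `M` and constant on the other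
  -- summand. The orientation is pulled back along these maps, each on its own summand.
  let r : M → M ⊕ M' → M := fun p => Sum.elim id fun _ => p
  let r' : M' → M ⊕ M' → M' := fun p => Sum.elim (fun _ => p) id
  have hr : ∀ p, ContMDiff I I 1 (r p) := fun p => contMDiff_id.sumElim contMDiff_const
  have hr' : ∀ p, ContMDiff I I 1 (r' p) := fun p => contMDiff_const.sumElim contMDiff_id
  have hrd : ∀ p q (v : TangentSpace I q), mfderiv I I (r p) (Sum.inl q)
      (mfderiv I I (Sum.inl : M → M ⊕ M') q v) = v := by
    intro p q v
    have h1 := mfderiv_comp_apply q ((hr p).mdifferentiable one_ne_zero (Sum.inl q))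
      ((ContMDiff.inl (I := I) (n := 1) (M := M) (M' := M')).mdifferentiable one_ne_zero q) v
    rw [← h1]
    change mfderiv I I id q v = v
    rw [mfderiv_id]
    rfl
  have hrd' : ∀ p q (v : TangentSpace I q), mfderiv I I (r' p) (Sum.inr q)
      (mfderiv I I (Sum.inr : M' → M ⊕ M') q v) = v := by
    intro p q v
    have h1 := mfderiv_comp_apply q ((hr' p).mdifferentiable one_ne_zero (Sum.inr q))
      ((ContMDiff.inr (I := I) (n := 1) (M := M) (M' := M')).mdifferentiable one_ne_zero q) v
    rw [← h1]
    change mfderiv I I id q v = v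
    rw [mfderiv_id]
    rfl
  have hex : ∀ z : M ⊕ M', ∃ oz : Orientation ℝ (TangentSpace I z) (Fin k),
      (∀ p, z = Sum.inl p → ∀ v : Fin k → TangentSpace I z, ∀ q, osign oz v =
        o.frameSign (r q z) (fun i => mfderiv I I (r q) z (v i))) ∧
      (∀ p, z = Sum.inr p → ∀ v : Fin k → TangentSpace I z, ∀ q, osign oz v =
        o'.frameSign (r' q z) (fun i => mfderiv I I (r' q) z (v i))) := by
    intro z
    rcases z with p | p
    · obtain ⟨oz, hoz⟩ := exists_osign_comp (mfderiv I I (r p) (Sum.inl p)).toLinearMap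
        (fun v => ⟨_, hrd p p v⟩) (o.orient p)
      refine ⟨oz, fun p' hp' v q => ?_, fun p' hp' => by cases hp'⟩
      rw [hoz]
      change _ = osign (o.orient p) _
      congr 1
      funext i
      have : r q =ᶠ[𝓝 (Sum.inl p)] r p := by
        filter_upwards [isOpen_range_inl.mem_nhds ⟨p, rfl⟩] with y hy
        obtain ⟨y, rfl⟩ := hy
        rfl
      rw [this.mfderiv_eq]
      rfl
    · obtain ⟨oz, hoz⟩ := exists_osign_comp (mfderiv I I (r' p) (Sum.inr p)).toLinearMap
        (fun v => ⟨_, hrd' p p v⟩) (o'.orient p)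
      refine ⟨oz, fun p' hp' => (by cases hp'), fun p' hp' v q => ?_⟩
      rw [hoz]
      change _ = osign (o'.orient p) _
      congr 1
      funext i
      have : r' q =ᶠ[𝓝 (Sum.inr p)] r' p := by
        filter_upwards [isOpen_range_inr.mem_nhds ⟨p, rfl⟩] with y hy
        obtain ⟨y, rfl⟩ := hy
        rfl
      rw [this.mfderiv_eq]
      rfl
  choose oS h1 h2 using hex
  refine ⟨ManifoldOrientation.ofFrames hk oS ?_, fun x v => ?_, fun x v => ?_⟩
  · rintro (p | p)
    · refine exists_frame_of_pullback hk hk o oS (hr p) _ ?_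
      filter_upwards [isOpen_range_inl.mem_nhds ⟨p, rfl⟩] with y hy v
      obtain ⟨y, rfl⟩ := hy
      exact h1 _ y rfl v p
    · refine exists_frame_of_pullback hk hk o' oS (hr' p) _ ?_
      filter_upwards [isOpen_range_inr.mem_nhds ⟨p, rfl⟩] with y hy v
      obtain ⟨y, rfl⟩ := hy
      exact h2 _ y rfl v p
  · refine (h1 _ x rfl _ x).trans ?_
    change osign (o.orient x) _ = osign (o.orient x) _
    congr 1
    funext i
    exact hrd x x (v i)
  · refine (h2 _ x rfl _ x).trans ?_
    change osign (o'.orient x) _ = osign (o'.orient x) _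
    congr 1
    funext i
    exact hrd' x x (v i)

/-- The constant orientation of a vector space. -/
theorem exists_orientation_modelSpace (hk : finrank ℝ E = k) (o₀ : Orientation ℝ E (Fin k)) :
    ∃ o : ManifoldOrientation 𝓘(ℝ, E) E k, ∀ x (v : Fin k → E), o.frameSign x v = osign o₀ v := by
  refine ⟨⟨fun x => o₀, fun x₀ => ⟨o₀, Filter.Eventually.of_forall fun x hx => ?_⟩⟩,
    fun x v => rfl⟩
  let c : Basis (Fin k) ℝ E := finBasisOfFinrankEq ℝ E hk
  have h1 : ∀ v : E, (trivializationAt E (TangentSpace 𝓘(ℝ, E)) x₀).continuousLinearEquivAt ℝ x hx v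
      = v := by
    intro v
    rw [Bundle.Trivialization.coe_continuousLinearEquivAt_eq,
      TangentBundle.continuousLinearMapAt_trivializationAt (mem_univ x)]
    exact congrArg (fun A : E →L[ℝ] E => A v) (mfderiv_id (I := 𝓘(ℝ, E)) (x := x))
  refine osign_ext c ?_
  refine Eq.trans ?_ (osign_map ((trivializationAt E (TangentSpace 𝓘(ℝ, E))
    x₀).continuousLinearEquivAt ℝ x hx).toLinearEquiv o₀ c)
  congr 1
  funext i
  exact (h1 _).symm

end ContinuousFrames

/-! ### Orientations of fibre products of manifolds -/

section FibreOrientation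

open Module

variable {EB HB B EM HM M EX HX X EZ HZ Z : Type*}
  [NormedAddCommGroup EB] [NormedSpace ℝ EB] [FiniteDimensional ℝ EB] [TopologicalSpace HB]
  {IB : ModelWithCorners ℝ EB HB} [TopologicalSpace B] [ChartedSpace HB B] [IsManifold IB 1 B]
  [NormedAddCommGroup EM] [NormedSpace ℝ EM] [FiniteDimensional ℝ EM] [TopologicalSpace HM]
  {IM : ModelWithCorners ℝ EM HM} [TopologicalSpace M] [ChartedSpace HM M] [IsManifold IM 1 M]
  [NormedAddCommGroup EX] [NormedSpace ℝ EX] [FiniteDimensional ℝ EX] [TopologicalSpace HX]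
  {IX : ModelWithCorners ℝ EX HX} [TopologicalSpace X] [ChartedSpace HX X] [IsManifold IX 1 X]
  [NormedAddCommGroup EZ] [NormedSpace ℝ EZ] [FiniteDimensional ℝ EZ] [TopologicalSpace HZ]
  {IZ : ModelWithCorners ℝ EZ HZ} [TopologicalSpace Z] [ChartedSpace HZ Z] [IsManifold IZ 1 Z]
  {kb l n d : ℕ}

/-- The derivative of a map between manifolds, as a map between the model spaces. -/
def mdiff (IB : ModelWithCorners ℝ EB HB) (IX : ModelWithCorners ℝ EX HX) (F : B → X) (p : B) :
    EB →L[ℝ] EX := mfderiv IB IX F p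

/-- The map `(v, w) ↦ dF v - df w` on tangent vectors. -/
def jointDiff (IB : ModelWithCorners ℝ EB HB) (IM : ModelWithCorners ℝ EM HM)
    (IX : ModelWithCorners ℝ EX HX) (F : B → X) (f : M → X) (p : B) (q : M) : EB × EM →L[ℝ] EX :=
  (mdiff IB IX F p).comp (ContinuousLinearMap.fst ℝ EB EM) -
    (mdiff IM IX f q).comp (ContinuousLinearMap.snd ℝ EB EM)

/-- The orientation of a fibre product of manifolds. -/
theorem exists_fibreProduct_orientation (hB : finrank ℝ EB = kb) (hM : finrank ℝ EM = l)
    (hX : finrank ℝ EX = n) (hZ : finrank ℝ EZ = d)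
    (oB : ManifoldOrientation IB B kb) (oM : ManifoldOrientation IM M l)
    (oX : ManifoldOrientation IX X n) (τ : Fin kb ⊕ Fin l ≃ Fin d ⊕ Fin n)
    {F : B → X} {f : M → X} {h : Z → X} {pB : Z → B} {pM : Z → M} (hF : ContMDiff IB IX 1 F)
    (hf : ContMDiff IM IX 1 f) (hpB : ContMDiff IZ IB 1 pB) (hpM : ContMDiff IZ IM 1 pM)
    (hhB : ∀ x, h x = F (pB x)) (hhM : ∀ x, h x = f (pM x))
    (hinj : ∀ x, Function.Injective ((mdiff IZ IB pB x).prod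
      (mdiff IZ IM pM x)))
    (hsurj : ∀ x, Function.Surjective (jointDiff IB IM IX F f (pB x) (pM x)))
    (hd : d + n = kb + l) {ε : SignType} (hε : ε ≠ 0) :
    ∃ oZ : ManifoldOrientation IZ Z d, ∀ x (a : Basis (Fin kb) ℝ (TangentSpace IB (pB x)))
      (b : Basis (Fin l) ℝ (TangentSpace IM (pM x))) (w : Basis (Fin d) ℝ (TangentSpace IZ x))
      (z : Basis (Fin n) ℝ (TangentSpace IX (h x)))
      (s : Fin n → TangentSpace IB (pB x) × TangentSpace IM (pM x)),
      (∀ j, jointDiff IB IM IX F f (pB x) (pM x) (s j) = z j) →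
      oZ.frameSign x w * oX.frameSign (h x) z * SignType.sign ((a.prod b).det
        (Sum.elim (fun i => (mfderiv IZ IB pB x (w i), mfderiv IZ IM pM x (w i))) s ∘ τ)) =
        ε * (oB.frameSign (pB x) a * oM.frameSign (pM x) b) := by
  obtain rfl : h = F ∘ pB := funext hhB
  set D : ∀ x, EZ →L[ℝ] EB × EM := fun x => (mdiff IZ IB pB x).prod
      (mdiff IZ IM pM x) with hD
  have hzero : ∀ x u, jointDiff IB IM IX F f (pB x) (pM x) (D x u) = 0 := by
    intro x u
    change mdiff IB IX F (pB x) (mfderiv IZ IB pB x u) -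
      mdiff IM IX f (pM x) (mfderiv IZ IM pM x u) = 0
    have h1 := mfderiv_comp_apply x (hF.mdifferentiable one_ne_zero (pB x))
      (hpB.mdifferentiable one_ne_zero x) u
    have h2 := mfderiv_comp_apply x (hf.mdifferentiable one_ne_zero (pM x))
      (hpM.mdifferentiable one_ne_zero x) u
    have h3 : F ∘ pB = f ∘ pM := funext hhM
    rw [sub_eq_zero]
    refine h1.symm.trans (Eq.trans ?_ h2)
    rw [h3]
  -- One inclusion is the chain rule for the two expressions of `h`; equality follows from counting
  -- dimensions.
  have hex : ∀ x, LinearMap.range (D x).toLinearMap =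
      LinearMap.ker (jointDiff IB IM IX F f (pB x) (pM x)).toLinearMap := by
    intro x
    refine Submodule.eq_of_le_of_finrank_eq ?_ ?_
    · rintro _ ⟨u, rfl⟩
      exact hzero x u
    · have h1 := LinearMap.finrank_range_add_finrank_ker
        (jointDiff IB IM IX F f (pB x) (pM x)).toLinearMap
      rw [LinearMap.range_eq_top.2 (hsurj x), finrank_top, finrank_prod, hB, hM, hX] at h1
      rw [LinearMap.finrank_range_of_inj (hinj x), hZ]
      omega
  let a₀ : Basis (Fin kb) ℝ EB := finBasisOfFinrankEq ℝ EB hB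
  let b₀ : Basis (Fin l) ℝ EM := finBasisOfFinrankEq ℝ EM hM
  let z₀ : Basis (Fin n) ℝ EX := finBasisOfFinrankEq ℝ EX hX
  let w₀ : Basis (Fin d) ℝ EZ := finBasisOfFinrankEq ℝ EZ hZ
  choose oZ hoZ using fun x => exists_fibre_orientation (VB := EB) (VM := EM) (VX := EX) (VZ := EZ)
    (oB.orient (pB x)) (oM.orient (pM x)) (oX.orient (F (pB x))) τ (hinj x) (hsurj x) (hex x)
    a₀ b₀ z₀ w₀ hε
  refine ⟨ManifoldOrientation.ofFrames hZ oZ fun x₀ => ?_, fun x a b w z s hs =>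
    hoZ x a b w z s hs⟩
  have hcont := (hF.comp hpB).continuous.continuousAt (x := x₀)
  -- A lift of a basis at `x₀` is extended by vector fields that are constant in trivialisations.
  -- Their images `z` under the joint differential are then continuous and still form a frame near
  -- `x₀`.
  choose s₀ hs₀ using fun j => hsurj x₀ (z₀ j)
  have hbB := FiberBundle.mem_baseSet_trivializationAt' (F := EB) (E := TangentSpace IB) (pB x₀)
  have hbM := FiberBundle.mem_baseSet_trivializationAt' (F := EM) (E := TangentSpace IM) (pM x₀)
  let sB : Fin n → ∀ y : B, TangentSpace IB y := fun j =>
    constField IB (pB x₀) (coordAt IB (pB x₀) ⟨pB x₀, (s₀ j).1⟩)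
  let sM : Fin n → ∀ y : M, TangentSpace IM y := fun j =>
    constField IM (pM x₀) (coordAt IM (pM x₀) ⟨pM x₀, (s₀ j).2⟩)
  have hsB₀ : ∀ j, sB j (pB x₀) = (s₀ j).1 := fun j => by
    obtain ⟨c, hc1, hc2⟩ := exists_basis_constField (I := IB) hbB a₀
    refine c.repr.injective (Finsupp.ext fun i => ?_)
    exact (hc2 _ i).trans ((congrArg (fun e => a₀.repr e i)
      (coordAt_constField hbB _)).trans (hc2 _ i).symm)
  have hsM₀ : ∀ j, sM j (pM x₀) = (s₀ j).2 := fun j => by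
    obtain ⟨c, hc1, hc2⟩ := exists_basis_constField (I := IM) hbM b₀
    refine c.repr.injective (Finsupp.ext fun i => ?_)
    exact (hc2 _ i).trans ((congrArg (fun e => b₀.repr e i)
      (coordAt_constField hbM _)).trans (hc2 _ i).symm)
  have hsBc : ∀ j, ContinuousFieldAt IB pB (fun x => sB j (pB x)) x₀ := fun j =>
    (continuousFieldAt_constField (I := IB) (pB x₀) _).comp hpB.continuous.continuousAt
  have hsMc : ∀ j, ContinuousFieldAt IM pM (fun x => sM j (pM x)) x₀ := fun j =>
    (continuousFieldAt_constField (I := IM) (pM x₀) _).comp hpM.continuous.continuousAt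
  let a : Fin kb → ∀ x, TangentSpace IB (pB x) := fun i x => constField IB (pB x₀) (a₀ i) (pB x)
  let b : Fin l → ∀ x, TangentSpace IM (pM x) := fun i x => constField IM (pM x₀) (b₀ i) (pM x)
  let w : Fin d → ∀ x, TangentSpace IZ x := fun i x => constField IZ x₀ (w₀ i) x
  have hac : ∀ i, ContinuousFieldAt IB pB (a i) x₀ := fun j =>
    (continuousFieldAt_constField (I := IB) (pB x₀) _).comp hpB.continuous.continuousAt
  have hbc : ∀ i, ContinuousFieldAt IM pM (b i) x₀ := fun j =>
    (continuousFieldAt_constField (I := IM) (pM x₀) _).comp hpM.continuous.continuousAt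
  have hwc : ∀ i, ContinuousFieldAt IZ id (w i) x₀ := fun i => continuousFieldAt_constField x₀ _
  have hwB : ∀ i, ContinuousFieldAt IB pB (fun x => mfderiv IZ IB pB x (w i x)) x₀ := fun i =>
    ContinuousAt.comp (f := fun x => (⟨x, w i x⟩ : TangentBundle IZ Z))
      (hpB.continuous_tangentMap le_rfl).continuousAt (hwc i)
  have hwM : ∀ i, ContinuousFieldAt IM pM (fun x => mfderiv IZ IM pM x (w i x)) x₀ := fun i =>
    ContinuousAt.comp (f := fun x => (⟨x, w i x⟩ : TangentBundle IZ Z))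
      (hpM.continuous_tangentMap le_rfl).continuousAt (hwc i)
  let z : Fin n → ∀ x, TangentSpace IX ((F ∘ pB) x) := fun j x =>
    jointDiff IB IM IX F f (pB x) (pM x) (sB j (pB x), sM j (pM x))
  have hzc : ∀ j, ContinuousFieldAt IX (F ∘ pB) (z j) x₀ := by
    intro j
    have h1 : ContinuousFieldAt IX (F ∘ pB) (fun x => mfderiv IB IX F (pB x) (sB j (pB x))) x₀ :=
      ContinuousAt.comp (f := fun x => (⟨pB x, sB j (pB x)⟩ : TangentBundle IB B))
        (hF.continuous_tangentMap le_rfl).continuousAt (hsBc j)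
    have h2 : ContinuousFieldAt IX (f ∘ pM) (fun x => mfderiv IM IX f (pM x) (sM j (pM x))) x₀ :=
      ContinuousAt.comp (f := fun x => (⟨pM x, sM j (pM x)⟩ : TangentBundle IM M))
        (hf.continuous_tangentMap le_rfl).continuousAt (hsMc j)
    have h3 : ContinuousFieldAt IX (F ∘ pB)
        (fun x => mdiff IM IX f (pM x) (sM j (pM x))) x₀ := by
      refine ContinuousAt.congr h2 (Filter.Eventually.of_forall fun x => ?_)
      have := hhM x
      simp only [Function.comp_apply] at this ⊢
      rw [← this]
      rfl
    exact h1.sub h3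
  have hz₀ : ∀ j, z j x₀ = z₀ j := by
    intro j
    change jointDiff IB IM IX F f (pB x₀) (pM x₀) (sB j (pB x₀), sM j (pM x₀)) = z₀ j
    rw [hsB₀, hsM₀]
    exact hs₀ j
  let v : Z → Fin kb ⊕ Fin l → EB × EM := fun x => (Sum.elim (fun i =>
    (coordAt IB (pB x₀) ⟨pB x, mfderiv IZ IB pB x (w i x)⟩,
      coordAt IM (pM x₀) ⟨pM x, mfderiv IZ IM pM x (w i x)⟩)) fun j =>
    (coordAt IB (pB x₀) ⟨pB x, sB j (pB x)⟩, coordAt IM (pM x₀) ⟨pM x, sM j (pM x)⟩)) ∘ τ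
  have hvc : ContinuousAt (fun x => (a₀.prod b₀).det (v x)) x₀ := by
    refine ContinuousAt.comp (f := v) (continuous_basis_det (a₀.prod b₀)).continuousAt
      (continuousAt_pi.2 fun i => ?_)
    rcases hi : τ i with t | t
    · simp only [v, Function.comp_apply, hi]
      exact (hwB t).continuousAt_coordAt.prodMk (hwM t).continuousAt_coordAt
    · simp only [v, Function.comp_apply, hi]
      exact (hsBc t).continuousAt_coordAt.prodMk (hsMc t).continuousAt_coordAt
  -- The pointwise sign relation, written in continuous frames with the determinant taken in the
  -- fixed model spaces. All its other factors have locally constant nonzero sign, hence so does the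
  -- sign of the frame `w`.
  have key : ∀ x, x ∈ (trivializationAt EZ (TangentSpace IZ) x₀).baseSet →
      pB x ∈ (trivializationAt EB (TangentSpace IB) (pB x₀)).baseSet →
      pM x ∈ (trivializationAt EM (TangentSpace IM) (pM x₀)).baseSet →
      oX.frameSign ((F ∘ pB) x) (fun j => z j x) ≠ 0 →
      osign (oZ x) (fun i => w i x) * oX.frameSign ((F ∘ pB) x) (fun j => z j x) *
        SignType.sign ((a₀.prod b₀).det (v x)) =
        ε * (oB.frameSign (pB x) (fun i => a i x) * oM.frameSign (pM x) (fun i => b i x)) := by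
    intro x hxZ hxB hxM hxz
    obtain ⟨aB, ha1, ha2⟩ := exists_basis_constField (I := IB) hxB a₀
    obtain ⟨bM, hb1, hb2⟩ := exists_basis_constField (I := IM) hxM b₀
    obtain ⟨wZ, hw1, -⟩ := exists_basis_constField (I := IZ) hxZ w₀
    obtain ⟨zX, hz1⟩ := exists_basis_of_osign_ne_zero (V := EX) z₀ hxz
    have h1 := hoZ x aB bM wZ zX (fun j => (sB j (pB x), sM j (pM x))) fun j =>
      (congrFun hz1 j).symm
    have ha : (fun i => a i x) = aB := funext fun i => (ha1 i).symm
    have hb : (fun i => b i x) = bM := funext fun i => (hb1 i).symm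
    have hw : (fun i => w i x) = wZ := funext fun i => (hw1 i).symm
    have hdet : (a₀.prod b₀).det (v x) = (aB.prod bM).det
        (Sum.elim (fun i => D x (wZ i)) (fun j => (sB j (pB x), sM j (pM x))) ∘ τ) := by
      rw [← hw]
      rw [Basis.det_apply, Basis.det_apply]
      congr 1
      ext i j
      rw [Basis.toMatrix_apply, Basis.toMatrix_apply]
      rcases i with i | i <;> rcases hj : τ j with t | t <;>
        simp only [v, Function.comp_apply, hj, Sum.elim_inl, Sum.elim_inr, Basis.prod_repr_inl,
          Basis.prod_repr_inr, ha2, hb2] <;> rfl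
    rw [ha, hb, hw, hdet]
    have hz' : (fun j => z j x) = zX := hz1.symm
    rw [hz']
    exact h1
  have hz0 : oX.frameSign ((F ∘ pB) x₀) (fun j => z j x₀) ≠ 0 := by
    rw [show (fun j => z j x₀) = z₀ from funext hz₀]
    exact osign_basis_ne_zero (V := EX) _ z₀
  have hw0 : osign (oZ x₀) (fun i => w i x₀) ≠ 0 := by
    obtain ⟨c, hc, -⟩ := exists_basis_constField (I := IZ) (FiberBundle.mem_baseSet_trivializationAt'
      (F := EZ) (E := TangentSpace IZ) x₀) w₀
    rw [show (fun i => w i x₀) = c from funext fun i => (hc i).symm]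
    exact osign_basis_ne_zero _ c
  have ha0 : oB.frameSign (pB x₀) (fun i => a i x₀) ≠ 0 := by
    obtain ⟨c, hc, -⟩ := exists_basis_constField (I := IB) hbB a₀
    rw [show (fun i => a i x₀) = c from funext fun i => (hc i).symm]
    exact osign_basis_ne_zero _ c
  have hb0 : oM.frameSign (pM x₀) (fun i => b i x₀) ≠ 0 := by
    obtain ⟨c, hc, -⟩ := exists_basis_constField (I := IM) hbM b₀
    rw [show (fun i => b i x₀) = c from funext fun i => (hc i).symm]
    exact osign_basis_ne_zero _ c
  have hk0 := key x₀ (FiberBundle.mem_baseSet_trivializationAt' x₀) hbB hbM hz0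
  have hdet0 : SignType.sign ((a₀.prod b₀).det (v x₀)) ≠ 0 := by
    intro h
    rw [h, mul_zero, eq_comm, mul_eq_zero, mul_eq_zero] at hk0
    exact hk0.elim hε fun h => h.elim ha0 hb0
  have hdetc := (ContinuousAt.comp (f := fun x => (a₀.prod b₀).det (v x))
    (continuousAt_sign_of_ne_zero (sign_ne_zero.1 hdet0)) hvc).eventually
    (IsOpen.mem_nhds (isOpen_discrete {SignType.sign ((a₀.prod b₀).det (v x₀))}) rfl)
  refine ⟨w, hwc, hw0, ?_⟩
  filter_upwards [hdetc, eventually_frameSign_eq hB oB hpB.continuous.continuousAt hac ha0,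
    eventually_frameSign_eq hM oM hpM.continuous.continuousAt hbc hb0,
    eventually_frameSign_eq hX oX hcont hzc hz0, eventually_mem_baseSet (I := IZ) x₀,
    hpB.continuous.continuousAt.eventually (eventually_mem_baseSet (I := IB) (pB x₀)),
    hpM.continuous.continuousAt.eventually (eventually_mem_baseSet (I := IM) (pM x₀))]
    with x h1 h2 h3 h4 h5 h6 h7
  have hkx := key x h5 h6 h7 (by rw [h4]; exact hz0)
  have h1' : SignType.sign ((a₀.prod b₀).det (v x)) = SignType.sign ((a₀.prod b₀).det (v x₀)) := h1
  rw [h1', h2, h3, h4, ← hk0] at hkx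
  exact mul_right_cancel₀ hz0 (mul_right_cancel₀ hdet0 hkx)

end FibreOrientation

end Pseudocycles

end

noncomputable section

namespace Pseudocycles

/-! ### Transversality and local equations of fibre products -/

section Transversality

open Module

variable {EB HB B EM HM M EX HX X EC HC C : Type*}
  [NormedAddCommGroup EB] [NormedSpace ℝ EB] [TopologicalSpace HB]
  {IB : ModelWithCorners ℝ EB HB} [TopologicalSpace B] [ChartedSpace HB B]
  [NormedAddCommGroup EM] [NormedSpace ℝ EM] [TopologicalSpace HM]
  {IM : ModelWithCorners ℝ EM HM} [TopologicalSpace M] [ChartedSpace HM M]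
  [NormedAddCommGroup EX] [NormedSpace ℝ EX] [TopologicalSpace HX]
  {IX : ModelWithCorners ℝ EX HX} [TopologicalSpace X] [ChartedSpace HX X]
  [NormedAddCommGroup EC] [NormedSpace ℝ EC] [TopologicalSpace HC]
  {IC : ModelWithCorners ℝ EC HC} [TopologicalSpace C] [ChartedSpace HC C]

theorem mdiff_comp {g : M → X} {f : B → M} (hg : ContMDiff IM IX ∞ g) (hf : ContMDiff IB IM ∞ f)
    (x : B) : mdiff IB IX (g ∘ f) x = (mdiff IM IX g (f x)).comp (mdiff IB IM f x) :=
  mfderiv_comp x (hg.mdifferentiable (by simp) _) (hf.mdifferentiable (by simp) _)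

theorem mdiff_comp_apply {g : M → X} {f : B → M} (hg : ContMDiff IM IX ∞ g)
    (hf : ContMDiff IB IM ∞ f) (x : B) (v : EB) :
    mdiff IB IX (g ∘ f) x v = mdiff IM IX g (f x) (mdiff IB IM f x v) := by
  rw [mdiff_comp hg hf]; rfl

theorem mdiff_id (x : B) : mdiff IB IB id x = ContinuousLinearMap.id ℝ EB := mfderiv_id

theorem jointDiff_apply (F : B → X) (f : M → X) (p : B) (q : M) (v : EB × EM) :
    jointDiff IB IM IX F f p q v = mdiff IB IX F p v.1 - mdiff IM IX f q v.2 := rfl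

variable (IB IM IX) in
/-- Transversality of two maps. -/
def Trans (F : B → X) (f : M → X) : Prop :=
  ∀ p q, F p = f q → Function.Surjective (jointDiff IB IM IX F f p q)

theorem Trans.symm {F : B → X} {f : M → X} (h : Trans IB IM IX F f) : Trans IM IB IX f F := by
  intro q p hpq v
  obtain ⟨u, hu⟩ := h p q hpq.symm (-v)
  refine ⟨(u.2, u.1), ?_⟩
  rw [jointDiff_apply] at hu ⊢
  rw [← neg_sub, hu, neg_neg]

/-- The image of `F` with its tangent spaces contains that of `F'`, up to larger tangent spaces
of `F'`. -/
def Dominates (IB : ModelWithCorners ℝ EB HB) (IC : ModelWithCorners ℝ EC HC)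
    (IX : ModelWithCorners ℝ EX HX) (F : B → X) (F' : C → X) : Prop :=
  ∀ c, ∃ b, F b = F' c ∧ ∀ v, ∃ w, mdiff IC IX F' c w = mdiff IB IX F b v

theorem Trans.mono {F : B → X} {f : M → X} {F' : C → X} (h : Trans IB IM IX F f)
    (hd : Dominates IB IC IX F F') : Trans IC IM IX F' f := by
  intro c q hcq v
  obtain ⟨b, hb, hw⟩ := hd c
  obtain ⟨u, hu⟩ := h b q (hb.trans hcq) v
  obtain ⟨w, hw⟩ := hw u.1
  refine ⟨(w, u.2), ?_⟩
  rw [← hu, jointDiff_apply, jointDiff_apply, hw]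

theorem dominates_of_comp {F : B → X} {F' : C → X} {ψ : C → B} (hF : ContMDiff IB IX ∞ F)
    (hψ : ContMDiff IC IB ∞ ψ) (h : ∀ c, F' c = F (ψ c))
    (hs : ∀ c, Function.Surjective (mdiff IC IB ψ c)) : Dominates IB IC IX F F' := by
  obtain rfl : F' = F ∘ ψ := funext h
  intro c
  refine ⟨ψ c, rfl, fun v => ?_⟩
  obtain ⟨w, hw⟩ := hs c v
  exact ⟨w, by rw [mdiff_comp_apply hF hψ, hw]⟩

/-- Near a common point, the fibre product is the zero set of a function. -/
theorem exists_local_equation [IsManifold IX ∞ X] {F : B → X} {f : M → X}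
    (hF : ContMDiff IB IX ∞ F) (hf : ContMDiff IM IX ∞ f) {p : B × M} (hp : F p.1 = f p.2) :
    ∃ (O : Set (B × M)) (g : B × M → EX), IsOpen O ∧ p ∈ O ∧
      ContMDiffOn (IB.prod IM) 𝓘(ℝ, EX) ∞ g O ∧ (∀ q ∈ O, F q.1 = f q.2 ↔ g q = 0) ∧
      mdiff (IB.prod IM) 𝓘(ℝ, EX) g p = jointDiff IB IM IX F f p.1 p.2 := by
  set ψ := extChartAt IX (F p.1) with hψ
  have hF' : ContMDiff (IB.prod IM) IX ∞ (F ∘ Prod.fst : B × M → X) := hF.comp contMDiff_fst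
  have hf' : ContMDiff (IB.prod IM) IX ∞ (f ∘ Prod.snd : B × M → X) := hf.comp contMDiff_snd
  have hOF := (isOpen_extChartAt_source (I := IX) (F p.1)).preimage hF'.continuous
  have hOf := (isOpen_extChartAt_source (I := IX) (F p.1)).preimage hf'.continuous
  have hpF : F p.1 ∈ ψ.source := mem_extChartAt_source _
  have hpf : f p.2 ∈ ψ.source := hp ▸ hpF
  have hψs : ContMDiffOn IX 𝓘(ℝ, EX) ∞ ψ ψ.source := by
    rw [hψ, extChartAt_source]; exact contMDiffOn_extChartAt
  have hψF : ContMDiffOn (IB.prod IM) 𝓘(ℝ, EX) ∞ (fun q : B × M => ψ (F q.1))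
      (F ∘ Prod.fst ⁻¹' ψ.source) := hψs.comp hF'.contMDiffOn fun q hq => hq
  have hψf : ContMDiffOn (IB.prod IM) 𝓘(ℝ, EX) ∞ (fun q : B × M => ψ (f q.2))
      (f ∘ Prod.snd ⁻¹' ψ.source) := hψs.comp hf'.contMDiffOn fun q hq => hq
  have hψm : ∀ x ∈ ψ.source, MDifferentiableAt IX 𝓘(ℝ, EX) ψ x := fun x hx =>
    (hψs.contMDiffAt ((isOpen_extChartAt_source _).mem_nhds hx)).mdifferentiableAt (by simp)
  -- The preferred chart has identity derivative at its base point, so the derivative of the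
  -- equation is literally the joint differential.
  have hψ' : mfderiv IX 𝓘(ℝ, EX) ψ (F p.1) = ContinuousLinearMap.id ℝ EX := mfderiv_extChartAt_self
  refine ⟨(F ∘ Prod.fst ⁻¹' ψ.source) ∩ (f ∘ Prod.snd ⁻¹' ψ.source),
    fun q => ψ (F q.1) - ψ (f q.2), hOF.inter hOf, ⟨hpF, hpf⟩,
    (hψF.mono inter_subset_left).sub (hψf.mono inter_subset_right), fun q hq => ?_, ?_⟩
  · rw [sub_eq_zero]
    exact ⟨fun h => by rw [h], fun h => ψ.injOn hq.1 hq.2 h⟩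
  · have h1 : MDifferentiableAt (IB.prod IM) 𝓘(ℝ, EX) (fun q : B × M => ψ (F q.1)) p :=
      (hψF.contMDiffAt (hOF.mem_nhds hpF)).mdifferentiableAt (by simp)
    have h2 : MDifferentiableAt (IB.prod IM) 𝓘(ℝ, EX) (fun q : B × M => ψ (f q.2)) p :=
      (hψf.contMDiffAt (hOf.mem_nhds hpf)).mdifferentiableAt (by simp)
    have h3 : mdiff (IB.prod IM) 𝓘(ℝ, EX) (fun q : B × M => ψ (F q.1) - ψ (f q.2)) p =
        mdiff (IB.prod IM) 𝓘(ℝ, EX) (fun q : B × M => ψ (F q.1)) p -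
        mdiff (IB.prod IM) 𝓘(ℝ, EX) (fun q : B × M => ψ (f q.2)) p :=
      mfderiv_sub h1 h2
    rw [h3]
    have h4 : mdiff (IB.prod IM) 𝓘(ℝ, EX) (fun q : B × M => ψ (F q.1)) p =
        (mdiff IB IX F p.1).comp (ContinuousLinearMap.fst ℝ EB EM) := by
      refine (mfderiv_comp p (hψm _ hpF) (hF'.mdifferentiable (by simp) p)).trans ?_
      refine ContinuousLinearMap.ext fun v => ?_
      refine (congrArg (fun A : EX →L[ℝ] EX => A _) hψ').trans ?_
      refine (mfderiv_comp_apply p (hF.mdifferentiable (by simp) p.1) mdifferentiableAt_fst v).trans ?_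
      rw [mfderiv_fst]
      rfl
    have h5 : mdiff (IB.prod IM) 𝓘(ℝ, EX) (fun q : B × M => ψ (f q.2)) p =
        (mdiff IM IX f p.2).comp (ContinuousLinearMap.snd ℝ EB EM) := by
      refine (mfderiv_comp p (hψm _ hpf) (hf'.mdifferentiable (by simp) p)).trans ?_
      refine ContinuousLinearMap.ext fun v => ?_
      rw [hp] at hψ'
      refine (congrArg (fun A : EX →L[ℝ] EX => A _) hψ').trans ?_
      refine (mfderiv_comp_apply p (hf.mdifferentiable (by simp) p.2) mdifferentiableAt_snd v).trans ?_
      rw [mfderiv_snd]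
      rfl
    rw [h4, h5]
    rfl

namespace SubmanifoldAtlas

variable {S : Set (B × M)} (c : SubmanifoldAtlas (IB.prod IM) IC S)

/-- The first projection of a submanifold of a product. -/
def fst (z : c.Carrier) : B := (c.val z).1

/-- The second projection of a submanifold of a product. -/
def snd (z : c.Carrier) : M := (c.val z).2

theorem contMDiff_fst : ContMDiff IC IB ∞ c.fst := _root_.contMDiff_fst.comp c.contMDiff_val

theorem contMDiff_snd : ContMDiff IC IM ∞ c.snd := _root_.contMDiff_snd.comp c.contMDiff_val

theorem mdiff_val (z : c.Carrier) : mdiff IC (IB.prod IM) c.val z =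
    (mdiff IC IB c.fst z).prod (mdiff IC IM c.snd z) :=
  MDifferentiableAt.mfderiv_prod (c.contMDiff_fst.mdifferentiable (by simp) z)
    (c.contMDiff_snd.mdifferentiable (by simp) z)

theorem prod_mdiff_injective (z : c.Carrier) :
    Function.Injective ((mdiff IC IB c.fst z).prod (mdiff IC IM c.snd z)) := by
  rw [← c.mdiff_val]
  exact c.mfderiv_val_injective z

end SubmanifoldAtlas

end Transversality

/-! ### Fibre products as manifolds -/

section FibreProducts

open Module

variable {EX HX X : Type*} [NormedAddCommGroup EX] [NormedSpace ℝ EX] [FiniteDimensional ℝ EX]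
  [TopologicalSpace HX] {IX : ModelWithCorners ℝ EX HX} [TopologicalSpace X] [ChartedSpace HX X]
  [IsManifold IX ∞ X] {a b d : ℕ} {M : Type*} [TopologicalSpace M]
  [ChartedSpace (EuclideanSpace ℝ (Fin b)) M] [IsManifold (𝓡 b) ∞ M]

/-- An open set of interior points is a submanifold. -/
theorem nonempty_submanifoldAtlas_of_isOpen {E H P : Type*} [NormedAddCommGroup E]
    [NormedSpace ℝ E] [FiniteDimensional ℝ E] [TopologicalSpace H] {I : ModelWithCorners ℝ E H}
    [TopologicalSpace P] [ChartedSpace H P] [IsManifold I ∞ P] {S : Set P} (hS : IsOpen S)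
    (hi : ∀ p ∈ S, I.IsInteriorPoint p) (hd : finrank ℝ E = d) :
    Nonempty (SubmanifoldAtlas I (𝓡 d) S) := by
  refine ⟨fun p => Classical.choice ?_⟩
  refine exists_submanifoldChart_of_interior (F := EuclideanSpace ℝ (Fin 0)) p.2 (hi p p.2)
    (g := fun _ => 0) hS p.2 contMDiffOn_const (fun q hq => by simp [hq]) ?_ ?_
  · intro v
    exact ⟨0, Subsingleton.elim (α := EuclideanSpace ℝ (Fin 0)) _ _⟩
  · simp [hd]

/-- The fibre product of transverse maps. -/
theorem Trans.nonempty_submanifoldAtlas {B : Type*} [TopologicalSpace B]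
    [ChartedSpace (EuclideanSpace ℝ (Fin a)) B] [IsManifold (𝓡 a) ∞ B] {F : B → X} {f : M → X}
    (hF : ContMDiff (𝓡 a) IX ∞ F) (hf : ContMDiff (𝓡 b) IX ∞ f) (h : Trans (𝓡 a) (𝓡 b) IX F f)
    (hd : d + finrank ℝ EX = a + b) :
    Nonempty (SubmanifoldAtlas ((𝓡 a).prod (𝓡 b)) (𝓡 d) {z : B × M | F z.1 = f z.2}) := by
  refine ⟨fun p => Classical.choice ?_⟩
  obtain ⟨O, g, hO, hpO, hg, hS, hg'⟩ := exists_local_equation hF hf p.2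
  refine exists_submanifoldChart_of_interior p.2 BoundarylessManifold.isInteriorPoint hO hpO hg hS
    ?_ ?_
  · intro v
    obtain ⟨u, hu⟩ := h _ _ p.2 v
    exact ⟨u, (congrArg (fun A : _ →L[ℝ] EX => A u) hg').trans hu⟩
  · simp only [finrank_prod, finrank_euclideanSpace_fin]
    omega

/-- The fibre product of a map from a manifold with boundary which is transverse along the
boundary, too. -/
theorem Trans.exists_submanifoldAtlas_halfSpace {B : Type*} [TopologicalSpace B]
    [ChartedSpace (EuclideanHalfSpace (a + 1)) B] [IsManifold (𝓡∂ (a + 1)) ∞ B] {F : B → X}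
    {f : M → X} (hF : ContMDiff (𝓡∂ (a + 1)) IX ∞ F) (hf : ContMDiff (𝓡 b) IX ∞ f)
    (h : Trans (𝓡∂ (a + 1)) (𝓡 b) IX F f)
    (h' : ∀ p q, F p = f q → (𝓡∂ (a + 1)).IsBoundaryPoint p → ∀ v, ∃ u, u.1 0 = 0 ∧
      jointDiff (𝓡∂ (a + 1)) (𝓡 b) IX F f p q u = v)
    (hd : d + finrank ℝ EX = a + b) :
    ∃ c : SubmanifoldAtlas ((𝓡∂ (a + 1)).prod (𝓡 b)) (𝓡∂ (d + 1)) {z : B × M | F z.1 = f z.2},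
      ∀ p, (𝓡∂ (a + 1)).IsBoundaryPoint p.1.1 → ∀ q ∈ (c p).source, F q.1 = f q.2 →
        (𝓡∂ (d + 1)) ((c p).toFun q) 0 = extChartAt (𝓡∂ (a + 1)) p.1.1 q.1 0 := by
  have key : ∀ p : {z : B × M | F z.1 = f z.2}, ∃ c : SubmanifoldChart
      ((𝓡∂ (a + 1)).prod (𝓡 b)) (𝓡∂ (d + 1)) {z : B × M | F z.1 = f z.2} p,
      (𝓡∂ (a + 1)).IsBoundaryPoint p.1.1 → ∀ q ∈ c.source, q ∈ {z : B × M | F z.1 = f z.2} →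
        (𝓡∂ (d + 1)) (c.toFun q) 0 = extChartAt (𝓡∂ (a + 1)) p.1.1 q.1 0 := by
    intro p
    obtain ⟨O, g, hO, hpO, hg, hS, hg'⟩ := exists_local_equation hF hf p.2
    refine exists_submanifoldChart_halfSpace p.2 hO hpO hg hS ?_ ?_ ?_
    · intro v
      obtain ⟨u, hu⟩ := h _ _ p.2 v
      exact ⟨u, (congrArg (fun A : _ →L[ℝ] EX => A u) hg').trans hu⟩
    · intro hb v
      obtain ⟨u, hu, huv⟩ := h' _ _ p.2 hb v
      exact ⟨u, hu, (congrArg (fun A : _ →L[ℝ] EX => A u) hg').trans huv⟩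
    · omega
  choose c hc using key
  exact ⟨c, hc⟩

end FibreProducts

/-! ### Maps from manifolds and dimensions of sets -/

section MapsFromManifolds

open Module

variable {n : ℕ} {X : Type*} [TopologicalSpace X] [ChartedSpace (EuclideanSpace ℝ (Fin n)) X]

variable (n X) in
/-- The map from the empty manifold. -/
def emptyMap (d : ℤ) : MapFromManifold n X d :=
  let _ : ChartedSpace (EuclideanSpace ℝ (Fin d.toNat)) Empty := ChartedSpace.empty _ _
  have _ : IsManifold (𝓡 d.toNat) ∞ Empty := IsManifold.empty _
  { M := Empty, isEmpty_of_neg := fun _ => inferInstance, map := Empty.elim, smooth := fun x => x.elim }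

/-- A smooth map from a manifold with boundary, restricted to an open set of interior points. -/
theorem exists_mapFromManifold_of_isOpen {E H P : Type} [NormedAddCommGroup E]
    [NormedSpace ℝ E] [FiniteDimensional ℝ E] [TopologicalSpace H] {I : ModelWithCorners ℝ E H}
    [TopologicalSpace P] [T2Space P] [SecondCountableTopology P] [ChartedSpace H P]
    [IsManifold I ∞ P] {S : Set P} (hS : IsOpen S)
    (hi : ∀ p ∈ S, I.IsInteriorPoint p) {d : ℤ} (hd : S.Nonempty → (finrank ℝ E : ℤ) = d)
    {F : P → X} (hF : ContMDiff I (𝓡 n) ∞ F) :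
    ∃ (g : MapFromManifold n X d) (e : g.M → P), range e = S ∧ (∀ p, g.map p = F (e p)) ∧
      ContMDiff (𝓡 d.toNat) I ∞ e ∧ ∀ p, Function.Surjective (mdiff (𝓡 d.toNat) I e p) := by
  by_cases hne : S.Nonempty
  · have hd' : finrank ℝ E = d.toNat := by have := hd hne; omega
    obtain ⟨c⟩ := nonempty_submanifoldAtlas_of_isOpen (I := I) hS hi hd'
    refine ⟨{ M := c.Carrier, isEmpty_of_neg := fun h => ?_, map := F ∘ c.val,
              smooth := hF.comp c.contMDiff_val }, c.val, c.range_val, fun p => rfl,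
              c.contMDiff_val, fun p => ?_⟩
    · have := hd hne; omega
    · exact (LinearMap.injective_iff_surjective_of_finrank_eq_finrank (by simp [hd'])
        (f := (mdiff (𝓡 d.toNat) I c.val p).toLinearMap)).1 (c.mfderiv_val_injective p)
  -- For empty `S` nothing relates `d` to the dimension of `E`, and `d` may be negative.
  · have : IsEmpty (emptyMap n X d).M := inferInstanceAs (IsEmpty Empty)
    refine ⟨emptyMap n X d, isEmptyElim, ?_, isEmptyElim, isEmptyElim, isEmptyElim⟩
    rw [not_nonempty_iff_eq_empty.1 hne]
    exact range_eq_empty _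

theorem DimAtMost.mono {d : ℤ} {S T : Set X} (h : DimAtMost n d T) (hST : S ⊆ T) :
    DimAtMost n d S := h.imp fun _ hg => hST.trans hg

theorem dimAtMost_empty (d : ℤ) : DimAtMost n d (∅ : Set X) := ⟨emptyMap n X d, empty_subset _⟩

/-- A map from a manifold, composed with the projection from a product with a line. -/
theorem MapFromManifold.exists_prod_real {d : ℤ} (g : MapFromManifold n X d) {S : Set (g.M × ℝ)}
    (hS : IsOpen S) {F : g.M × ℝ → X} (hF : ContMDiff ((𝓡 d.toNat).prod 𝓘(ℝ, ℝ)) (𝓡 n) ∞ F) :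
    ∃ (g' : MapFromManifold n X (d + 1)) (e : g'.M → g.M × ℝ), range e = S ∧
      (∀ p, g'.map p = F (e p)) ∧ ContMDiff (𝓡 (d + 1).toNat) ((𝓡 d.toNat).prod 𝓘(ℝ, ℝ)) ∞ e ∧
      ∀ p, Function.Surjective (mdiff (𝓡 (d + 1).toNat) ((𝓡 d.toNat).prod 𝓘(ℝ, ℝ)) e p) := by
  refine exists_mapFromManifold_of_isOpen hS (fun p _ => BoundarylessManifold.isInteriorPoint)
    (fun h => ?_) hF
  obtain ⟨p, -⟩ := h
  have : 0 ≤ d := by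
    by_contra hd
    exact (g.isEmpty_of_neg (not_le.1 hd)).false p.1
  simp only [finrank_prod, finrank_euclideanSpace_fin, finrank_self]
  omega

/-- Coverings have exactly the prescribed dimension, so the covering is multiplied by a line. -/
theorem DimAtMost.succ {d : ℤ} {S : Set X} (h : DimAtMost n d S) : DimAtMost n (d + 1) S := by
  obtain ⟨g, hg⟩ := h
  obtain ⟨g', e, he, hge, -, -⟩ := g.exists_prod_real isOpen_univ
    (F := fun p => g.map p.1) (g.smooth.comp contMDiff_fst)
  refine ⟨g', hg.trans ?_⟩
  rintro _ ⟨p, rfl⟩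
  obtain ⟨q, hq⟩ : (p, (0 : ℝ)) ∈ range e := he ▸ mem_univ _
  exact ⟨q, by rw [hge, hq]⟩

theorem DimAtMost.of_le {d d' : ℤ} {S : Set X} (h : DimAtMost n d S) (hd : d ≤ d') :
    DimAtMost n d' S := by
  obtain ⟨m, rfl⟩ := Int.le.dest hd
  induction m with
  | zero => simpa using h
  | succ m ih => 
    have := (ih (by omega)).succ
    rwa [show d + ((m + 1 : ℕ) : ℤ) = d + m + 1 by push_cast; ring]

/-- The disjoint union of two maps from manifolds. -/
def MapFromManifold.sum {d : ℤ} (f g : MapFromManifold n X d) : MapFromManifold n X d where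
  M := f.M ⊕ g.M
  isEmpty_of_neg h := isEmpty_sum.2 ⟨f.isEmpty_of_neg h, g.isEmpty_of_neg h⟩
  map := Sum.elim f.map g.map
  smooth := f.smooth.sumElim g.smooth

theorem MapFromManifold.range_sum {d : ℤ} (f g : MapFromManifold n X d) :
    range (f.sum g).map = range f.map ∪ range g.map := Sum.elim_range _ _

theorem DimAtMost.union {d : ℤ} {S T : Set X} (hS : DimAtMost n d S) (hT : DimAtMost n d T) :
    DimAtMost n d (S ∪ T) := by
  obtain ⟨f, hf⟩ := hS
  obtain ⟨g, hg⟩ := hT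
  exact ⟨f.sum g, by rw [f.range_sum]; exact union_subset_union hf hg⟩

theorem mdiff_sumElim_inl {E E' H H' A B C : Type*} [NormedAddCommGroup E] [NormedSpace ℝ E]
    [NormedAddCommGroup E'] [NormedSpace ℝ E'] [TopologicalSpace H] [TopologicalSpace H']
    {I : ModelWithCorners ℝ E H} {J : ModelWithCorners ℝ E' H'} [TopologicalSpace A]
    [TopologicalSpace B] [TopologicalSpace C] [ChartedSpace H A] [ChartedSpace H B]
    [ChartedSpace H' C] [IsManifold I ∞ A] [IsManifold I ∞ B] {f : A → C} {g : B → C}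
    (hf : ContMDiff I J ∞ f) (hg : ContMDiff I J ∞ g) (p : A) :
    mdiff I J (Sum.elim f g) (Sum.inl p) = mdiff I J f p := by
  have h1 := mdiff_comp (hf.sumElim hg) (ContMDiff.inl (I := I) (M := A) (M' := B)) p
  have h2 : mdiff I I (Sum.inl : A → A ⊕ B) p = ContinuousLinearMap.id ℝ E :=
    mfderiv_sumInl (p := Sum.inl p)
  rw [h2] at h1
  exact h1.symm

theorem mdiff_sumElim_inr {E E' H H' A B C : Type*} [NormedAddCommGroup E] [NormedSpace ℝ E]
    [NormedAddCommGroup E'] [NormedSpace ℝ E'] [TopologicalSpace H] [TopologicalSpace H']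
    {I : ModelWithCorners ℝ E H} {J : ModelWithCorners ℝ E' H'} [TopologicalSpace A]
    [TopologicalSpace B] [TopologicalSpace C] [ChartedSpace H A] [ChartedSpace H B]
    [ChartedSpace H' C] [IsManifold I ∞ A] [IsManifold I ∞ B] {f : A → C} {g : B → C}
    (hf : ContMDiff I J ∞ f) (hg : ContMDiff I J ∞ g) (p : B) :
    mdiff I J (Sum.elim f g) (Sum.inr p) = mdiff I J g p := by
  have h1 := mdiff_comp (hf.sumElim hg) (ContMDiff.inr (I := I) (M := A) (M' := B)) p
  have h2 : mdiff I I (Sum.inr : B → A ⊕ B) p = ContinuousLinearMap.id ℝ E :=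
    mfderiv_sumInr (q' := p)
  rw [h2] at h1
  exact h1.symm

/-- Only the sign of the second summand differs between the two formulations. -/
theorem transverse_iff_trans {d e : ℤ} {f : MapFromManifold n X d} {g : MapFromManifold n X e} :
    Transverse f g ↔ Trans (𝓡 d.toNat) (𝓡 e.toNat) (𝓡 n) f.map g.map := by
  refine forall_congr' fun p => forall_congr' fun q => forall_congr' fun _ => forall_congr' fun v =>
    ⟨?_, ?_⟩
  · rintro ⟨a, b, h⟩
    refine ⟨(a, -b), ?_⟩
    refine Eq.trans ?_ h
    change mdiff (𝓡 d.toNat) (𝓡 n) f.map p a - mdiff (𝓡 e.toNat) (𝓡 n) g.map q (-b) =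
      mdiff (𝓡 d.toNat) (𝓡 n) f.map p a + mdiff (𝓡 e.toNat) (𝓡 n) g.map q b
    exact (congrArg _ (map_neg (mdiff (𝓡 e.toNat) (𝓡 n) g.map q) b)).trans (sub_neg_eq_add _ _)
  · rintro ⟨u, h⟩
    refine ⟨u.1, -u.2, ?_⟩
    rw [jointDiff_apply, sub_eq_add_neg, ← map_neg] at h
    exact h

theorem Trans.sumElim {E E' E'' H H' H'' A B C D : Type*} [NormedAddCommGroup E] [NormedSpace ℝ E]
    [NormedAddCommGroup E'] [NormedSpace ℝ E'] [TopologicalSpace H] [TopologicalSpace H']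
    [NormedAddCommGroup E''] [NormedSpace ℝ E''] [TopologicalSpace H'']
    {I : ModelWithCorners ℝ E H} {J : ModelWithCorners ℝ E' H'} {K : ModelWithCorners ℝ E'' H''}
    [TopologicalSpace A] [TopologicalSpace B] [TopologicalSpace C] [TopologicalSpace D]
    [ChartedSpace H A] [ChartedSpace H B] [ChartedSpace H' C] [ChartedSpace H'' D]
    [IsManifold I ∞ A] [IsManifold I ∞ B] {f : A → C} {g : B → C} {h : D → C}
    (hf : ContMDiff I J ∞ f) (hg : ContMDiff I J ∞ g) (hfh : Trans I K J f h)
    (hgh : Trans I K J g h) : Trans I K J (Sum.elim f g) h := by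
  rintro (p | p) q hpq v
  · obtain ⟨u, hu⟩ := hfh p q hpq v
    exact ⟨u, by rw [← hu, jointDiff_apply, jointDiff_apply, mdiff_sumElim_inl hf hg]⟩
  · obtain ⟨u, hu⟩ := hgh p q hpq v
    exact ⟨u, by rw [← hu, jointDiff_apply, jointDiff_apply, mdiff_sumElim_inr hf hg]⟩

/-- A transverse common point rules out negative dimensions, so that arithmetic with `Int.toNat`
agrees with integer arithmetic. -/
theorem le_add_of_surjective_jointDiff {d e : ℤ} {f : MapFromManifold n X d}
    {g : MapFromManifold n X e} (p : f.M) (q : g.M) (h : Function.Surjective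
      (jointDiff (𝓡 d.toNat) (𝓡 e.toNat) (𝓡 n) f.map g.map p q)) :
    0 ≤ d ∧ 0 ≤ e ∧ n ≤ d.toNat + e.toNat := by
  refine ⟨?_, ?_, ?_⟩
  · by_contra hd
    exact (f.isEmpty_of_neg (not_le.1 hd)).false p
  · by_contra hd
    exact (g.isEmpty_of_neg (not_le.1 hd)).false q
  · have := LinearMap.finrank_le_finrank_of_surjective (f := (jointDiff (𝓡 d.toNat) (𝓡 e.toNat)
      (𝓡 n) f.map g.map p q).toLinearMap) h
    simpa using this

/-- The intersection of the images of transverse maps has the expected dimension. -/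
theorem Transverse.dimAtMost_inter [IsManifold (𝓡 n) ∞ X] {d e : ℤ} {f : MapFromManifold n X d}
    {g : MapFromManifold n X e} (h : Transverse f g) :
    DimAtMost n (d + e - n) (range f.map ∩ range g.map) := by
  rw [transverse_iff_trans] at h
  by_cases hne : (range f.map ∩ range g.map).Nonempty
  · obtain ⟨_, ⟨p, rfl⟩, q, hq⟩ := hne
    obtain ⟨hd, he, hn⟩ := le_add_of_surjective_jointDiff p q (h p q hq.symm)
    obtain ⟨c⟩ := h.nonempty_submanifoldAtlas f.smooth g.smooth
      (d := (d + e - n).toNat) (by simp only [finrank_euclideanSpace_fin]; omega)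
    refine ⟨{ M := c.Carrier, isEmpty_of_neg := fun h => by omega, map := f.map ∘ c.fst,
              smooth := f.smooth.comp c.contMDiff_fst }, ?_⟩
    rintro _ ⟨⟨p, rfl⟩, q, hq⟩
    exact ⟨c.mk (p, q) hq.symm, rfl⟩
  · rw [not_nonempty_iff_eq_empty.1 hne]
    exact dimAtMost_empty _

end MapsFromManifolds

/-! ### Limit sets via ultrafilters -/

section LimitSets

open Filter

variable {M X : Type*} [TopologicalSpace M] [TopologicalSpace X] {f : M → X} {x : X}

/-- `Bd f` consists of the cluster points of `f` along the complements of compact sets, and a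
cluster point is the limit along a finer ultrafilter. -/
theorem mem_bd_iff : x ∈ Bd f ↔ ∃ u : Ultrafilter M, ↑u ≤ cocompact M ∧ Tendsto f u (𝓝 x) := by
  rw [← mapClusterPt_iff_ultrafilter, MapClusterPt, clusterPt_iff_forall_mem_closure]
  constructor
  · intro h s hs
    obtain ⟨K, hK, hKs⟩ := mem_cocompact.1 (mem_map.1 hs)
    exact closure_mono ((image_mono hKs).trans (image_preimage_subset f s)) (mem_iInter₂.1 h K hK)
  · intro h
    refine mem_iInter₂.2 fun K hK => h _ ?_
    exact mem_map.2 (mem_of_superset hK.compl_mem_cocompact (subset_preimage_image f _))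

theorem exists_isCompact_mem_of_not_le {u : Ultrafilter M} (h : ¬ ↑u ≤ cocompact M) :
    ∃ K, IsCompact K ∧ K ∈ u := by
  by_contra! hK
  refine h fun s hs => ?_
  obtain ⟨K, hK', hKs⟩ := mem_cocompact.1 hs
  exact mem_of_superset (Ultrafilter.compl_mem_iff_notMem.2 (hK K hK')) hKs

theorem Bd_subset_closure_range (f : M → X) : Bd f ⊆ closure (range f) := by
  intro x hx
  have := mem_iInter₂.1 hx ∅ isCompact_empty
  rwa [compl_empty, image_univ] at this

/-- An ultrafilter that does not escape to infinity contains a compact set and so converges; by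
continuity the limit of `f` is attained there. -/
theorem mem_range_of_tendsto [T2Space X] (hf : Continuous f) {u : Ultrafilter M}
    (h : ¬ ↑u ≤ cocompact M) (hx : Tendsto f u (𝓝 x)) : x ∈ range f := by
  obtain ⟨K, hK, hKu⟩ := exists_isCompact_mem_of_not_le h
  obtain ⟨y, -, hy⟩ := hK.ultrafilter_le_nhds u (le_principal_iff.2 hKu)
  exact ⟨y, tendsto_nhds_unique ((hf.tendsto y).mono_left hy) hx⟩

theorem mem_range_union_bd_of_tendsto [T2Space X] (hf : Continuous f) {u : Ultrafilter M}
    (hx : Tendsto f u (𝓝 x)) : x ∈ range f ∪ Bd f := by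
  by_cases h : ↑u ≤ cocompact M
  · exact Or.inr (mem_bd_iff.2 ⟨u, h, hx⟩)
  · exact Or.inl (mem_range_of_tendsto hf h hx)

/-- The limit set of a fibre product. -/
theorem bd_fibreProduct_subset [T2Space X] {B Z : Type*} [TopologicalSpace B] [TopologicalSpace Z]
    {F : B → X} (hF : Continuous F) (hf : Continuous f) {h : Z → X} {v : Z → B × M}
    (hv : IsClosedEmbedding v) (hB : ∀ z, h z = F (v z).1) (hM : ∀ z, h z = f (v z).2) :
    Bd h ⊆ (Bd F ∩ range f) ∪ (range F ∩ Bd f) ∪ (Bd F ∩ Bd f) := by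
  intro x hx
  obtain ⟨u, hu, hux⟩ := mem_bd_iff.1 hx
  have h1 : Tendsto F (u.map fun z => (v z).1) (𝓝 x) := by
    rw [Ultrafilter.coe_map, tendsto_map'_iff]
    exact hux.congr hB
  have h2 : Tendsto f (u.map fun z => (v z).2) (𝓝 x) := by
    rw [Ultrafilter.coe_map, tendsto_map'_iff]
    exact hux.congr hM
  have h3 := mem_range_union_bd_of_tendsto hF h1
  have h4 := mem_range_union_bd_of_tendsto hf h2
  by_cases hc : x ∈ Bd F ∨ x ∈ Bd f
  · rcases hc with hc | hc
    · rcases h4 with h4 | h4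
      · exact Or.inl (Or.inl ⟨hc, h4⟩)
      · exact Or.inr ⟨hc, h4⟩
    · rcases h3 with h3 | h3
      · exact Or.inl (Or.inr ⟨h3, hc⟩)
      · exact Or.inr ⟨h3, hc⟩
  -- If neither factor escapes, the ultrafilter lives on the preimage of some compact `K ×ˢ L`,
  -- which is compact since `v` is a closed embedding. This contradicts escape in `Z`.
  · exfalso
    rw [not_or] at hc
    obtain ⟨K, hK, hKu⟩ := exists_isCompact_mem_of_not_le (M := B)
      fun h => hc.1 (mem_bd_iff.2 ⟨_, h, h1⟩)
    obtain ⟨L, hL, hLu⟩ := exists_isCompact_mem_of_not_le (M := M)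
      fun h => hc.2 (mem_bd_iff.2 ⟨_, h, h2⟩)
    have h5 := hv.tendsto_cocompact.mono_left hu (hK.prod hL).compl_mem_cocompact
    have h6 : v ⁻¹' (K ×ˢ L) ∈ (u : Filter Z) := inter_mem hKu hLu
    obtain ⟨z, hz1, hz2⟩ := u.nonempty_of_mem (inter_mem h6 (mem_map.1 h5))
    exact hz2 hz1

/-- The limit set of a map on `[0, 1] × M`. -/
theorem bd_cylinder_subset [T2Space X] {Y Z K : Type*} [TopologicalSpace Y]
    [TopologicalSpace Z] [TopologicalSpace K] [CompactSpace K] {f : M → Y}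
    (hfc : IsCompact (closure (range f))) {A : K × Y → X} (hA : Continuous A) {v : Z → K × M}
    (hv : IsClosedEmbedding v) :
    Bd (fun z => A ((v z).1, f (v z).2)) ⊆ {x | ∃ t, ∃ y ∈ Bd f, A (t, y) = x} := by
  intro x hx
  obtain ⟨u, hu, hux⟩ := mem_bd_iff.1 hx
  -- The time converges by compactness of `K` and the values of `f` by compactness of the closure of
  -- its range. Since time cannot escape, the other coordinate does, which puts the limit `y` into
  -- `Bd f`.
  obtain ⟨t, -, ht⟩ := isCompact_univ.ultrafilter_le_nhds (u.map fun z => (v z).1)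
    (by simp)
  obtain ⟨y, -, hy⟩ := hfc.ultrafilter_le_nhds (u.map fun z => f (v z).2)
    (le_principal_iff.2 (mem_map.2 (univ_mem' fun z => subset_closure (mem_range_self _))))
  have h1 : Tendsto (fun z => A ((v z).1, f (v z).2)) u (𝓝 (A (t, y))) :=
    (hA.tendsto (t, y)).comp (Tendsto.prodMk_nhds ht hy)
  refine ⟨t, y, ?_, tendsto_nhds_unique h1 hux⟩
  refine mem_bd_iff.2 ⟨u.map fun z => (v z).2, ?_, ?_⟩
  · intro s hs
    obtain ⟨L, hL, hLs⟩ := mem_cocompact.1 hs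
    have h5 := hv.tendsto_cocompact.mono_left hu
      ((isCompact_univ (X := K)).prod hL).compl_mem_cocompact
    change (fun z => (v z).2) ⁻¹' s ∈ (u : Filter Z)
    refine mem_of_superset (mem_map.1 h5) fun z hz => hLs fun hzL => hz ⟨mem_univ _, hzL⟩
  · rw [Ultrafilter.coe_map, tendsto_map'_iff]
    exact hy

end LimitSets

end Pseudocycles

end

noncomputable section
namespace Pseudocycles

open Module MeasureTheory Filter

/-! ### Parametric transversality -/

/-- The filter of conull sets of a finite dimensional vector space. -/
def generic (S : Type*) [NormedAddCommGroup S] [NormedSpace ℝ S] [FiniteDimensional ℝ S] :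
    Filter S :=
  let _ : MeasurableSpace S := borel S
  have : BorelSpace S := ⟨rfl⟩
  ae (Measure.addHaar : Measure S)

instance (S : Type*) [NormedAddCommGroup S] [NormedSpace ℝ S] [FiniteDimensional ℝ S] :
    (generic S).NeBot := by
  let _ : MeasurableSpace S := borel S
  have : BorelSpace S := ⟨rfl⟩
  change (ae (Measure.addHaar : Measure S)).NeBot
  infer_instance

section ParametricTransversality

variable {EX HX X : Type*} [NormedAddCommGroup EX] [NormedSpace ℝ EX]
  [TopologicalSpace HX] {IX : ModelWithCorners ℝ EX HX} [TopologicalSpace X] [ChartedSpace HX X]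
  [IsManifold IX ∞ X]

theorem hasFDerivAt_extChartAt_comp {V : Type*} [NormedAddCommGroup V] [NormedSpace ℝ V] {x₀ : X}
    {h : V → X} {ξ : V} (hh : MDifferentiableAt 𝓘(ℝ, V) IX h ξ)
    (hx : h ξ ∈ (extChartAt IX x₀).source) :
    HasFDerivAt (fun y => extChartAt IX x₀ (h y))
      ((mdiff IX 𝓘(ℝ, EX) (extChartAt IX x₀) (h ξ)).comp (mdiff 𝓘(ℝ, V) IX h ξ)) ξ := by
  have h1 : MDifferentiableAt IX 𝓘(ℝ, EX) (extChartAt IX x₀) (h ξ) :=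
    mdifferentiableAt_extChartAt (by rwa [← extChartAt_source IX])
  exact (h1.hasMFDerivAt.comp ξ hh.hasMFDerivAt).hasFDerivAt

theorem bijective_mdiff_extChartAt {x₀ x : X} (hx : x ∈ (extChartAt IX x₀).source) :
    Function.Bijective (mdiff IX 𝓘(ℝ, EX) (extChartAt IX x₀) x) :=
  (isInvertible_mfderiv_extChartAt hx).bijective

end ParametricTransversality

/-- In charts the coincidences `G (p, s) = f q` are the zeros of a function `H` which is submersive
in `s` alone. For almost every `s` it is then submersive in `(p, q)` at its zeros, which is
transversality. Second countability reduces the claim to countably many charts. -/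
theorem generic_trans {EN EM EX S : Type} {HN N HM M HX X : Type*}
    [NormedAddCommGroup EN] [NormedSpace ℝ EN] [FiniteDimensional ℝ EN]
    [NormedAddCommGroup EM] [NormedSpace ℝ EM] [FiniteDimensional ℝ EM]
    [NormedAddCommGroup EX] [NormedSpace ℝ EX] [FiniteDimensional ℝ EX]
    [NormedAddCommGroup S] [NormedSpace ℝ S] [FiniteDimensional ℝ S]
    [TopologicalSpace HN] {IN : ModelWithCorners ℝ EN HN} [TopologicalSpace N]
    [ChartedSpace HN N] [IsManifold IN ∞ N] [IN.Boundaryless] [SecondCountableTopology N]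
    [TopologicalSpace HM] {IM : ModelWithCorners ℝ EM HM} [TopologicalSpace M]
    [ChartedSpace HM M] [IsManifold IM ∞ M] [IM.Boundaryless] [SecondCountableTopology M]
    [TopologicalSpace HX] {IX : ModelWithCorners ℝ EX HX} [TopologicalSpace X]
    [ChartedSpace HX X] [IsManifold IX ∞ X]
    {G : N × S → X} (hG : ContMDiff (IN.prod 𝓘(ℝ, S)) IX ∞ G) {f : M → X}
    (hf : ContMDiff IM IX ∞ f)
    (hs : ∀ p s, Function.Surjective (mdiff 𝓘(ℝ, S) IX (fun σ => G (p, σ)) s)) :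
    ∀ᶠ s in generic S, Trans IN IM IX (fun p => G (p, s)) f := by
  let _ : MeasurableSpace S := borel S
  have : BorelSpace S := ⟨rfl⟩
  set μ : Measure S := Measure.addHaar
  let Z : Set ((N × M) × S) := {z | G (z.1.1, z.2) = f z.1.2 ∧ ¬ Function.Surjective
    (jointDiff IN IM IX (fun p => G (p, z.2)) f z.1.1 z.1.2)}
  suffices h : μ (Prod.snd '' Z) = 0 by
    change ∀ᵐ s ∂μ, _
    filter_upwards [measure_eq_zero_iff_ae_notMem.1 h] with s hs' p q hpq
    by_contra hc
    exact hs' ⟨((p, q), s), ⟨hpq, hc⟩, rfl⟩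
  refine measure_image_null_of_locally_null μ _ _ ?_
  rintro ⟨⟨p₀, q₀⟩, s₀⟩ ⟨h0, -⟩
  set eN := extChartAt IN p₀
  set eM := extChartAt IM q₀
  set eX := extChartAt IX (f q₀)
  have hGs : ∀ s, ContMDiff IN IX ∞ fun p => G (p, s) := fun s =>
    hG.comp (contMDiff_id.prodMk contMDiff_const)
  have hGp : ∀ p, ContMDiff 𝓘(ℝ, S) IX ∞ fun s => G (p, s) := fun p =>
    hG.comp (contMDiff_const.prodMk contMDiff_id)
  have heN : ContMDiffOn 𝓘(ℝ, EN) IN ∞ eN.symm eN.target := contMDiffOn_extChartAt_symm p₀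
  have heM : ContMDiffOn 𝓘(ℝ, EM) IM ∞ eM.symm eM.target := contMDiffOn_extChartAt_symm q₀
  have hoN : IsOpen eN.target := isOpen_extChartAt_target p₀
  have hoM : IsOpen eM.target := isOpen_extChartAt_target q₀
  have hoX : IsOpen eX.source := isOpen_extChartAt_source (f q₀)
  let g₁ : (EN × EM) × S → X := fun z => G (eN.symm z.1.1, z.2)
  let g₂ : (EN × EM) × S → X := fun z => f (eM.symm z.1.2)
  let T : Set ((EN × EM) × S) := (eN.target ×ˢ eM.target) ×ˢ univ
  have hT : IsOpen T := (hoN.prod hoM).prod isOpen_univ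
  have hg₁ : ContMDiffOn 𝓘(ℝ, (EN × EM) × S) IX ∞ g₁ T :=
    hG.comp_contMDiffOn ((heN.comp (contDiff_fst.comp contDiff_fst).contMDiff.contMDiffOn
      fun z hz => hz.1.1).prodMk contDiff_snd.contMDiff.contMDiffOn)
  have hg₂ : ContMDiffOn 𝓘(ℝ, (EN × EM) × S) IX ∞ g₂ T :=
    hf.comp_contMDiffOn (heM.comp (contDiff_snd.comp contDiff_fst).contMDiff.contMDiffOn
      fun z hz => hz.1.2)
  let Ω : Set ((EN × EM) × S) := (T ∩ g₁ ⁻¹' eX.source) ∩ (T ∩ g₂ ⁻¹' eX.source)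
  have hΩ : IsOpen Ω := (hg₁.continuousOn.isOpen_inter_preimage hT hoX).inter
    (hg₂.continuousOn.isOpen_inter_preimage hT hoX)
  have heX : ContMDiffOn IX 𝓘(ℝ, EX) ∞ eX eX.source := by
    rw [extChartAt_source]
    exact contMDiffOn_extChartAt
  let H : (EN × EM) × S → EX := fun z => eX (g₁ z) - eX (g₂ z)
  have hH : ContDiffOn ℝ ∞ H Ω := by
    have h1 : ContMDiffOn 𝓘(ℝ, (EN × EM) × S) 𝓘(ℝ, EX) ∞ (eX ∘ g₁) Ω :=
      heX.comp (hg₁.mono fun z hz => hz.1.1) fun z hz => hz.1.2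
    have h2 : ContMDiffOn 𝓘(ℝ, (EN × EM) × S) 𝓘(ℝ, EX) ∞ (eX ∘ g₂) Ω :=
      heX.comp (hg₂.mono fun z hz => hz.1.1) fun z hz => hz.2.2
    exact h1.contDiffOn.sub h2.contDiffOn
  have hHd : ∀ z ∈ Ω, HasFDerivAt H (fderiv ℝ H z) z := fun z hz =>
    ((hH.contDiffAt (hΩ.mem_nhds hz)).differentiableAt (by simp)).hasFDerivAt
  have hS : ∀ z ∈ Ω, ∀ σ, fderiv ℝ H z (0, σ) = mdiff IX 𝓘(ℝ, EX) eX (g₁ z)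
      (mdiff 𝓘(ℝ, S) IX (fun s => G (eN.symm z.1.1, s)) z.2 σ) := by
    rintro ⟨⟨ξ, η⟩, s⟩ hz σ
    have h1 := (hHd _ hz).comp s (hasFDerivAt_prodMk_right (𝕜 := ℝ) (ξ, η) s)
    have h2 := (hasFDerivAt_extChartAt_comp (x₀ := f q₀)
      ((hGp (eN.symm ξ)).mdifferentiableAt (by simp) (x := s)) hz.1.2).sub_const (eX (f (eM.symm η)))
    exact congrArg (fun A : S →L[ℝ] EX => A σ) (h1.unique h2)
  -- In the directions of `p` and `q` the derivative of `H` is the joint differential, seen through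
  -- the charts.
  have hE : ∀ z ∈ Ω, ∀ a b, fderiv ℝ H z ((a, b), 0) =
      mdiff IX 𝓘(ℝ, EX) eX (g₁ z) (mdiff IN IX (fun p => G (p, z.2)) (eN.symm z.1.1)
        (mdiff 𝓘(ℝ, EN) IN eN.symm z.1.1 a)) -
      mdiff IX 𝓘(ℝ, EX) eX (g₂ z) (mdiff IM IX f (eM.symm z.1.2)
        (mdiff 𝓘(ℝ, EM) IM eM.symm z.1.2 b)) := by
    rintro ⟨⟨ξ, η⟩, s⟩ hz a b
    have h1 := (hHd _ hz).comp ξ ((hasFDerivAt_prodMk_left (𝕜 := ℝ) (ξ, η) s).comp ξ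
      (hasFDerivAt_prodMk_left (𝕜 := ℝ) ξ η))
    have hN1 : MDifferentiableAt 𝓘(ℝ, EN) IN eN.symm ξ :=
      (heN.contMDiffAt (hoN.mem_nhds hz.1.1.1.1)).mdifferentiableAt (by simp)
    have hN2 := (hGs s).mdifferentiableAt (by simp) (x := eN.symm ξ)
    have h2 := (hasFDerivAt_extChartAt_comp (x₀ := f q₀) (hN2.comp ξ hN1)
      hz.1.2).sub_const (eX (f (eM.symm η)))
    have h1' := (hHd _ hz).comp η ((hasFDerivAt_prodMk_left (𝕜 := ℝ) (ξ, η) s).comp η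
      (hasFDerivAt_prodMk_right (𝕜 := ℝ) ξ η))
    have hM1 : MDifferentiableAt 𝓘(ℝ, EM) IM eM.symm η :=
      (heM.contMDiffAt (hoM.mem_nhds hz.1.1.1.2)).mdifferentiableAt (by simp)
    have hM2 := hf.mdifferentiableAt (by simp) (x := eM.symm η)
    have h2' := (hasFDerivAt_extChartAt_comp (x₀ := f q₀) (hM2.comp η hM1)
      hz.2.2).const_sub (eX (G (eN.symm ξ, s)))
    have k := congrArg (fun A : EN →L[ℝ] EX => A a) (h1.unique h2)
    have k' := congrArg (fun A : EM →L[ℝ] EX => A b) (h1'.unique h2')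
    have c : mdiff 𝓘(ℝ, EN) IX (fun p => G (eN.symm p, s)) ξ =
      (mdiff IN IX (fun p => G (p, s)) (eN.symm ξ)).comp (mdiff 𝓘(ℝ, EN) IN eN.symm ξ) :=
      mfderiv_comp ξ hN2 hN1
    have c' : mdiff 𝓘(ℝ, EM) IX (fun p => f (eM.symm p)) η =
      (mdiff IM IX f (eM.symm η)).comp (mdiff 𝓘(ℝ, EM) IM eM.symm η) := mfderiv_comp η hM2 hM1
    have k1 : fderiv ℝ H ((ξ, η), s) ((a, 0), 0) = mdiff IX 𝓘(ℝ, EX) eX (g₁ ((ξ, η), s))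
      (mdiff 𝓘(ℝ, EN) IX (fun p => G (eN.symm p, s)) ξ a) := k
    have k2 : fderiv ℝ H ((ξ, η), s) ((0, b), 0) = -mdiff IX 𝓘(ℝ, EX) eX (g₂ ((ξ, η), s))
      (mdiff 𝓘(ℝ, EM) IX (fun p => f (eM.symm p)) η b) := k'
    rw [c] at k1
    rw [c'] at k2
    have : (((a, b), 0) : (EN × EM) × S) = ((a, 0), 0) + ((0, b), 0) := by simp
    rw [this, map_add, k1, k2]
    exact (sub_eq_add_neg _ _).symm
  have hg12 : ∀ z ∈ Ω, H z = 0 → g₁ z = g₂ z := fun z hz h =>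
    eX.injOn hz.1.2 hz.2.2 (sub_eq_zero.1 h)
  have key := parametric_zero_null μ hΩ hH (by
    intro z hz hz0 v
    obtain ⟨w, hw⟩ := (bijective_mdiff_extChartAt (IX := IX) hz.1.2).2 v
    obtain ⟨σ, hσ⟩ := hs (eN.symm z.1.1) z.2 w
    exact ⟨σ, (hS z hz σ).trans ((congrArg _ hσ).trans hw)⟩)
  refine ⟨(fun z : (N × M) × S => ((eN z.1.1, eM z.1.2), z.2)) ⁻¹' Ω ∩
    ((eN.source ×ˢ eM.source) ×ˢ univ), ?_, measure_mono_null ?_ key⟩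
  · have ho : IsOpen ((eN.source ×ˢ eM.source) ×ˢ (univ : Set S)) :=
      ((isOpen_extChartAt_source p₀).prod (isOpen_extChartAt_source q₀)).prod isOpen_univ
    have hc : ContinuousOn (fun z : (N × M) × S => ((eN z.1.1, eM z.1.2), z.2))
        ((eN.source ×ˢ eM.source) ×ˢ (univ : Set S)) :=
      (((continuousOn_extChartAt p₀).comp continuousOn_fst.fst fun z hz => hz.1.1).prodMk
        ((continuousOn_extChartAt q₀).comp continuousOn_fst.snd fun z hz => hz.1.2)).prodMk
        continuousOn_snd
    rw [inter_comm]
    refine (hc.isOpen_inter_preimage ho hΩ).mem_nhds ⟨⟨⟨mem_extChartAt_source p₀,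
      mem_extChartAt_source q₀⟩, mem_univ _⟩, ?_⟩
    have hl : eN.symm (eN p₀) = p₀ := eN.left_inv (mem_extChartAt_source p₀)
    have hr : eM.symm (eM q₀) = q₀ := eM.left_inv (mem_extChartAt_source q₀)
    have hTm : ((eN p₀, eM q₀), s₀) ∈ T :=
      ⟨⟨mem_extChartAt_target p₀, mem_extChartAt_target q₀⟩, mem_univ _⟩
    refine ⟨⟨hTm, ?_⟩, hTm, ?_⟩
    · change G (eN.symm (eN p₀), s₀) ∈ eX.source
      rw [hl, show G (p₀, s₀) = f q₀ from h0]
      exact mem_extChartAt_source (f q₀)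
    · change f (eM.symm (eM q₀)) ∈ eX.source
      rw [hr]
      exact mem_extChartAt_source (f q₀)
  · rintro _ ⟨⟨⟨p, q⟩, s⟩, ⟨⟨h1, h2⟩, h3, h4⟩, rfl⟩
    have hp : eN.symm (eN p) = p := eN.left_inv h4.1.1
    have hq : eM.symm (eM q) = q := eM.left_inv h4.1.2
    have h5 : g₁ ((eN p, eM q), s) = g₂ ((eN p, eM q), s) := by
      change G (eN.symm (eN p), s) = f (eM.symm (eM q))
      rw [hp, hq]
      exact h1
    refine ⟨(eN p, eM q), h3, sub_eq_zero.2 (congrArg _ h5), fun hc => h2 fun v => ?_⟩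
    -- Only injectivity of the derivative of the chart of `X` is needed to return to the manifold;
    -- the charts of the domains merely supply the witnesses.
    obtain ⟨⟨a, b⟩, hab⟩ := hc (mdiff IX 𝓘(ℝ, EX) eX (g₁ ((eN p, eM q), s)) v)
    rw [hE _ h3, ← h5, ← map_sub] at hab
    have h6 := (bijective_mdiff_extChartAt (IX := IX) h3.1.2).1 hab
    simp only [hp, hq] at h6
    exact ⟨(_, _), h6⟩

end Pseudocycles

end

noncomputable section
namespace Pseudocycles

open Module Filter

/-! ### Perturbations -/

variable {n : ℕ} {X : Type*} [TopologicalSpace X] [ChartedSpace (EuclideanSpace ℝ (Fin n)) X]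

variable (n) in
/-- A smooth family of diffeomorphisms of `X` which moves the points of `U` in all directions. -/
structure Perturbation (U : Set X) where
  S : Type
  [group : NormedAddCommGroup S]
  [space : NormedSpace ℝ S]
  [finiteDimensional : FiniteDimensional ℝ S]
  toDiffeo : S → X ≃ₘ^∞⟮𝓡 n, 𝓡 n⟯ X
  smooth : ContMDiff (𝓘(ℝ, S).prod (𝓡 n)) (𝓡 n) ∞ fun z : S × X => toDiffeo z.1 z.2
  zero : toDiffeo 0 = Diffeomorph.refl (𝓡 n) X ∞
  surjective : ∀ x ∈ U, ∀ s,
    Function.Surjective (mdiff 𝓘(ℝ, S) (𝓡 n) (fun σ => toDiffeo σ x) s)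

attribute [instance] Perturbation.group Perturbation.space Perturbation.finiteDimensional

theorem surjective_mdiff_diffeo (φ : X ≃ₘ^∞⟮𝓡 n, 𝓡 n⟯ X) (x : X) :
    Function.Surjective (mdiff (𝓡 n) (𝓡 n) φ x) :=
  (φ.mfderivToContinuousLinearEquiv (by simp) x).surjective

section Reparametrise

variable {S : Type*} [NormedAddCommGroup S] [InnerProductSpace ℝ S]

/-- Allows parameter spaces to be whole vector spaces although only small parameters are harmless: a
diffeomorphism onto a ball is precomposed, which preserves submersivity. -/
theorem exists_ball_reparametrisation {ε : ℝ} (hε : 0 < ε) : ∃ ρ : S → S, ContDiff ℝ ∞ ρ ∧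
    ρ 0 = 0 ∧ (∀ s, ‖ρ s‖ < ε) ∧ ∀ s, Function.Surjective (fderiv ℝ ρ s) := by
  refine ⟨OpenPartialHomeomorph.univBall 0 ε, OpenPartialHomeomorph.contDiff_univBall,
    OpenPartialHomeomorph.univBall_apply_zero _ _, fun s => ?_, fun s => ?_⟩
  · have := (OpenPartialHomeomorph.univBall (0 : S) ε).map_source (x := s) (by simp)
    rw [OpenPartialHomeomorph.univBall_target _ hε] at this
    simpa using this
  · set β := OpenPartialHomeomorph.univBall (0 : S) ε
    have hs : s ∈ β.source := by simp [β]
    have h1 : DifferentiableAt ℝ β s := (OpenPartialHomeomorph.contDiff_univBall (n := ⊤)).differentiable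
      (by simp) s
    have hb : β.target = Metric.ball 0 ε := OpenPartialHomeomorph.univBall_target _ hε
    have h2 : DifferentiableAt ℝ β.symm (β s) :=
      ((OpenPartialHomeomorph.contDiffOn_univBall_symm (n := ⊤)).contDiffAt
        (Metric.isOpen_ball.mem_nhds (hb ▸ β.map_source hs))).differentiableAt (by simp)
    have h3 : HasFDerivAt (β ∘ β.symm) (ContinuousLinearMap.id ℝ S) (β s) :=
      (hasFDerivAt_id _).congr_of_eventuallyEq
        (Filter.eventuallyEq_of_mem (β.open_target.mem_nhds (β.map_source hs))
          fun y hy => β.right_inv hy)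
    have h4 : HasFDerivAt β (fderiv ℝ β s) (β.symm (β s)) := by
      rw [β.left_inv hs]; exact h1.hasFDerivAt
    have h5 := (h4.comp _ h2.hasFDerivAt).unique h3
    exact fun v => ⟨_, congrArg (fun A : S →L[ℝ] S => A v) h5⟩

end Reparametrise

/-- Translations that are cut off by a bump function. -/
theorem exists_local_translation {E : Type} [NormedAddCommGroup E] [InnerProductSpace ℝ E]
    [FiniteDimensional ℝ E] (c : E) {r R : ℝ} (hr : 0 < r) (hR : r < R) :
    ∃ T : E → E ≃ₜ E, ContDiff ℝ ∞ (fun z : E × E => T z.1 z.2) ∧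
      (∀ s, ContDiff ℝ ∞ (T s).symm) ∧ (∀ y, T 0 y = y) ∧
      (∀ s y, y ∉ Metric.closedBall c R → T s y = y) ∧
      ∀ y ∈ Metric.ball c r, ∀ s, Function.Surjective (fderiv ℝ (fun σ => T σ y) s) := by
  let ψ : ContDiffBump c := ⟨r, R, hr, hR⟩
  have hψ : ContDiff ℝ ∞ ψ := ψ.contDiff
  obtain ⟨L, hL⟩ := (hψ.of_le (by simp : (1 : WithTop ℕ∞) ≤ ∞)).lipschitzWith_of_hasCompactSupport
    ψ.hasCompactSupport (by simp)
  -- With `L` a Lipschitz constant of the bump function, this bound makes the displacement `ψ y • ρ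
  -- s` at most `1 / 2`-Lipschitz in `y`. Identity plus such a displacement is a homeomorphism with
  -- invertible derivatives.
  obtain ⟨ρ, hρ, hρ0, hρε, hρs⟩ := exists_ball_reparametrisation (S := E)
    (ε := 1 / (2 * (L + 1))) (by positivity)
  let t : E → E → E := fun s y => y + ψ y • ρ s
  have hsm : ContDiff ℝ ∞ fun z : E × E => t z.1 z.2 :=
    contDiff_snd.add ((hψ.comp contDiff_snd).smul (hρ.comp contDiff_fst))
  have hb : (L : ℝ) * (1 / (2 * (L + 1))) ≤ 1 / 2 := by
    rw [mul_one_div, div_le_div_iff₀ (by positivity) (by norm_num)]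
    nlinarith [L.coe_nonneg]
  have hlip : ∀ s, ApproximatesLinearOn (t s)
      (ContinuousLinearEquiv.refl ℝ E : E →L[ℝ] E) univ (1 / 2) := by
    intro s x _ y _
    have h1 : t s x - t s y - (x - y) = (ψ x - ψ y) • ρ s := by
      simp only [t, sub_smul]; abel
    change ‖t s x - t s y - (x - y)‖ ≤ (1 / 2 : ℝ) * ‖x - y‖
    rw [h1, norm_smul]
    calc ‖ψ x - ψ y‖ * ‖ρ s‖ ≤ (L * ‖x - y‖) * (1 / (2 * (L + 1))) :=
          mul_le_mul (hL.norm_sub_le x y) (hρε s).le (norm_nonneg _) (by positivity)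
      _ = (L * (1 / (2 * (L + 1)))) * ‖x - y‖ := by ring
      _ ≤ _ := mul_le_mul_of_nonneg_right hb (norm_nonneg _)
  have hc : Subsingleton E ∨
      (1 / 2 : NNReal) < ‖((ContinuousLinearEquiv.refl ℝ E).symm : E →L[ℝ] E)‖₊⁻¹ := by
    rcases subsingleton_or_nontrivial E with h | h
    · exact Or.inl h
    · right
      have : ‖((ContinuousLinearEquiv.refl ℝ E).symm : E →L[ℝ] E)‖₊ = 1 :=
        NNReal.eq (ContinuousLinearMap.norm_id (𝕜 := ℝ) (E := E))
      rw [this, inv_one]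
      exact NNReal.half_lt_self one_ne_zero
  let T : E → E ≃ₜ E := fun s => (hlip s).toHomeomorph (t s) hc
  have hTt : ∀ s y, T s y = t s y := fun s y => rfl
  have hd : ∀ s y, HasFDerivAt (T s)
      (ContinuousLinearMap.id ℝ E + (fderiv ℝ ψ y).smulRight (ρ s)) y := fun s y =>
    (hasFDerivAt_id y).add (((hψ.differentiable (by simp) y).hasFDerivAt).smul_const (ρ s))
  have hinj : ∀ s y, Function.Injective
      (ContinuousLinearMap.id ℝ E + (fderiv ℝ ψ y).smulRight (ρ s)) := by
    intro s y
    refine (injective_iff_map_eq_zero _).2 fun v hv => ?_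
    have h1 : v = -(fderiv ℝ ψ y v • ρ s) := eq_neg_of_add_eq_zero_left hv
    have h2 : ‖v‖ ≤ 1 / 2 * ‖v‖ := by
      calc ‖v‖ = ‖fderiv ℝ ψ y v‖ * ‖ρ s‖ := by
            conv_lhs => rw [h1]
            rw [norm_neg, norm_smul]
        _ ≤ (L * ‖v‖) * (1 / (2 * (L + 1))) := by
            refine mul_le_mul ?_ (hρε s).le (norm_nonneg _) (by positivity)
            exact ((fderiv ℝ ψ y).le_opNorm v).trans
              (mul_le_mul_of_nonneg_right (norm_fderiv_le_of_lipschitz ℝ hL) (norm_nonneg _))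
        _ = (L * (1 / (2 * (L + 1)))) * ‖v‖ := by ring
        _ ≤ _ := mul_le_mul_of_nonneg_right hb (norm_nonneg _)
    exact norm_le_zero_iff.1 (by linarith)
  refine ⟨T, hsm, fun s => ?_, fun y => ?_, fun s y hy => ?_, fun y hy s => ?_⟩
  · refine (T s).contDiff_symm (f₀' := fun y => (LinearEquiv.ofInjectiveEndo _
      (hinj s y)).toContinuousLinearEquiv) (fun y => ?_)
      (hsm.comp (contDiff_const.prodMk contDiff_id))
    convert hd s y using 1
    ext v
    rfl
  · rw [hTt]
    simp [t, hρ0]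
  · have : ψ y = 0 := ψ.zero_of_le_dist (not_le.1 hy).le
    rw [hTt]
    simp [t, this]
  · have h1 : ψ y = 1 := ψ.one_of_mem_closedBall (Metric.ball_subset_closedBall hy)
    have h2 : (fun σ => T σ y) = fun σ => y + ρ σ := by
      ext σ
      rw [hTt]
      simp [t, h1]
    rw [h2, fderiv_const_add]
    exact hρs s

section Transplant

variable (x₀ : X)

open Classical in
/-- A self-map of the model space, transplanted to `X` by means of a chart. -/
def transplant (t : EuclideanSpace ℝ (Fin n) → EuclideanSpace ℝ (Fin n)) (x : X) : X :=
  if x ∈ (extChartAt (𝓡 n) x₀).source then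
    (extChartAt (𝓡 n) x₀).symm (t (extChartAt (𝓡 n) x₀ x)) else x

variable {x₀} {t t' : EuclideanSpace ℝ (Fin n) → EuclideanSpace ℝ (Fin n)}

theorem transplant_of_mem {x : X} (h : x ∈ (extChartAt (𝓡 n) x₀).source) :
    transplant x₀ t x = (extChartAt (𝓡 n) x₀).symm (t (extChartAt (𝓡 n) x₀ x)) := if_pos h

theorem transplant_of_notMem {x : X} (h : x ∉ (extChartAt (𝓡 n) x₀).source) :
    transplant x₀ t x = x := if_neg h

theorem transplant_eq_self {x : X} (h : x ∈ (extChartAt (𝓡 n) x₀).source →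
    t (extChartAt (𝓡 n) x₀ x) = extChartAt (𝓡 n) x₀ x) : transplant x₀ t x = x := by
  by_cases hx : x ∈ (extChartAt (𝓡 n) x₀).source
  · rw [transplant_of_mem hx, h hx, (extChartAt (𝓡 n) x₀).left_inv hx]
  · exact transplant_of_notMem hx

theorem transplant_transplant (h : MapsTo t' (extChartAt (𝓡 n) x₀).target
    (extChartAt (𝓡 n) x₀).target) (ht : ∀ y, t (t' y) = y) (x : X) :
    transplant x₀ t (transplant x₀ t' x) = x := by
  by_cases hx : x ∈ (extChartAt (𝓡 n) x₀).source
  · have h1 := h ((extChartAt (𝓡 n) x₀).map_source hx)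
    rw [transplant_of_mem hx, transplant_of_mem ((extChartAt (𝓡 n) x₀).map_target h1),
      (extChartAt (𝓡 n) x₀).right_inv h1, ht, (extChartAt (𝓡 n) x₀).left_inv hx]
  · rw [transplant_of_notMem hx, transplant_of_notMem hx]

/-- `X` is covered by two open sets: the chart domain, where the map is smooth in coordinates, and
the complement of the image of `B`, where it is the identity. The image of `B` is closed because it
is compact in a Hausdorff space. -/
theorem contMDiff_transplant [T2Space X] [IsManifold (𝓡 n) ∞ X] {V : Type*}
    [NormedAddCommGroup V] [NormedSpace ℝ V] {B : Set (EuclideanSpace ℝ (Fin n))}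
    (hB : IsCompact B) (hBt : B ⊆ (extChartAt (𝓡 n) x₀).target)
    {T : V → EuclideanSpace ℝ (Fin n) → EuclideanSpace ℝ (Fin n)}
    (hT : ContDiff ℝ ∞ fun z : V × EuclideanSpace ℝ (Fin n) => T z.1 z.2)
    (hTB : ∀ s y, y ∉ B → T s y = y)
    (hTt : ∀ s, MapsTo (T s) (extChartAt (𝓡 n) x₀).target (extChartAt (𝓡 n) x₀).target) :
    ContMDiff (𝓘(ℝ, V).prod (𝓡 n)) (𝓡 n) ∞ fun z : V × X => transplant x₀ (T z.1) z.2 := by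
  set e := extChartAt (𝓡 n) x₀
  rintro ⟨s, x⟩
  by_cases hx : x ∈ e.source
  · have ho : IsOpen ((univ : Set V) ×ˢ e.source) :=
      isOpen_univ.prod (isOpen_extChartAt_source x₀)
    have h1 : ContMDiffOn (𝓘(ℝ, V).prod (𝓡 n)) 𝓘(ℝ, EuclideanSpace ℝ (Fin n)) ∞
        (fun z : V × X => e z.2) (univ ×ˢ e.source) :=
      (contMDiffOn_extChartAt (x := x₀)).comp contMDiffOn_snd fun z hz => by
        rw [← extChartAt_source (𝓡 n)]; exact hz.2
    have h2 : ContMDiffOn (𝓘(ℝ, V).prod (𝓡 n)) 𝓘(ℝ, V) ∞ (fun z : V × X => z.1)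
        (univ ×ˢ e.source) := contMDiffOn_fst
    have h3 := hT.contMDiff.comp_contMDiffOn (h2.prodMk_space h1)
    have h4 : ContMDiffOn (𝓘(ℝ, V).prod (𝓡 n)) (𝓡 n) ∞
        (fun z : V × X => e.symm (T z.1 (e z.2))) (univ ×ˢ e.source) :=
      (contMDiffOn_extChartAt_symm x₀).comp h3 fun z hz => hTt _ (e.map_source hz.2)
    refine (h4.contMDiffAt (ho.mem_nhds ⟨mem_univ _, hx⟩)).congr_of_eventuallyEq ?_
    filter_upwards [ho.mem_nhds (show (s, x) ∈ _ from ⟨mem_univ s, hx⟩)] with z hz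
    exact transplant_of_mem hz.2
  · have hc : IsClosed (e.symm '' B) :=
      (hB.image_of_continuousOn ((continuousOn_extChartAt_symm x₀).mono hBt)).isClosed
    have ho : IsOpen ((univ : Set V) ×ˢ (e.symm '' B)ᶜ) := isOpen_univ.prod hc.isOpen_compl
    have hxB : x ∉ e.symm '' B := by
      rintro ⟨y, hy, rfl⟩
      exact hx (e.map_target (hBt hy))
    refine contMDiffAt_snd.congr_of_eventuallyEq ?_
    filter_upwards [ho.mem_nhds (show (s, x) ∈ _ from ⟨mem_univ s, hxB⟩)] with z hz
    exact transplant_eq_self fun hz' => hTB _ _ fun hB' => hz.2 ⟨_, hB', e.left_inv hz'⟩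

end Transplant

/-- Translations in a chart, cut off outside a ball inside the chart, are transplanted to `X`; on
the smaller ball they are honest translations. -/
theorem exists_perturbation_nhds [T2Space X] [IsManifold (𝓡 n) ∞ X] (x₀ : X) :
    ∃ U ∈ 𝓝 x₀, IsOpen U ∧ Nonempty (Perturbation n U) := by
  set e := extChartAt (𝓡 n) x₀
  obtain ⟨R, hR, hRt⟩ := Metric.nhds_basis_closedBall.mem_iff.1
    ((isOpen_extChartAt_target x₀).mem_nhds (mem_extChartAt_target (I := 𝓡 n) x₀))
  obtain ⟨T, hT, hTs, hT0, hTB, hTd⟩ := exists_local_translation (e x₀) (half_pos hR)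
    (half_lt_self hR)
  have hBc : IsCompact (Metric.closedBall (e x₀) R) := isCompact_closedBall _ _
  have hTsB : ∀ s y, y ∉ Metric.closedBall (e x₀) R → (T s).symm y = y := fun s y hy =>
    (T s).symm_apply_eq.2 (hTB s y hy).symm
  -- A point sent outside the target lands where `φ` is the identity, so by injectivity it was not
  -- moved at all.
  have hmaps : ∀ (φ : EuclideanSpace ℝ (Fin n) ≃ₜ EuclideanSpace ℝ (Fin n)),
      (∀ y, y ∉ Metric.closedBall (e x₀) R → φ y = y) → MapsTo φ e.target e.target := by
    intro φ hφ y hy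
    by_contra hc
    have h1 : φ y ∉ Metric.closedBall (e x₀) R := fun h => hc (hRt h)
    have h2 := φ.injective (hφ _ h1)
    rw [h2] at hc
    exact hc hy
  have hsm := contMDiff_transplant (x₀ := x₀) hBc hRt hT hTB fun s => hmaps _ (hTB s)
  have hsm' : ∀ s, ContMDiff (𝓡 n) (𝓡 n) ∞ (transplant x₀ (T s).symm) := fun s =>
    (contMDiff_transplant (x₀ := x₀) (V := EuclideanSpace ℝ (Fin n)) (T := fun _ => (T s).symm)
      hBc hRt ((hTs s).comp contDiff_snd) (fun _ => hTsB s)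
      fun _ => hmaps _ (hTsB s)).comp (contMDiff_const (c := 0).prodMk contMDiff_id)
  let D : EuclideanSpace ℝ (Fin n) → X ≃ₘ^∞⟮𝓡 n, 𝓡 n⟯ X := fun s =>
    { toFun := transplant x₀ (T s)
      invFun := transplant x₀ (T s).symm
      left_inv := transplant_transplant (hmaps _ (hTB s)) (T s).symm_apply_apply
      right_inv := transplant_transplant (hmaps _ (hTsB s)) (T s).apply_symm_apply
      contMDiff_toFun := hsm.comp (contMDiff_const (c := s).prodMk contMDiff_id)
      contMDiff_invFun := hsm' s }
  have hU : IsOpen (e.source ∩ e ⁻¹' Metric.ball (e x₀) (R / 2)) :=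
    (continuousOn_extChartAt x₀).isOpen_inter_preimage (isOpen_extChartAt_source x₀)
      Metric.isOpen_ball
  refine ⟨_, hU.mem_nhds ⟨mem_extChartAt_source x₀, Metric.mem_ball_self (half_pos hR)⟩, hU,
    ⟨{ S := EuclideanSpace ℝ (Fin n)
       toDiffeo := D
       smooth := hsm
       zero := ?_
       surjective := ?_ }⟩⟩
  · ext x
    exact transplant_eq_self fun _ => hT0 _
  · rintro x ⟨hx, hxb⟩ s
    have h1 : (fun σ => D σ x) = e.symm ∘ fun σ => T σ (e x) := by
      ext σ
      exact transplant_of_mem hx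
    have h2 : T s (e x) ∈ e.target := hmaps _ (hTB s) (e.map_source hx)
    have h3 : MDifferentiableAt 𝓘(ℝ, EuclideanSpace ℝ (Fin n)) (𝓡 n) e.symm (T s (e x)) :=
      ((contMDiffOn_extChartAt_symm (n := ∞) x₀).contMDiffAt
        ((isOpen_extChartAt_target x₀).mem_nhds h2)).mdifferentiableAt (by simp)
    have h4 : ContDiff ℝ ∞ fun σ => T σ (e x) := hT.comp (contDiff_id.prodMk contDiff_const)
    have h5 : MDifferentiableAt 𝓘(ℝ, EuclideanSpace ℝ (Fin n)) 𝓘(ℝ, EuclideanSpace ℝ (Fin n))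
      (fun σ => T σ (e x)) s := (h4.differentiable (by simp) s).mdifferentiableAt
    have h6 : mdiff 𝓘(ℝ, EuclideanSpace ℝ (Fin n)) (𝓡 n) (fun σ => D σ x) s =
        (mdiff 𝓘(ℝ, EuclideanSpace ℝ (Fin n)) (𝓡 n) e.symm (T s (e x))).comp
          (fderiv ℝ (fun σ => T σ (e x)) s) := by
      have := mfderiv_comp s h3 h5
      rw [mfderiv_eq_fderiv] at this
      rw [h1]
      exact this
    have h7 : Function.Surjective
        (mdiff 𝓘(ℝ, EuclideanSpace ℝ (Fin n)) (𝓡 n) e.symm (T s (e x))) := by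
      have := (isInvertible_mfderivWithin_extChartAt_symm (I := 𝓡 n) h2).bijective.2
      simp only [ModelWithCorners.range_eq_univ, mfderivWithin_univ] at this
      exact this
    rw [h6]
    exact h7.comp (hTd _ hxb s)

/-- The composition `Φ ∘ Ψ` moves points of `V` by varying `Ψ`, because `Φ` is a diffeomorphism. It
moves points near `K` by varying `Φ`, provided `Ψ` does not carry them out of `U`; therefore the
parameter of `Ψ` is confined to a small ball. -/
theorem exists_perturbation_union {U V K : Set X} (hU : IsOpen U) (hK : IsCompact K) (hKU : K ⊆ U)
    [LocallyCompactSpace X] [IsManifold (𝓡 n) ∞ X]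
    (hV : IsOpen V) (Φ : Perturbation n U) (Ψ : Perturbation n V) :
    ∃ W, IsOpen W ∧ K ⊆ W ∧ V ⊆ W ∧ Nonempty (Perturbation n W) := by
  obtain ⟨L, hL, hKL, hLU⟩ := exists_compact_between hK hU hKU
  have hc : Continuous fun z : Ψ.S × X => Ψ.toDiffeo z.1 z.2 := Ψ.smooth.continuous
  -- A tube around `{0} × L`: for parameters in `u` the family `Ψ` keeps the compact set `L` inside
  -- `U`.
  obtain ⟨u, v, hu, hv, h0u, hLv, huv⟩ := generalized_tube_lemma (s := {(0 : Ψ.S)}) (t := L)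
    isCompact_singleton hL (hU.preimage hc) (by
      rintro ⟨s, x⟩ ⟨hs, hx⟩
      rw [mem_singleton_iff] at hs
      subst hs
      change Ψ.toDiffeo 0 x ∈ U
      rw [Ψ.zero]
      exact hLU hx)
  let e := toEuclidean (E := Ψ.S)
  obtain ⟨ε, hε, hεu⟩ := Metric.isOpen_iff.1 (hu.preimage e.symm.continuous) 0
    (by simpa using h0u)
  obtain ⟨ρ, hρ, hρ0, hρε, hρs⟩ := exists_ball_reparametrisation
    (S := EuclideanSpace ℝ (Fin (finrank ℝ Ψ.S))) hε
  let r : Ψ.S → Ψ.S := fun s => e.symm (ρ (e s))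
  have hr : ContDiff ℝ ∞ r := e.symm.contDiff.comp (hρ.comp e.contDiff)
  have hru : ∀ s, r s ∈ u := fun s => hεu (by simpa using hρε (e s))
  have hrs : ∀ s, Function.Surjective (mdiff 𝓘(ℝ, Ψ.S) 𝓘(ℝ, Ψ.S) r s) := by
    intro s
    have h1 : HasFDerivAt r ((e.symm : _ →L[ℝ] Ψ.S).comp ((fderiv ℝ ρ (e s)).comp
        (e : Ψ.S →L[ℝ] _))) s :=
      e.symm.hasFDerivAt.comp s
        (((hρ.differentiable (by simp) (e s)).hasFDerivAt).comp s e.hasFDerivAt)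
    have h2 : mdiff 𝓘(ℝ, Ψ.S) 𝓘(ℝ, Ψ.S) r s = _ := mfderiv_eq_fderiv.trans h1.fderiv
    rw [h2]
    exact e.symm.surjective.comp ((hρs _).comp e.surjective)
  have hsm : ContMDiff (𝓘(ℝ, Φ.S × Ψ.S).prod (𝓡 n)) (𝓡 n) ∞
      fun z : (Φ.S × Ψ.S) × X => Φ.toDiffeo z.1.1 (Ψ.toDiffeo (r z.1.2) z.2) := by
    have h1 : ContMDiff (𝓘(ℝ, Φ.S × Ψ.S).prod (𝓡 n)) 𝓘(ℝ, Φ.S) ∞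
      fun z : (Φ.S × Ψ.S) × X => z.1.1 := contDiff_fst.contMDiff.comp contMDiff_fst
    have h2 : ContMDiff (𝓘(ℝ, Φ.S × Ψ.S).prod (𝓡 n)) 𝓘(ℝ, Ψ.S) ∞
      fun z : (Φ.S × Ψ.S) × X => r z.1.2 :=
      (hr.comp contDiff_snd).contMDiff.comp contMDiff_fst
    exact Φ.smooth.comp (h1.prodMk (Ψ.smooth.comp (h2.prodMk contMDiff_snd)))
  have hΦs : ∀ x, ContMDiff 𝓘(ℝ, Φ.S) (𝓡 n) ∞ fun s => Φ.toDiffeo s x := fun x =>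
    Φ.smooth.comp (contMDiff_id.prodMk contMDiff_const)
  have hΨs : ∀ x, ContMDiff 𝓘(ℝ, Ψ.S) (𝓡 n) ∞ fun s => Ψ.toDiffeo s x := fun x =>
    Ψ.smooth.comp (contMDiff_id.prodMk contMDiff_const)
  refine ⟨interior L ∪ V, isOpen_interior.union hV, hKL.trans subset_union_left,
    subset_union_right, ⟨{
      S := Φ.S × Ψ.S
      toDiffeo := fun s => (Ψ.toDiffeo (r s.2)).trans (Φ.toDiffeo s.1)
      smooth := hsm
      zero := ?_
      surjective := ?_ }⟩⟩
  · have : r 0 = 0 := by simp [r, hρ0]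
    ext x
    change Φ.toDiffeo 0 (Ψ.toDiffeo (r 0) x) = x
    rw [this, Φ.zero, Ψ.zero]
    rfl
  · rintro x hx ⟨s, s'⟩
    have hg : ContMDiff 𝓘(ℝ, Φ.S × Ψ.S) (𝓡 n) ∞ fun σ : Φ.S × Ψ.S =>
      Φ.toDiffeo σ.1 (Ψ.toDiffeo (r σ.2) x) := hsm.comp (contMDiff_id.prodMk contMDiff_const)
    change Function.Surjective (mdiff 𝓘(ℝ, Φ.S × Ψ.S) (𝓡 n)
      (fun σ : Φ.S × Ψ.S => Φ.toDiffeo σ.1 (Ψ.toDiffeo (r σ.2) x)) (s, s'))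
    rcases hx with hx | hx
    · have h1 : Ψ.toDiffeo (r s') x ∈ U :=
        huv (show (r s', x) ∈ u ×ˢ v from ⟨hru s', hLv (interior_subset hx)⟩)
      have h2 := mdiff_comp hg (contDiff_prodMk_left s').contMDiff s
      intro w
      obtain ⟨a, ha⟩ := Φ.surjective _ h1 s w
      exact ⟨_, (congrArg (fun A : Φ.S →L[ℝ] _ => A a) h2).symm.trans ha⟩
    · have h2 := mdiff_comp hg (contDiff_prodMk_right s).contMDiff s'
      have h3 := mdiff_comp (Φ.toDiffeo s).contMDiff ((hΨs x).comp hr.contMDiff) s'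
      have h4 := mdiff_comp (hΨs x) hr.contMDiff s'
      intro w
      obtain ⟨b, hb⟩ := surjective_mdiff_diffeo (Φ.toDiffeo s) (Ψ.toDiffeo (r s') x) w
      obtain ⟨c, hc⟩ := Ψ.surjective x hx (r s') b
      obtain ⟨a, ha⟩ := hrs s' c
      refine ⟨_, (congrArg (fun A : Ψ.S →L[ℝ] _ => A a) h2).symm.trans
        ((congrArg (fun A : Ψ.S →L[ℝ] _ => A a) h3).trans (Eq.trans ?_ hb))⟩
      refine congrArg (mdiff (𝓡 n) (𝓡 n) (Φ.toDiffeo s) (Ψ.toDiffeo (r s') x)) ?_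
      exact (congrArg (fun A : Ψ.S →L[ℝ] _ => A a) h4).trans
        ((congrArg (mdiff 𝓘(ℝ, Ψ.S) (𝓡 n) (fun s => Ψ.toDiffeo s x) (r s')) ha).trans hc)

/-- Induction over compact sets. The compact set `L` is part of the induction statement since
joining two families only keeps a neighbourhood of a compact part of `U`. -/
theorem exists_perturbation [T2Space X] [IsManifold (𝓡 n) ∞ X] {K : Set X} (hK : IsCompact K) :
    ∃ U, IsOpen U ∧ K ⊆ U ∧ Nonempty (Perturbation n U) := by
  have : LocallyCompactSpace X := Manifold.locallyCompact_of_finiteDimensional (𝓡 n)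
  suffices h : ∃ L, IsCompact L ∧ K ⊆ L ∧ ∃ U, IsOpen U ∧ L ⊆ U ∧ Nonempty (Perturbation n U) by
    obtain ⟨L, -, hKL, U, hU, hLU, hΦ⟩ := h
    exact ⟨U, hU, hKL.trans hLU, hΦ⟩
  refine hK.induction_on (p := fun K => ∃ L, IsCompact L ∧ K ⊆ L ∧
    ∃ U, IsOpen U ∧ L ⊆ U ∧ Nonempty (Perturbation n U)) ?_ ?_ ?_ ?_
  · refine ⟨∅, isCompact_empty, subset_rfl, ∅, isOpen_empty, subset_rfl, ⟨{
      S := EuclideanSpace ℝ (Fin 0)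
      toDiffeo := fun _ => Diffeomorph.refl _ _ _
      smooth := contMDiff_snd
      zero := rfl
      surjective := fun x hx => hx.elim }⟩⟩
  · rintro s t hst ⟨L, hL, htL, h⟩
    exact ⟨L, hL, hst.trans htL, h⟩
  · rintro s t ⟨L, hL, hsL, U, hU, hLU, ⟨Φ⟩⟩ ⟨L', hL', hsL', V, hV, hLV, ⟨Ψ⟩⟩
    obtain ⟨W, hW, hLW, hVW, hΦ⟩ := exists_perturbation_union hU hL hLU hV Φ Ψ
    exact ⟨L ∪ L', hL.union hL', union_subset_union hsL hsL', W, hW,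
      union_subset hLW (hLV.trans hVW), hΦ⟩
  · intro x _
    obtain ⟨U, hxU, hU, hΦ⟩ := exists_perturbation_nhds (n := n) x
    obtain ⟨L, hL, hLU, hLc⟩ := local_compact_nhds hxU
    exact ⟨L, mem_nhdsWithin_of_mem_nhds hL, L, hLc, subset_rfl, U, hU, hLU, hΦ⟩

end Pseudocycles

end

noncomputable section
namespace Pseudocycles

open Module

/-! ### Fillings -/

section LinearAlgebra

/-- Splitting off the first index. -/
def headEquiv (a b : ℕ) : Fin (a + 1) ⊕ Fin b ≃ (Fin a ⊕ Fin b) ⊕ Unit where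
  toFun := Sum.elim (Fin.cases (Sum.inr ()) fun i => Sum.inl (Sum.inl i))
    fun j => Sum.inl (Sum.inr j)
  invFun := Sum.elim (Sum.elim (fun i => Sum.inl i.succ) Sum.inr) fun _ => Sum.inl 0
  left_inv := by
    rintro (i | j)
    · refine Fin.cases rfl (fun i => rfl) i
    · rfl
  right_inv := by rintro ((i | j) | u) <;> rfl

/-- The extension of a bijection by a common first index. -/
def extendEquiv {a b d n : ℕ} (τ : Fin a ⊕ Fin b ≃ Fin d ⊕ Fin n) :
    Fin (a + 1) ⊕ Fin b ≃ Fin (d + 1) ⊕ Fin n :=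
  (headEquiv a b).trans ((Equiv.sumCongr τ (Equiv.refl Unit)).trans (headEquiv d n).symm)

/-- The vectors other than `w' 0` have no component along `eB 0`, and `w' 0` has coefficient `1`
there, so the matrix is block triangular. No sign appears because the new index is the first one in
both orderings. -/
theorem det_extendEquiv {VP VB VM : Type*} [AddCommGroup VB] [Module ℝ VB] [AddCommGroup VM]
    [Module ℝ VM] [AddCommGroup VP] [Module ℝ VP] {a l d n : ℕ} (eP : Basis (Fin a) ℝ VP)
    (eB : Basis (Fin (a + 1)) ℝ VB) (b : Basis (Fin l) ℝ VM) (J : VP →ₗ[ℝ] VB)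
    (hJ : ∀ i, eB (Fin.succ i) = J (eP i)) (τ : Fin a ⊕ Fin l ≃ Fin d ⊕ Fin n)
    {w : Fin d → VP × VM} {s : Fin n → VP × VM} {w' : Fin (d + 1) → VB × VM}
    {s' : Fin n → VB × VM} (h0 : (w' 0).1 = eB 0) (hw : ∀ i, w' (Fin.succ i) = (J (w i).1, (w i).2))
    (hs : ∀ j, s' j = (J (s j).1, (s j).2)) :
    (eB.prod b).det (Sum.elim w' s' ∘ extendEquiv τ) = (eP.prod b).det (Sum.elim w s ∘ τ) := by
  have hJr0 : ∀ u, eB.repr (J u) 0 = 0 := by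
    intro u
    have : (eB.coord 0).comp J = 0 := eP.ext fun i => by
      simp [← hJ, Basis.coord_apply, (Fin.succ_ne_zero i)]
    exact congrArg (fun A : VP →ₗ[ℝ] ℝ => A u) this
  have hJr : ∀ u i, eB.repr (J u) (Fin.succ i) = eP.repr u i := by
    intro u i
    have : (eB.coord i.succ).comp J = eP.coord i := eP.ext fun j => by
      simp [← hJ, Basis.coord_apply, Finsupp.single_apply]
    exact congrArg (fun A : VP →ₗ[ℝ] ℝ => A u) this
  set v := Sum.elim w s ∘ τ
  have h1 : ∀ x, (Sum.elim w' s' ∘ extendEquiv τ) ((headEquiv a l).symm (Sum.inl x)) =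
      (J (v x).1, (v x).2) := by
    intro x
    have : extendEquiv τ ((headEquiv a l).symm (Sum.inl x)) =
      (headEquiv d n).symm (Sum.inl (τ x)) := by simp [extendEquiv]
    change Sum.elim w' s' (extendEquiv τ ((headEquiv a l).symm (Sum.inl x))) =
      (J (Sum.elim w s (τ x)).1, (Sum.elim w s (τ x)).2)
    rw [this]
    rcases τ x with i | j
    · exact hw i
    · exact hs j
  have h2 : (Sum.elim w' s' ∘ extendEquiv τ) ((headEquiv a l).symm (Sum.inr ())) = w' 0 := by
    change Sum.elim w' s' (extendEquiv τ ((headEquiv a l).symm (Sum.inr ()))) = w' 0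
    have : extendEquiv τ ((headEquiv a l).symm (Sum.inr ())) = (headEquiv d n).symm (Sum.inr ()) := by
      simp [extendEquiv]
    rw [this]
    rfl
  have h3 : (eB.prod b).det (Sum.elim w' s' ∘ extendEquiv τ) =
      ((eB.prod b).reindex (headEquiv a l)).det
        (Sum.elim (fun x => (J (v x).1, (v x).2)) fun _ => w' 0) := by
    rw [Basis.det_reindex]
    congr 1
    ext1 x
    obtain ⟨y, rfl⟩ := (headEquiv a l).symm.surjective x
    rcases y with y | y
    · rw [h1]; simp
    · rw [h2]; simp
  have hr : ∀ u y, ((eB.prod b).reindex (headEquiv a l)).repr u y =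
      (eB.prod b).repr u ((headEquiv a l).symm y) := fun u y => Basis.repr_reindex_apply _ _ _ _
  have hx : ∀ i : Fin a, (headEquiv a l).symm (Sum.inl (Sum.inl i)) = Sum.inl i.succ := fun _ => rfl
  have hy : ∀ i : Fin l, (headEquiv a l).symm (Sum.inl (Sum.inr i)) = Sum.inr i := fun _ => rfl
  have hz : ∀ i : Unit, (headEquiv a l).symm (Sum.inr i) = Sum.inl 0 := fun _ => rfl
  rw [h3, det_sum_elim_of_triangular]
  · have h4 : (Matrix.of fun i j => ((eB.prod b).reindex (headEquiv a l)).repr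
        ((fun _ : Unit => w' 0) j) (Sum.inr i)).det = 1 := by
      rw [Matrix.det_unique, Matrix.of_apply, hr, hz]
      simp [h0]
    rw [h4, mul_one, Basis.det_apply]
    congr 1
    ext x y
    rw [Matrix.of_apply, hr]
    rcases x with x | x
    · rw [hx]; simp [Basis.toMatrix_apply, hJr]
    · rw [hy]; simp [Basis.toMatrix_apply]
  · rintro i j
    rw [hr, hz]
    simp [hJr0]

end LinearAlgebra

/-- An oriented manifold with boundary `P`.  The orientation of the boundary, with the outward
normal first, is described by the signs of families of tangent vectors. -/
structure Filling (d : ℕ) (P : Type) [TopologicalSpace P]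
    [ChartedSpace (EuclideanSpace ℝ (Fin d)) P]
    (σ : P → (Fin d → EuclideanSpace ℝ (Fin d)) → SignType) where
  B : Type
  [topB : TopologicalSpace B]
  [t2 : T2Space B]
  [secondCountable : SecondCountableTopology B]
  [charted : ChartedSpace (EuclideanHalfSpace (d + 1)) B]
  [manifold : IsManifold (𝓡∂ (d + 1)) ∞ B]
  orientation : ManifoldOrientation (𝓡∂ (d + 1)) B (d + 1)
  ι : P → B
  isSmoothEmbedding : Manifold.IsSmoothEmbedding (𝓡 d) (𝓡∂ (d + 1)) ∞ ι
  range_eq : range ι = (𝓡∂ (d + 1)).boundary B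
  orient : ∀ (p : P) (ν : EuclideanSpace ℝ (Fin (d + 1))), ν 0 < 0 → ∀ v,
    orientation.frameSign (ι p)
      (Fin.cons ν fun i => mdiff (𝓡 d) (𝓡∂ (d + 1)) ι p (v i) :
        Fin (d + 1) → EuclideanSpace ℝ (Fin (d + 1))) = σ p v

attribute [instance] Filling.topB Filling.t2 Filling.secondCountable Filling.charted
  Filling.manifold

section Filling

variable {d : ℕ} {P : Type} [TopologicalSpace P] [ChartedSpace (EuclideanSpace ℝ (Fin d)) P]
  {σ : P → (Fin d → EuclideanSpace ℝ (Fin d)) → SignType}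

theorem Filling.smooth (W : Filling d P σ) : ContMDiff (𝓡 d) (𝓡∂ (d + 1)) ∞ W.ι :=
  W.isSmoothEmbedding.contMDiff

theorem Filling.isBoundaryPoint (W : Filling d P σ) (p : P) :
    (𝓡∂ (d + 1)).IsBoundaryPoint (W.ι p) :=
  (W.range_eq ▸ mem_range_self p : W.ι p ∈ (𝓡∂ (d + 1)).boundary W.B)

theorem Filling.exists_eq (W : Filling d P σ) {q : W.B} (h : (𝓡∂ (d + 1)).IsBoundaryPoint q) :
    ∃ p, W.ι p = q :=
  (W.range_eq ▸ h : q ∈ range W.ι)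

theorem Filling.mdiff_injective [IsManifold (𝓡 d) ∞ P] (W : Filling d P σ) (p : P) :
    Function.Injective (mdiff (𝓡 d) (𝓡∂ (d + 1)) W.ι p) := by
  obtain ⟨F, _, _, h⟩ := W.isSmoothEmbedding.isImmersion
  exact IsImmersionAtOfComplement.mfderiv_injective (h p)

theorem Filling.mdiff_apply_zero (W : Filling d P σ) (p : P) (v : EuclideanSpace ℝ (Fin d)) :
    mdiff (𝓡 d) (𝓡∂ (d + 1)) W.ι p v 0 = 0 :=
  mfderiv_apply_zero_of_isBoundaryPoint (W.smooth.mdifferentiable (by simp) p) W.isBoundaryPoint v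

theorem linearIndependent_cons {m : ℕ} {v : Fin d → EuclideanSpace ℝ (Fin (m + 1))}
    {ν : EuclideanSpace ℝ (Fin (m + 1))} (hv : LinearIndependent ℝ v) (h0 : ∀ i, v i 0 = 0)
    (hν : ν 0 ≠ 0) : LinearIndependent ℝ (Fin.cons ν v : Fin (d + 1) → _) := by
  refine linearIndependent_finCons.2 ⟨hv, fun h => hν ?_⟩
  have : Submodule.span ℝ (range v) ≤ LinearMap.ker
      (EuclideanSpace.proj 0 : EuclideanSpace ℝ (Fin (m + 1)) →L[ℝ] ℝ).toLinearMap := by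
    rw [Submodule.span_le]
    rintro _ ⟨i, rfl⟩
    exact h0 i
  exact this h

theorem exists_basis_of_linearIndependent {m : ℕ} {v : Fin m → EuclideanSpace ℝ (Fin m)}
    (hv : LinearIndependent ℝ v) : ∃ c : Basis (Fin m) ℝ (EuclideanSpace ℝ (Fin m)), ⇑c = v :=
  ⟨basisOfLinearIndependentOfCardEqFinrank' v hv (by simp),
    coe_basisOfLinearIndependentOfCardEqFinrank' v hv (by simp)⟩

end Filling

/-- The preferred chart has identity derivative at its own base point; this gives coordinate `0` of
a tangent vector an intrinsic meaning as derivative of a boundary coordinate. -/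
theorem hasMFDerivAt_extChartAt_zero {m : ℕ} {Q : Type*} [TopologicalSpace Q]
    [ChartedSpace (EuclideanHalfSpace (m + 1)) Q] [IsManifold (𝓡∂ (m + 1)) ∞ Q] (q : Q) :
    HasMFDerivAt (𝓡∂ (m + 1)) 𝓘(ℝ, ℝ) (fun q' => extChartAt (𝓡∂ (m + 1)) q q' 0) q
      (EuclideanSpace.proj 0 : EuclideanSpace ℝ (Fin (m + 1)) →L[ℝ] ℝ) := by
  have h1 : MDifferentiableAt (𝓡∂ (m + 1)) 𝓘(ℝ, EuclideanSpace ℝ (Fin (m + 1)))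
    (extChartAt (𝓡∂ (m + 1)) q) q := mdifferentiableAt_extChartAt (mem_chart_source _ q)
  have h2 := h1.hasMFDerivAt
  rw [mfderiv_extChartAt_self] at h2
  exact (ContinuousLinearMap.hasMFDerivAt (EuclideanSpace.proj 0 :
    EuclideanSpace ℝ (Fin (m + 1)) →L[ℝ] ℝ)).comp q h2

/-- The first coordinate of the derivative of a map which respects the defining functions of the
boundaries. -/
theorem mdiff_apply_zero_of_chart {d a : ℕ} {Z B : Type*} [TopologicalSpace Z]
    [ChartedSpace (EuclideanHalfSpace (d + 1)) Z] [IsManifold (𝓡∂ (d + 1)) ∞ Z]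
    [TopologicalSpace B] [ChartedSpace (EuclideanHalfSpace (a + 1)) B]
    [IsManifold (𝓡∂ (a + 1)) ∞ B] {p : Z → B} {z : Z}
    (hp : MDifferentiableAt (𝓡∂ (d + 1)) (𝓡∂ (a + 1)) p z)
    (h : ∀ᶠ z' in 𝓝 z, extChartAt (𝓡∂ (d + 1)) z z' 0 =
      extChartAt (𝓡∂ (a + 1)) (p z) (p z') 0) (ν : EuclideanSpace ℝ (Fin (d + 1))) :
    mdiff (𝓡∂ (d + 1)) (𝓡∂ (a + 1)) p z ν 0 = ν 0 := by
  have h1 := hasMFDerivAt_extChartAt_zero (m := d) z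
  have h2 := ((hasMFDerivAt_extChartAt_zero (m := a) (p z)).comp z hp.hasMFDerivAt).congr_of_eventuallyEq h
  exact congrArg (fun A : EuclideanSpace ℝ (Fin (d + 1)) →L[ℝ] ℝ => A ν)
    (hasMFDerivAt_unique h2 h1)

theorem ManifoldOrientation.frameSign_ne_zero {E H M : Type*} [NormedAddCommGroup E]
    [NormedSpace ℝ E] [TopologicalSpace H] {I : ModelWithCorners ℝ E H} [TopologicalSpace M]
    [ChartedSpace H M] [IsManifold I 1 M] {k : ℕ} (o : ManifoldOrientation I M k) (x : M)
    (e : Basis (Fin k) ℝ E) : o.frameSign x e ≠ 0 := osign_basis_ne_zero (V := E) (o.orient x) e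

theorem ManifoldOrientation.linearIndependent_of_frameSign_ne_zero {E H M : Type*}
    [NormedAddCommGroup E] [NormedSpace ℝ E] [FiniteDimensional ℝ E] [TopologicalSpace H]
    {I : ModelWithCorners ℝ E H} [TopologicalSpace M] [ChartedSpace H M] [IsManifold I 1 M] {k : ℕ}
    (o : ManifoldOrientation I M k) {x : M} {v : Fin k → E} (h : o.frameSign x v ≠ 0) :
    LinearIndependent ℝ v := by
  by_contra hv
  exact h (sign_eq_zero_iff.2 (AlternatingMap.map_linearDependent _ v hv))

/-- The sign of a boundary frame of a fibre product. -/
theorem sign_boundary_fibre {a b d n : ℕ}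
    {dι : EuclideanSpace ℝ (Fin a) →L[ℝ] EuclideanSpace ℝ (Fin (a + 1))}
    {dp : EuclideanSpace ℝ (Fin d) →L[ℝ] EuclideanSpace ℝ (Fin a)}
    {dq : EuclideanSpace ℝ (Fin d) →L[ℝ] EuclideanSpace ℝ (Fin b)}
    {dj : EuclideanSpace ℝ (Fin d) →L[ℝ] EuclideanSpace ℝ (Fin (d + 1))}
    {dB : EuclideanSpace ℝ (Fin (d + 1)) →L[ℝ] EuclideanSpace ℝ (Fin (a + 1))}
    {dM : EuclideanSpace ℝ (Fin (d + 1)) →L[ℝ] EuclideanSpace ℝ (Fin b)}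
    {Δ : EuclideanSpace ℝ (Fin a) × EuclideanSpace ℝ (Fin b) → EuclideanSpace ℝ (Fin n)}
    {Δ' : EuclideanSpace ℝ (Fin (a + 1)) × EuclideanSpace ℝ (Fin b) → EuclideanSpace ℝ (Fin n)}
    (hΔ : ∀ u, Δ' (dι u.1, u.2) = Δ u) (hs : Function.Surjective Δ)
    (hι : Function.Injective dι) (hι0 : ∀ u, dι u 0 = 0)
    (hj : Function.Injective dj) (hj0 : ∀ u, dj u 0 = 0)
    (hB0 : ∀ u, dB u 0 = u 0) (hBj : ∀ u, dB (dj u) = dι (dp u)) (hMj : ∀ u, dM (dj u) = dq u)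
    {τ : Fin a ⊕ Fin b ≃ Fin d ⊕ Fin n} {ε : SignType} (hε : ε ≠ 0)
    {sZ : (Fin (d + 1) → EuclideanSpace ℝ (Fin (d + 1))) → SignType}
    {sB : (Fin (a + 1) → EuclideanSpace ℝ (Fin (a + 1))) → SignType}
    {sM : (Fin b → EuclideanSpace ℝ (Fin b)) → SignType}
    {sY : (Fin n → EuclideanSpace ℝ (Fin n)) → SignType}
    {sP : (Fin a → EuclideanSpace ℝ (Fin a)) → SignType}
    {sN : (Fin d → EuclideanSpace ℝ (Fin d)) → SignType}
    (hZ : ∀ (e : Basis (Fin (a + 1)) ℝ (EuclideanSpace ℝ (Fin (a + 1))))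
      (c : Basis (Fin b) ℝ (EuclideanSpace ℝ (Fin b)))
      (w : Basis (Fin (d + 1)) ℝ (EuclideanSpace ℝ (Fin (d + 1))))
      (y : Basis (Fin n) ℝ (EuclideanSpace ℝ (Fin n)))
      (s : Fin n → EuclideanSpace ℝ (Fin (a + 1)) × EuclideanSpace ℝ (Fin b)),
      (∀ j, Δ' (s j) = y j) → sZ w * sY y * SignType.sign ((e.prod c).det
        (Sum.elim (fun i => (dB (w i), dM (w i))) s ∘ extendEquiv τ)) = ε * (sB e * sM c))
    (hN : ∀ (e : Basis (Fin a) ℝ (EuclideanSpace ℝ (Fin a)))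
      (c : Basis (Fin b) ℝ (EuclideanSpace ℝ (Fin b)))
      (w : Basis (Fin d) ℝ (EuclideanSpace ℝ (Fin d)))
      (y : Basis (Fin n) ℝ (EuclideanSpace ℝ (Fin n)))
      (s : Fin n → EuclideanSpace ℝ (Fin a) × EuclideanSpace ℝ (Fin b)),
      (∀ j, Δ (s j) = y j) → sN w * sY y * SignType.sign ((e.prod c).det
        (Sum.elim (fun i => (dp (w i), dq (w i))) s ∘ τ)) = ε * (sP e * sM c))
    (hP : ∀ ν : EuclideanSpace ℝ (Fin (a + 1)), ν 0 < 0 → ∀ v,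
      sB (Fin.cons ν fun i => dι (v i)) = sP v)
    (hM0 : ∀ c : Basis (Fin b) ℝ (EuclideanSpace ℝ (Fin b)), sM c ≠ 0)
    (hB0' : ∀ c : Basis (Fin (a + 1)) ℝ (EuclideanSpace ℝ (Fin (a + 1))), sB c ≠ 0)
    (hZ0 : ∀ w, sZ w ≠ 0 → LinearIndependent ℝ w) (hN0 : ∀ w, sN w ≠ 0 → LinearIndependent ℝ w)
    {ν : EuclideanSpace ℝ (Fin (d + 1))} (hν : ν 0 < 0) (w : Fin d → EuclideanSpace ℝ (Fin d)) :
    sZ (Fin.cons ν fun i => dj (w i)) = sN w := by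
  by_cases hw : LinearIndependent ℝ w
  · obtain ⟨w, rfl⟩ := exists_basis_of_linearIndependent hw
    let e : Basis (Fin a) ℝ (EuclideanSpace ℝ (Fin a)) := (EuclideanSpace.basisFun _ ℝ).toBasis
    let c : Basis (Fin b) ℝ (EuclideanSpace ℝ (Fin b)) := (EuclideanSpace.basisFun _ ℝ).toBasis
    let y : Basis (Fin n) ℝ (EuclideanSpace ℝ (Fin n)) := (EuclideanSpace.basisFun _ ℝ).toBasis
    choose s hs using fun i => hs (y i)
    have hwi : LinearIndependent ℝ fun i => dj (w i) :=
      w.linearIndependent.map' dj.toLinearMap (LinearMap.ker_eq_bot.2 hj)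
    have hei : LinearIndependent ℝ fun i => dι (e i) :=
      e.linearIndependent.map' dι.toLinearMap (LinearMap.ker_eq_bot.2 hι)
    have hμ : dB ν 0 < 0 := by rwa [hB0]
    obtain ⟨w', hw'⟩ := exists_basis_of_linearIndependent
      (linearIndependent_cons hwi (fun i => hj0 _) hν.ne)
    -- The frame of `B` begins with `dB ν`, which is again outward pointing since `dB` preserves
    -- coordinate `0`. With matching first vectors the determinants for `B` and for its boundary
    -- agree, so the two sign relations can be compared.
    obtain ⟨e', he'⟩ := exists_basis_of_linearIndependent
      (linearIndependent_cons hei (fun i => hι0 _) hμ.ne)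
    have k1 := hZ e' c w' y (fun i => (dι (s i).1, (s i).2)) fun i => (hΔ _).trans (hs i)
    have k2 := hN e c w y s hs
    have k3 := hP (dB ν) hμ e
    have k4 := det_extendEquiv e e' c dι.toLinearMap (fun i => by rw [he']; rfl) τ
      (w := fun i => (dp (w i), dq (w i))) (s := s) (w' := fun i => (dB (w' i), dM (w' i)))
      (s' := fun i => (dι (s i).1, (s i).2)) (by rw [hw', he']; rfl)
      (fun i => by
        rw [hw']
        exact Prod.ext (hBj (w i)) (hMj (w i)))
      (fun _ => rfl)
    rw [← he'] at k3
    rw [k4, k3, ← k2, mul_assoc, mul_assoc] at k1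
    have h0 : ε * (sP e * sM c) ≠ 0 := by
      rw [← k3]
      exact mul_ne_zero hε (mul_ne_zero (hB0' _) (hM0 _))
    rw [← k2, mul_assoc] at h0
    rw [← hw']
    exact mul_right_cancel₀ (right_ne_zero_of_mul h0) k1
  -- Dependent families have sign zero on both sides.
  · have h1 : sN w = 0 := by
      by_contra h
      exact hw (hN0 w h)
    rw [h1]
    by_contra h
    have h2 := (linearIndependent_finCons.1 (hZ0 _ h)).1
    exact hw (LinearIndependent.of_comp dj.toLinearMap h2)

/-- The fibre product of an oriented manifold with boundary with an oriented manifold. -/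
theorem Filling.exists_fibreProduct {a b d n : ℕ} {P M Z : Type} {Y : Type*}
    [TopologicalSpace P] [ChartedSpace (EuclideanSpace ℝ (Fin a)) P] [IsManifold (𝓡 a) ∞ P]
    [TopologicalSpace M] [T2Space M] [SecondCountableTopology M]
    [ChartedSpace (EuclideanSpace ℝ (Fin b)) M] [IsManifold (𝓡 b) ∞ M]
    [TopologicalSpace Z] [ChartedSpace (EuclideanSpace ℝ (Fin d)) Z] [IsManifold (𝓡 d) ∞ Z]
    [TopologicalSpace Y] [T2Space Y] [ChartedSpace (EuclideanSpace ℝ (Fin n)) Y]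
    [IsManifold (𝓡 n) ∞ Y]
    {σ : P → (Fin a → EuclideanSpace ℝ (Fin a)) → SignType} (W : Filling a P σ)
    (oM : ManifoldOrientation (𝓡 b) M b) (oY : ManifoldOrientation (𝓡 n) Y n)
    {F : W.B → Y} {f : M → Y} (hF : ContMDiff (𝓡∂ (a + 1)) (𝓡 n) ∞ F)
    (hf : ContMDiff (𝓡 b) (𝓡 n) ∞ f) (hT : Trans (𝓡∂ (a + 1)) (𝓡 b) (𝓡 n) F f)
    (hT' : Trans (𝓡 a) (𝓡 b) (𝓡 n) (F ∘ W.ι) f) (hd : d + n = a + b)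
    {pr₀ : Z → P} {pr₁ : Z → M} (h₀ : ContMDiff (𝓡 d) (𝓡 a) ∞ pr₀)
    (h₁ : ContMDiff (𝓡 d) (𝓡 b) ∞ pr₁) (he : IsClosedEmbedding fun z => (pr₀ z, pr₁ z))
    (hi : ∀ z, Function.Injective ((mdiff (𝓡 d) (𝓡 a) pr₀ z).prod (mdiff (𝓡 d) (𝓡 b) pr₁ z)))
    (hr : range (fun z => (pr₀ z, pr₁ z)) = {q | F (W.ι q.1) = f q.2})
    {τ : Fin a ⊕ Fin b ≃ Fin d ⊕ Fin n} {ε : SignType} (hε : ε ≠ 0)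
    {σ' : Z → (Fin d → EuclideanSpace ℝ (Fin d)) → SignType}
    (hσ0 : ∀ z w, ¬ LinearIndependent ℝ w → σ' z w = 0)
    (hσ : ∀ z (e : Basis (Fin a) ℝ (EuclideanSpace ℝ (Fin a)))
      (c : Basis (Fin b) ℝ (EuclideanSpace ℝ (Fin b)))
      (w : Basis (Fin d) ℝ (EuclideanSpace ℝ (Fin d)))
      (y : Basis (Fin n) ℝ (EuclideanSpace ℝ (Fin n)))
      (s : Fin n → EuclideanSpace ℝ (Fin a) × EuclideanSpace ℝ (Fin b)),
      (∀ j, jointDiff (𝓡 a) (𝓡 b) (𝓡 n) (F ∘ W.ι) f (pr₀ z) (pr₁ z) (s j) = y j) →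
      σ' z w * oY.frameSign (f (pr₁ z)) y * SignType.sign ((e.prod c).det
        (Sum.elim (fun i => (mdiff (𝓡 d) (𝓡 a) pr₀ z (w i), mdiff (𝓡 d) (𝓡 b) pr₁ z (w i))) s
          ∘ τ)) = ε * (σ (pr₀ z) e * oM.frameSign (pr₁ z) c)) :
    ∃ (W' : Filling d Z σ') (pB : W'.B → W.B) (pM : W'.B → M),
      ContMDiff (𝓡∂ (d + 1)) (𝓡∂ (a + 1)) ∞ pB ∧ ContMDiff (𝓡∂ (d + 1)) (𝓡 b) ∞ pM ∧
      IsClosedEmbedding (fun z => (pB z, pM z)) ∧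
      range (fun z => (pB z, pM z)) = {q | F q.1 = f q.2} ∧
      (∀ z, pB (W'.ι z) = W.ι (pr₀ z)) ∧ ∀ z, pM (W'.ι z) = pr₁ z := by
  have hcomp := mdiff_comp hF W.smooth
  have hlift : ∀ p q u, jointDiff (𝓡∂ (a + 1)) (𝓡 b) (𝓡 n) F f (W.ι p) q
      (mdiff (𝓡 a) (𝓡∂ (a + 1)) W.ι p u.1, u.2) =
      jointDiff (𝓡 a) (𝓡 b) (𝓡 n) (F ∘ W.ι) f p q u := fun p q u =>
    congrArg (fun A : EuclideanSpace ℝ (Fin a) →L[ℝ] EuclideanSpace ℝ (Fin n) =>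
      A u.1 - mdiff (𝓡 b) (𝓡 n) f q u.2) (hcomp p).symm
  -- Transversality of the boundary map provides solutions that are tangent to the boundary, as the
  -- charts at boundary points require.
  obtain ⟨c, hc⟩ := hT.exists_submanifoldAtlas_halfSpace hF hf (by
    rintro p q hpq hp v
    obtain ⟨p, rfl⟩ := W.exists_eq hp
    obtain ⟨u, hu⟩ := hT' p q hpq v
    exact ⟨(mdiff (𝓡 a) (𝓡∂ (a + 1)) W.ι p u.1, u.2), W.mdiff_apply_zero p u.1,
      (hlift p q u).trans hu⟩) (d := d) (by simpa using hd)
  have hbd : ∀ z, (𝓡∂ (d + 1)).IsBoundaryPoint z ↔ (𝓡∂ (a + 1)).IsBoundaryPoint (c.fst z) := by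
    intro z
    have h1 := c.isInteriorPoint_iff z
    rw [← not_iff_not, ← ModelWithCorners.isInteriorPoint_iff_not_isBoundaryPoint,
      ← ModelWithCorners.isInteriorPoint_iff_not_isBoundaryPoint, h1]
    change c.val z ∈ ((𝓡∂ (a + 1)).prod (𝓡 b)).interior (W.B × M) ↔ _
    rw [ModelWithCorners.interior_prod]
    exact ⟨fun h => h.1, fun h => ⟨h, BoundarylessManifold.isInteriorPoint⟩⟩
  have hval : ∀ z : c.Carrier, F (c.fst z) = f (c.snd z) := fun z => c.val_mem z
  obtain ⟨oZ, hoZ⟩ := exists_fibreProduct_orientation (by simp) (by simp) (by simp) (by simp)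
    W.orientation oM oY (extendEquiv τ) (h := fun z => f (c.snd z)) (hF.of_le (by simp))
    (hf.of_le (by simp))
    (c.contMDiff_fst.of_le (by simp)) (c.contMDiff_snd.of_le (by simp)) (fun z => (hval z).symm)
    (fun _ => rfl) c.prod_mdiff_injective (fun z => hT _ _ (hval z)) (by omega) hε
  have hmem : ∀ z, F (W.ι (pr₀ z)) = f (pr₁ z) := fun z => by
    have : (pr₀ z, pr₁ z) ∈ {q : P × M | F (W.ι q.1) = f q.2} := hr ▸ mem_range_self z
    exact this
  let j : Z → c.Carrier := fun z => c.mk (W.ι (pr₀ z), pr₁ z) (hmem z)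
  have hj : ContMDiff (𝓡 d) (𝓡∂ (d + 1)) ∞ j :=
    c.contMDiff_iff.2 ((W.smooth.comp h₀).prodMk h₁)
  have hjb : ∀ z, (𝓡∂ (d + 1)).IsBoundaryPoint (j z) := fun z =>
    (hbd _).2 (W.isBoundaryPoint (pr₀ z))
  have hj1 : ∀ z w, mdiff (𝓡∂ (d + 1)) (𝓡∂ (a + 1)) c.fst (j z) (mdiff (𝓡 d) (𝓡∂ (d + 1)) j z w) =
      mdiff (𝓡 a) (𝓡∂ (a + 1)) W.ι (pr₀ z) (mdiff (𝓡 d) (𝓡 a) pr₀ z w) := fun z w =>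
    (mdiff_comp_apply c.contMDiff_fst hj z w).symm.trans (mdiff_comp_apply W.smooth h₀ z w)
  have hj2 : ∀ z w, mdiff (𝓡∂ (d + 1)) (𝓡 b) c.snd (j z) (mdiff (𝓡 d) (𝓡∂ (d + 1)) j z w) =
      mdiff (𝓡 d) (𝓡 b) pr₁ z w := fun z w =>
    (mdiff_comp_apply c.contMDiff_snd hj z w).symm
  have hji : ∀ z, Function.Injective (mdiff (𝓡 d) (𝓡∂ (d + 1)) j z) := by
    intro z u w huw
    refine hi z (Prod.ext ?_ ?_)
    · exact W.mdiff_injective _ ((hj1 z u).symm.trans ((congrArg _ huw).trans (hj1 z w)))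
    · exact (hj2 z u).symm.trans ((congrArg _ huw).trans (hj2 z w))
  have hj0 : ∀ z w, mdiff (𝓡 d) (𝓡∂ (d + 1)) j z w 0 = 0 := fun z w =>
    mfderiv_apply_zero_of_isBoundaryPoint (hj.mdifferentiable (by simp) z) hjb w
  -- The charts were chosen with the boundary coordinate of `W.B` as their own, so the projection to
  -- `W.B` preserves normal components.
  have hν : ∀ z : c.Carrier, (𝓡∂ (a + 1)).IsBoundaryPoint (c.fst z) → ∀ ν,
      mdiff (𝓡∂ (d + 1)) (𝓡∂ (a + 1)) c.fst z ν 0 = ν 0 := by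
    intro z hz ν
    refine mdiff_apply_zero_of_chart (c.contMDiff_fst.mdifferentiable (by simp) z) ?_ ν
    filter_upwards [(chartAt (EuclideanHalfSpace (d + 1)) z).open_source.mem_nhds
      (mem_chart_source _ z)] with z' hz'
    exact hc ⟨c.val z, c.val_mem z⟩ hz (c.val z') hz' (c.val_mem z')
  have hcl : IsClosed {q : W.B × M | F q.1 = f q.2} :=
    isClosed_eq (hF.continuous.comp continuous_fst) (hf.continuous.comp continuous_snd)
  refine ⟨{ B := c.Carrier
            orientation := oZ
            ι := j
            isSmoothEmbedding := ⟨isImmersion_of_injective_boundary hj hjb hji, ?_⟩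
            range_eq := ?_
            orient := ?_ }, c.fst, c.snd, c.contMDiff_fst, c.contMDiff_snd,
    ⟨c.isEmbedding_val, ?_⟩, c.range_val, fun z => rfl, fun z => rfl⟩
  · refine IsEmbedding.of_comp hj.continuous c.isEmbedding_val.continuous ?_
    exact (W.isSmoothEmbedding.isEmbedding.prodMap IsEmbedding.id).comp he.isEmbedding
  · refine Subset.antisymm ?_ fun z hz => ?_
    · rintro _ ⟨z, rfl⟩
      exact hjb z
    · obtain ⟨p, hp⟩ := W.exists_eq ((hbd z).1 hz)
      have h1 : (p, c.snd z) ∈ {q : P × M | F (W.ι q.1) = f q.2} :=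
        (congrArg F hp).trans (hval z)
      rw [← hr] at h1
      obtain ⟨z', hz'⟩ := h1
      refine ⟨z', c.val_injective (Prod.ext ?_ ?_)⟩
      · exact (congrArg W.ι (congrArg Prod.fst hz')).trans hp
      · exact (congrArg Prod.snd hz' :)
  · intro z ν hν0 w
    -- The boundary orientation is pure linear algebra at each point: both fibre products carry the
    -- same sign `ε`, and their index bijections correspond under `extendEquiv`.
    refine sign_boundary_fibre (hlift (pr₀ z) (pr₁ z)) (hT' _ _ (hmem z)) (W.mdiff_injective _)
      (W.mdiff_apply_zero _) (hji z) (hj0 z) (hν (j z) (W.isBoundaryPoint (pr₀ z))) (hj1 z) (hj2 z)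
      (τ := τ) hε (sB := W.orientation.frameSign (W.ι (pr₀ z))) (sM := oM.frameSign (pr₁ z))
      (sY := oY.frameSign (f (pr₁ z))) (hoZ (j z)) (hσ z) (W.orient (pr₀ z))
      (oM.frameSign_ne_zero _) (W.orientation.frameSign_ne_zero _)
      (fun w hw => oZ.linearIndependent_of_frameSign_ne_zero hw)
      (fun w hw => by_contra fun h => hw (hσ0 z w h)) hν0 w
  · rw [show range (fun z => (c.fst z, c.snd z)) = _ from c.range_val]
    exact hcl

end Pseudocycles

end

noncomputable section
namespace Pseudocycles

open Module Filter

/-! ### Operations on fillings -/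

section Sums

variable {E E' H H' A B C : Type*} [NormedAddCommGroup E] [NormedSpace ℝ E]
  [NormedAddCommGroup E'] [NormedSpace ℝ E'] [TopologicalSpace H] [TopologicalSpace H']
  {I : ModelWithCorners ℝ E H} {J : ModelWithCorners ℝ E' H'} [TopologicalSpace A]
  [TopologicalSpace B] [TopologicalSpace C] [ChartedSpace H A] [ChartedSpace H B]
  [ChartedSpace H' C]

theorem mdiff_sumInl (p : A) : mdiff I I (Sum.inl : A → A ⊕ B) p = ContinuousLinearMap.id ℝ E :=
  mfderiv_sumInl (p := Sum.inl p)

theorem mdiff_sumInr (p : B) : mdiff I I (Sum.inr : B → A ⊕ B) p = ContinuousLinearMap.id ℝ E :=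
  mfderiv_sumInr (q' := p)

theorem ManifoldOrientation.exists_sum_frameSign [FiniteDimensional ℝ E] {k : ℕ} [IsManifold I 1 A]
    [IsManifold I 1 B] (hk : finrank ℝ E = k) (o : ManifoldOrientation I A k)
    (o' : ManifoldOrientation I B k) :
    ∃ oS : ManifoldOrientation I (A ⊕ B) k,
      (∀ x (v : Fin k → E), oS.frameSign (Sum.inl x) v = o.frameSign x v) ∧
      ∀ x (v : Fin k → E), oS.frameSign (Sum.inr x) v = o'.frameSign x v := by
  obtain ⟨oS, h1, h2⟩ := ManifoldOrientation.exists_sum hk o o'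
  refine ⟨oS, fun x v => (Eq.trans ?_ (h1 x v)), fun x v => (Eq.trans ?_ (h2 x v))⟩
  · exact congrArg (fun A : E →L[ℝ] E => ManifoldOrientation.frameSign oS (Sum.inl x)
      fun i => A (v i)) (mdiff_sumInl (I := I) (B := B) x).symm
  · exact congrArg (fun A : E →L[ℝ] E => ManifoldOrientation.frameSign oS (Sum.inr x)
      fun i => A (v i)) (mdiff_sumInr (I := I) (A := A) x).symm

theorem mdiff_comp_inl {h : A ⊕ B → C} (hh : ContMDiff I J ∞ h) (p : A) :
    mdiff I J (fun q => h (Sum.inl q)) p = mdiff I J h (Sum.inl p) := by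
  refine (mdiff_comp hh ContMDiff.inl p).trans ?_
  rw [mdiff_sumInl]
  rfl

theorem mdiff_comp_inr {h : A ⊕ B → C} (hh : ContMDiff I J ∞ h) (p : B) :
    mdiff I J (fun q => h (Sum.inr q)) p = mdiff I J h (Sum.inr p) := by
  refine (mdiff_comp hh ContMDiff.inr p).trans ?_
  rw [mdiff_sumInr]
  rfl

end Sums

section Topology

variable {A B C D : Type*} [TopologicalSpace A] [TopologicalSpace B] [TopologicalSpace C]
  [TopologicalSpace D]

theorem isClosedEmbedding_sumMap {f : A → C} {g : B → D} (hf : IsClosedEmbedding f)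
    (hg : IsClosedEmbedding g) : IsClosedEmbedding (Sum.map f g) :=
  .of_continuous_injective_isClosedMap (hf.continuous.sumMap hg.continuous)
    (hf.injective.sumMap hg.injective) (hf.isClosedMap.sumMap hg.isClosedMap)

theorem isClosedEmbedding_sum_prod {Z₀ Z₁ : Type*} [TopologicalSpace Z₀] [TopologicalSpace Z₁]
    {p₀ : Z₀ → A} {p₁ : Z₁ → B} {m₀ : Z₀ → C} {m₁ : Z₁ → C}
    (h₀ : IsClosedEmbedding fun z => (p₀ z, m₀ z)) (h₁ : IsClosedEmbedding fun z => (p₁ z, m₁ z)) :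
    IsClosedEmbedding fun z : Z₀ ⊕ Z₁ => (Sum.map p₀ p₁ z, Sum.elim m₀ m₁ z) := by
  have h := (Homeomorph.sumProdDistrib (X := A) (Y := B) (Z := C)).symm.isClosedEmbedding.comp
    (isClosedEmbedding_sumMap h₀ h₁)
  convert h using 1
  ext1 z
  rcases z with z | z <;> rfl

end Topology

/-- The signs of boundary frames of a cobordism. -/
def cobSign {d : ℕ} {A B : Type*} [TopologicalSpace A] [TopologicalSpace B]
    [ChartedSpace (EuclideanSpace ℝ (Fin d)) A] [ChartedSpace (EuclideanSpace ℝ (Fin d)) B]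
    [IsManifold (𝓡 d) 1 A] [IsManifold (𝓡 d) 1 B] (o₀ : ManifoldOrientation (𝓡 d) A d)
    (o₁ : ManifoldOrientation (𝓡 d) B d) : A ⊕ B → (Fin d → EuclideanSpace ℝ (Fin d)) → SignType :=
  Sum.elim (fun p v => -o₀.frameSign p v) (fun p v => o₁.frameSign p v)

section Filling

variable {d : ℕ} {P P' : Type} [TopologicalSpace P] [ChartedSpace (EuclideanSpace ℝ (Fin d)) P]
  [TopologicalSpace P'] [ChartedSpace (EuclideanSpace ℝ (Fin d)) P']
  {σ : P → (Fin d → EuclideanSpace ℝ (Fin d)) → SignType}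
  {σ' : P' → (Fin d → EuclideanSpace ℝ (Fin d)) → SignType}

theorem injective_mdiff_diffeo (Φ : P' ≃ₘ^∞⟮𝓡 d, 𝓡 d⟯ P) (p : P') :
    Function.Injective (mdiff (𝓡 d) (𝓡 d) Φ p) :=
  (Φ.mfderivToContinuousLinearEquiv (by simp) p).injective

theorem Filling.isClosedEmbedding (W : Filling d P σ) : IsClosedEmbedding W.ι :=
  ⟨W.isSmoothEmbedding.isEmbedding, by
    rw [W.range_eq]
    exact ModelWithCorners.isClosed_boundary (n := ∞) (by simp)⟩

variable [IsManifold (𝓡 d) ∞ P] [IsManifold (𝓡 d) ∞ P']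

/-- A filling of a diffeomorphic manifold. -/
def Filling.reindex (W : Filling d P σ) (Φ : P' ≃ₘ^∞⟮𝓡 d, 𝓡 d⟯ P)
    (h : ∀ p v, σ (Φ p) (fun i => mdiff (𝓡 d) (𝓡 d) Φ p (v i)) = σ' p v) : Filling d P' σ' where
  B := W.B
  orientation := W.orientation
  ι := W.ι ∘ Φ
  isSmoothEmbedding := by
    refine ⟨isImmersion_of_injective_boundary (W.smooth.comp Φ.contMDiff)
      (fun p => W.isBoundaryPoint _) fun p => ?_,
      W.isSmoothEmbedding.isEmbedding.comp Φ.toHomeomorph.isEmbedding⟩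
    have := mdiff_comp W.smooth Φ.contMDiff p
    change Function.Injective (mdiff (𝓡 d) (𝓡∂ (d + 1)) (W.ι ∘ Φ) p)
    rw [this]
    exact (W.mdiff_injective _).comp (injective_mdiff_diffeo Φ p)
  range_eq := (Φ.surjective.range_comp W.ι).trans W.range_eq
  orient p ν hν v := by
    rw [← h, ← W.orient _ ν hν, mdiff_comp W.smooth Φ.contMDiff p]
    rfl

/-- The disjoint union of two fillings. -/
def Filling.sum (W : Filling d P σ) (W' : Filling d P' σ') :
    Filling d (P ⊕ P') (Sum.elim σ σ') where
  B := W.B ⊕ W'.B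
  orientation := (W.orientation.exists_sum_frameSign (by simp) W'.orientation).choose
  ι := Sum.map W.ι W'.ι
  isSmoothEmbedding := by
    have hc : ContMDiff (𝓡 d) (𝓡∂ (d + 1)) ∞ (Sum.map W.ι W'.ι) := W.smooth.sumMap W'.smooth
    refine ⟨isImmersion_of_injective_boundary hc ?_ ?_,
      (isClosedEmbedding_sumMap W.isClosedEmbedding W'.isClosedEmbedding).isEmbedding⟩
    · change ∀ y, Sum.map W.ι W'.ι y ∈ (𝓡∂ (d + 1)).boundary (W.B ⊕ W'.B)
      rw [ModelWithCorners.boundary_disjointUnion]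
      rintro (y | y)
      · exact Or.inl ⟨_, W.isBoundaryPoint y, rfl⟩
      · exact Or.inr ⟨_, W'.isBoundaryPoint y, rfl⟩
    · rintro (y | y)
      · change Function.Injective (mdiff (𝓡 d) (𝓡∂ (d + 1)) (Sum.map W.ι W'.ι) (Sum.inl y))
        rw [← mdiff_comp_inl hc]
        have := mdiff_comp (ContMDiff.inl (I := 𝓡∂ (d + 1)) (M := W.B) (M' := W'.B)) W.smooth y
        refine this.symm ▸ ?_
        rw [mdiff_sumInl]
        exact W.mdiff_injective y
      · change Function.Injective (mdiff (𝓡 d) (𝓡∂ (d + 1)) (Sum.map W.ι W'.ι) (Sum.inr y))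
        rw [← mdiff_comp_inr hc]
        have := mdiff_comp (ContMDiff.inr (I := 𝓡∂ (d + 1)) (M := W.B) (M' := W'.B)) W'.smooth y
        refine this.symm ▸ ?_
        rw [mdiff_sumInr]
        exact W'.mdiff_injective y
  range_eq := by
    rw [ModelWithCorners.boundary_disjointUnion, ← W.range_eq, ← W'.range_eq, ← range_comp,
      ← range_comp]
    ext x
    simp
  orient := by
    have hc : ContMDiff (𝓡 d) (𝓡∂ (d + 1)) ∞ (Sum.map W.ι W'.ι) := W.smooth.sumMap W'.smooth
    obtain ⟨h1, h2⟩ := (W.orientation.exists_sum_frameSign (by simp) W'.orientation).choose_spec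
    rintro (p | p) ν hν v
    · rw [← mdiff_comp_inl hc]
      have h3 := mdiff_comp (ContMDiff.inl (I := 𝓡∂ (d + 1)) (M := W.B) (M' := W'.B)) W.smooth p
      rw [mdiff_sumInl] at h3
      exact (congrArg (fun A : EuclideanSpace ℝ (Fin d) →L[ℝ] EuclideanSpace ℝ (Fin (d + 1)) =>
        ManifoldOrientation.frameSign _ _ (Fin.cons ν fun i => A (v i) :
          Fin (d + 1) → EuclideanSpace ℝ (Fin (d + 1)))) h3).trans
          ((h1 (W.ι p) _).trans (W.orient p ν hν v))
    · rw [← mdiff_comp_inr hc]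
      have h3 := mdiff_comp (ContMDiff.inr (I := 𝓡∂ (d + 1)) (M := W.B) (M' := W'.B)) W'.smooth p
      rw [mdiff_sumInr] at h3
      exact (congrArg (fun A : EuclideanSpace ℝ (Fin d) →L[ℝ] EuclideanSpace ℝ (Fin (d + 1)) =>
        ManifoldOrientation.frameSign _ _ (Fin.cons ν fun i => A (v i) :
          Fin (d + 1) → EuclideanSpace ℝ (Fin (d + 1)))) h3).trans
          ((h2 (W'.ι p) _).trans (W'.orient p ν hν v))

end Filling

section Interval

instance : ChartedSpace (EuclideanHalfSpace (0 + 1)) unitInterval :=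
  inferInstanceAs (ChartedSpace (EuclideanHalfSpace 1) (Icc (0 : ℝ) 1))

instance : IsManifold (𝓡∂ (0 + 1)) ∞ unitInterval :=
  inferInstanceAs (IsManifold (𝓡∂ 1) ∞ (Icc (0 : ℝ) 1))

/-- The preferred chart is `t` at points below `1` and `1 - t` at the right end point, whence the
two signs. -/
theorem mdiff_coe_unitInterval (z : unitInterval) (ν : EuclideanSpace ℝ (Fin (0 + 1))) :
    mdiff (𝓡∂ (0 + 1)) 𝓘(ℝ, ℝ) (Subtype.val : unitInterval → ℝ) z ν =
      if z.1 < 1 then ν 0 else -ν 0 := by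
  have h := hasMFDerivAt_extChartAt_zero (m := 0) z
  have hc : HasMFDerivAt (𝓡∂ (0 + 1)) 𝓘(ℝ, ℝ) (Subtype.val : unitInterval → ℝ) z
      (mdiff (𝓡∂ (0 + 1)) 𝓘(ℝ, ℝ) (Subtype.val : unitInterval → ℝ) z) :=
    ((contMDiff_subtypeVal_Icc (n := ∞)).mdifferentiableAt (by simp)).hasMFDerivAt
  split_ifs with hz
  · have h1 : (fun z' => extChartAt (𝓡∂ (0 + 1)) z z' 0) = (Subtype.val : unitInterval → ℝ) := by
      ext z'
      rw [extChartAt, show chartAt (EuclideanHalfSpace (0 + 1)) z = IccLeftChart 0 1 from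
        Icc_chartedSpaceChartAt_of_le_top hz]
      exact sub_zero _
    rw [h1] at h
    exact congrArg (fun A : EuclideanSpace ℝ (Fin (0 + 1)) →L[ℝ] ℝ => A ν) (hasMFDerivAt_unique hc h)
  · have h1 : (fun z' => extChartAt (𝓡∂ (0 + 1)) z z' 0) = fun z' : unitInterval => 1 - z'.1 := by
      ext z'
      rw [extChartAt, show chartAt (EuclideanHalfSpace (0 + 1)) z = IccRightChart 0 1 from
        Icc_chartedSpaceChartAt_of_top_le (not_lt.1 hz)]
      rfl
    rw [h1] at h
    have h2 : HasMFDerivAt 𝓘(ℝ, ℝ) 𝓘(ℝ, ℝ) (fun t : ℝ => 1 - t) z.1 (-ContinuousLinearMap.id ℝ ℝ) :=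
      ((hasFDerivAt_id z.1).const_sub 1).hasMFDerivAt
    have h3 := hasMFDerivAt_unique (h2.comp z hc) h
    have h4 : -(mdiff (𝓡∂ (0 + 1)) 𝓘(ℝ, ℝ) (Subtype.val : unitInterval → ℝ) z ν) = ν 0 :=
      congrArg (fun A : EuclideanSpace ℝ (Fin (0 + 1)) →L[ℝ] ℝ => A ν) h3
    rw [← h4, neg_neg]

theorem exists_orientation_point :
    ∃ o : ManifoldOrientation (𝓡 0) (EuclideanSpace ℝ (Fin 0)) 0, ∀ p v, o.frameSign p v = 1 := by
  obtain ⟨o₀, h₀⟩ := exists_osign_eq (EuclideanSpace.basisFun (Fin 0) ℝ).toBasis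
    (ε := 1) (by decide)
  obtain ⟨o, ho⟩ := exists_orientation_modelSpace (E := EuclideanSpace ℝ (Fin 0)) (by simp) o₀
  refine ⟨o, fun p v => (ho p v).trans (Eq.trans ?_ h₀)⟩
  exact congrArg (osign o₀) (Subsingleton.elim _ _)

/-- With the orientation of the line, the outward direction is negative at `0` and positive at `1`;
these are exactly the signs of an incoming and an outgoing end. -/
theorem exists_filling_interval
    (o : ManifoldOrientation (𝓡 0) (EuclideanSpace ℝ (Fin 0)) 0) (ho : ∀ p v, o.frameSign p v = 1) :
    ∃ (W : Filling 0 (EuclideanSpace ℝ (Fin 0) ⊕ EuclideanSpace ℝ (Fin 0)) (cobSign o o))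
      (t : W.B → unitInterval), ContMDiff (𝓡∂ (0 + 1)) (𝓡∂ 1) ∞ t ∧ IsClosedEmbedding t ∧
      ∀ z, t (W.ι z) = Sum.elim (fun _ => 0) (fun _ => 1) z := by
  let bR : Basis (Fin 1) ℝ ℝ := Basis.singleton (Fin 1) ℝ
  obtain ⟨o₀, h₀⟩ := exists_osign_eq bR (ε := 1) (by decide)
  have h₀' : ∀ v, osign o₀ v = SignType.sign (v 0) := by
    intro v
    rw [osign_eq_mul bR, h₀, one_mul, Basis.det_apply, Matrix.det_unique, Basis.toMatrix_apply]
    simp [bR]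
  obtain ⟨oR, hoR⟩ := exists_orientation_modelSpace (E := ℝ) (by simp) o₀
  have hcoe : ContMDiff (𝓡∂ (0 + 1)) 𝓘(ℝ, ℝ) 1 (Subtype.val : unitInterval → ℝ) :=
    contMDiff_subtypeVal_Icc
  obtain ⟨oI, hoI⟩ := exists_pullback_orientation (J := 𝓡∂ (0 + 1)) (N := unitInterval) (by simp)
    (by simp) oR hcoe (fun z (v : ℝ) => by
      by_cases hz : z.1 < 1
      · exact ⟨EuclideanSpace.single 0 v, (mdiff_coe_unitInterval z _).trans (by simp [hz])⟩
      · exact ⟨EuclideanSpace.single 0 (-v), (mdiff_coe_unitInterval z _).trans (by simp [hz])⟩)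
  have hs : ∀ z (ν : EuclideanSpace ℝ (Fin (0 + 1))) (v : Fin 0 → EuclideanSpace ℝ (Fin (0 + 1))),
      oI.frameSign z (Fin.cons ν v : Fin (0 + 1) → EuclideanSpace ℝ (Fin (0 + 1))) =
        SignType.sign (if z.1 < 1 then ν 0 else -ν 0) := by
    intro z ν v
    rw [← mdiff_coe_unitInterval]
    exact (hoI z _).trans ((hoR _ _).trans (h₀' _))
  let j : EuclideanSpace ℝ (Fin 0) ⊕ EuclideanSpace ℝ (Fin 0) → unitInterval :=
    Sum.elim (fun _ => 0) (fun _ => 1)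
  have hj : ContMDiff (𝓡 0) (𝓡∂ (0 + 1)) ∞ j := contMDiff_const.sumElim contMDiff_const
  have hbd : (𝓡∂ (0 + 1)).boundary unitInterval = {0, 1} := boundary_Icc
  have hinj : Function.Injective j := by
    rintro (x | x) (y | y) h
    · exact congrArg _ (Subsingleton.elim _ _)
    · exact absurd h zero_ne_one
    · exact absurd h one_ne_zero
    · exact congrArg _ (Subsingleton.elim _ _)
  refine ⟨{ B := unitInterval
            orientation := oI
            ι := j
            isSmoothEmbedding := ⟨isImmersion_of_injective_boundary hj ?_ ?_, ?_⟩
            range_eq := ?_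
            orient := ?_ }, id, contMDiff_id, IsClosedEmbedding.id, fun _ => rfl⟩
  · change ∀ y, j y ∈ (𝓡∂ (0 + 1)).boundary unitInterval
    rw [hbd]
    rintro (y | y)
    · exact Or.inl rfl
    · exact Or.inr rfl
  · intro x
    exact Function.injective_of_subsingleton (α := EuclideanSpace ℝ (Fin 0)) _
  · exact (hj.continuous.isClosedEmbedding hinj).isEmbedding
  · rw [hbd, Set.Sum.elim_range]
    simp [Set.pair_comm]
  · rintro (p | p) ν hν v
    · refine (hs _ ν _).trans (Eq.trans ?_ (congrArg Neg.neg (ho p v)).symm)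
      rw [if_pos (show ((j (Sum.inl p) : unitInterval) : ℝ) < 1 from zero_lt_one), sign_neg hν]
    · refine (hs _ ν _).trans (Eq.trans ?_ (ho p v).symm)
      rw [if_neg (show ¬ ((j (Sum.inr p) : unitInterval) : ℝ) < 1 from lt_irrefl 1), sign_pos (neg_pos.2 hν)]

end Interval

end Pseudocycles

end

noncomputable section
namespace Pseudocycles

open Module Filter

/-! ### Cylinders -/

/-- The orientation bookkeeping of a product with a point: the first factor and the base of the
fibre product contribute empty blocks. -/
theorem det_prod_sumComm {b : ℕ} {V W : Type*} [AddCommGroup V] [Module ℝ V] [AddCommGroup W]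
    [Module ℝ W] (e : Basis (Fin 0) ℝ V) (c : Basis (Fin b) ℝ W) (w : Fin b → V × W)
    (s : Fin 0 → V × W) :
    (e.prod c).det (Sum.elim w s ∘ Equiv.sumComm (Fin 0) (Fin b)) = c.det fun i => (w i).2 := by
  have h : Sum.elim w s ∘ Equiv.sumComm (Fin 0) (Fin b) = Sum.elim s w := by
    ext1 x
    rcases x with x | x <;> rfl
  rw [h, det_sum_elim_of_triangular _ _ _ fun i => i.elim0, Matrix.det_isEmpty, one_mul,
    Basis.det_apply]
  congr 1

theorem isClosedEmbedding_const_prod {A B C : Type*} [TopologicalSpace A] [TopologicalSpace B]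
    [TopologicalSpace C] [Subsingleton C] (m : A ≃ₜ B) (x : C) :
    IsClosedEmbedding fun a => (x, m a) := by
  let _ : Unique C := ⟨⟨x⟩, fun _ => Subsingleton.elim _ _⟩
  exact (Homeomorph.uniqueProd C B).symm.isClosedEmbedding.comp m.isClosedEmbedding

variable {b : ℕ} {M Z₀ Z₁ : Type} [TopologicalSpace M] [T2Space M] [SecondCountableTopology M]
  [ChartedSpace (EuclideanSpace ℝ (Fin b)) M] [IsManifold (𝓡 b) ∞ M]
  [TopologicalSpace Z₀] [ChartedSpace (EuclideanSpace ℝ (Fin b)) Z₀] [IsManifold (𝓡 b) ∞ Z₀]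
  [TopologicalSpace Z₁] [ChartedSpace (EuclideanSpace ℝ (Fin b)) Z₁] [IsManifold (𝓡 b) ∞ Z₁]

/-- The cylinder is the fibre product of the interval and `M` over a point, so its smooth structure
and boundary orientation are instances of `Filling.exists_fibreProduct`. The ends are identified
with `M` by arbitrary orientation-preserving diffeomorphisms, which makes one construction serve for
reparametrisations too. -/
theorem exists_cylinder (oM : ManifoldOrientation (𝓡 b) M b) (o₀ : ManifoldOrientation (𝓡 b) Z₀ b)
    (o₁ : ManifoldOrientation (𝓡 b) Z₁ b) (m₀ : Z₀ ≃ₘ^∞⟮𝓡 b, 𝓡 b⟯ M) (m₁ : Z₁ ≃ₘ^∞⟮𝓡 b, 𝓡 b⟯ M)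
    (h₀ : ∀ z v, oM.frameSign (m₀ z) (fun i => mdiff (𝓡 b) (𝓡 b) m₀ z (v i)) = o₀.frameSign z v)
    (h₁ : ∀ z v, oM.frameSign (m₁ z) (fun i => mdiff (𝓡 b) (𝓡 b) m₁ z (v i)) = o₁.frameSign z v) :
    ∃ (W : Filling b (Z₀ ⊕ Z₁) (cobSign o₀ o₁)) (t : W.B → unitInterval) (m : W.B → M),
      ContMDiff (𝓡∂ (b + 1)) (𝓡∂ 1) ∞ t ∧ ContMDiff (𝓡∂ (b + 1)) (𝓡 b) ∞ m ∧
      IsClosedEmbedding (fun z => (t z, m z)) ∧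
      (∀ z, t (W.ι (Sum.inl z)) = 0 ∧ m (W.ι (Sum.inl z)) = m₀ z) ∧
      ∀ z, t (W.ι (Sum.inr z)) = 1 ∧ m (W.ι (Sum.inr z)) = m₁ z := by
  obtain ⟨o, ho⟩ := exists_orientation_point
  obtain ⟨V, t, ht, hte, hti⟩ := exists_filling_interval o ho
  have hm : ContMDiff (𝓡 b) (𝓡 b) ∞ (Sum.elim m₀ m₁) := m₀.contMDiff.sumElim m₁.contMDiff
  have hp : ContMDiff (𝓡 b) (𝓡 0) ∞ (Sum.map (fun _ => 0) (fun _ => 0) :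
      Z₀ ⊕ Z₁ → EuclideanSpace ℝ (Fin 0) ⊕ EuclideanSpace ℝ (Fin 0)) :=
    contMDiff_const.sumMap contMDiff_const
  have hsurj : ∀ {E F : Type} [NormedAddCommGroup E] [NormedSpace ℝ E] [NormedAddCommGroup F]
      [NormedSpace ℝ F] (A : E × F →L[ℝ] EuclideanSpace ℝ (Fin 0)), Function.Surjective A :=
    fun A y => ⟨0, Subsingleton.elim _ _⟩
  have hcl : IsClosedEmbedding fun z : Z₀ ⊕ Z₁ =>
      ((Sum.map (fun _ => 0) (fun _ => 0) z :
        EuclideanSpace ℝ (Fin 0) ⊕ EuclideanSpace ℝ (Fin 0)), Sum.elim m₀ m₁ z) :=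
    isClosedEmbedding_sum_prod (isClosedEmbedding_const_prod m₀.toHomeomorph _)
      (isClosedEmbedding_const_prod m₁.toHomeomorph _)
  have hinj : ∀ z, Function.Injective (mdiff (𝓡 b) (𝓡 b) (Sum.elim m₀ m₁) z) := by
    rintro (z | z)
    · rw [mdiff_sumElim_inl m₀.contMDiff m₁.contMDiff]
      exact injective_mdiff_diffeo m₀ z
    · rw [mdiff_sumElim_inr m₀.contMDiff m₁.contMDiff]
      exact injective_mdiff_diffeo m₁ z
  have hoM : ∀ z w, cobSign o₀ o₁ z w = (Sum.elim (fun _ => -1) (fun _ => 1) z : SignType) *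
      oM.frameSign (Sum.elim m₀ m₁ z) fun i => mdiff (𝓡 b) (𝓡 b) (Sum.elim m₀ m₁) z (w i) := by
    rintro (z | z) w
    · rw [mdiff_sumElim_inl m₀.contMDiff m₁.contMDiff]
      exact (congrArg Neg.neg (h₀ z w).symm).trans (neg_one_mul _).symm
    · rw [mdiff_sumElim_inr m₀.contMDiff m₁.contMDiff]
      exact (h₁ z w).symm.trans (one_mul _).symm
  obtain ⟨W, pB, m, hpB, hm', he, -, hi₀, hi₁⟩ := V.exists_fibreProduct (n := 0) (d := b)
    (Y := EuclideanSpace ℝ (Fin 0)) oM o (F := fun _ => 0) (f := fun _ => 0) contMDiff_const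
    contMDiff_const (fun _ _ _ => hsurj _) (fun _ _ _ => hsurj _) (by omega) hp hm hcl
    (fun z u v huv => hinj z (congrArg Prod.snd huv)) (by
      refine eq_univ_of_forall ?_ |>.trans (eq_univ_of_forall fun _ => rfl).symm
      rintro ⟨x | x, y⟩
      · exact ⟨Sum.inl (m₀.symm y), by simp [Subsingleton.elim x 0]⟩
      · exact ⟨Sum.inr (m₁.symm y), by simp [Subsingleton.elim x 0]⟩)
    (τ := Equiv.sumComm _ _) (ε := 1) (by decide) (σ' := cobSign o₀ o₁) (by
      rintro (z | z) w hw
      · by_contra h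
        exact hw (o₀.linearIndependent_of_frameSign_ne_zero fun h' => h
          ((congrArg Neg.neg h').trans neg_zero))
      · by_contra h
        exact hw (o₁.linearIndependent_of_frameSign_ne_zero h)) (by
      -- The base and the end points have sign `1` up to the sign of the end, so the relation only
      -- says that the sign of a frame and the sign of its determinant multiply as they should.
      intro z e c w y s _
      rw [det_prod_sumComm, hoM]
      have h1 := osign_eq_mul (V := EuclideanSpace ℝ (Fin b)) c (oM.orient (Sum.elim m₀ m₁ z))
        fun i => mdiff (𝓡 b) (𝓡 b) (Sum.elim m₀ m₁) z (w i)
      have h2 : oM.frameSign (Sum.elim m₀ m₁ z)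
        (fun i => mdiff (𝓡 b) (𝓡 b) (Sum.elim m₀ m₁) z (w i)) = oM.frameSign (Sum.elim m₀ m₁ z) c *
          SignType.sign (c.det fun i => mdiff (𝓡 b) (𝓡 b) (Sum.elim m₀ m₁) z (w i)) := h1
      have h3 : SignType.sign (c.det fun i => mdiff (𝓡 b) (𝓡 b) (Sum.elim m₀ m₁) z (w i)) ≠ 0 := by
        intro h
        rw [h, mul_zero] at h2
        have h4 := exists_basis_of_linearIndependent (w.linearIndependent.map'
          (mdiff (𝓡 b) (𝓡 b) (Sum.elim m₀ m₁) z).toLinearMap (LinearMap.ker_eq_bot.2 (hinj z)))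
        obtain ⟨w', hw'⟩ := h4
        exact oM.frameSign_ne_zero _ w' (by rw [hw']; exact h2)
      have h5 : o.frameSign 0 y = 1 := ho 0 y
      have h6 : cobSign o o (Sum.map (fun _ => 0) (fun _ => 0) z) e =
          (Sum.elim (fun _ => -1) (fun _ => 1) z : SignType) := by
        rcases z with z | z
        · exact congrArg Neg.neg (ho 0 e)
        · exact ho 0 e
      rw [h5, h6, h2]
      generalize SignType.sign (c.det fun i => mdiff (𝓡 b) (𝓡 b) (Sum.elim m₀ m₁) z (w i)) = x at *
      generalize oM.frameSign (Sum.elim m₀ m₁ z) c = y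
      generalize (Sum.elim (fun _ => -1) (fun _ => 1) z : SignType) = u
      clear h6 h5 h2 h1
      decide +revert)
  refine ⟨W, fun z => t (pB z), m, ht.comp hpB, hm', ?_, fun z => ⟨?_, hi₁ _⟩, fun z => ⟨?_, hi₁ _⟩⟩
  · exact (hte.prodMap IsClosedEmbedding.id).comp he
  · exact (congrArg t (hi₀ _)).trans (hti _)
  · exact (congrArg t (hi₀ _)).trans (hti _)

end Pseudocycles

end

noncomputable section
namespace Pseudocycles

open Module Filter

/-! ### The group of pseudocycles up to equivalence -/

section LimitSets

theorem isCompact_closure_range_sum {A B X : Type*} [TopologicalSpace X] {f : A ⊕ B → X}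
    (h₀ : IsCompact (closure (range fun a => f (Sum.inl a))))
    (h₁ : IsCompact (closure (range fun b => f (Sum.inr b)))) : IsCompact (closure (range f)) := by
  have : range f = range (fun a => f (Sum.inl a)) ∪ range fun b => f (Sum.inr b) := by
    conv_lhs => rw [← Sum.elim_comp_inl_inr f, Sum.elim_range]
    rfl
  rw [this, closure_union]
  exact h₀.union h₁

variable {A B C X : Type*} [TopologicalSpace A] [TopologicalSpace B] [TopologicalSpace C]
  [TopologicalSpace X]

theorem bd_eq_empty_of_isEmpty [IsEmpty A] (f : A → X) : Bd f = ∅ := by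
  have h := Bd_subset_closure_range f
  rwa [range_eq_empty, closure_empty, subset_empty_iff] at h

/-- An ultrafilter on a disjoint union lives on one of the summands, and compact sets of a summand
are compact in the union. -/
theorem bd_sum_subset {f : A ⊕ B → X} :
    Bd f ⊆ Bd (fun a => f (Sum.inl a)) ∪ Bd (fun b => f (Sum.inr b)) := by
  intro x hx
  obtain ⟨u, hu, hux⟩ := mem_bd_iff.1 hx
  have h : range Sum.inl ∪ range Sum.inr ∈ u := by
    rw [range_inl_union_range_inr]
    exact univ_mem
  rcases Ultrafilter.union_mem_iff.1 h with h | h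
  · left
    obtain ⟨v, hv⟩ : ∃ v : Ultrafilter A, v.map Sum.inl = u :=
      ⟨u.comap Sum.inl_injective h, Ultrafilter.coe_injective (by
        rw [Ultrafilter.coe_map, Ultrafilter.coe_comap]
        exact Filter.map_comap_of_mem h)⟩
    refine mem_bd_iff.2 ⟨v, fun s hs => ?_, by rw [← hv] at hux; exact hux⟩
    obtain ⟨K, hK, hKs⟩ := mem_cocompact.1 hs
    have h1 : (Sum.inl '' K)ᶜ ∈ (u : Filter (A ⊕ B)) :=
      hu (hK.image continuous_inl).compl_mem_cocompact
    rw [← hv] at h1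
    have h2 : Sum.inl ⁻¹' (Sum.inl '' K : Set (A ⊕ B))ᶜ ∈ (v : Filter A) := h1
    exact mem_of_superset h2 fun a ha => hKs fun hK' => ha ⟨a, hK', rfl⟩
  · right
    obtain ⟨v, hv⟩ : ∃ v : Ultrafilter B, v.map Sum.inr = u :=
      ⟨u.comap Sum.inr_injective h, Ultrafilter.coe_injective (by
        rw [Ultrafilter.coe_map, Ultrafilter.coe_comap]
        exact Filter.map_comap_of_mem h)⟩
    refine mem_bd_iff.2 ⟨v, fun s hs => ?_, by rw [← hv] at hux; exact hux⟩
    obtain ⟨K, hK, hKs⟩ := mem_cocompact.1 hs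
    have h1 : (Sum.inr '' K)ᶜ ∈ (u : Filter (A ⊕ B)) :=
      hu (hK.image continuous_inr).compl_mem_cocompact
    rw [← hv] at h1
    have h2 : Sum.inr ⁻¹' (Sum.inr '' K : Set (A ⊕ B))ᶜ ∈ (v : Filter B) := h1
    exact mem_of_superset h2 fun a ha => hKs fun hK' => ha ⟨a, hK', rfl⟩

end LimitSets

variable {n : ℕ} {X : Type*} [TopologicalSpace X] [ChartedSpace (EuclideanSpace ℝ (Fin n)) X] {k : ℤ}

attribute [instance] Cobordism.topB Cobordism.t2 Cobordism.secondCountable Cobordism.charted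
  Cobordism.manifold

/-- The filling that underlies a cobordism. -/
def Cobordism.filling {f₀ f₁ : Pseudocycle n X k} (C : Cobordism f₀ f₁) :
    Filling k.toNat (f₀.M ⊕ f₁.M) (cobSign f₀.orientation f₁.orientation) :=
  have hc := C.isSmoothEmbedding.contMDiff
  { B := C.B
    orientation := C.orientation
    ι := Sum.elim C.ι₀ C.ι₁
    isSmoothEmbedding := C.isSmoothEmbedding
    range_eq := C.range_eq
    orient := by
      rintro (p | p) ν hν v
      · rw [← mdiff_comp_inl hc]
        exact C.orient₀ p ν hν v
      · rw [← mdiff_comp_inr hc]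
        exact C.orient₁ p ν hν v }

theorem Cobordism.smooth_filling {f₀ f₁ : Pseudocycle n X k} (C : Cobordism f₀ f₁) :
    ContMDiff (𝓡∂ (k.toNat + 1)) (𝓡 n) ∞ (C.F : C.filling.B → X) := C.smooth

theorem Cobordism.map_ι {f₀ f₁ : Pseudocycle n X k} (C : Cobordism f₀ f₁) (z : f₀.M ⊕ f₁.M) :
    C.F (C.filling.ι z) = Sum.elim f₀.map f₁.map z := by
  rcases z with z | z
  · exact C.restrict₀ z
  · exact C.restrict₁ z

/-- The empty cobordism. It also settles negative dimensions, where `Int.toNat` would give wrong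
dimension counts. -/
theorem equivalent_of_isEmpty (f₀ f₁ : Pseudocycle n X k) (h₀ : IsEmpty f₀.M)
    (h₁ : IsEmpty f₁.M) : Equivalent f₀ f₁ := by
  let _ : ChartedSpace (EuclideanHalfSpace (k.toNat + 1)) Empty := ChartedSpace.empty _ _
  have _ : IsManifold (𝓡∂ (k.toNat + 1)) ∞ Empty := IsManifold.empty _
  exact ⟨{
    B := Empty
    isEmpty_of_neg := fun _ => inferInstance
    orientation := ⟨fun x => x.elim, fun x => x.elim⟩
    F := Empty.elim
    smooth := fun x => x.elim
    isCompact_closure := by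
      rw [range_eq_empty, closure_empty]
      exact isCompact_empty
    dim_bd := by
      rw [bd_eq_empty_of_isEmpty]
      exact dimAtMost_empty _
    ι₀ := fun p => (h₀.false p).elim
    ι₁ := fun p => (h₁.false p).elim
    isSmoothEmbedding := ⟨isImmersion_of_injective_boundary (fun x => isEmptyElim x)
      (fun x => isEmptyElim x) (fun x => isEmptyElim x), IsEmbedding.of_subsingleton _⟩
    range_eq := Subsingleton.elim _ _
    restrict₀ := fun p => (h₀.false p).elim
    restrict₁ := fun p => (h₁.false p).elim
    orient₀ := fun p => (h₀.false p).elim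
    orient₁ := fun p => (h₁.false p).elim }⟩

/-- Negative `k` is treated apart because a cobordism must then be empty, which a filling of
dimension `k.toNat + 1` need not be. -/
theorem equivalent_of_filling {f₀ f₁ : Pseudocycle n X k}
    (W : Filling k.toNat (f₀.M ⊕ f₁.M) (cobSign f₀.orientation f₁.orientation)) {F : W.B → X}
    (hF : ContMDiff (𝓡∂ (k.toNat + 1)) (𝓡 n) ∞ F) (hc : IsCompact (closure (range F)))
    (hd : DimAtMost n (k - 1) (Bd F)) (hι : ∀ z, F (W.ι z) = Sum.elim f₀.map f₁.map z) :
    Equivalent f₀ f₁ := by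
  by_cases hk : k < 0
  · exact equivalent_of_isEmpty _ _ (f₀.isEmpty_of_neg hk) (f₁.isEmpty_of_neg hk)
  have he : Sum.elim (fun p => W.ι (Sum.inl p)) (fun p => W.ι (Sum.inr p)) = W.ι :=
    Sum.elim_comp_inl_inr W.ι
  exact ⟨{
    B := W.B
    isEmpty_of_neg := fun h => (hk h).elim
    orientation := W.orientation
    F := F
    smooth := hF
    isCompact_closure := hc
    dim_bd := hd
    ι₀ := fun p => W.ι (Sum.inl p)
    ι₁ := fun p => W.ι (Sum.inr p)
    isSmoothEmbedding := by rw [he]; exact W.isSmoothEmbedding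
    range_eq := by rw [he]; exact W.range_eq
    restrict₀ := fun p => hι (Sum.inl p)
    restrict₁ := fun p => hι (Sum.inr p)
    orient₀ := by
      intro p ν hν v
      have h := W.orient (Sum.inl p) ν hν v
      rw [← mdiff_comp_inl W.smooth] at h
      exact h
    orient₁ := by
      intro p ν hν v
      have h := W.orient (Sum.inr p) ν hν v
      rw [← mdiff_comp_inr W.smooth] at h
      exact h }⟩

/-- The homotopy is defined for all real times, so that a covering `g` of `Bd f` gives a covering by
the boundaryless manifold `g.M × ℝ` of dimension `k - 2 + 1 = k - 1`. -/
theorem exists_cylinder_map [T2Space X] (f : Pseudocycle n X k) {Z₀ Z₁ : Type} [TopologicalSpace Z₀]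
    [ChartedSpace (EuclideanSpace ℝ (Fin k.toNat)) Z₀] [IsManifold (𝓡 k.toNat) ∞ Z₀]
    [TopologicalSpace Z₁] [ChartedSpace (EuclideanSpace ℝ (Fin k.toNat)) Z₁]
    [IsManifold (𝓡 k.toNat) ∞ Z₁]
    (o₀ : ManifoldOrientation (𝓡 k.toNat) Z₀ k.toNat)
    (o₁ : ManifoldOrientation (𝓡 k.toNat) Z₁ k.toNat)
    (m₀ : Z₀ ≃ₘ^∞⟮𝓡 k.toNat, 𝓡 k.toNat⟯ f.M) (m₁ : Z₁ ≃ₘ^∞⟮𝓡 k.toNat, 𝓡 k.toNat⟯ f.M)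
    (h₀ : ∀ z v, f.orientation.frameSign (m₀ z)
      (fun i => mdiff (𝓡 k.toNat) (𝓡 k.toNat) m₀ z (v i)) = o₀.frameSign z v)
    (h₁ : ∀ z v, f.orientation.frameSign (m₁ z)
      (fun i => mdiff (𝓡 k.toNat) (𝓡 k.toNat) m₁ z (v i)) = o₁.frameSign z v)
    {A : ℝ × X → X} (hA : ContMDiff (𝓘(ℝ, ℝ).prod (𝓡 n)) (𝓡 n) ∞ A) :
    ∃ (W : Filling k.toNat (Z₀ ⊕ Z₁) (cobSign o₀ o₁)) (F : W.B → X),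
      ContMDiff (𝓡∂ (k.toNat + 1)) (𝓡 n) ∞ F ∧ IsCompact (closure (range F)) ∧
      DimAtMost n (k - 1) (Bd F) ∧ ∀ z, F (W.ι z) =
        Sum.elim (fun z => A (0, f.map (m₀ z))) (fun z => A (1, f.map (m₁ z))) z := by
  obtain ⟨W, t, m, ht, hm, he, hi₀, hi₁⟩ := exists_cylinder f.orientation o₀ o₁ m₀ m₁ h₀ h₁
  have hcoe : ContMDiff (𝓡∂ 1) 𝓘(ℝ, ℝ) ∞ (Subtype.val : unitInterval → ℝ) :=
    contMDiff_subtypeVal_Icc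
  have hAI : Continuous fun z : unitInterval × X => A (z.1, z.2) :=
    hA.continuous.comp (hcoe.continuous.prodMap continuous_id)
  refine ⟨W, fun z => A (t z, f.map (m z)), ?_, ?_, ?_, ?_⟩
  · exact hA.comp ((hcoe.comp ht).prodMk (f.smooth.comp hm))
  · have h1 : IsCompact ((fun z : unitInterval × X => A (z.1, z.2)) ''
        (univ ×ˢ closure (range f.map))) :=
      (isCompact_univ.prod f.isCompact_closure).image hAI
    refine h1.of_isClosed_subset isClosed_closure (closure_minimal ?_ h1.isClosed)
    rintro _ ⟨z, rfl⟩
    exact ⟨(t z, f.map (m z)), ⟨mem_univ _, subset_closure (mem_range_self _)⟩, rfl⟩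
  · obtain ⟨g, hg⟩ := f.dim_bd
    have hAg : ContMDiff ((𝓡 (k - 2).toNat).prod 𝓘(ℝ, ℝ)) (𝓡 n) ∞
        fun z : g.M × ℝ => A (z.2, g.map z.1) :=
      hA.comp (contMDiff_snd.prodMk (g.smooth.comp contMDiff_fst))
    obtain ⟨g', e, he', hg', -⟩ := g.exists_prod_real isOpen_univ hAg
    have hk : k - 2 + 1 = k - 1 := by ring
    rw [← hk]
    refine ⟨g', (bd_cylinder_subset f.isCompact_closure hAI he).trans ?_⟩
    rintro x ⟨s, y, hy, rfl⟩
    obtain ⟨w, rfl⟩ := hg hy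
    obtain ⟨p, hp⟩ := (he' ▸ mem_univ (w, s.1) : (w, s.1) ∈ range e)
    refine ⟨p, (hg' p).trans ?_⟩
    rw [hp]
  · rintro (z | z)
    · have h := hi₀ z
      simp only [h.1, h.2]
      rfl
    · have h := hi₁ z
      simp only [h.1, h.2]
      rfl

theorem equivalent_of_homotopy [T2Space X] {f f₀ f₁ : Pseudocycle n X k}
    (m₀ : f₀.M ≃ₘ^∞⟮𝓡 k.toNat, 𝓡 k.toNat⟯ f.M) (m₁ : f₁.M ≃ₘ^∞⟮𝓡 k.toNat, 𝓡 k.toNat⟯ f.M)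
    (h₀ : ∀ z v, f.orientation.frameSign (m₀ z)
      (fun i => mdiff (𝓡 k.toNat) (𝓡 k.toNat) m₀ z (v i)) = f₀.orientation.frameSign z v)
    (h₁ : ∀ z v, f.orientation.frameSign (m₁ z)
      (fun i => mdiff (𝓡 k.toNat) (𝓡 k.toNat) m₁ z (v i)) = f₁.orientation.frameSign z v)
    {A : ℝ × X → X} (hA : ContMDiff (𝓘(ℝ, ℝ).prod (𝓡 n)) (𝓡 n) ∞ A)
    (hf₀ : ∀ p, f₀.map p = A (0, f.map (m₀ p))) (hf₁ : ∀ p, f₁.map p = A (1, f.map (m₁ p))) :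
    Equivalent f₀ f₁ := by
  obtain ⟨W, F, hF, hc, hd, hι⟩ := exists_cylinder_map f _ _ m₀ m₁ h₀ h₁ hA
  refine equivalent_of_filling W hF hc hd fun z => (hι z).trans ?_
  rcases z with z | z
  · exact (hf₀ z).symm
  · exact (hf₁ z).symm

theorem frameSign_mdiff_refl (f : Pseudocycle n X k) (z : f.M)
    (v : Fin k.toNat → EuclideanSpace ℝ (Fin k.toNat)) :
    f.orientation.frameSign (Diffeomorph.refl (𝓡 k.toNat) f.M ∞ z) (fun i =>
      mdiff (𝓡 k.toNat) (𝓡 k.toNat) (Diffeomorph.refl (𝓡 k.toNat) f.M ∞) z (v i)) =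
      f.orientation.frameSign z v :=
  congrArg (fun A : EuclideanSpace ℝ (Fin k.toNat) →L[ℝ] EuclideanSpace ℝ (Fin k.toNat) =>
    f.orientation.frameSign z fun i => A (v i)) (mdiff_id z)

theorem equivalent_of_diffeo [T2Space X] {f f' : Pseudocycle n X k}
    (Φ : f'.M ≃ₘ^∞⟮𝓡 k.toNat, 𝓡 k.toNat⟯ f.M)
    (h : ∀ z v, f.orientation.frameSign (Φ z)
      (fun i => mdiff (𝓡 k.toNat) (𝓡 k.toNat) Φ z (v i)) = f'.orientation.frameSign z v)
    (hm : ∀ p, f'.map p = f.map (Φ p)) : Equivalent f' f :=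
  equivalent_of_homotopy (f := f) Φ (Diffeomorph.refl (𝓡 k.toNat) f.M ∞) h (frameSign_mdiff_refl f)
    (A := Prod.snd) contMDiff_snd hm fun _ => rfl

theorem Equivalent.refl [T2Space X] (f : Pseudocycle n X k) : Equivalent f f :=
  equivalent_of_diffeo (Diffeomorph.refl (𝓡 k.toNat) f.M ∞) (frameSign_mdiff_refl f) fun _ => rfl

/-- The homotopy runs along the ray `t • s` in the parameter space. -/
theorem equivalent_comp_perturbation [T2Space X] {U : Set X} (Φ : Perturbation n U) (s : Φ.S)
    (f : Pseudocycle n X k) : Equivalent f (f.comp (Φ.toDiffeo s)) := by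
  have hA : ContMDiff (𝓘(ℝ, ℝ).prod (𝓡 n)) (𝓡 n) ∞
      fun z : ℝ × X => Φ.toDiffeo (z.1 • s) z.2 := by
    have h1 : ContMDiff 𝓘(ℝ, ℝ) 𝓘(ℝ, Φ.S) ∞ fun t : ℝ => t • s :=
      (contDiff_id.smul contDiff_const).contMDiff
    exact Φ.smooth.comp ((h1.comp contMDiff_fst).prodMk contMDiff_snd)
  refine equivalent_of_homotopy (f := f) (f₁ := f.comp (Φ.toDiffeo s))
    (Diffeomorph.refl (𝓡 k.toNat) f.M ∞) (Diffeomorph.refl (𝓡 k.toNat) f.M ∞)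
    (frameSign_mdiff_refl f) (frameSign_mdiff_refl f) hA (fun p => ?_) (fun p => ?_)
  · change _ = Φ.toDiffeo ((0 : ℝ) • s) _
    rw [zero_smul, Φ.zero]
    rfl
  · change _ = Φ.toDiffeo ((1 : ℝ) • s) _
    rw [one_smul]
    rfl

/-- The disjoint union. -/
def Pseudocycle.sum (f g : Pseudocycle n X k) : Pseudocycle n X k where
  toMapFromManifold := f.toMapFromManifold.sum g.toMapFromManifold
  orientation := (f.orientation.exists_sum_frameSign (by simp) g.orientation).choose
  isCompact_closure := isCompact_closure_range_sum f.isCompact_closure g.isCompact_closure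
  dim_bd := (f.dim_bd.union g.dim_bd).mono bd_sum_subset

theorem Pseudocycle.frameSign_sum_inl (f g : Pseudocycle n X k) (p : f.M)
    (v : Fin k.toNat → EuclideanSpace ℝ (Fin k.toNat)) :
    (f.sum g).orientation.frameSign (Sum.inl p : f.M ⊕ g.M) v = f.orientation.frameSign p v :=
  (f.orientation.exists_sum_frameSign (by simp) g.orientation).choose_spec.1 p v

theorem Pseudocycle.frameSign_sum_inr (f g : Pseudocycle n X k) (p : g.M)
    (v : Fin k.toNat → EuclideanSpace ℝ (Fin k.toNat)) :
    (f.sum g).orientation.frameSign (Sum.inr p : f.M ⊕ g.M) v = g.orientation.frameSign p v :=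
  (f.orientation.exists_sum_frameSign (by simp) g.orientation).choose_spec.2 p v

variable (n X k) in
/-- The empty pseudocycle. -/
def Pseudocycle.empty : Pseudocycle n X k where
  toMapFromManifold := emptyMap n X k
  orientation := ⟨fun x => x.elim, fun x => x.elim⟩
  isCompact_closure := by
    have : IsEmpty (emptyMap n X k).M := inferInstanceAs (IsEmpty Empty)
    rw [range_eq_empty, closure_empty]
    exact isCompact_empty
  dim_bd := by
    have : IsEmpty (emptyMap n X k).M := inferInstanceAs (IsEmpty Empty)
    rw [bd_eq_empty_of_isEmpty]
    exact dimAtMost_empty _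

instance : IsEmpty (Pseudocycle.empty n X k).M := inferInstanceAs (IsEmpty Empty)

/-- The pseudocycle with the opposite orientation. -/
def Pseudocycle.neg (f : Pseudocycle n X k) : Pseudocycle n X k :=
  { f with orientation := (ManifoldOrientation.exists_neg (by simp) f.orientation).choose }

theorem Pseudocycle.frameSign_neg (f : Pseudocycle n X k) (p : f.M)
    (v : Fin k.toNat → EuclideanSpace ℝ (Fin k.toNat)) :
    f.neg.orientation.frameSign p v = -f.orientation.frameSign p v :=
  (ManifoldOrientation.exists_neg (by simp) f.orientation).choose_spec p v

end Pseudocycles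

end

noncomputable section
namespace Pseudocycles

open Module Filter

variable {n : ℕ} {X : Type*} [TopologicalSpace X] [ChartedSpace (EuclideanSpace ℝ (Fin n)) X] {k : ℤ}

/-! ### Rearranging disjoint unions and the group laws -/

section SumDiffeo

variable {d : ℕ} {A B A' B' : Type*}
  [TopologicalSpace A] [ChartedSpace (EuclideanSpace ℝ (Fin d)) A]
  [TopologicalSpace B] [ChartedSpace (EuclideanSpace ℝ (Fin d)) B]
  [TopologicalSpace A'] [ChartedSpace (EuclideanSpace ℝ (Fin d)) A']
  [TopologicalSpace B'] [ChartedSpace (EuclideanSpace ℝ (Fin d)) B']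

/-- The interchange of the middle summands. -/
def sumSumSumCommDiffeo (d : ℕ) (A B A' B' : Type*)
    [TopologicalSpace A] [ChartedSpace (EuclideanSpace ℝ (Fin d)) A]
    [TopologicalSpace B] [ChartedSpace (EuclideanSpace ℝ (Fin d)) B]
    [TopologicalSpace A'] [ChartedSpace (EuclideanSpace ℝ (Fin d)) A']
    [TopologicalSpace B'] [ChartedSpace (EuclideanSpace ℝ (Fin d)) B'] :
    ((A ⊕ B) ⊕ (A' ⊕ B')) ≃ₘ^∞⟮𝓡 d, 𝓡 d⟯ ((A ⊕ A') ⊕ (B ⊕ B')) where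
  toEquiv := Equiv.sumSumSumComm A B A' B'
  contMDiff_toFun := by
    have h : ⇑(Equiv.sumSumSumComm A B A' B') =
        Sum.elim (Sum.map Sum.inl Sum.inl) (Sum.map Sum.inr Sum.inr) := by
      ext1 x; rcases x with (x | x) | (x | x) <;> rfl
    change ContMDiff (𝓡 d) (𝓡 d) ∞ ⇑(Equiv.sumSumSumComm A B A' B')
    rw [h]
    exact (ContMDiff.inl.sumMap ContMDiff.inl).sumElim (ContMDiff.inr.sumMap ContMDiff.inr)
  contMDiff_invFun := by
    have h : ⇑(Equiv.sumSumSumComm A B A' B').symm =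
        Sum.elim (Sum.map Sum.inl Sum.inl) (Sum.map Sum.inr Sum.inr) := by
      ext1 x; rcases x with (x | x) | (x | x) <;> rfl
    change ContMDiff (𝓡 d) (𝓡 d) ∞ ⇑(Equiv.sumSumSumComm A B A' B').symm
    rw [h]
    exact (ContMDiff.inl.sumMap ContMDiff.inl).sumElim (ContMDiff.inr.sumMap ContMDiff.inr)

variable {C D E : Type*} [TopologicalSpace C] [ChartedSpace (EuclideanSpace ℝ (Fin d)) C]
  [TopologicalSpace D] [ChartedSpace (EuclideanSpace ℝ (Fin d)) D]
  [TopologicalSpace E] [ChartedSpace (EuclideanSpace ℝ (Fin d)) E]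
  {g : D → E} {f : C → D}

/-- An iterated inclusion of a summand. -/
def IsSummand (d : ℕ) {C D : Type*} [TopologicalSpace C] [ChartedSpace (EuclideanSpace ℝ (Fin d)) C]
    [TopologicalSpace D] [ChartedSpace (EuclideanSpace ℝ (Fin d)) D] (f : C → D) : Prop :=
  ContMDiff (𝓡 d) (𝓡 d) ∞ f ∧ ∀ p, mdiff (𝓡 d) (𝓡 d) f p = ContinuousLinearMap.id ℝ _

theorem IsSummand.comp (hg : IsSummand d g) (hf : IsSummand d f) : IsSummand d (g ∘ f) :=
  ⟨hg.1.comp hf.1, fun p => (mdiff_comp hg.1 hf.1 p).trans (by rw [hg.2, hf.2]; rfl)⟩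

theorem isSummand_id : IsSummand d (id : C → C) := ⟨contMDiff_id, mdiff_id⟩

theorem isSummand_inl : IsSummand d (Sum.inl : A → A ⊕ B) := ⟨ContMDiff.inl, mdiff_sumInl⟩

theorem isSummand_inr : IsSummand d (Sum.inr : B → A ⊕ B) := ⟨ContMDiff.inr, mdiff_sumInr⟩

theorem IsSummand.mdiff_eq {h : D → E} (hh : ContMDiff (𝓡 d) (𝓡 d) ∞ h) (hf : IsSummand d f)
    (hhf : IsSummand d (h ∘ f)) (p : C) :
    mdiff (𝓡 d) (𝓡 d) h (f p) = ContinuousLinearMap.id ℝ _ := by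
  have h1 := mdiff_comp hh hf.1 p
  rw [hhf.2, hf.2] at h1
  exact h1.symm

/-- Rearrangements of disjoint unions are inclusions on each summand, so they have identity
derivative there and do not affect signs of frames. -/
theorem IsSummand.sign_eq {h : D → E} (hf : IsSummand d f) (hh : ContMDiff (𝓡 d) (𝓡 d) ∞ h)
    (hhf : IsSummand d (h ∘ f)) (σ : E → (Fin d → EuclideanSpace ℝ (Fin d)) → SignType) (p : C)
    (v : Fin d → EuclideanSpace ℝ (Fin d)) :
    σ (h (f p)) (fun i => mdiff (𝓡 d) (𝓡 d) h (f p) (v i)) = σ (h (f p)) v := by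
  rw [hf.mdiff_eq hh hhf]
  rfl

end SumDiffeo

section Reorder

variable {d : ℕ} {A B A' B' : Type}
  [TopologicalSpace A] [ChartedSpace (EuclideanSpace ℝ (Fin d)) A] [IsManifold (𝓡 d) ∞ A]
  [TopologicalSpace B] [ChartedSpace (EuclideanSpace ℝ (Fin d)) B] [IsManifold (𝓡 d) ∞ B]
  [TopologicalSpace A'] [ChartedSpace (EuclideanSpace ℝ (Fin d)) A'] [IsManifold (𝓡 d) ∞ A']
  [TopologicalSpace B'] [ChartedSpace (EuclideanSpace ℝ (Fin d)) B'] [IsManifold (𝓡 d) ∞ B']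
  {oA : ManifoldOrientation (𝓡 d) A d} {oB : ManifoldOrientation (𝓡 d) B d}
  {oA' : ManifoldOrientation (𝓡 d) A' d} {oB' : ManifoldOrientation (𝓡 d) B' d}

/-- The disjoint union of two fillings, with the boundary sorted by its two ends. -/
def Filling.sumSwap (W : Filling d (A ⊕ A') (cobSign oA oA'))
    (W' : Filling d (B ⊕ B') (cobSign oB oB')) (o : ManifoldOrientation (𝓡 d) (A ⊕ B) d)
    (o' : ManifoldOrientation (𝓡 d) (A' ⊕ B') d)
    (h1 : ∀ p (v : Fin d → EuclideanSpace ℝ (Fin d)),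
      o.frameSign (Sum.inl p) v = oA.frameSign p v)
    (h2 : ∀ p (v : Fin d → EuclideanSpace ℝ (Fin d)),
      o.frameSign (Sum.inr p) v = oB.frameSign p v)
    (h3 : ∀ p (v : Fin d → EuclideanSpace ℝ (Fin d)),
      o'.frameSign (Sum.inl p) v = oA'.frameSign p v)
    (h4 : ∀ p (v : Fin d → EuclideanSpace ℝ (Fin d)),
      o'.frameSign (Sum.inr p) v = oB'.frameSign p v) :
    Filling d ((A ⊕ B) ⊕ (A' ⊕ B')) (cobSign o o') :=
  (W.sum W').reindex (sumSumSumCommDiffeo d A B A' B') (by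
    have hΦ := (sumSumSumCommDiffeo d A B A' B').contMDiff
    rintro ((p | p) | (p | p)) v
    · exact ((isSummand_inl.comp isSummand_inl).sign_eq (f := fun q => Sum.inl (Sum.inl q)) hΦ
          (isSummand_inl.comp isSummand_inl) _ p v).trans (congrArg Neg.neg (h1 p v)).symm
    · exact ((isSummand_inl.comp isSummand_inr).sign_eq (f := fun q => Sum.inl (Sum.inr q)) hΦ
          (isSummand_inr.comp isSummand_inl) _ p v).trans (congrArg Neg.neg (h2 p v)).symm
    · exact ((isSummand_inr.comp isSummand_inl).sign_eq (f := fun q => Sum.inr (Sum.inl q)) hΦ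
          (isSummand_inl.comp isSummand_inr) _ p v).trans (h3 p v).symm
    · exact ((isSummand_inr.comp isSummand_inr).sign_eq (f := fun q => Sum.inr (Sum.inr q)) hΦ
          (isSummand_inr.comp isSummand_inr) _ p v).trans (h4 p v).symm)

/-- A filling of `A ⊔ B`, with all of the boundary regarded as incoming. -/
def Filling.bend [IsEmpty A'] (W : Filling d (A ⊕ B) (cobSign oA oB))
    (o : ManifoldOrientation (𝓡 d) (A ⊕ B) d)
    (h1 : ∀ p (v : Fin d → EuclideanSpace ℝ (Fin d)),
      o.frameSign (Sum.inl p) v = oA.frameSign p v)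
    (h2 : ∀ p (v : Fin d → EuclideanSpace ℝ (Fin d)),
      o.frameSign (Sum.inr p) v = -oB.frameSign p v) :
    Filling d ((A ⊕ B) ⊕ A') (cobSign o oA') :=
  W.reindex (Diffeomorph.sumEmpty (𝓡 d) (A ⊕ B) ∞) (by
    have hΦ := (Diffeomorph.sumEmpty (𝓡 d) (A ⊕ B) (M' := A') ∞).contMDiff
    rintro ((p | p) | p) v
    · exact ((isSummand_inl.comp isSummand_inl).sign_eq (f := fun q => Sum.inl (Sum.inl q)) hΦ
          isSummand_inl _ p v).trans (congrArg Neg.neg (h1 p v)).symm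
    · exact ((isSummand_inl.comp isSummand_inr).sign_eq (f := fun q => Sum.inl (Sum.inr q)) hΦ
          isSummand_inr _ p v).trans ((congrArg Neg.neg (h2 p v)).trans (neg_neg _)).symm
    · exact isEmptyElim p)

end Reorder

theorem equivalent_sum {f f' g g' : Pseudocycle n X k} (h : Equivalent f f') (h' : Equivalent g g') :
    Equivalent (f.sum g) (f'.sum g') := by
  obtain ⟨C⟩ := h
  obtain ⟨D⟩ := h'
  have hF : ContMDiff (𝓡∂ (k.toNat + 1)) (𝓡 n) ∞ (Sum.elim C.F D.F : C.B ⊕ D.B → X) :=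
    C.smooth.sumElim D.smooth
  refine equivalent_of_filling (f₀ := f.sum g) (f₁ := f'.sum g')
    (C.filling.sumSwap D.filling (f.sum g).orientation (f'.sum g').orientation
      (f.frameSign_sum_inl g) (f.frameSign_sum_inr g) (f'.frameSign_sum_inl g')
      (f'.frameSign_sum_inr g'))
    hF
    (isCompact_closure_range_sum C.isCompact_closure D.isCompact_closure)
    ((C.dim_bd.union D.dim_bd).mono bd_sum_subset) ?_
  rintro ((p | p) | (p | p))
  · exact C.map_ι (Sum.inl p)
  · exact D.map_ι (Sum.inl p)
  · exact C.map_ι (Sum.inr p)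
  · exact D.map_ι (Sum.inr p)

theorem cls_eq {f g : Pseudocycle n X k} (h : Equivalent f g) : f.cls = g.cls := Quot.sound h

theorem Homology.ind {p : Homology n X k → Prop} (h : ∀ f : Pseudocycle n X k, p f.cls) (a) : p a :=
  Quot.ind h a

theorem isDisjointUnion_sum (f g : Pseudocycle n X k) : IsDisjointUnion f g (f.sum g) := by
  refine ⟨Diffeomorph.refl (𝓡 k.toNat) (f.M ⊕ g.M) ∞, fun _ => rfl, fun _ => rfl, fun p v => ?_,
    fun p v => ?_⟩
  · exact (congrArg (fun A : EuclideanSpace ℝ (Fin k.toNat) →L[ℝ] EuclideanSpace ℝ (Fin k.toNat) =>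
      (f.sum g).orientation.frameSign (Sum.inl p : f.M ⊕ g.M) fun i => A (v i))
      (mdiff_sumInl (I := 𝓡 k.toNat) (B := g.M) p)).trans (f.frameSign_sum_inl g p v)
  · exact (congrArg (fun A : EuclideanSpace ℝ (Fin k.toNat) →L[ℝ] EuclideanSpace ℝ (Fin k.toNat) =>
      (f.sum g).orientation.frameSign (Sum.inr p : f.M ⊕ g.M) fun i => A (v i))
      (mdiff_sumInr (I := 𝓡 k.toNat) (A := f.M) p)).trans (f.frameSign_sum_inr g p v)

variable [T2Space X]

/-- The constant cylinder over `f`, with its outgoing end regarded as incoming; this reverses the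
orientation of that end. -/
theorem equivalent_sum_neg (f : Pseudocycle n X k) :
    Equivalent (f.sum f.neg) (Pseudocycle.empty n X k) := by
  let r := Diffeomorph.refl (𝓡 k.toNat) f.M ∞
  obtain ⟨W, F, hF, hc, hd, hι⟩ := exists_cylinder_map f f.orientation f.orientation r r
    (frameSign_mdiff_refl f) (frameSign_mdiff_refl f) (A := Prod.snd) contMDiff_snd
  have : IsEmpty (Pseudocycle.empty n X k).M := inferInstance
  refine equivalent_of_filling (f₀ := f.sum f.neg)
    (W.bend (f.sum f.neg).orientation (f.frameSign_sum_inl f.neg) fun p v =>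
      (f.frameSign_sum_inr f.neg p v).trans (f.frameSign_neg p v)) hF hc hd ?_
  rintro ((p | p) | p)
  · exact hι (Sum.inl p)
  · exact hι (Sum.inr p)
  · exact this.elim p

theorem equivalent_sum_comm (f g : Pseudocycle n X k) : Equivalent (f.sum g) (g.sum f) := by
  refine equivalent_of_diffeo (f := g.sum f) (f' := f.sum g)
    (Diffeomorph.sumComm (𝓡 k.toNat) f.M ∞ g.M) ?_ ?_
  · have hΦ := (Diffeomorph.sumComm (𝓡 k.toNat) f.M ∞ g.M).contMDiff
    rintro (p | p) v
    · exact (isSummand_inl.sign_eq hΦ isSummand_inr (g.sum f).orientation.frameSign p v).trans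
        ((g.frameSign_sum_inr f p v).trans (f.frameSign_sum_inl g p v).symm)
    · exact (isSummand_inr.sign_eq hΦ isSummand_inl (g.sum f).orientation.frameSign p v).trans
        ((g.frameSign_sum_inl f p v).trans (f.frameSign_sum_inr g p v).symm)
  · rintro (p | p) <;> rfl

theorem equivalent_sum_assoc (f g h : Pseudocycle n X k) :
    Equivalent ((f.sum g).sum h) (f.sum (g.sum h)) := by
  refine equivalent_of_diffeo (f := f.sum (g.sum h)) (f' := (f.sum g).sum h)
    (Diffeomorph.sumAssoc (𝓡 k.toNat) f.M ∞ g.M h.M) ?_ ?_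
  · have hΦ := (Diffeomorph.sumAssoc (𝓡 k.toNat) f.M ∞ g.M h.M).contMDiff
    rintro ((p | p) | p) v
    · exact ((isSummand_inl.comp isSummand_inl).sign_eq (f := fun q => Sum.inl (Sum.inl q)) hΦ
        isSummand_inl (f.sum (g.sum h)).orientation.frameSign p v).trans
        ((f.frameSign_sum_inl (g.sum h) p v).trans
          (((f.sum g).frameSign_sum_inl h (Sum.inl p : f.M ⊕ g.M) v).trans
            (f.frameSign_sum_inl g p v)).symm)
    · exact ((isSummand_inl.comp isSummand_inr).sign_eq (f := fun q => Sum.inl (Sum.inr q)) hΦ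
        (isSummand_inr.comp isSummand_inl) (f.sum (g.sum h)).orientation.frameSign p v).trans
        (((f.frameSign_sum_inr (g.sum h) (Sum.inl p : g.M ⊕ h.M) v).trans
          (g.frameSign_sum_inl h p v)).trans
          (((f.sum g).frameSign_sum_inl h (Sum.inr p : f.M ⊕ g.M) v).trans
            (f.frameSign_sum_inr g p v)).symm)
    · exact (isSummand_inr.sign_eq hΦ (isSummand_inr.comp isSummand_inr)
        (f.sum (g.sum h)).orientation.frameSign p v).trans
        (((f.frameSign_sum_inr (g.sum h) (Sum.inr p : g.M ⊕ h.M) v).trans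
          (g.frameSign_sum_inr h p v)).trans ((f.sum g).frameSign_sum_inr h p v).symm)
  · rintro ((p | p) | p) <;> rfl

theorem equivalent_sum_empty (f : Pseudocycle n X k) :
    Equivalent (f.sum (Pseudocycle.empty n X k)) f := by
  have : IsEmpty (Pseudocycle.empty n X k).M := inferInstance
  refine equivalent_of_diffeo (f := f) (f' := f.sum (Pseudocycle.empty n X k))
    (Diffeomorph.sumEmpty (𝓡 k.toNat) f.M (M' := (Pseudocycle.empty n X k).M) ∞) ?_ ?_
  · have hΦ := (Diffeomorph.sumEmpty (𝓡 k.toNat) f.M (M' := (Pseudocycle.empty n X k).M) ∞).contMDiff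
    rintro (p | p) v
    · exact (isSummand_inl.sign_eq hΦ isSummand_id f.orientation.frameSign p v).trans
        (f.frameSign_sum_inl _ p v).symm
    · exact this.elim p
  · rintro (p | p)
    · rfl
    · exact this.elim p

/-- The sum of classes. -/
def Homology.add : Homology n X k → Homology n X k → Homology n X k :=
  Quot.map₂ Pseudocycle.sum (fun f _ _ h => equivalent_sum (Equivalent.refl f) h)
    (fun _ _ g h => equivalent_sum h (Equivalent.refl g))

theorem Homology.add_comm (a b : Homology n X k) : a.add b = b.add a := by
  induction a using Homology.ind with | _ f
  induction b using Homology.ind with | _ g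
  exact cls_eq (equivalent_sum_comm f g)

/-- Existence of inverses is enough for a group, so orientation reversal need not be shown to
respect equivalence. -/
theorem Homology.exists_neg (a : Homology n X k) :
    ∃ b : Homology n X k, b.add a = (Pseudocycle.empty n X k).cls := by
  induction a using Homology.ind with | _ f
  exact ⟨f.neg.cls, (Homology.add_comm _ _).trans (cls_eq (equivalent_sum_neg f))⟩

theorem Homology.add_empty (a : Homology n X k) : a.add (Pseudocycle.empty n X k).cls = a := by
  induction a using Homology.ind with | _ f
  exact cls_eq (equivalent_sum_empty f)

variable (n X k) in
/-- The group of classes of pseudocycles under disjoint union. -/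
@[reducible]
def Homology.addCommGroup : AddCommGroup (Homology n X k) :=
  let _ : Add (Homology n X k) := ⟨Homology.add⟩
  let _ : Zero (Homology n X k) := ⟨(Pseudocycle.empty n X k).cls⟩
  let _ : Neg (Homology n X k) := ⟨fun a => a.exists_neg.choose⟩
  { add := Homology.add
    zero := (Pseudocycle.empty n X k).cls
    neg := fun a => a.exists_neg.choose
    add_assoc := fun a b c => by
      induction a using Homology.ind with | _ f
      induction b using Homology.ind with | _ g
      induction c using Homology.ind with | _ h
      exact cls_eq (equivalent_sum_assoc f g h)
    zero_add := fun a => (Homology.add_comm _ _).trans (Homology.add_empty a)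
    add_zero := Homology.add_empty
    add_comm := Homology.add_comm
    neg_add_cancel := fun a => a.exists_neg.choose_spec
    nsmul := nsmulRec
    zsmul := zsmulRec }

attribute [local instance] Homology.addCommGroup

theorem cls_sum (f g : Pseudocycle n X k) : (f.sum g).cls = f.cls + g.cls := rfl

theorem IsDisjointUnion.cls_eq {f g h : Pseudocycle n X k} (H : IsDisjointUnion f g h) :
    h.cls = f.cls + g.cls := by
  obtain ⟨Φ, h1, h2, h3, h4⟩ := H
  rw [← cls_sum]
  refine (Pseudocycles.cls_eq (equivalent_of_diffeo (f := h) (f' := f.sum g) Φ ?_ ?_)).symm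
  · rintro (p | p) v
    · refine Eq.trans ?_ ((h3 p v).trans (f.frameSign_sum_inl g p v).symm)
      exact (congrArg (fun A : EuclideanSpace ℝ (Fin k.toNat) →L[ℝ] EuclideanSpace ℝ (Fin k.toNat) =>
        h.orientation.frameSign (Φ (Sum.inl p)) fun i => A (v i))
        (mdiff_comp_inl Φ.contMDiff p)).symm
    · refine Eq.trans ?_ ((h4 p v).trans (f.frameSign_sum_inr g p v).symm)
      exact (congrArg (fun A : EuclideanSpace ℝ (Fin k.toNat) →L[ℝ] EuclideanSpace ℝ (Fin k.toNat) =>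
        h.orientation.frameSign (Φ (Sum.inr p)) fun i => A (v i))
        (mdiff_comp_inr Φ.contMDiff p)).symm
  · rintro (p | p)
    · exact (h1 p).symm
    · exact (h2 p).symm

end Pseudocycles

end

noncomputable section
namespace Pseudocycles

open Module Filter

/-! ### Fibre products of pseudocycles -/

section FibreOrientation

variable {k l d n : ℕ}

/-- The order-preserving bijection of the index sets in the orientation of a fibre product. -/
def frameEquiv (h : d + n = k + l) : Fin k ⊕ Fin l ≃ Fin d ⊕ Fin n :=
  finSumFinEquiv.trans ((finCongr h.symm).trans finSumFinEquiv.symm)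

/-- The relation between the signs of frames of a fibre product and those of its factors. -/
def FibreSign (sZ : (Fin d → EuclideanSpace ℝ (Fin d)) → SignType)
    (sB : (Fin k → EuclideanSpace ℝ (Fin k)) → SignType)
    (sM : (Fin l → EuclideanSpace ℝ (Fin l)) → SignType)
    (sX : (Fin n → EuclideanSpace ℝ (Fin n)) → SignType)
    (A₀ : EuclideanSpace ℝ (Fin d) →L[ℝ] EuclideanSpace ℝ (Fin k))
    (A₁ : EuclideanSpace ℝ (Fin d) →L[ℝ] EuclideanSpace ℝ (Fin l))
    (J : EuclideanSpace ℝ (Fin k) × EuclideanSpace ℝ (Fin l) →L[ℝ] EuclideanSpace ℝ (Fin n))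
    (τ : Fin k ⊕ Fin l ≃ Fin d ⊕ Fin n) (ε : SignType) : Prop :=
  ∀ (a : Basis (Fin k) ℝ (EuclideanSpace ℝ (Fin k)))
    (b : Basis (Fin l) ℝ (EuclideanSpace ℝ (Fin l)))
    (w : Basis (Fin d) ℝ (EuclideanSpace ℝ (Fin d)))
    (z : Basis (Fin n) ℝ (EuclideanSpace ℝ (Fin n)))
    (s : Fin n → EuclideanSpace ℝ (Fin k) × EuclideanSpace ℝ (Fin l)),
    (∀ j, J (s j) = z j) →
    sZ w * sX z * SignType.sign ((a.prod b).det
      (Sum.elim (fun i => (A₀ (w i), A₁ (w i))) s ∘ τ)) = ε * (sB a * sM b)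

theorem det_prod_swap {V W : Type*} [AddCommGroup V] [Module ℝ V] [AddCommGroup W] [Module ℝ W]
    (a : Basis (Fin k) ℝ V) (b : Basis (Fin l) ℝ W) (v : Fin l ⊕ Fin k → W × V) :
    (b.prod a).det v = (a.prod b).det fun i => (v (Equiv.sumComm _ _ i)).swap := by
  have h : b.prod a = ((a.prod b).reindex (Equiv.sumComm (Fin k) (Fin l))).map
      (LinearEquiv.prodComm ℝ V W) := by
    refine Basis.eq_of_apply_eq fun i => ?_
    rcases i with i | i <;> simp
  rw [h, Basis.det_map, Basis.det_reindex]
  rfl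

/-- The sign of the permutation, extracted before the basis and the vectors are chosen so that it
can be used uniformly. -/
theorem exists_sign_det_comp {ι : Type*} [Fintype ι] [DecidableEq ι] (ρ : Equiv.Perm ι) :
    ∃ δ : SignType, δ ≠ 0 ∧ ∀ {V : Type} [AddCommGroup V] [Module ℝ V] (c : Basis ι ℝ V) (v : ι → V),
      SignType.sign (c.det (v ∘ ρ)) = δ * SignType.sign (c.det v) := by
  rcases Int.units_eq_one_or (Equiv.Perm.sign ρ) with h | h
  · refine ⟨1, by decide, fun c v => ?_⟩
    rw [AlternatingMap.map_perm, h]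
    simp
  · refine ⟨-1, by decide, fun c v => ?_⟩
    rw [AlternatingMap.map_perm, h]
    simp [Left.sign_neg]

/-- Exchanging the factors permutes the frame and replaces `df₀ v₀ - df₁ v₁` by its negative. The
two effects are the sign of a permutation of the index set and `(-1) ^ n`, both determined by the
dimensions. -/
theorem FibreSign.exists_swap (h : d + n = k + l) (h' : d + n = l + k) : ∃ δ : SignType, δ ≠ 0 ∧
    ∀ {sZ sB sM sX A₀ A₁ J J' ε}, FibreSign sZ sB sM sX A₀ A₁ J (frameEquiv h) ε →
      (∀ u v, J' (u, v) = -J (v, u)) → (∀ z, sX (fun i => -z i) = (-1) ^ n * sX z) →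
      FibreSign sZ sM sB sX A₁ A₀ J' (frameEquiv h') (ε * δ) := by
  obtain ⟨δ, hδ, hρ⟩ := exists_sign_det_comp
    (((Equiv.sumComm (Fin k) (Fin l)).trans (frameEquiv h')).trans (frameEquiv h).symm)
  refine ⟨(-1) ^ n * δ, mul_ne_zero (pow_ne_zero _ (by decide)) hδ, ?_⟩
  intro sZ sB sM sX A₀ A₁ J J' ε H hJ hX b a w z s hs
  -- The same lifts, with factors exchanged, map to the negative of the basis `z`.
  have h1 := H a b w (z.map (LinearEquiv.neg ℝ)) (fun j => (s j).swap) fun j => by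
    have := hs j
    rw [← Prod.mk.eta (p := s j), hJ] at this
    rw [Basis.map_apply, ← this]
    exact (neg_neg _).symm
  have h2 : ⇑(z.map (LinearEquiv.neg ℝ)) = fun i => -z i := by ext1 i; simp
  rw [h2, hX] at h1
  have h3 : (fun i => ((Sum.elim (fun i => (A₁ (w i), A₀ (w i))) s ∘ frameEquiv h')
      (Equiv.sumComm _ _ i)).swap) =
      (Sum.elim (fun i => (A₀ (w i), A₁ (w i))) (fun j => (s j).swap) ∘ frameEquiv h) ∘
      ((Equiv.sumComm (Fin k) (Fin l)).trans (frameEquiv h')).trans (frameEquiv h).symm := by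
    funext i
    simp only [Function.comp_apply, Equiv.trans_apply, Equiv.apply_symm_apply]
    rcases frameEquiv h' (Equiv.sumComm _ _ i) with j | j <;> rfl
  rw [det_prod_swap, h3, hρ]
  have h4 : ((-1 : SignType) ^ n) * (-1) ^ n = 1 := by
    rw [← mul_pow]; simp
  calc _ = ((-1) ^ n * (-1) ^ n) * (sZ w * sX z * (δ * SignType.sign ((a.prod b).det
        (Sum.elim (fun i => (A₀ (w i), A₁ (w i))) (fun j => (s j).swap) ∘ frameEquiv h)))) := by
        rw [h4, one_mul]
    _ = (-1) ^ n * δ * (sZ w * ((-1) ^ n * sX z) * SignType.sign ((a.prod b).det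
        (Sum.elim (fun i => (A₀ (w i), A₁ (w i))) (fun j => (s j).swap) ∘ frameEquiv h))) := by ac_rfl
    _ = _ := by rw [h1, mul_comm (sB a)]; ac_rfl

end FibreOrientation

variable {n : ℕ} {X : Type*} [TopologicalSpace X] [ChartedSpace (EuclideanSpace ℝ (Fin n)) X]
  [IsManifold (𝓡 n) ∞ X]

theorem ManifoldOrientation.frameSign_neg_frame {V H M : Type*} [NormedAddCommGroup V]
    [NormedSpace ℝ V] [FiniteDimensional ℝ V] [TopologicalSpace H] {I : ModelWithCorners ℝ V H}
    [TopologicalSpace M] [ChartedSpace H M] [IsManifold I 1 M] {m : ℕ} (hm : finrank ℝ V = m)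
    (o : ManifoldOrientation I M m) (x : M) (v : Fin m → V) :
    o.frameSign x (fun i => -v i) = (-1) ^ m * o.frameSign x v := by
  let e : Basis (Fin m) ℝ V := finBasisOfFinrankEq ℝ V hm
  have h1 := osign_eq_mul e (o.orient x) (fun i => -v i)
  have h2 := osign_eq_mul e (o.orient x) v
  have h3 : e.det (fun i => -v i) = (-1) ^ m * e.det v := by
    have := e.det.map_smul_univ (fun _ => (-1 : ℝ)) v
    simpa using this
  refine h1.trans ?_
  rw [h3, sign_mul, sign_pow, Left.sign_neg, sign_one]
  exact (mul_left_comm _ _ _).trans (congrArg _ h2.symm)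

/-- `f` is the fibre product of `f₀` and `f₁`, oriented with the sign `ε`. -/
structure IsFibreProduct (oX : ManifoldOrientation (𝓡 n) X n) (ε : SignType) {k l d : ℤ}
    (f₀ : Pseudocycle n X k) (f₁ : Pseudocycle n X l) (f : Pseudocycle n X d)
    (pr₀ : f.M → f₀.M) (pr₁ : f.M → f₁.M) : Prop where
  smooth₀ : ContMDiff (𝓡 d.toNat) (𝓡 k.toNat) ∞ pr₀
  smooth₁ : ContMDiff (𝓡 d.toNat) (𝓡 l.toNat) ∞ pr₁
  isClosedEmbedding : IsClosedEmbedding fun p => (pr₀ p, pr₁ p)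
  injective : ∀ p, Function.Injective
    ((mdiff (𝓡 d.toNat) (𝓡 k.toNat) pr₀ p).prod (mdiff (𝓡 d.toNat) (𝓡 l.toNat) pr₁ p))
  range_eq : range (fun p => (pr₀ p, pr₁ p)) = {q | f₀.map q.1 = f₁.map q.2}
  map_eq : ∀ p, f.map p = f₀.map (pr₀ p)
  fibreSign : ∀ (h : d.toNat + n = k.toNat + l.toNat) (p : f.M),
    FibreSign (f.orientation.frameSign p) (f₀.orientation.frameSign (pr₀ p))
      (f₁.orientation.frameSign (pr₁ p)) (oX.frameSign (f.map p))
      (mdiff (𝓡 d.toNat) (𝓡 k.toNat) pr₀ p) (mdiff (𝓡 d.toNat) (𝓡 l.toNat) pr₁ p)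
      (jointDiff (𝓡 k.toNat) (𝓡 l.toNat) (𝓡 n) f₀.map f₁.map (pr₀ p) (pr₁ p)) (frameEquiv h) ε

section

variable {oX : ManifoldOrientation (𝓡 n) X n} {ε : SignType} {k l d : ℤ}
  {f₀ : Pseudocycle n X k} {f₁ : Pseudocycle n X l}

theorem IsFibreProduct.map_eq_map {f : Pseudocycle n X d} {pr₀ : f.M → f₀.M} {pr₁ : f.M → f₁.M}
    (h : IsFibreProduct oX ε f₀ f₁ f pr₀ pr₁) (p : f.M) : f₀.map (pr₀ p) = f₁.map (pr₁ p) := by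
  have : (pr₀ p, pr₁ p) ∈ {q : f₀.M × f₁.M | f₀.map q.1 = f₁.map q.2} :=
    h.range_eq ▸ mem_range_self p
  exact this

/-- Translates between frames indexed by sums of types and the concatenated frames in the definition
of an intersection. -/
theorem det_append_cast {a b c m : ℕ} {V : Type*} [AddCommGroup V] [Module ℝ V]
    (e : Basis (Fin a ⊕ Fin b) ℝ V) (h : c + m = a + b) (u : Fin c → V) (s : Fin m → V) :
    (e.reindex finSumFinEquiv).det (Fin.append u s ∘ Fin.cast h.symm) =
      e.det (Sum.elim u s ∘ frameEquiv h) := by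
  rw [Basis.det_reindex]
  congr 1
  funext i
  change Fin.append u s (Fin.cast h.symm (finSumFinEquiv i)) =
    Sum.elim u s (finSumFinEquiv.symm (Fin.cast h.symm (finSumFinEquiv i)))
  obtain ⟨j, hj⟩ := finSumFinEquiv.surjective (Fin.cast h.symm (finSumFinEquiv i))
  rw [← hj, Equiv.symm_apply_apply]
  rcases j with j | j <;> simp

theorem IsIntersection.isFibreProduct [T2Space X] {f : Pseudocycle n X (k + l - n)}
    {pr₀ : f.M → f₀.M} {pr₁ : f.M → f₁.M} (h : IsIntersection oX f₀ f₁ f pr₀ pr₁) :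
    IsFibreProduct oX ((-1) ^ (l.toNat * n)) f₀ f₁ f pr₀ pr₁ := by
  have hs := h.isSmoothEmbedding.contMDiff
  have h0 : ContMDiff (𝓡 (k + l - n).toNat) (𝓡 k.toNat) ∞ pr₀ := contMDiff_fst.comp hs
  have h1 : ContMDiff (𝓡 (k + l - n).toNat) (𝓡 l.toNat) ∞ pr₁ := contMDiff_snd.comp hs
  refine ⟨h0, h1, ⟨h.isSmoothEmbedding.isEmbedding, ?_⟩, fun p => ?_, h.range_eq, h.map_eq₀, ?_⟩
  · rw [h.range_eq]
    exact isClosed_eq (f₀.smooth.continuous.comp continuous_fst)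
      (f₁.smooth.continuous.comp continuous_snd)
  · obtain ⟨F, _, _, hF⟩ := h.isSmoothEmbedding.isImmersion
    have h2 := IsImmersionAtOfComplement.mfderiv_injective (hF p)
    have h3 := (h0.mdifferentiable (by simp) p).mfderiv_prod (h1.mdifferentiable (by simp) p)
    rw [h3] at h2
    exact h2
  · intro hd p a b w z s hz
    exact (congrArg (fun r : ℝ => f.orientation.frameSign p w * oX.frameSign (f.map p) z *
      SignType.sign r) (det_append_cast (a.prod b) hd (fun i => (_, _)) s).symm).trans
      (h.orient_eq p hd a b w z s hz)

theorem IsFibreProduct.isIntersection {f : Pseudocycle n X (k + l - n)}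
    {pr₀ : f.M → f₀.M} {pr₁ : f.M → f₁.M}
    (h : IsFibreProduct oX ((-1) ^ (l.toNat * n)) f₀ f₁ f pr₀ pr₁) :
    IsIntersection oX f₀ f₁ f pr₀ pr₁ := by
  refine ⟨⟨?_, h.isClosedEmbedding.isEmbedding⟩, h.range_eq, h.map_eq,
    fun p => (h.map_eq p).trans (h.map_eq_map p), ?_⟩
  · have h2 : ∀ p, Function.Injective (mfderiv (𝓡 (k + l - n).toNat)
        ((𝓡 k.toNat).prod (𝓡 l.toNat)) (fun p => (pr₀ p, pr₁ p)) p) := fun p => by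
      rw [(h.smooth₀.mdifferentiable (by simp) p).mfderiv_prod
        (h.smooth₁.mdifferentiable (by simp) p)]
      exact h.injective p
    by_cases hd : (k + l - n).toNat ≤ k.toNat + l.toNat
    · exact isImmersion_of_injective (c := k.toNat + l.toNat - (k + l - n).toNat)
        (h.smooth₀.prodMk h.smooth₁) h2 (by simp; omega)
    · exact absurd (show (k + l - n).toNat ≤ k.toNat + l.toNat by omega) hd
  · intro p hd a b w z s hz
    exact (congrArg (fun r : ℝ => f.orientation.frameSign p w * oX.frameSign (f.map p) z *
      SignType.sign r) (det_append_cast (a.prod b) hd (fun i => (_, _)) s)).trans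
      (h.fibreSign hd p a b w z s hz)

theorem isFibreProduct_of_isEmpty (f : Pseudocycle n X d) (hf : IsEmpty f.M)
    (hne : ∀ p q, f₀.map p ≠ f₁.map q) :
    IsFibreProduct oX ε f₀ f₁ f isEmptyElim isEmptyElim := by
  have he : {q : f₀.M × f₁.M | f₀.map q.1 = f₁.map q.2} = ∅ :=
    eq_empty_of_forall_notMem fun q hq => hne _ _ hq
  refine ⟨isEmptyElim, isEmptyElim, ?_, isEmptyElim, ?_, isEmptyElim, fun _ p => isEmptyElim p⟩
  · exact ⟨.of_subsingleton _, by rw [range_eq_empty]; exact isClosed_empty⟩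
  · rw [range_eq_empty, he]

/-- The limit set is covered by three intersections of transverse maps, of dimensions `k - 2 + l -
n`, `k + (l - 2) - n` and `k - 2 + (l - 2) - n`, all at most `d - 2`. If the images are disjoint,
`d` may be negative and the empty pseudocycle serves. -/
theorem StronglyTransverse.exists_isFibreProduct [T2Space X] (oX : ManifoldOrientation (𝓡 n) X n)
    (h : StronglyTransverse f₀ f₁) (hd : d = k + l - n) (hε : ε ≠ 0) :
    ∃ (f : Pseudocycle n X d) (pr₀ : f.M → f₀.M) (pr₁ : f.M → f₁.M),
      IsFibreProduct oX ε f₀ f₁ f pr₀ pr₁ := by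
  by_cases hne : ∃ p q, f₀.map p = f₁.map q
  · obtain ⟨p, q, hpq⟩ := hne
    obtain ⟨g₀, g₁, hg₀, hg₁, h1, h2, h3, h4⟩ := h
    have hT := transverse_iff_trans.1 h1
    obtain ⟨hk, hl, hn⟩ := le_add_of_surjective_jointDiff p q (hT p q hpq)
    have hdim : d.toNat + n = k.toNat + l.toNat := by omega
    obtain ⟨c⟩ := hT.nonempty_submanifoldAtlas f₀.smooth f₁.smooth (d := d.toNat)
      (by simp only [finrank_euclideanSpace_fin]; omega)
    have hval : ∀ z, f₀.map (c.fst z) = f₁.map (c.snd z) := fun z => c.val_mem z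
    obtain ⟨oZ, hoZ⟩ := exists_fibreProduct_orientation (by simp) (by simp) (by simp) (by simp)
      f₀.orientation f₁.orientation oX (frameEquiv hdim) (h := fun z => f₀.map (c.fst z))
      (f₀.smooth.of_le (by simp)) (f₁.smooth.of_le (by simp)) (c.contMDiff_fst.of_le (by simp))
      (c.contMDiff_snd.of_le (by simp)) (fun _ => rfl) hval c.prod_mdiff_injective
      (fun z => hT _ _ (hval z)) hdim hε
    have hcl : IsClosedEmbedding fun z : c.Carrier => (c.fst z, c.snd z) :=
      ⟨c.isEmbedding_val, by
        refine (congrArg IsClosed c.range_val).mpr ?_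
        exact isClosed_eq (f₀.smooth.continuous.comp continuous_fst)
          (f₁.smooth.continuous.comp continuous_snd)⟩
    refine ⟨{ M := c.Carrier
              isEmpty_of_neg := fun _ => by omega
              map := fun z => f₀.map (c.fst z)
              smooth := f₀.smooth.comp c.contMDiff_fst
              orientation := oZ
              isCompact_closure := f₀.isCompact_closure.of_isClosed_subset isClosed_closure
                (closure_mono (range_subset_iff.2 fun z => mem_range_self _))
              dim_bd := ?_ }, c.fst, c.snd, ?_⟩
    · refine DimAtMost.mono ?_ (bd_fibreProduct_subset f₀.smooth.continuous f₁.smooth.continuous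
        hcl (fun _ => rfl) hval)
      refine ((DimAtMost.of_le ?_ (?_ : k - 2 + l - n ≤ d - 2)).union
        (DimAtMost.of_le ?_ (?_ : k + (l - 2) - n ≤ d - 2))).union
        (DimAtMost.of_le ?_ (?_ : k - 2 + (l - 2) - n ≤ d - 2))
      · exact h4.dimAtMost_inter.mono (inter_subset_inter_left _ hg₀)
      · omega
      · exact h3.dimAtMost_inter.mono (inter_subset_inter_right _ hg₁)
      · omega
      · exact h2.dimAtMost_inter.mono (inter_subset_inter hg₀ hg₁)
      · omega
    · exact ⟨c.contMDiff_fst, c.contMDiff_snd, hcl, c.prod_mdiff_injective, c.range_val,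
        fun _ => rfl, fun _ => hoZ⟩
  · push Not at hne
    exact ⟨_, _, _, isFibreProduct_of_isEmpty (Pseudocycle.empty n X d) inferInstance hne⟩

variable (X) in
-- The sign is chosen before `ε` and the pseudocycles. This uniformity lets additivity in one
-- variable be transported to the other.
theorem exists_sign_swap (oX : ManifoldOrientation (𝓡 n) X n) (k l d : ℤ) :
    ∃ δ : SignType, δ ≠ 0 ∧ ∀ {ε : SignType} {f₀ : Pseudocycle n X k} {f₁ : Pseudocycle n X l}
      {f : Pseudocycle n X d} {pr₀ : f.M → f₀.M} {pr₁ : f.M → f₁.M},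
      IsFibreProduct oX ε f₀ f₁ f pr₀ pr₁ → IsFibreProduct oX (ε * δ) f₁ f₀ f pr₁ pr₀ := by
  have key : ∀ {δ ε : SignType} {f₀ : Pseudocycle n X k} {f₁ : Pseudocycle n X l}
      {f : Pseudocycle n X d} {pr₀ : f.M → f₀.M} {pr₁ : f.M → f₁.M},
      IsFibreProduct oX ε f₀ f₁ f pr₀ pr₁ → (∀ (h : d.toNat + n = l.toNat + k.toNat) (p : f.M),
      FibreSign (f.orientation.frameSign p) (f₁.orientation.frameSign (pr₁ p))
        (f₀.orientation.frameSign (pr₀ p)) (oX.frameSign (f.map p))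
        (mdiff (𝓡 d.toNat) (𝓡 l.toNat) pr₁ p) (mdiff (𝓡 d.toNat) (𝓡 k.toNat) pr₀ p)
        (jointDiff (𝓡 l.toNat) (𝓡 k.toNat) (𝓡 n) f₁.map f₀.map (pr₁ p) (pr₀ p)) (frameEquiv h)
        (ε * δ)) → IsFibreProduct oX (ε * δ) f₁ f₀ f pr₁ pr₀ := by
    intro δ ε f₀ f₁ f pr₀ pr₁ h hs
    refine ⟨h.smooth₁, h.smooth₀,
      (Homeomorph.prodComm f₀.M f₁.M).isClosedEmbedding.comp h.isClosedEmbedding,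
      fun p u v huv => h.injective p (Prod.ext (congrArg Prod.snd huv) (congrArg Prod.fst huv)),
      ?_, fun p => (h.map_eq p).trans (h.map_eq_map p), hs⟩
    ext ⟨q₁, q₀⟩
    have := Set.ext_iff.1 h.range_eq (q₀, q₁)
    simp only [mem_range, Prod.mk.injEq, mem_ofPred_eq] at this ⊢
    rw [eq_comm, ← this]
    exact exists_congr fun _ => and_comm
  by_cases hd : d.toNat + n = k.toNat + l.toNat
  · obtain ⟨δ, hδ, H⟩ := FibreSign.exists_swap hd (by omega : d.toNat + n = l.toNat + k.toNat)
    exact ⟨δ, hδ, fun h => key h fun _ p => H (h.fibreSign hd p)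
      (fun u v => (neg_sub (_ : EuclideanSpace ℝ (Fin n)) _).symm)
      (oX.frameSign_neg_frame (by simp) _)⟩
  -- If the dimensions do not add up, the orientation condition is vacuous.
  · exact ⟨1, by decide, fun h => key h fun hd' => absurd (by omega) hd⟩

end

end Pseudocycles

end

/-! ### Fibre products of disjoint unions and of cobordisms -/

noncomputable section
namespace Pseudocycles

open Module Filter

theorem FibreSign.congr {k l d n : ℕ}
    {sZ sZ' : (Fin d → EuclideanSpace ℝ (Fin d)) → SignType}
    {sB sB' : (Fin k → EuclideanSpace ℝ (Fin k)) → SignType}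
    {sM : (Fin l → EuclideanSpace ℝ (Fin l)) → SignType}
    {sX : (Fin n → EuclideanSpace ℝ (Fin n)) → SignType}
    {A₀ A₀' : EuclideanSpace ℝ (Fin d) →L[ℝ] EuclideanSpace ℝ (Fin k)}
    {A₁ A₁' : EuclideanSpace ℝ (Fin d) →L[ℝ] EuclideanSpace ℝ (Fin l)}
    {J J' : EuclideanSpace ℝ (Fin k) × EuclideanSpace ℝ (Fin l) →L[ℝ] EuclideanSpace ℝ (Fin n)}
    {τ : Fin k ⊕ Fin l ≃ Fin d ⊕ Fin n} {ε : SignType}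
    (h : FibreSign sZ sB sM sX A₀ A₁ J τ ε) (hZ : sZ' = sZ) (hB : sB' = sB) (hA₀ : A₀' = A₀)
    (hA₁ : A₁' = A₁) (hJ : J' = J) : FibreSign sZ' sB' sM sX A₀' A₁' J' τ ε := by
  subst hZ hB hA₀ hA₁ hJ
  exact h

theorem FibreSign.neg {k l d n : ℕ}
    {sZ : (Fin d → EuclideanSpace ℝ (Fin d)) → SignType}
    {sB : (Fin k → EuclideanSpace ℝ (Fin k)) → SignType}
    {sM : (Fin l → EuclideanSpace ℝ (Fin l)) → SignType}
    {sX : (Fin n → EuclideanSpace ℝ (Fin n)) → SignType}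
    {A₀ : EuclideanSpace ℝ (Fin d) →L[ℝ] EuclideanSpace ℝ (Fin k)}
    {A₁ : EuclideanSpace ℝ (Fin d) →L[ℝ] EuclideanSpace ℝ (Fin l)}
    {J : EuclideanSpace ℝ (Fin k) × EuclideanSpace ℝ (Fin l) →L[ℝ] EuclideanSpace ℝ (Fin n)}
    {τ : Fin k ⊕ Fin l ≃ Fin d ⊕ Fin n} {ε : SignType}
    (h : FibreSign sZ sB sM sX A₀ A₁ J τ ε) :
    FibreSign (fun w => -sZ w) (fun w => -sB w) sM sX A₀ A₁ J τ ε := fun a b w z s hs => by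
  have := h a b w z s hs
  rw [neg_mul, neg_mul, neg_mul, mul_neg, this]

section SumMap

variable {E E' H H' A B A' B' C : Type*} [NormedAddCommGroup E] [NormedSpace ℝ E]
  [NormedAddCommGroup E'] [NormedSpace ℝ E'] [TopologicalSpace H] [TopologicalSpace H']
  {I : ModelWithCorners ℝ E H} {J : ModelWithCorners ℝ E' H'} [TopologicalSpace A]
  [TopologicalSpace B] [TopologicalSpace A'] [TopologicalSpace B'] [TopologicalSpace C]
  [ChartedSpace H A] [ChartedSpace H B] [ChartedSpace H' A'] [ChartedSpace H' B']
  [ChartedSpace H' C] {f : A → A'} {g : B → B'}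

theorem mdiff_sumMap_inl (hf : ContMDiff I J ∞ f) (hg : ContMDiff I J ∞ g) (p : A) :
    mdiff I J (Sum.map f g) (Sum.inl p) = mdiff I J f p := by
  rw [← mdiff_comp_inl (hf.sumMap hg)]
  refine (mdiff_comp (ContMDiff.inl (I := J) (M := A') (M' := B')) hf p).trans ?_
  rw [mdiff_sumInl]
  rfl

theorem mdiff_sumMap_inr (hf : ContMDiff I J ∞ f) (hg : ContMDiff I J ∞ g) (p : B) :
    mdiff I J (Sum.map f g) (Sum.inr p) = mdiff I J g p := by
  rw [← mdiff_comp_inr (hf.sumMap hg)]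
  refine (mdiff_comp (ContMDiff.inr (I := J) (M := A') (M' := B')) hg p).trans ?_
  rw [mdiff_sumInr]
  rfl

end SumMap

section SumFibre

variable {E₀ H₀ E₁ H₁ E₂ H₂ E₃ H₃ B B' M Z Z' : Type*}
  [NormedAddCommGroup E₀] [NormedSpace ℝ E₀] [TopologicalSpace H₀] {I₀ : ModelWithCorners ℝ E₀ H₀}
  [NormedAddCommGroup E₁] [NormedSpace ℝ E₁] [TopologicalSpace H₁] {I₁ : ModelWithCorners ℝ E₁ H₁}
  [NormedAddCommGroup E₂] [NormedSpace ℝ E₂] [TopologicalSpace H₂] {I₂ : ModelWithCorners ℝ E₂ H₂}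
  [TopologicalSpace B] [ChartedSpace H₁ B] [TopologicalSpace B'] [ChartedSpace H₁ B']
  [TopologicalSpace M] [ChartedSpace H₂ M] [TopologicalSpace Z] [ChartedSpace H₀ Z]
  [TopologicalSpace Z'] [ChartedSpace H₀ Z']
  [IsManifold I₀ ∞ Z] [IsManifold I₀ ∞ Z'] {p₀ : Z → B} {p₁ : Z → M} {q₀ : Z' → B'} {q₁ : Z' → M}

theorem injective_mdiff_sum (hp₀ : ContMDiff I₀ I₁ ∞ p₀) (hp₁ : ContMDiff I₀ I₂ ∞ p₁)
    (hq₀ : ContMDiff I₀ I₁ ∞ q₀) (hq₁ : ContMDiff I₀ I₂ ∞ q₁)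
    (hp : ∀ z, Function.Injective ((mdiff I₀ I₁ p₀ z).prod (mdiff I₀ I₂ p₁ z)))
    (hq : ∀ z, Function.Injective ((mdiff I₀ I₁ q₀ z).prod (mdiff I₀ I₂ q₁ z))) (z : Z ⊕ Z') :
    Function.Injective ((mdiff I₀ I₁ (Sum.map p₀ q₀) z).prod (mdiff I₀ I₂ (Sum.elim p₁ q₁) z)) := by
  rcases z with z | z
  · rw [mdiff_sumMap_inl hp₀ hq₀, mdiff_sumElim_inl hp₁ hq₁]
    exact hp z
  · rw [mdiff_sumMap_inr hp₀ hq₀, mdiff_sumElim_inr hp₁ hq₁]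
    exact hq z

end SumFibre

theorem range_sum_fibreProduct {B B' M Z Z' X : Type*} {p₀ : Z → B} {p₁ : Z → M}
    {q₀ : Z' → B'} {q₁ : Z' → M} {F : B → X} {F' : B' → X} {f : M → X}
    (hp : range (fun z => (p₀ z, p₁ z)) = {q | F q.1 = f q.2})
    (hq : range (fun z => (q₀ z, q₁ z)) = {q | F' q.1 = f q.2}) :
    range (fun z => (Sum.map p₀ q₀ z, Sum.elim p₁ q₁ z)) = {q | Sum.elim F F' q.1 = f q.2} := by
  ext ⟨b | b, m⟩
  · have := Set.ext_iff.1 hp (b, m)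
    simpa using this
  · have := Set.ext_iff.1 hq (b, m)
    simpa using this

variable {n : ℕ} {X : Type*} [TopologicalSpace X] [ChartedSpace (EuclideanSpace ℝ (Fin n)) X]
  [IsManifold (𝓡 n) ∞ X] {oX : ManifoldOrientation (𝓡 n) X n} {ε : SignType} {k l d : ℤ}
  {f f' : Pseudocycle n X k} {g : Pseudocycle n X l} {h h' : Pseudocycle n X d}
  {p₀ : h.M → f.M} {p₁ : h.M → g.M} {q₀ : h'.M → f'.M} {q₁ : h'.M → g.M}

theorem jointDiff_congr_left {EB HB B EM HM M EX HX Y : Type*}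
    [NormedAddCommGroup EB] [NormedSpace ℝ EB] [TopologicalSpace HB]
    {IB : ModelWithCorners ℝ EB HB} [TopologicalSpace B] [ChartedSpace HB B]
    [NormedAddCommGroup EM] [NormedSpace ℝ EM] [TopologicalSpace HM]
    {IM : ModelWithCorners ℝ EM HM} [TopologicalSpace M] [ChartedSpace HM M]
    [NormedAddCommGroup EX] [NormedSpace ℝ EX] [TopologicalSpace HX]
    {IX : ModelWithCorners ℝ EX HX} [TopologicalSpace Y] [ChartedSpace HX Y]
    {B' : Type*} [TopologicalSpace B'] [ChartedSpace HB B'] {F : B → Y} {F' : B' → Y} {m : M → Y}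
    {b : B} {b' : B'} (q : M) (h : mdiff IB IX F b = mdiff IB IX F' b') :
    jointDiff IB IM IX F m b q = jointDiff IB IM IX F' m b' q := by
  ext v
  · exact (jointDiff_apply F m b q _).trans ((congrArg (fun A : EB →L[ℝ] EX => A _ - _) h).trans
      (jointDiff_apply F' m b' q _).symm)
  · exact (jointDiff_apply F m b q _).trans ((congrArg (fun A : EB →L[ℝ] EX => A _ - _) h).trans
      (jointDiff_apply F' m b' q _).symm)

/-- Fibre products distribute over disjoint unions in the first factor, so the product is additive
there already on pseudocycles; orientations are checked summand by summand. -/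
theorem IsFibreProduct.sum (H : IsFibreProduct oX ε f g h p₀ p₁)
    (H' : IsFibreProduct oX ε f' g h' q₀ q₁) :
    IsFibreProduct oX ε (f.sum f') g (h.sum h') (Sum.map p₀ q₀) (Sum.elim p₁ q₁) := by
  refine ⟨H.smooth₀.sumMap H'.smooth₀, H.smooth₁.sumElim H'.smooth₁,
    isClosedEmbedding_sum_prod H.isClosedEmbedding H'.isClosedEmbedding,
    injective_mdiff_sum H.smooth₀ H.smooth₁ H'.smooth₀ H'.smooth₁ H.injective H'.injective,
    range_sum_fibreProduct H.range_eq H'.range_eq, ?_, ?_⟩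
  · rintro (p | p)
    · exact H.map_eq p
    · exact H'.map_eq p
  · rintro hd (p | p)
    · exact (H.fibreSign hd p).congr (funext (h.frameSign_sum_inl h' p))
        (funext (f.frameSign_sum_inl f' (p₀ p))) (mdiff_sumMap_inl H.smooth₀ H'.smooth₀ p)
        (mdiff_sumElim_inl H.smooth₁ H'.smooth₁ p)
        (jointDiff_congr_left _ (mdiff_sumElim_inl f.smooth f'.smooth (p₀ p)))
    · exact (H'.fibreSign hd p).congr (funext (h.frameSign_sum_inr h' p))
        (funext (f.frameSign_sum_inr f' (q₀ p))) (mdiff_sumMap_inr H.smooth₀ H'.smooth₀ p)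
        (mdiff_sumElim_inr H.smooth₁ H'.smooth₁ p)
        (jointDiff_congr_left _ (mdiff_sumElim_inr f.smooth f'.smooth (q₀ p)))

/-- Transversality of a map on a manifold with boundary may be checked on its boundary and on its
interior separately, each parametrised by a boundaryless manifold. -/
theorem surjective_jointDiff_of_comp {EB HB B EM HM M EX HX Y EN HN N : Type*}
    [NormedAddCommGroup EB] [NormedSpace ℝ EB] [TopologicalSpace HB]
    {IB : ModelWithCorners ℝ EB HB} [TopologicalSpace B] [ChartedSpace HB B]
    [NormedAddCommGroup EM] [NormedSpace ℝ EM] [TopologicalSpace HM]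
    {IM : ModelWithCorners ℝ EM HM} [TopologicalSpace M] [ChartedSpace HM M]
    [NormedAddCommGroup EX] [NormedSpace ℝ EX] [TopologicalSpace HX]
    {IX : ModelWithCorners ℝ EX HX} [TopologicalSpace Y] [ChartedSpace HX Y]
    [NormedAddCommGroup EN] [NormedSpace ℝ EN] [TopologicalSpace HN]
    {IN : ModelWithCorners ℝ EN HN} [TopologicalSpace N] [ChartedSpace HN N]
    {F : B → Y} {m : M → Y} {e : N → B} (hF : ContMDiff IB IX ∞ F) (he : ContMDiff IN IB ∞ e)
    {p : N} {q : M} (h : Function.Surjective (jointDiff IN IM IX (F ∘ e) m p q)) :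
    Function.Surjective (jointDiff IB IM IX F m (e p) q) := by
  intro v
  obtain ⟨u, hu⟩ := h v
  exact ⟨(mdiff IN IB e p u.1, u.2), by
    rw [← hu, jointDiff_apply, jointDiff_apply, mdiff_comp_apply hF he]⟩

variable [T2Space X]

/-- The fibre product of a bordism with `g` is a bordism of the fibre products of its ends. -/
theorem equivalent_of_isFibreProduct_filling (H : IsFibreProduct oX ε f g h p₀ p₁)
    (H' : IsFibreProduct oX ε f' g h' q₀ q₁) (hε : ε ≠ 0) (hd : d = k + l - n)
    (W : Filling k.toNat (f.M ⊕ f'.M) (cobSign f.orientation f'.orientation)) {F : W.B → X}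
    (hF : ContMDiff (𝓡∂ (k.toNat + 1)) (𝓡 n) ∞ F) (hc : IsCompact (closure (range F)))
    (hι : ∀ z, F (W.ι z) = Sum.elim f.map f'.map z)
    (hf : Transverse f.toMapFromManifold g.toMapFromManifold)
    (hf' : Transverse f'.toMapFromManifold g.toMapFromManifold)
    (hT : ∀ p, (𝓡∂ (k.toNat + 1)).IsInteriorPoint p → ∀ q, F p = g.map q →
      Function.Surjective (jointDiff (𝓡∂ (k.toNat + 1)) (𝓡 l.toNat) (𝓡 n) F g.map p q))
    (hdim : DimAtMost n (d - 1) ((Bd F ∩ range g.map) ∪ (range F ∩ Bd g.map) ∪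
      (Bd F ∩ Bd g.map))) : Equivalent h h' := by
  by_cases hk : k < 0
  · have := f.isEmpty_of_neg hk
    have := f'.isEmpty_of_neg hk
    exact equivalent_of_isEmpty _ _ p₀.isEmpty q₀.isEmpty
  by_cases hl : l < 0
  · have := g.isEmpty_of_neg hl
    exact equivalent_of_isEmpty _ _ p₁.isEmpty q₁.isEmpty
  by_cases hd0 : d < 0
  · exact equivalent_of_isEmpty _ _ (h.isEmpty_of_neg hd0) (h'.isEmpty_of_neg hd0)
  have hdn : d.toNat + n = k.toNat + l.toNat := by omega
  have hFι : F ∘ W.ι = Sum.elim f.map f'.map := funext hι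
  have hT' : Trans (𝓡 k.toNat) (𝓡 l.toNat) (𝓡 n) (F ∘ W.ι) g.map := by
    rw [hFι]
    exact Trans.sumElim f.smooth f'.smooth (transverse_iff_trans.1 hf) (transverse_iff_trans.1 hf')
  have hTT : Trans (𝓡∂ (k.toNat + 1)) (𝓡 l.toNat) (𝓡 n) F g.map := by
    intro p q hpq
    rcases (𝓡∂ (k.toNat + 1)).isInteriorPoint_or_isBoundaryPoint p with hp | hp
    · exact hT p hp q hpq
    · obtain ⟨z, rfl⟩ := W.exists_eq hp
      exact surjective_jointDiff_of_comp hF W.smooth (hT' z q hpq)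
  obtain ⟨V, pB, pM, hB, hM, hcl, hr, hVB, hVM⟩ := W.exists_fibreProduct g.orientation oX hF
    g.smooth hTT hT' hdn (H.smooth₀.sumMap H'.smooth₀) (H.smooth₁.sumElim H'.smooth₁)
    (isClosedEmbedding_sum_prod H.isClosedEmbedding H'.isClosedEmbedding)
    (injective_mdiff_sum H.smooth₀ H.smooth₁ H'.smooth₀ H'.smooth₁ H.injective H'.injective)
    (by
      rw [range_sum_fibreProduct H.range_eq H'.range_eq, ← hFι]
      rfl) hε (τ := frameEquiv hdn) (σ' := cobSign h.orientation h'.orientation) (by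
      rintro (z | z) w hw
      · refine congrArg Neg.neg (?_ : h.orientation.frameSign z w = 0)
        by_contra h0
        exact hw (h.orientation.linearIndependent_of_frameSign_ne_zero h0)
      · by_contra h0
        exact hw (h'.orientation.linearIndependent_of_frameSign_ne_zero h0)) (by
      -- At the incoming end both the sign of `f` and that of the fibre product are reversed, so the
      -- same `ε` is right at both ends.
      rw [hFι]
      rintro (z | z)
      · rw [show g.map (Sum.elim p₁ q₁ (Sum.inl z)) = h.map z from
          ((H.map_eq z).trans (H.map_eq_map z)).symm]
        exact (H.fibreSign hdn z).neg.congr rfl rfl (mdiff_sumMap_inl H.smooth₀ H'.smooth₀ z)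
          (mdiff_sumElim_inl H.smooth₁ H'.smooth₁ z)
          (jointDiff_congr_left _ (mdiff_sumElim_inl f.smooth f'.smooth (p₀ z)))
      · rw [show g.map (Sum.elim p₁ q₁ (Sum.inr z)) = h'.map z from
          ((H'.map_eq z).trans (H'.map_eq_map z)).symm]
        exact (H'.fibreSign hdn z).congr rfl rfl (mdiff_sumMap_inr H.smooth₀ H'.smooth₀ z)
          (mdiff_sumElim_inr H.smooth₁ H'.smooth₁ z)
          (jointDiff_congr_left _ (mdiff_sumElim_inr f.smooth f'.smooth (q₀ z))))
  have hmem : ∀ z, F (pB z) = g.map (pM z) := fun z => by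
    have : (pB z, pM z) ∈ {q : W.B × g.M | F q.1 = g.map q.2} := hr ▸ mem_range_self z
    exact this
  refine equivalent_of_filling V (hF.comp hB) (hc.of_isClosed_subset isClosed_closure
    (closure_mono (range_comp_subset_range _ _)))
    (hdim.mono (bd_fibreProduct_subset hF.continuous g.smooth.continuous hcl (fun _ => rfl) hmem))
    fun z => (congrArg F (hVB z)).trans ((hι _).trans ?_)
  rcases z with z | z
  · exact (H.map_eq z).symm
  · exact (H'.map_eq z).symm

end Pseudocycles

end

/-! ### Generic strong transversality and invariance under cobordism -/

noncomputable section
namespace Pseudocycles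

open Module Filter

variable {n : ℕ} {X : Type*} [TopologicalSpace X] [ChartedSpace (EuclideanSpace ℝ (Fin n)) X]

/-- The composition of a map from a manifold with a diffeomorphism. -/
def MapFromManifold.comp {d : ℤ} (φ : X ≃ₘ^∞⟮𝓡 n, 𝓡 n⟯ X) (g : MapFromManifold n X d) :
    MapFromManifold n X d :=
  { g with map := φ ∘ g.map, smooth := φ.contMDiff.comp g.smooth }

theorem Transverse.symm {d e : ℤ} {f : MapFromManifold n X d} {g : MapFromManifold n X e}
    (h : Transverse f g) : Transverse g f :=
  transverse_iff_trans.2 (transverse_iff_trans.1 h).symm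

/-- Each of two maps is transverse to each of two others. -/
def TransversePairs {a b c d : ℤ} (f : MapFromManifold n X a) (f' : MapFromManifold n X b)
    (g : MapFromManifold n X c) (g' : MapFromManifold n X d) : Prop :=
  Transverse f g ∧ Transverse f' g' ∧ Transverse f g' ∧ Transverse f' g

theorem StronglyTransverse.symm {k l : ℤ} {f : Pseudocycle n X k} {g : Pseudocycle n X l}
    (h : StronglyTransverse f g) : StronglyTransverse g f := by
  obtain ⟨g₀, g₁, h0, h1, h2, h3, h4, h5⟩ := h
  exact ⟨g₁, g₀, h1, h0, h2.symm, h3.symm, h5.symm, h4.symm⟩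

theorem MapFromManifold.exists_restrict [IsManifold (𝓡 n) ∞ X] {d : ℤ} (g : MapFromManifold n X d)
    {U : Set X} (hU : IsOpen U) :
    ∃ (g' : MapFromManifold n X d) (e : g'.M → g.M), ContMDiff (𝓡 d.toNat) (𝓡 d.toNat) ∞ e ∧
      (∀ p, Function.Surjective (mdiff (𝓡 d.toNat) (𝓡 d.toNat) e p)) ∧ g'.map = g.map ∘ e ∧
      range g'.map = range g.map ∩ U := by
  obtain ⟨g', e, he, hg', hs, hd⟩ := exists_mapFromManifold_of_isOpen (I := 𝓡 d.toNat) (d := d)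
    (hU.preimage g.smooth.continuous) (fun p _ => BoundarylessManifold.isInteriorPoint)
    (fun ⟨p, _⟩ => by
      have : ¬ d < 0 := fun h => (g.isEmpty_of_neg h).elim p
      simp only [finrank_euclideanSpace_fin]
      omega) g.smooth
  refine ⟨g', e, hs, hd, funext hg', ?_⟩
  rw [show g'.map = g.map ∘ e from funext hg', range_comp, he, image_preimage_eq_range_inter]

variable {U : Set X}

theorem Perturbation.eventually_transverse [IsManifold (𝓡 n) ∞ X] (Φ : Perturbation n U) {a b : ℤ}
    {N : MapFromManifold n X a} (hN : range N.map ⊆ U) (M : MapFromManifold n X b) :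
    ∀ᶠ s in generic Φ.S, Transverse (N.comp (Φ.toDiffeo s)) M := by
  have h := generic_trans (IN := 𝓡 a.toNat) (IM := 𝓡 b.toNat) (IX := 𝓡 n) (S := Φ.S)
    (G := fun z : N.M × Φ.S => Φ.toDiffeo z.2 (N.map z.1))
    (Φ.smooth.comp (contMDiff_snd.prodMk (N.smooth.comp contMDiff_fst))) M.smooth
    (fun p => Φ.surjective _ (hN (mem_range_self p)))
  exact h.mono fun s hs => transverse_iff_trans.2 hs

theorem Perturbation.eventually_transversePairs [IsManifold (𝓡 n) ∞ X] (Φ : Perturbation n U)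
    {a b c d : ℤ} {f : MapFromManifold n X a} {f' : MapFromManifold n X b}
    (hf : range f.map ⊆ U) (hf' : range f'.map ⊆ U) (g : MapFromManifold n X c)
    (g' : MapFromManifold n X d) : ∀ᶠ s in generic Φ.S,
      TransversePairs (f.comp (Φ.toDiffeo s)) (f'.comp (Φ.toDiffeo s)) g g' :=
  (Φ.eventually_transverse hf g).and ((Φ.eventually_transverse hf' g').and
    ((Φ.eventually_transverse hf g').and (Φ.eventually_transverse hf' g)))

/-- A perturbation is known to be submersive only at points of `U`, so coverings have to be
restricted to the preimage of `U` before they are moved. -/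
theorem exists_covering_subset [IsManifold (𝓡 n) ∞ X] {d : ℤ} {S : Set X} (h : DimAtMost n d S)
    (hU : IsOpen U) (hS : S ⊆ U) :
    ∃ g : MapFromManifold n X d, S ⊆ range g.map ∧ range g.map ⊆ U := by
  obtain ⟨g, hg⟩ := h
  obtain ⟨g', e, -, -, -, hr⟩ := g.exists_restrict hU
  exact ⟨g', hr ▸ subset_inter hg hS, hr ▸ inter_subset_right⟩

theorem Pseudocycle.bd_subset {k : ℤ} (f : Pseudocycle n X k) (h : closure (range f.map) ⊆ U) :
    Bd f.map ⊆ U := (Bd_subset_closure_range f.map).trans h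

theorem Pseudocycle.bd_comp {k : ℤ} (φ : X ≃ₘ^∞⟮𝓡 n, 𝓡 n⟯ X) (f : Pseudocycle n X k) :
    Bd (f.comp φ).map = φ '' Bd f.map := Pseudocycles.bd_comp φ.toHomeomorph f.map

theorem Pseudocycle.bd_comp_subset {k : ℤ} (φ : X ≃ₘ^∞⟮𝓡 n, 𝓡 n⟯ X) (f : Pseudocycle n X k) {d : ℤ}
    {g : MapFromManifold n X d} (h : Bd f.map ⊆ range g.map) :
    Bd (f.comp φ).map ⊆ range (g.comp φ).map := by
  rw [f.bd_comp]
  refine (image_mono h).trans ?_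
  rw [← range_comp]
  exact subset_rfl

theorem TransversePairs.stronglyTransverse {k l : ℤ} {f : Pseudocycle n X k} {g : Pseudocycle n X l}
    {f' : MapFromManifold n X (k - 2)} {g' : MapFromManifold n X (l - 2)}
    (h : TransversePairs f.toMapFromManifold f' g.toMapFromManifold g')
    (hf : Bd f.map ⊆ range f'.map) (hg : Bd g.map ⊆ range g'.map) : StronglyTransverse f g :=
  ⟨f', g', hf, hg, h.1, h.2.1, h.2.2.1, h.2.2.2⟩

/-- Strong transversality amounts to four transversality conditions, each valid for almost all
parameters; a covering of `Bd f` is moved along with `f`. -/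
theorem Perturbation.eventually_stronglyTransverse [IsManifold (𝓡 n) ∞ X] (Φ : Perturbation n U)
    (hU : IsOpen U) {k l : ℤ} (f : Pseudocycle n X k) (hf : closure (range f.map) ⊆ U)
    (g : Pseudocycle n X l) :
    ∀ᶠ s in generic Φ.S, StronglyTransverse (f.comp (Φ.toDiffeo s)) g := by
  obtain ⟨f', hf', hfU⟩ := exists_covering_subset f.dim_bd hU (f.bd_subset hf)
  obtain ⟨g', hg'⟩ := g.dim_bd
  filter_upwards [Φ.eventually_transversePairs (f := f.toMapFromManifold)
    (subset_closure.trans hf) hfU g.toMapFromManifold g'] with s hs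
  exact TransversePairs.stronglyTransverse (f := f.comp (Φ.toDiffeo s)) hs
    (f.bd_comp_subset _ hf') hg'

/-- Generic transversality is stated for boundaryless manifolds; the interior takes the place of the
filling there, and the ends are treated separately. -/
theorem Filling.exists_interior {k : ℤ} (hk : 0 ≤ k) {P : Type} [TopologicalSpace P]
    [ChartedSpace (EuclideanSpace ℝ (Fin k.toNat)) P] [IsManifold (𝓡 k.toNat) ∞ P]
    {σ : P → (Fin k.toNat → EuclideanSpace ℝ (Fin k.toNat)) → SignType}
    (W : Filling k.toNat P σ) {F : W.B → X} (hF : ContMDiff (𝓡∂ (k.toNat + 1)) (𝓡 n) ∞ F) :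
    ∃ (N : MapFromManifold n X (k + 1)) (e : N.M → W.B),
      range e = (𝓡∂ (k.toNat + 1)).interior W.B ∧ N.map = F ∘ e ∧
      ContMDiff (𝓡 (k + 1).toNat) (𝓡∂ (k.toNat + 1)) ∞ e := by
  obtain ⟨N, e, he, hN, hs, -⟩ := exists_mapFromManifold_of_isOpen (I := 𝓡∂ (k.toNat + 1))
    (d := k + 1) ((𝓡∂ (k.toNat + 1)).isOpen_interior (M := W.B) (n := ∞) (by simp))
    (fun p hp => hp) (fun _ => by simp only [finrank_euclideanSpace_fin]; omega) hF
  exact ⟨N, e, he, funext hN, hs⟩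

section Bordism

variable [IsManifold (𝓡 n) ∞ X] [T2Space X]
  {oX : ManifoldOrientation (𝓡 n) X n} {ε : SignType} {k l d : ℤ}
  {f f' : Pseudocycle n X k} {g : Pseudocycle n X l} {h h' : Pseudocycle n X d}
  {p₀ : h.M → f.M} {p₁ : h.M → g.M} {q₀ : h'.M → f'.M} {q₁ : h'.M → g.M}

/-- The image of a cobordism is that of its interior and those of its ends. Intersected with a
covering of `Bd g` they have dimensions at most `k + 1 + (l - 2) - n = d - 1` and `k + (l - 2) - n`,
which leaves only the parts that meet `Bd F` as hypotheses. -/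
theorem equivalent_of_transverse_filling (H : IsFibreProduct oX ε f g h p₀ p₁)
    (H' : IsFibreProduct oX ε f' g h' q₀ q₁) (hε : ε ≠ 0) (hd : d = k + l - n)
    (W : Filling k.toNat (f.M ⊕ f'.M) (cobSign f.orientation f'.orientation)) {F : W.B → X}
    (hF : ContMDiff (𝓡∂ (k.toNat + 1)) (𝓡 n) ∞ F) (hc : IsCompact (closure (range F)))
    (hι : ∀ z, F (W.ι z) = Sum.elim f.map f'.map z) {N : MapFromManifold n X (k + 1)}
    {e : N.M → W.B} (he : ContMDiff (𝓡 (k + 1).toNat) (𝓡∂ (k.toNat + 1)) ∞ e)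
    (hr : range e = (𝓡∂ (k.toNat + 1)).interior W.B) (hN : N.map = F ∘ e)
    {g' : MapFromManifold n X (l - 2)} (hg' : Bd g.map ⊆ range g'.map)
    (hNg : Transverse N g.toMapFromManifold) (hNg' : Transverse N g')
    (hfg : Transverse f.toMapFromManifold g.toMapFromManifold)
    (hfg' : Transverse f.toMapFromManifold g')
    (hf'g : Transverse f'.toMapFromManifold g.toMapFromManifold)
    (hf'g' : Transverse f'.toMapFromManifold g')
    (hB : DimAtMost n (d - 1) (Bd F ∩ range g.map))
    (hB' : DimAtMost n (d - 1) (Bd F ∩ range g'.map)) : Equivalent h h' := by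
  refine equivalent_of_isFibreProduct_filling H H' hε hd W hF hc hι hfg hf'g ?_ ?_
  · intro p hp q hpq
    obtain ⟨x, rfl⟩ : p ∈ range e := hr ▸ hp
    refine surjective_jointDiff_of_comp hF he ?_
    rw [← hN]
    exact transverse_iff_trans.1 hNg x q (by rw [hN]; exact hpq)
  · have hsub : range F ⊆ range N.map ∪ (range f.map ∪ range f'.map) := by
      rintro _ ⟨p, rfl⟩
      rcases (𝓡∂ (k.toNat + 1)).isInteriorPoint_or_isBoundaryPoint p with hp | hp
      · obtain ⟨x, rfl⟩ : p ∈ range e := hr ▸ hp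
        exact Or.inl ⟨x, by rw [hN]; rfl⟩
      · obtain ⟨z, rfl⟩ := W.exists_eq hp
        rw [hι]
        rcases z with z | z
        · exact Or.inr (Or.inl ⟨z, rfl⟩)
        · exact Or.inr (Or.inr ⟨z, rfl⟩)
    refine (hB.union (DimAtMost.mono ?_ (inter_subset_inter hsub hg'))).union
      (hB'.mono (inter_subset_inter_right _ hg'))
    rw [union_inter_distrib_right, union_inter_distrib_right]
    exact (hNg'.dimAtMost_inter.of_le (by omega)).union
      ((hfg'.dimAtMost_inter.of_le (by omega)).union (hf'g'.dimAtMost_inter.of_le (by omega)))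

end Bordism

section Generic

variable [IsManifold (𝓡 n) ∞ X] [T2Space X] {k l : ℤ}

/-- A generic position of `g` is transverse to the interior of the cobordism, to a covering of its
limit set and to both ends; the fibre product with such a `g` is a cobordism. -/
theorem Cobordism.eventually_equivalent {f f' : Pseudocycle n X k} (C : Cobordism f f')
    (Φ : Perturbation n U) (hU : IsOpen U) (g : Pseudocycle n X l)
    (hg : closure (range g.map) ⊆ U) :
    ∀ᶠ s in generic Φ.S, ∀ {oX : ManifoldOrientation (𝓡 n) X n} {ε : SignType} {d : ℤ}
      {h h' : Pseudocycle n X d} {p₀ : h.M → f.M} {p₁ : h.M → (g.comp (Φ.toDiffeo s)).M}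
      {q₀ : h'.M → f'.M} {q₁ : h'.M → (g.comp (Φ.toDiffeo s)).M},
      IsFibreProduct oX ε f (g.comp (Φ.toDiffeo s)) h p₀ p₁ →
      IsFibreProduct oX ε f' (g.comp (Φ.toDiffeo s)) h' q₀ q₁ → ε ≠ 0 → d = k + l - n →
      Equivalent h h' := by
  by_cases hk : k < 0
  · refine Eventually.of_forall fun s oX ε d h h' p₀ p₁ q₀ q₁ _ _ _ _ => ?_
    have := f.isEmpty_of_neg hk
    have := f'.isEmpty_of_neg hk
    exact equivalent_of_isEmpty _ _ p₀.isEmpty q₀.isEmpty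
  obtain ⟨N, e, hr, hN, he⟩ := C.filling.exists_interior (not_lt.1 hk) C.smooth_filling
  obtain ⟨G, hG⟩ := C.dim_bd
  obtain ⟨g', hg', hgU⟩ := exists_covering_subset g.dim_bd hU (g.bd_subset hg)
  have hgr : range g.toMapFromManifold.map ⊆ U := subset_closure.trans hg
  filter_upwards [Φ.eventually_transversePairs hgr hgU N G,
    Φ.eventually_transversePairs hgr hgU f.toMapFromManifold f'.toMapFromManifold]
    with s h1 h2 oX ε d h h' p₀ p₁ q₀ q₁ H H' hε hd
  refine equivalent_of_transverse_filling H H' hε hd C.filling C.smooth_filling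
    C.isCompact_closure C.map_ι he hr hN (g.bd_comp_subset _ hg') h1.1.symm h1.2.2.2.symm
    h2.1.symm h2.2.2.2.symm h2.2.2.1.symm h2.2.1.symm ?_ ?_
  · exact (h1.2.2.1.symm.dimAtMost_inter.mono (inter_subset_inter_left _ hG)).of_le (by omega)
  · exact (h1.2.1.symm.dimAtMost_inter.mono (inter_subset_inter_left _ hG)).of_le (by omega)

end Generic

end Pseudocycles

end

/-! ### Independence of the perturbation parameter -/

noncomputable section
namespace Pseudocycles

open Module Filter

variable {n : ℕ} {X : Type*} [TopologicalSpace X] [ChartedSpace (EuclideanSpace ℝ (Fin n)) X]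
  {U : Set X}

namespace Perturbation

variable (Φ : Perturbation n U) (s s' : Φ.S)

/-- A path from `s` to `s'`, deformed by `u`. -/
def path (u : Φ.S) (t : ℝ) : Φ.S := s + t • (s' - s) + (t * (1 - t)) • u

theorem path_zero (u : Φ.S) : Φ.path s s' u 0 = s := by simp [path]

theorem path_one (u : Φ.S) : Φ.path s s' u 1 = s' := by simp [path]

theorem contDiff_path : ContDiff ℝ ∞ fun z : ℝ × Φ.S => Φ.path s s' z.2 z.1 := by
  unfold path
  fun_prop

theorem contMDiff_path_apply {E H N : Type*} [NormedAddCommGroup E] [NormedSpace ℝ E]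
    [TopologicalSpace H] {I : ModelWithCorners ℝ E H} [TopologicalSpace N] [ChartedSpace H N]
    {τ : N → ℝ} {υ : N → Φ.S} {y : N → X} (hτ : ContMDiff I 𝓘(ℝ, ℝ) ∞ τ)
    (hυ : ContMDiff I 𝓘(ℝ, Φ.S) ∞ υ) (hy : ContMDiff I (𝓡 n) ∞ y) :
    ContMDiff I (𝓡 n) ∞ fun p => Φ.toDiffeo (Φ.path s s' (υ p) (τ p)) (y p) :=
  Φ.smooth.comp (((Φ.contDiff_path s s').contMDiff.comp (hτ.prodMk_space hυ)).prodMk hy)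

/-- For times in the open interval the factor `t * (1 - t)` is nonzero, so varying `u` varies the
parameter of the diffeomorphism in all directions. -/
theorem surjective_mdiff_path {t : ℝ} (ht : t ∈ Ioo (0 : ℝ) 1) {x : X} (hx : x ∈ U) (u : Φ.S) :
    Function.Surjective (mdiff 𝓘(ℝ, Φ.S) (𝓡 n)
      (fun v => Φ.toDiffeo (Φ.path s s' v t) x) u) := by
  have h1 : ContMDiff 𝓘(ℝ, Φ.S) (𝓡 n) ∞ fun σ => Φ.toDiffeo σ x :=
    Φ.smooth.comp (contMDiff_id.prodMk contMDiff_const)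
  have h2 : ContDiff ℝ ∞ fun v => Φ.path s s' v t := by
    unfold path
    fun_prop
  have h3 : mdiff 𝓘(ℝ, Φ.S) 𝓘(ℝ, Φ.S) (fun v => Φ.path s s' v t) u =
      (t * (1 - t)) • ContinuousLinearMap.id ℝ Φ.S := by
    refine mfderiv_eq_fderiv.trans (HasFDerivAt.fderiv ?_)
    exact ((hasFDerivAt_id u).const_smul (t * (1 - t))).const_add _
  have h4 := mdiff_comp h1 h2.contMDiff u
  intro w
  obtain ⟨v, hv⟩ := Φ.surjective x hx (Φ.path s s' u t) w
  refine ⟨(t * (1 - t))⁻¹ • v, ?_⟩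
  have h5 : t * (1 - t) ≠ 0 := mul_ne_zero ht.1.ne' (sub_pos.2 ht.2).ne'
  refine (congrArg (fun A : Φ.S →L[ℝ] EuclideanSpace ℝ (Fin n) => A ((t * (1 - t))⁻¹ • v)) h4).trans
    ((congrArg (mdiff 𝓘(ℝ, Φ.S) (𝓡 n) (fun σ => Φ.toDiffeo σ x) (Φ.path s s' u t)) ?_).trans hv)
  refine (congrArg (fun A : Φ.S →L[ℝ] Φ.S => A ((t * (1 - t))⁻¹ • v)) h3).trans ?_
  exact smul_inv_smul₀ h5 v

theorem eventually_transverse_path [IsManifold (𝓡 n) ∞ X] {a b : ℤ} (N : MapFromManifold n X a)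
    {τ : N.M → ℝ} (hτ : ContMDiff (𝓡 a.toNat) 𝓘(ℝ, ℝ) ∞ τ) (hτ' : ∀ p, τ p ∈ Ioo (0 : ℝ) 1)
    {y : N.M → X} (hy : ContMDiff (𝓡 a.toNat) (𝓡 n) ∞ y) (hyU : ∀ p, y p ∈ U)
    (g : MapFromManifold n X b) : ∀ᶠ u in generic Φ.S, Transverse
      { N with
        map := fun p => Φ.toDiffeo (Φ.path s s' u (τ p)) (y p)
        smooth := Φ.contMDiff_path_apply s s' hτ contMDiff_const hy } g := by
  have h := generic_trans (IN := 𝓡 a.toNat) (IM := 𝓡 b.toNat) (IX := 𝓡 n) (S := Φ.S)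
    (G := fun z : N.M × Φ.S => Φ.toDiffeo (Φ.path s s' z.2 (τ z.1)) (y z.1))
    (Φ.contMDiff_path_apply s s' (hτ.comp contMDiff_fst) contMDiff_snd (hy.comp contMDiff_fst))
    g.smooth (fun p => Φ.surjective_mdiff_path s s' (hτ' p) (hyU p))
  exact h.mono fun s hs => transverse_iff_trans.2 hs

end Perturbation

variable [IsManifold (𝓡 n) ∞ X] [T2Space X] {oX : ManifoldOrientation (𝓡 n) X n} {ε : SignType}
  {k l d : ℤ}

/-- The two positions of `f` are joined by the trace of a path of parameters. The ends are
transverse by hypothesis and independent of `u`, and a generic `u` makes the trace at times strictly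
between them, as well as that of the covering `G`, transverse to `g` and `g'`. -/
theorem equivalent_of_transversePairs (Φ : Perturbation n U) {f : Pseudocycle n X k}
    (hfU : closure (range f.map) ⊆ U) {G : MapFromManifold n X (k - 2)}
    (hG : Bd f.map ⊆ range G.map) (hGU : range G.map ⊆ U) {g : Pseudocycle n X l}
    {g' : MapFromManifold n X (l - 2)} (hg' : Bd g.map ⊆ range g'.map) {s s' : Φ.S}
    (hs : TransversePairs (f.toMapFromManifold.comp (Φ.toDiffeo s)) (G.comp (Φ.toDiffeo s))
      g.toMapFromManifold g')
    (hs' : TransversePairs (f.toMapFromManifold.comp (Φ.toDiffeo s')) (G.comp (Φ.toDiffeo s'))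
      g.toMapFromManifold g') {h h' : Pseudocycle n X d} {p₀ : h.M → (f.comp (Φ.toDiffeo s)).M}
    {p₁ : h.M → g.M} {q₀ : h'.M → (f.comp (Φ.toDiffeo s')).M} {q₁ : h'.M → g.M}
    (H : IsFibreProduct oX ε (f.comp (Φ.toDiffeo s)) g h p₀ p₁)
    (H' : IsFibreProduct oX ε (f.comp (Φ.toDiffeo s')) g h' q₀ q₁) (hε : ε ≠ 0)
    (hd : d = k + l - n) : Equivalent h h' := by
  by_cases hk : k < 0
  · have : IsEmpty (f.comp (Φ.toDiffeo s)).M := f.isEmpty_of_neg hk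
    have : IsEmpty (f.comp (Φ.toDiffeo s')).M := f.isEmpty_of_neg hk
    exact equivalent_of_isEmpty _ _ p₀.isEmpty q₀.isEmpty
  let r := Diffeomorph.refl (𝓡 k.toNat) f.M ∞
  obtain ⟨W, t, m, ht, hm, he, hi₀, hi₁⟩ := exists_cylinder f.orientation f.orientation
    f.orientation r r (frameSign_mdiff_refl f) (frameSign_mdiff_refl f)
  have hcoe : ContMDiff (𝓡∂ 1) 𝓘(ℝ, ℝ) ∞ (Subtype.val : unitInterval → ℝ) :=
    contMDiff_subtypeVal_Icc
  have htc : ContMDiff (𝓡∂ (k.toNat + 1)) 𝓘(ℝ, ℝ) ∞ fun z => (t z : ℝ) := hcoe.comp ht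
  have hfm : ContMDiff (𝓡∂ (k.toNat + 1)) (𝓡 n) ∞ fun z => f.map (m z) := f.smooth.comp hm
  obtain ⟨N, e, hr, hN, he'⟩ := W.exists_interior (not_lt.1 hk) hfm
  -- An interior point at time `0` or `1` would coincide with a boundary point, because the cylinder
  -- embeds in the product of the interval and `f.M`.
  have hint : ∀ p, (t (e p) : ℝ) ∈ Ioo (0 : ℝ) 1 := by
    intro p
    have hp : (𝓡∂ (k.toNat + 1)).IsInteriorPoint (e p) :=
      (hr ▸ mem_range_self p : e p ∈ (𝓡∂ (k.toNat + 1)).interior W.B)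
    have hp' : ∀ z, e p ≠ W.ι z := fun z hz =>
      ((𝓡∂ (k.toNat + 1)).isInteriorPoint_iff_not_isBoundaryPoint _).1 hp
        (hz ▸ W.isBoundaryPoint z)
    refine ⟨lt_of_le_of_ne (t (e p)).2.1 fun h0 => ?_, lt_of_le_of_ne (t (e p)).2.2 fun h1 => ?_⟩
    · refine hp' (Sum.inl (m (e p))) (he.injective (Prod.ext ?_ ?_))
      · exact (Subtype.ext h0.symm).trans (hi₀ (m (e p))).1.symm
      · exact (hi₀ (m (e p))).2.symm
    · refine hp' (Sum.inr (m (e p))) (he.injective (Prod.ext ?_ ?_))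
      · exact (Subtype.ext h1).trans (hi₁ (m (e p))).1.symm
      · exact (hi₁ (m (e p))).2.symm
  have hS : IsOpen (univ ×ˢ Ioo 0 1 : Set (G.M × ℝ)) := isOpen_univ.prod isOpen_Ioo
  -- The covering at intermediate times, where moving `u` is effective.
  obtain ⟨G', e₁, hr₁, -, he₁, -⟩ := G.exists_prod_real hS (F := fun z => G.map z.1)
    (G.smooth.comp contMDiff_fst)
  have hint₁ : ∀ p, (e₁ p).2 ∈ Ioo (0 : ℝ) 1 := fun p =>
    (show e₁ p ∈ (univ ×ˢ Ioo 0 1 : Set (G.M × ℝ)) from hr₁ ▸ mem_range_self p).2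
  have hτN := htc.comp he'
  have hyN := hfm.comp he'
  have hτG := (contMDiff_snd (I := 𝓡 (k - 2).toNat) (J := 𝓘(ℝ, ℝ))).comp he₁
  have hyG := (G.smooth.comp (contMDiff_fst (I := 𝓡 (k - 2).toNat) (J := 𝓘(ℝ, ℝ)))).comp he₁
  have hUN : ∀ p, f.map (m (e p)) ∈ U := fun p => hfU (subset_closure (mem_range_self _))
  have hUG : ∀ p, G.map (e₁ p).1 ∈ U := fun p => hGU (mem_range_self _)
  obtain ⟨u, h1, h2, h3, h4⟩ := ((Φ.eventually_transverse_path s s' N hτN hint hyN hUN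
    g.toMapFromManifold).and ((Φ.eventually_transverse_path s s' N hτN hint hyN hUN g').and
    ((Φ.eventually_transverse_path s s' G' hτG hint₁ hyG hUG g.toMapFromManifold).and
    (Φ.eventually_transverse_path s s' G' hτG hint₁ hyG hUG g')))).exists
  have hA : Continuous fun z : unitInterval × X => Φ.toDiffeo (Φ.path s s' u z.1) z.2 :=
    (Φ.contMDiff_path_apply s s' (I := (𝓡∂ 1).prod (𝓡 n)) (hcoe.comp contMDiff_fst)
      (contMDiff_const (c := u)) contMDiff_snd).continuous
  have hF : ContMDiff (𝓡∂ (k.toNat + 1)) (𝓡 n) ∞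
      fun z => Φ.toDiffeo (Φ.path s s' u (t z)) (f.map (m z)) :=
    Φ.contMDiff_path_apply s s' htc contMDiff_const hfm
  -- A limit point of the trace comes from a time and a point of `Bd f`. Times `0` and `1` are
  -- covered by the two given positions of `G`, the others by `G'`.
  have hbd := bd_cylinder_subset f.isCompact_closure hA he
  have hbd' : Bd (fun z => Φ.toDiffeo (Φ.path s s' u (t z)) (f.map (m z))) ⊆
      range (fun p => Φ.toDiffeo (Φ.path s s' u (e₁ p).2) (G.map (e₁ p).1)) ∪
        (range (G.comp (Φ.toDiffeo s)).map ∪ range (G.comp (Φ.toDiffeo s')).map) := by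
    refine hbd.trans ?_
    rintro x ⟨τ, y, hy, rfl⟩
    obtain ⟨w, rfl⟩ := hG hy
    rcases eq_or_lt_of_le τ.2.1 with h0 | h0
    · refine Or.inr (Or.inl ⟨w, ?_⟩)
      change _ = Φ.toDiffeo (Φ.path s s' u (τ : ℝ)) _
      rw [← h0, Φ.path_zero]
      rfl
    rcases eq_or_lt_of_le τ.2.2 with h1 | h1
    · refine Or.inr (Or.inr ⟨w, ?_⟩)
      change _ = Φ.toDiffeo (Φ.path s s' u (τ : ℝ)) _
      rw [h1, Φ.path_one]
      rfl
    · obtain ⟨p, hp⟩ : (w, (τ : ℝ)) ∈ range e₁ := hr₁ ▸ ⟨mem_univ _, h0, h1⟩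
      exact Or.inl ⟨p, by
        change Φ.toDiffeo (Φ.path s s' u (e₁ p).2) (G.map (e₁ p).1) = _
        rw [hp]⟩
  -- At intermediate times the dimension is at most `k - 2 + 1 + b - n`, hence at most `d - 1` when
  -- `b ≤ l`; at the ends it is one less.
  have hdim : ∀ {b : ℤ} {M : MapFromManifold n X b}, b ≤ l →
      Transverse { G' with
        map := fun p => Φ.toDiffeo (Φ.path s s' u (e₁ p).2) (G.map (e₁ p).1)
        smooth := Φ.contMDiff_path_apply s s' hτG contMDiff_const hyG } M →
      Transverse (G.comp (Φ.toDiffeo s)) M → Transverse (G.comp (Φ.toDiffeo s')) M →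
      DimAtMost n (d - 1) (Bd (fun z => Φ.toDiffeo (Φ.path s s' u (t z)) (f.map (m z))) ∩
        range M.map) := by
    intro b M hb hM hM₀ hM₁
    refine DimAtMost.mono ?_ (inter_subset_inter_left _ hbd')
    rw [union_inter_distrib_right, union_inter_distrib_right]
    exact (hM.dimAtMost_inter.of_le (by omega)).union
      ((hM₀.dimAtMost_inter.of_le (by omega)).union (hM₁.dimAtMost_inter.of_le (by omega)))
  have hι : ∀ z, Φ.toDiffeo (Φ.path s s' u (t (W.ι z))) (f.map (m (W.ι z))) =
      Sum.elim (fun p => Φ.toDiffeo s (f.map p)) (fun p => Φ.toDiffeo s' (f.map p)) z := by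
    rintro (z | z)
    · rw [(hi₀ z).1, (hi₀ z).2]
      exact congrArg (fun σ => Φ.toDiffeo σ (f.map z)) (Φ.path_zero s s' u)
    · rw [(hi₁ z).1, (hi₁ z).2]
      exact congrArg (fun σ => Φ.toDiffeo σ (f.map z)) (Φ.path_one s s' u)
  refine equivalent_of_transverse_filling H H' hε hd W hF ?_ ?_ (N := { N with
    map := fun p => Φ.toDiffeo (Φ.path s s' u (t (e p))) (f.map (m (e p)))
    smooth := hF.comp he' }) he' hr rfl hg' h1 h2 hs.1
    hs.2.2.1 hs'.1 hs'.2.2.1 (hdim le_rfl h3 hs.2.2.2 hs'.2.2.2)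
    (hdim (by omega) h4 hs.2.1 hs'.2.1)
  · have h1 : IsCompact ((fun z : unitInterval × X => Φ.toDiffeo (Φ.path s s' u z.1) z.2) ''
        (univ ×ˢ closure (range f.map))) :=
      (isCompact_univ.prod f.isCompact_closure).image hA
    refine h1.of_isClosed_subset isClosed_closure (closure_minimal ?_ h1.isClosed)
    rintro _ ⟨z, rfl⟩
    exact ⟨(t z, f.map (m z)), ⟨mem_univ _, subset_closure (mem_range_self _)⟩, rfl⟩
  · exact hι

end Pseudocycles

end

/-! ### The product of classes -/

noncomputable section
namespace Pseudocycles

open Module Filter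

variable {n : ℕ} {X : Type*} [TopologicalSpace X] [ChartedSpace (EuclideanSpace ℝ (Fin n)) X]
  {U : Set X}

attribute [local instance] Homology.addCommGroup

theorem Perturbation.isotopicToId (Φ : Perturbation n U) (s : Φ.S) :
    IsotopicToId (Φ.toDiffeo s) := by
  have hcoe : ContMDiff (𝓡∂ 1) 𝓘(ℝ, ℝ) ∞ (Subtype.val : unitInterval → ℝ) :=
    contMDiff_subtypeVal_Icc
  have h1 : ContMDiff 𝓘(ℝ, ℝ) 𝓘(ℝ, Φ.S) ∞ fun t : ℝ => t • s :=
    (contDiff_id.smul contDiff_const).contMDiff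
  refine ⟨fun t => Φ.toDiffeo ((t : ℝ) • s), ?_, ?_, ?_⟩
  · exact Φ.smooth.comp (((h1.comp hcoe).comp contMDiff_fst).prodMk contMDiff_snd)
  · simp [Φ.zero]
  · simp

variable [IsManifold (𝓡 n) ∞ X]

/-- Strong transversality of a moved pseudocycle yields a covering of the moved limit set in unknown
position. Pulling it back by `φ` and cutting it down to `U` makes it available for other parameters
without losing transversality. -/
theorem exists_covering_of_comp (φ : X ≃ₘ^∞⟮𝓡 n, 𝓡 n⟯ X) {k d : ℤ} (f : Pseudocycle n X k)
    {G : MapFromManifold n X d} (hG : Bd (f.comp φ).map ⊆ range G.map) (hU : IsOpen U)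
    (hf : closure (range f.map) ⊆ U) :
    ∃ G' : MapFromManifold n X d, Bd f.map ⊆ range G'.map ∧ range G'.map ⊆ U ∧
      ∀ {e : ℤ} {M : MapFromManifold n X e}, Transverse G M → Transverse (G'.comp φ) M := by
  obtain ⟨G', e, he, hs, hm, hr⟩ := (G.comp φ.symm).exists_restrict hU
  refine ⟨G', ?_, hr ▸ inter_subset_right, fun h => ?_⟩
  · rw [hr]
    refine subset_inter (fun x hx => ?_) (f.bd_subset hf)
    obtain ⟨p, hp⟩ := hG (f.bd_comp φ ▸ mem_image_of_mem φ hx)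
    exact ⟨p, (congrArg φ.symm hp).trans (φ.symm_apply_apply x)⟩
  · refine transverse_iff_trans.2 ((transverse_iff_trans.1 h).mono
      (dominates_of_comp G.smooth he (fun p => ?_) hs))
    change φ (G'.map p) = _
    rw [hm]
    exact φ.apply_symm_apply _

/-- The class of the fibre product of a strongly transverse pair. -/
def Represents (oX : ManifoldOrientation (𝓡 n) X n) (ε : SignType) {k l d : ℤ}
    (f : Pseudocycle n X k) (g : Pseudocycle n X l) (γ : Homology n X d) : Prop :=
  StronglyTransverse f g ∧ ∃ (h : Pseudocycle n X d) (p₀ : h.M → f.M) (p₁ : h.M → g.M),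
    IsFibreProduct oX ε f g h p₀ p₁ ∧ h.cls = γ

variable (X) in
theorem exists_represents_swap (oX : ManifoldOrientation (𝓡 n) X n) (k l d : ℤ) :
    ∃ δ : SignType, δ ≠ 0 ∧ ∀ {ε : SignType} {f : Pseudocycle n X k} {g : Pseudocycle n X l}
      {γ : Homology n X d}, Represents oX ε f g γ → Represents oX (ε * δ) g f γ := by
  obtain ⟨δ, hδ, H⟩ := exists_sign_swap X oX k l d
  exact ⟨δ, hδ, fun ⟨h, f', p₀, p₁, h', hγ⟩ => ⟨h.symm, f', p₁, p₀, H h', hγ⟩⟩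

variable [T2Space X] {oX : ManifoldOrientation (𝓡 n) X n} {ε : SignType} {k l d : ℤ}
  {f f' : Pseudocycle n X k} {g : Pseudocycle n X l} {γ γ' : Homology n X d}

theorem StronglyTransverse.exists_represents (oX : ManifoldOrientation (𝓡 n) X n)
    (h : StronglyTransverse f g) (hε : ε ≠ 0) (hd : d = k + l - n) :
    ∃ γ : Homology n X d, Represents oX ε f g γ := by
  obtain ⟨f', p₀, p₁, H⟩ := h.exists_isFibreProduct oX hd hε
  exact ⟨_, h, f', p₀, p₁, H, rfl⟩

/-- The two hypotheses may use different coverings of `Bd g`, so they are not joined directly. A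
third parameter `r`, generic with respect to both sets of coverings, is joined to each of them. -/
theorem Represents.eq_of_move_left (hε : ε ≠ 0) (hd : d = k + l - n) (hU : IsOpen U)
    (hf : closure (range f.map) ⊆ U) (Φ : Perturbation n U) {s s' : Φ.S}
    (h : Represents oX ε (f.comp (Φ.toDiffeo s)) g γ)
    (h' : Represents oX ε (f.comp (Φ.toDiffeo s')) g γ') : γ = γ' := by
  obtain ⟨⟨G₀, G₁, hG₀, hG₁, T1, T2, T3, T4⟩, f₁, p₀, p₁, H, rfl⟩ := h
  obtain ⟨⟨G₀', G₁', hG₀', hG₁', T1', T2', T3', T4'⟩, f₁', p₀', p₁', H', rfl⟩ := h'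
  obtain ⟨A, hA, hAU, hAT⟩ := exists_covering_of_comp _ f hG₀ hU hf
  obtain ⟨A', hA', hAU', hAT'⟩ := exists_covering_of_comp _ f hG₀' hU hf
  have hfU : range f.toMapFromManifold.map ⊆ U := subset_closure.trans hf
  obtain ⟨r, hr, hr'⟩ := ((Φ.eventually_transversePairs hfU hAU g.toMapFromManifold G₁).and
    (Φ.eventually_transversePairs hfU hAU' g.toMapFromManifold G₁')).exists
  obtain ⟨f₂, q₀, q₁, H₂⟩ := (TransversePairs.stronglyTransverse (f := f.comp (Φ.toDiffeo r)) hr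
    (f.bd_comp_subset _ hA) hG₁).exists_isFibreProduct oX hd hε
  exact (cls_eq (equivalent_of_transversePairs Φ hf hA hAU hG₁ ⟨T1, hAT T2, T3, hAT T4⟩ hr
    H H₂ hε hd)).trans (cls_eq (equivalent_of_transversePairs Φ hf hA' hAU' hG₁'
    ⟨T1', hAT' T2', T3', hAT' T4'⟩ hr' H' H₂ hε hd)).symm

theorem Represents.eq_of_move_right (hε : ε ≠ 0) (hd : d = k + l - n) (hU : IsOpen U)
    (hg : closure (range g.map) ⊆ U) (Φ : Perturbation n U) {s s' : Φ.S}
    (h : Represents oX ε f (g.comp (Φ.toDiffeo s)) γ)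
    (h' : Represents oX ε f (g.comp (Φ.toDiffeo s')) γ') : γ = γ' := by
  obtain ⟨δ, hδ, H⟩ := exists_represents_swap X oX k l d
  exact (H h).eq_of_move_left (mul_ne_zero hε hδ) (by omega) hU hg Φ (H h')

/-- The class of the fibre product of `f` with a perturbation of `g`. -/
def MovedRight (oX : ManifoldOrientation (𝓡 n) X n) (ε : SignType) {k l d : ℤ}
    (f : Pseudocycle n X k) (g : Pseudocycle n X l) (γ : Homology n X d) : Prop :=
  ∃ U : Set X, IsOpen U ∧ closure (range g.map) ⊆ U ∧ ∃ (Φ : Perturbation n U) (s : Φ.S),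
    Represents oX ε f (g.comp (Φ.toDiffeo s)) γ

/-- The class of the fibre product of a perturbation of `f` with `g`. -/
def MovedLeft (oX : ManifoldOrientation (𝓡 n) X n) (ε : SignType) {k l d : ℤ}
    (f : Pseudocycle n X k) (g : Pseudocycle n X l) (γ : Homology n X d) : Prop :=
  ∃ U : Set X, IsOpen U ∧ closure (range f.map) ⊆ U ∧ ∃ (Φ : Perturbation n U) (s : Φ.S),
    Represents oX ε (f.comp (Φ.toDiffeo s)) g γ

theorem Represents.movedRight (h : Represents oX ε f g γ) : MovedRight oX ε f g γ := by
  obtain ⟨U, hU, hgU, ⟨Φ⟩⟩ := exists_perturbation (n := n) g.isCompact_closure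
  refine ⟨U, hU, hgU, Φ, 0, ?_⟩
  rwa [Φ.zero]

/-- With `φ` moving `g` and `ψ` moving `f`, choose `q` such that `ψ_q f` is strongly transverse to
both `φ_s g` and `g`. The classes of `f · φ_s g`, `ψ_q f · φ_s g`, `ψ_q f · g` and `ψ_r f · g` are
successively equal, since in each step only one factor moves within one family. -/
theorem MovedRight.eq_of_movedLeft (hε : ε ≠ 0) (hd : d = k + l - n) (h : MovedRight oX ε f g γ)
    (h' : MovedLeft oX ε f g γ') : γ = γ' := by
  obtain ⟨U, hU, hgU, Φ, s, h⟩ := h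
  obtain ⟨V, hV, hfV, Ψ, r, h'⟩ := h'
  obtain ⟨q, hq, hq'⟩ := ((Ψ.eventually_stronglyTransverse hV f hfV (g.comp (Φ.toDiffeo s))).and
    (Ψ.eventually_stronglyTransverse hV f hfV g)).exists
  obtain ⟨a, ha⟩ := hq.exists_represents oX hε hd
  obtain ⟨b, hb⟩ := hq'.exists_represents oX hε hd
  have h1 : γ = a := by
    refine Represents.eq_of_move_left hε hd hV hfV Ψ (s := 0) ?_ ha
    rwa [Ψ.zero]
  have h2 : a = b := by
    refine ha.eq_of_move_right hε hd hU hgU Φ (s' := 0) ?_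
    rwa [Φ.zero]
  exact h1.trans (h2.trans (hb.eq_of_move_left hε hd hV hfV Ψ h'))

theorem exists_movedRight (oX : ManifoldOrientation (𝓡 n) X n) (hε : ε ≠ 0) (hd : d = k + l - n)
    (f : Pseudocycle n X k) (g : Pseudocycle n X l) :
    ∃ γ : Homology n X d, MovedRight oX ε f g γ := by
  obtain ⟨U, hU, hgU, ⟨Φ⟩⟩ := exists_perturbation (n := n) g.isCompact_closure
  obtain ⟨s, hs⟩ := (Φ.eventually_stronglyTransverse hU g hgU f).exists
  obtain ⟨γ, hγ⟩ := hs.symm.exists_represents oX hε hd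
  exact ⟨γ, U, hU, hgU, Φ, s, hγ⟩

theorem exists_movedLeft (oX : ManifoldOrientation (𝓡 n) X n) (hε : ε ≠ 0) (hd : d = k + l - n)
    (f : Pseudocycle n X k) (g : Pseudocycle n X l) :
    ∃ γ : Homology n X d, MovedLeft oX ε f g γ := by
  obtain ⟨U, hU, hfU, ⟨Φ⟩⟩ := exists_perturbation (n := n) f.isCompact_closure
  obtain ⟨s, hs⟩ := (Φ.eventually_stronglyTransverse hU f hfU g).exists
  obtain ⟨γ, hγ⟩ := hs.exists_represents oX hε hd
  exact ⟨γ, U, hU, hfU, Φ, s, hγ⟩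

/-- Two moves of `g` by unrelated families cannot be compared directly; both are compared with one
move of `f`. -/
theorem MovedRight.unique (hε : ε ≠ 0) (hd : d = k + l - n) (h : MovedRight oX ε f g γ)
    (h' : MovedRight oX ε f g γ') : γ = γ' := by
  obtain ⟨a, ha⟩ := exists_movedLeft (d := d) oX hε hd f g
  exact (h.eq_of_movedLeft hε hd ha).trans (h'.eq_of_movedLeft hε hd ha).symm

/-- Both classes may be computed with a single position of `g`, generic for the cobordism as well as
for its ends. -/
theorem MovedRight.eq_of_equivalent (hε : ε ≠ 0) (hd : d = k + l - n) (h : MovedRight oX ε f g γ)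
    (h' : MovedRight oX ε f' g γ') (hf : Equivalent f f') : γ = γ' := by
  obtain ⟨C⟩ := hf
  obtain ⟨U, hU, hgU, ⟨Φ⟩⟩ := exists_perturbation (n := n) g.isCompact_closure
  obtain ⟨s, h1, h2, h3⟩ := ((Φ.eventually_stronglyTransverse hU g hgU f).and
    ((Φ.eventually_stronglyTransverse hU g hgU f').and
      (C.eventually_equivalent Φ hU g hgU))).exists
  obtain ⟨a, p₀, p₁, ha⟩ := h1.symm.exists_isFibreProduct oX hd hε
  obtain ⟨b, q₀, q₁, hb⟩ := h2.symm.exists_isFibreProduct oX hd hε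
  exact (h.unique hε hd ⟨U, hU, hgU, Φ, s, h1.symm, a, p₀, p₁, ha, rfl⟩).trans
    ((cls_eq (h3 ha hb hε hd)).trans
      (h'.unique hε hd ⟨U, hU, hgU, Φ, s, h2.symm, b, q₀, q₁, hb, rfl⟩).symm)

/-- One position of `g` is generic for `f`, `f'` and their disjoint union, and for it the fibre
product is the disjoint union of two. -/
theorem MovedRight.sum (hε : ε ≠ 0) (hd : d = k + l - n) (h : MovedRight oX ε f g γ)
    (h' : MovedRight oX ε f' g γ') : MovedRight oX ε (f.sum f') g (γ + γ') := by
  obtain ⟨U, hU, hgU, ⟨Φ⟩⟩ := exists_perturbation (n := n) g.isCompact_closure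
  obtain ⟨s, h1, h2, h3⟩ := ((Φ.eventually_stronglyTransverse hU g hgU f).and
    ((Φ.eventually_stronglyTransverse hU g hgU f').and
      (Φ.eventually_stronglyTransverse hU g hgU (f.sum f')))).exists
  obtain ⟨a, p₀, p₁, ha⟩ := h1.symm.exists_isFibreProduct oX hd hε
  obtain ⟨b, q₀, q₁, hb⟩ := h2.symm.exists_isFibreProduct oX hd hε
  refine ⟨U, hU, hgU, Φ, s, h3.symm, a.sum b, _, _, ha.sum hb, ?_⟩
  rw [cls_sum, h.unique hε hd ⟨U, hU, hgU, Φ, s, h1.symm, a, p₀, p₁, ha, rfl⟩,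
    h'.unique hε hd ⟨U, hU, hgU, Φ, s, h2.symm, b, q₀, q₁, hb, rfl⟩]

variable (X) in
-- The class obtained by moving `g` is also obtained by moving `f`; after exchanging the factors,
-- moving `f` is a move of the right factor.
theorem exists_movedRight_swap (oX : ManifoldOrientation (𝓡 n) X n) (k l d : ℤ)
    (hd : d = k + l - n) :
    ∃ δ : SignType, δ ≠ 0 ∧ ∀ {ε : SignType} {f : Pseudocycle n X k} {g : Pseudocycle n X l}
      {γ : Homology n X d}, ε ≠ 0 → MovedRight oX ε f g γ → MovedRight oX (ε * δ) g f γ := by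
  obtain ⟨δ, hδ, H⟩ := exists_represents_swap X oX k l d
  refine ⟨δ, hδ, fun {ε f g γ} hε h => ?_⟩
  obtain ⟨a, ha⟩ := exists_movedLeft (d := d) oX hε hd f g
  obtain rfl := h.eq_of_movedLeft hε hd ha
  obtain ⟨U, hU, hfU, Φ, s, hs⟩ := ha
  exact ⟨U, hU, hfU, Φ, s, H hs⟩

/-- Choose a class for each pair of pseudocycles. Uniqueness of `MovedRight` makes the choice
invariant and additive in the first variable, and exchanging the factors, with the sign changed to
`ε * δ` throughout, gives the same in the second. -/
theorem exists_bilinear_product (oX : ManifoldOrientation (𝓡 n) X n) (hε : ε ≠ 0)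
    (hd : d = k + l - n) :
    ∃ μ : Homology n X k →ₗ[ℤ] Homology n X l →ₗ[ℤ] Homology n X d,
      ∀ (f : Pseudocycle n X k) (g : Pseudocycle n X l),
        MovedRight oX ε f g (μ f.cls g.cls) := by
  choose P hP using fun (f : Pseudocycle n X k) (g : Pseudocycle n X l) =>
    exists_movedRight (d := d) oX hε hd f g
  obtain ⟨δ, hδ, hs⟩ := exists_movedRight_swap X oX k l d hd
  have hεδ := mul_ne_zero hε hδ
  have hd' : d = l + k - n := by omega
  have hl : ∀ f f' g, Equivalent f f' → P f g = P f' g := fun f f' g h =>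
    (hP f g).eq_of_equivalent hε hd (hP f' g) h
  have hr : ∀ f g g', Equivalent g g' → P f g = P f g' := fun f g g' h =>
    (hs hε (hP f g)).eq_of_equivalent hεδ hd' (hs hε (hP f g')) h
  have hla : ∀ f f' g, P (f.sum f') g = P f g + P f' g := fun f f' g =>
    (hP (f.sum f') g).unique hε hd ((hP f g).sum hε hd (hP f' g))
  have hra : ∀ f g g', P f (g.sum g') = P f g + P f g' := fun f g g' =>
    (hs hε (hP f (g.sum g'))).unique hεδ hd'
      ((hs hε (hP f g)).sum hεδ hd' (hs hε (hP f g')))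
  let B : Homology n X k → Homology n X l → Homology n X d := Quot.lift
    (fun f => Quot.lift (P f) fun g g' => hr f g g')
    fun f f' h => funext (Quot.ind fun g => hl f f' g h)
  have hB : ∀ f g, B f.cls g.cls = P f g := fun f g => rfl
  refine ⟨(AddMonoidHom.mk' (fun a => (AddMonoidHom.mk' (B a) fun b b' => ?_).toIntLinearMap)
    fun a a' => ?_).toIntLinearMap, fun f g => hP f g⟩
  · induction a using Homology.ind with | _ f
    induction b using Homology.ind with | _ g
    induction b' using Homology.ind with | _ g'
    exact hra f g g'
  · ext b
    induction a using Homology.ind with | _ f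
    induction a' using Homology.ind with | _ f'
    induction b using Homology.ind with | _ g
    exact hla f f' g

end Pseudocycles

end

theorem proposition4p6 {n : ℕ} {X : Type*} [TopologicalSpace X] [T2Space X]
    [SecondCountableTopology X] [ChartedSpace (EuclideanSpace ℝ (Fin n)) X]
    [IsManifold (𝓡 n) ∞ X] (oX : ManifoldOrientation (𝓡 n) X n) :
    -- the classes of `k`-pseudocycles form an abelian group under disjoint union
    ∃ _ : ∀ k : ℤ, AddCommGroup (Homology n X k),
      (∀ (k : ℤ) (f g : Pseudocycle n X k),
        (∃ h, IsDisjointUnion f g h) ∧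
        ∀ h, IsDisjointUnion f g h → h.cls = f.cls + g.cls) ∧
      ∀ k l : ℤ,
        -- strongly transverse representatives exist
        (∀ (f₀ : Pseudocycle n X k) (f₁ : Pseudocycle n X l),
          ∃ φ : X ≃ₘ^∞⟮𝓡 n, 𝓡 n⟯ X, IsotopicToId φ ∧
            Equivalent f₁ (f₁.comp φ) ∧
            StronglyTransverse f₀ (f₁.comp φ)) ∧
        -- their fibre product is a pseudocycle
        (∀ (f₀ : Pseudocycle n X k) (f₁ : Pseudocycle n X l),
          StronglyTransverse f₀ f₁ →
            ∃ (f : Pseudocycle n X (k + l - n)) (pr₀ : f.M → f₀.M)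
              (pr₁ : f.M → f₁.M), IsIntersection oX f₀ f₁ f pr₀ pr₁) ∧
        -- and its class depends bilinearly on the classes of the representatives only
        ∃! μ : Homology n X k →ₗ[ℤ] Homology n X l →ₗ[ℤ]
            Homology n X (k + l - n),
          ∀ (f₀ : Pseudocycle n X k) (f₁ : Pseudocycle n X l)
            (f : Pseudocycle n X (k + l - n)) (pr₀ : f.M → f₀.M)
            (pr₁ : f.M → f₁.M),
            StronglyTransverse f₀ f₁ →
            IsIntersection oX f₀ f₁ f pr₀ pr₁ →
              μ f₀.cls f₁.cls = f.cls := by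
  have hε : ∀ l : ℤ, ((-1 : SignType) ^ (l.toNat * n)) ≠ 0 := fun l =>
    pow_ne_zero _ (by decide)
  have move : ∀ {k l : ℤ} (f₀ : Pseudocycle n X k) (f₁ : Pseudocycle n X l),
      ∃ φ : X ≃ₘ^∞⟮𝓡 n, 𝓡 n⟯ X, IsotopicToId φ ∧ Equivalent f₁ (f₁.comp φ) ∧
        StronglyTransverse f₀ (f₁.comp φ) := by
    intro k l f₀ f₁
    obtain ⟨U, hU, hfU, ⟨Φ⟩⟩ := exists_perturbation (n := n) f₁.isCompact_closure
    obtain ⟨s, hs⟩ := (Φ.eventually_stronglyTransverse hU f₁ hfU f₀).exists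
    exact ⟨Φ.toDiffeo s, Φ.isotopicToId s, equivalent_comp_perturbation Φ s f₁, hs.symm⟩
  have product : ∀ {k l : ℤ} (f₀ : Pseudocycle n X k) (f₁ : Pseudocycle n X l),
      StronglyTransverse f₀ f₁ → ∃ (f : Pseudocycle n X (k + l - n)) (pr₀ : f.M → f₀.M)
        (pr₁ : f.M → f₁.M), IsIntersection oX f₀ f₁ f pr₀ pr₁ := by
    intro k l f₀ f₁ h
    obtain ⟨f, pr₀, pr₁, hf⟩ := h.exists_isFibreProduct oX rfl (hε l)
    exact ⟨f, pr₀, pr₁, hf.isIntersection⟩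
  refine ⟨fun k => Homology.addCommGroup n X k, fun k f g => ⟨⟨_, isDisjointUnion_sum f g⟩, fun h H => H.cls_eq⟩,
    fun k l => ⟨move, product, ?_⟩⟩
  obtain ⟨μ, hμ⟩ := exists_bilinear_product (k := k) (l := l) oX (hε l) rfl
  have hμ' : ∀ (f₀ : Pseudocycle n X k) (f₁ : Pseudocycle n X l)
      (f : Pseudocycle n X (k + l - n)) (pr₀ : f.M → f₀.M) (pr₁ : f.M → f₁.M),
      StronglyTransverse f₀ f₁ → IsIntersection oX f₀ f₁ f pr₀ pr₁ →
        μ f₀.cls f₁.cls = f.cls := fun f₀ f₁ f pr₀ pr₁ hT hI =>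
    -- A strongly transverse pair is the case of the zero parameter, so its intersection is one of
    -- the fibre products that compute `μ`.
    (hμ f₀ f₁).unique (hε l) rfl
      (Represents.movedRight ⟨hT, f, pr₀, pr₁, hI.isFibreProduct, rfl⟩)
  refine ⟨μ, hμ', fun ν hν => ?_⟩
  let _ : ∀ k, AddCommGroup (Homology n X k) := fun k => Homology.addCommGroup n X k
  refine LinearMap.ext fun a => LinearMap.ext fun b => ?_
  induction a using Homology.ind with | _ f₀
  induction b using Homology.ind with | _ f₁
  -- Any two classes have strongly transverse representatives, on which both bilinear maps take the
  -- prescribed value.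
  obtain ⟨φ, -, he, hT⟩ := move f₀ f₁
  obtain ⟨f, pr₀, pr₁, hI⟩ := product _ _ hT
  rw [cls_eq he, hν _ _ _ _ _ hT hI, hμ' _ _ _ _ _ hT hI]
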